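/- Conventions. All algebras are C*-algebras, homomorphisms are $*$-homomorphisms, $\mathcal K$ is the algebra of compact operators on $\ell^2(\mathbb N)$, and $\varphi\sim\psi$ means that two homomorphisms $X\to Y$ are joined by a point-norm continuous path of homomorphisms $X\to Y$. $QA=A\star A$ is the free product with inclusions $\iota,\bar\iota:A\to QA$; $qA$ is the kernel of $\mathrm{id}\star\mathrm{id}:QA\to A$, and $\pi_A:qA\to A$ is the restriction of $\mathrm{id}\star 0$. If $\varphi,\bar\varphi:A\to E$ are homomorphisms and $J$ is a closed ideal of $E$ with $\varphi(x)-\bar\varphi(x)\in J$ for all $x$, then $q(\varphi,\bar\varphi):qA\to J$ is the restriction of $\varphi\star\bar\varphi$. A homomorphism $f:A\to B$ induces $q(f):qA\to qB$; homomorphisms are extended to matrices entrywise. Fixed isomorphisms $\mathcal K\cong\mathcal K\otimes\mathcal K$, $\mathcal K\cong M_n(\mathcal K)$ (induced by bijections of index sets) are used to identify $\mathcal K\otimes C\cong\mathcal K\otimes\mathcal K\otimes C\cong M_n(\mathcal K\otimes C)$. The product. Let $\eta,\bar\eta:QA\to Q^2A=Q(QA)$ be the two inclusions, $\varepsilon,\bar\varepsilon:A\to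 QA$ those of $A$, $q^2A=q(qA)$ (a subalgebra of $Q^2A$), $R\subseteq M_2(Q^2A)$ the C*-algebra generated by the matrices with entries in $\begin{pmatrix}R_1&R_1R_2\\R_2R_1&R_2\end{pmatrix}$, where $R_1=\eta(qA)$, $R_2=\bar\eta(qA)$, and $J=R\cap M_2(q^2A)$. Then $R/J\cong M_2(qA)$. Let $S$ be a self-adjoint multiplier of $R$ that lifts the multiplier $\begin{pmatrix}0&1\\1&0\end{pmatrix}$ of $R/J$ and commutes modulo $J$ with $\eta\varepsilon(x)\oplus\bar\eta\varepsilon(x)$ for all $x\in A$, and put $\sigma=\mathrm{Ad}\,e^{\frac{\pi i}{2}S}$. A universal map is a homomorphism $\varphi_A=q(\eta\varepsilon\oplus\bar\eta\bar\varepsilon,\ \sigma(\eta\bar\varepsilon\oplus\bar\eta\varepsilon)):qA\to J\subseteq M_2(q^2A)$ obtained from some such $S$. For $\alpha:qA\to\mathcal K\otimes B$ and $\beta:qB\to\mathcal K\otimes C$, with the natural map $\mu:q(\mathcal K\otimes B)\to\mathcal K\otimes qB$ given by $(\mathrm{id}\otimes\iota,\mathrm{id}\otimes\bar\iota)$, $\beta\,\sharp\,\alpha:qA\to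 M_2(\mathcal K\otimes\mathcal K\otimes C)\cong\mathcal K\otimes C$ denotes $(\mathrm{id}_{\mathcal K}\otimes\beta)\,\mu\,q(\alpha)\,\varphi_A$, for any universal map $\varphi_A$. The extension. For $\alpha:qA\to Y$ let $B_0=\overline{\alpha(qA)\,Y\,\alpha(qA)}$ be the hereditary subalgebra generated by $\alpha(qA)$, let $\alpha_0:qA\to B_0$ be the corestriction of $\alpha$ and $\alpha^\circ:QA\to\mathcal M(B_0)$ its canonical extension. Put $\alpha_E(x)=(\alpha^\circ(\iota x),x)$, $\bar\alpha_E(x)=(\alpha^\circ(\bar\iota x),x)$ in $\mathcal M(B_0)\oplus A$ and $E_\alpha=C^*(B_0,\alpha_E(A),\bar\alpha_E(A))$, and let $j_E:B_0\to E_\alpha$ be the inclusion. Statement. Let $A,B,C$ be C*-algebras with $A$ separable and let $\alpha:qA\to\mathcal K\otimes B$ be a homomorphism, with $B_0$, $E_\alpha$ as above. For $\beta':qE_\alpha\to\mathcal K\otimes C$ let $C_0\subseteq \mathcal K\otimes C$ be the hereditary subalgebra generated by $\beta'(qE_\alpha)$, let $\beta'_E,\bar\beta'_E:E_\alpha\to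 E_{\beta'}$ be the associated homomorphisms, and put $$\omega=q(\beta'_E\alpha_E\oplus\bar\beta'_E\bar\alpha_E,\ \bar\beta'_E\alpha_E\oplus\beta'_E\bar\alpha_E):qA\to M_2(C_0)\subseteq M_2(\mathcal K\otimes C)\cong\mathcal K\otimes C .$$ 1. A universal map $\varphi_A$ exists. 2. Let $\beta:qB_0\to\mathcal K\otimes C$ and $\beta':qE_\alpha\to\mathcal K\otimes C$ with $\beta'\,q(j_E)\sim\beta$. Then $\beta\, q(\alpha_0)\sim\omega\, q(\pi_A)$ as homomorphisms $q^2A\to M_2(\mathcal K\otimes C)$, and $\beta\, q(\alpha_0)\,\varphi_A\sim\omega$ as homomorphisms $qA\to M_2(\mathcal K\otimes C)$ for every universal map $\varphi_A$. 3. Let $\beta:qB\to\mathcal K\otimes C$. Then a product $\beta\,\sharp\,\alpha$ exists. If $\beta':qE_\alpha\to\mathcal K\otimes C$ extends $\beta$ up to homotopy, i.e. $\beta'q(j_E)$ is homotopic to the restriction $qB_0\to q(\mathcal K\otimes B)\to\mathcal K\otimes qB\to\mathcal K\otimes\mathcal K\otimes C\cong\mathcal K\otimes C$ of $\beta$, then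 every $\beta\,\sharp\,\alpha$ is homotopic to $\omega$, i.e. the $KK$-product is represented by $\omega$. 4. Let $B$ also be separable, let $D$ be a C*-algebra, and let $\beta:qB\to\mathcal K\otimes C$ and $\gamma:qC\to\mathcal K\otimes D$. If $\beta':qE_\alpha\to\mathcal K\otimes C$ extends $\beta$ up to homotopy and $\gamma':qE_{\beta'}\to\mathcal K\otimes D$ extends $\gamma$ up to homotopy (the latter on $qC_0$), then both $\gamma\,\sharp\,(\beta\,\sharp\,\alpha)$ and $(\gamma\,\sharp\,\beta)\,\sharp\,\alpha$ are homotopic to $$q(\gamma'_E\beta'_E\alpha_E\oplus\bar\gamma'_E\bar\beta'_E\alpha_E\oplus\gamma'_E\bar\beta'_E\bar\alpha_E\oplus\bar\gamma'_E\beta'_E\bar\alpha_E,\ \bar\gamma'_E\beta'_E\alpha_E\oplus\gamma'_E\bar\beta'_E\alpha_E\oplus\bar\gamma'_E\bar\beta'_E\bar\alpha_E\oplus\gamma'_E\beta'_E\bar\alpha_E):qA\to M_4(\mathcal K\otimes D)\cong\mathcal K\otimes D .$$ Moreover $\gamma\,\sharp\,(\beta\,\sharp\,\alpha)\sim(\gamma\,\sharp\,\beta)\,\sharp\,\alpha$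 for all such $\alpha,\beta,\gamma$. -/

import Mathlib

open scoped ENNReal MultiplierAlgebra

universe u

noncomputable section

namespace CuntzKK

/-! ### Homotopy of homomorphisms -/

section Basic

variable {X Y : Type u} [NonUnitalCStarAlgebra X] [NonUnitalCStarAlgebra Y]

/-- Homotopy of `*`-homomorphisms: a point-norm continuous path of `*`-homomorphisms
parametrized by `[0,1]`. -/
def Homotopic (φ ψ : X →⋆ₙₐ[ℂ] Y) : Prop :=
  ∃ Φ : unitInterval → (X →⋆ₙₐ[ℂ] Y), Φ 0 = φ ∧ Φ 1 = ψ ∧ ∀ x, Continuous fun t => Φ t x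

/-- `C*(s)`, the C*-subalgebra of `X` generated by a subset `s`. -/
def genC (s : Set X) : NonUnitalStarSubalgebra ℂ X :=
  (NonUnitalStarAlgebra.adjoin ℂ s).topologicalClosure

instance genC_isClosed (s : Set X) : IsClosed (genC s : Set X) :=
  NonUnitalStarSubalgebra.isClosed_topologicalClosure _

lemma subset_genC (s : Set X) : s ⊆ genC s := fun _ hx =>
  NonUnitalStarSubalgebra.le_topologicalClosure _ (NonUnitalStarAlgebra.subset_adjoin ℂ s hx)

lemma genC_le {s : Set X} {t : NonUnitalStarSubalgebra ℂ X} (h : s ⊆ t)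
    (ht : IsClosed (t : Set X)) : genC s ≤ t :=
  NonUnitalStarSubalgebra.topologicalClosure_minimal _
    (NonUnitalStarAlgebra.adjoin_le h) ht

lemma continuous_hom (φ : X →⋆ₙₐ[ℂ] Y) : Continuous φ :=
  AddMonoidHomClass.continuous_of_bound φ 1
    (fun x => by simpa using NonUnitalStarAlgHom.norm_apply_le φ x)

end Basic

/-! ### Universal C*-algebras given by generators and relations -/

/-- A set of relations on a family of generators indexed by `X`: a property of families of
elements of C*-algebras that forces a norm bound on each generator. -/
structure Relations (X : Type u) where
  holds : ∀ (D : Type u) [NonUnitalCStarAlgebra D], (X → D) → Prop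
  bound : X → ℝ
  norm_le : ∀ (D : Type u) [NonUnitalCStarAlgebra D] (f : X → D), holds D f →
    ∀ x, ‖f x‖ ≤ bound x

namespace Relations

variable {X : Type u}

/-- (Non-associative) `*`-polynomials in the generators. -/
abbrev Poly (X : Type u) : Type u := FreeNonUnitalNonAssocAlgebra ℂ (X ⊕ X)

/-- Evaluation of `*`-polynomials in a C*-algebra. -/
def eval {D : Type u} [NonUnitalCStarAlgebra D] (f : X → D) : Poly X →ₙₐ[ℂ] D :=
  FreeNonUnitalNonAssocAlgebra.lift ℂ (Sum.elim f fun x => star (f x))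

variable (R : Relations X)

/-- The C*-seminorms on `*`-polynomials that are induced by the families satisfying the relations.
They form a small index set for all such families. -/
def Idx : Type u :=
  {N : Poly X → ℝ // ∃ (D : Type u) (_ : NonUnitalCStarAlgebra D) (f : X → D),
    R.holds D f ∧ ∀ w, N w = ‖eval f w‖}

/-- A C*-algebra containing a family which induces the given seminorm. -/
def Alg (i : R.Idx) : Type u := i.2.choose

instance (i : R.Idx) : NonUnitalCStarAlgebra (R.Alg i) := i.2.choose_spec.choose

/-- A family which induces the given seminorm. -/
def fam (i : R.Idx) : X → R.Alg i := i.2.choose_spec.choose_spec.choose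

lemma holds_fam (i : R.Idx) : R.holds (R.Alg i) (R.fam i) :=
  i.2.choose_spec.choose_spec.choose_spec.1

lemma norm_fam (i : R.Idx) (w : Poly X) : i.1 w = ‖eval (R.fam i) w‖ :=
  i.2.choose_spec.choose_spec.choose_spec.2 w

/-- The family of generators in the product of all the algebras `R.Alg i`. -/
def gen' (x : X) : lp R.Alg ∞ :=
  ⟨fun i => R.fam i x, memℓp_infty ⟨R.bound x, by
    rintro _ ⟨i, rfl⟩
    exact R.norm_le _ _ (R.holds_fam i) x⟩⟩

/-- The universal C*-algebra with generators indexed by `X` subject to the relations `R`: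
the C*-subalgebra generated by the universal family in the product of all families. -/
def Univ : Type u := ↥(genC (Set.range R.gen'))

instance : NonUnitalCStarAlgebra R.Univ :=
  inferInstanceAs (NonUnitalCStarAlgebra ↥(genC (Set.range R.gen')))

/-- The universal generators. -/
def gen (x : X) : R.Univ := ⟨R.gen' x, subset_genC _ ⟨x, rfl⟩⟩

/-- The coordinates of an element of the universal C*-algebra. -/
def coord (i : R.Idx) (a : R.Univ) : R.Alg i := (Subtype.val a : lp R.Alg ∞) i

lemma ext_coord {a b : R.Univ} (h : ∀ i, R.coord i a = R.coord i b) : a = b :=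
  Subtype.ext (lp.ext (funext h))

lemma coord_add (i : R.Idx) (a b : R.Univ) : R.coord i (a + b) = R.coord i a + R.coord i b := rfl
lemma coord_zero (i : R.Idx) : R.coord i 0 = 0 := rfl
lemma coord_smul (i : R.Idx) (c : ℂ) (a : R.Univ) : R.coord i (c • a) = c • R.coord i a := rfl
lemma coord_mul (i : R.Idx) (a b : R.Univ) : R.coord i (a * b) = R.coord i a * R.coord i b := rfl
lemma coord_star (i : R.Idx) (a : R.Univ) : R.coord i (star a) = star (R.coord i a) := rfl
lemma coord_gen (i : R.Idx) (x : X) : R.coord i (R.gen x) = R.fam i x := rfl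

/-- Coordinates in the full product. -/
def proj (i : R.Idx) : lp R.Alg ∞ →ₙₐ[ℂ] R.Alg i where
  toFun a := a i
  map_smul' _ _ := rfl
  map_zero' := rfl
  map_add' _ _ := rfl
  map_mul' _ _ := rfl

lemma norm_eval_le {D : Type u} [NonUnitalCStarAlgebra D] (f : X → D) (hf : R.holds D f)
    (w : Poly X) : ‖eval f w‖ ≤ ‖eval R.gen' w‖ := by
  let i : R.Idx := ⟨fun w => ‖eval f w‖, D, _, f, hf, fun _ => rfl⟩
  have h1 : ‖eval f w‖ = ‖eval (R.fam i) w‖ := R.norm_fam i w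
  have h2 : (R.proj i).comp (eval R.gen') = eval (R.fam i) := by
    apply FreeNonUnitalNonAssocAlgebra.hom_ext
    intro x
    rcases x with x | x <;> simp [eval] <;> rfl
  have h3 : eval (R.fam i) w = (eval R.gen' w) i := by rw [← h2]; rfl
  rw [h1, h3]
  exact lp.norm_apply_le_norm ENNReal.top_ne_zero _ i

section Lift

variable {D : Type u} [NonUnitalCStarAlgebra D] (f : X → D)

/-- The graph of the homomorphism induced by a family. -/
def graph : NonUnitalStarSubalgebra ℂ (lp R.Alg ∞ × D) :=
  genC (Set.range fun x => (R.gen' x, f x))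

lemma graph_norm (hf : R.holds D f) {p : lp R.Alg ∞ × D} (hp : p ∈ R.graph f) :
    ‖p.2‖ ≤ ‖p.1‖ := by
  have hcl : IsClosed {p : lp R.Alg ∞ × D | ‖p.2‖ ≤ ‖p.1‖} :=
    isClosed_le (by fun_prop) (by fun_prop)
  refine closure_minimal ?_ hcl hp
  intro p hp
  suffices ∃ w, p = (eval R.gen' w, eval f w) by
    obtain ⟨w, rfl⟩ := this
    exact R.norm_eval_le f hf w
  change p ∈ NonUnitalAlgebra.adjoin ℂ _ at hp
  induction hp using NonUnitalAlgebra.adjoin_induction with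
  | mem x hx =>
    rcases hx with ⟨x, rfl⟩ | hx
    · exact ⟨FreeNonUnitalNonAssocAlgebra.of ℂ (Sum.inl x), by simp [eval]⟩
    · obtain ⟨y, hy⟩ := hx
      refine ⟨FreeNonUnitalNonAssocAlgebra.of ℂ (Sum.inr y), ?_⟩
      rw [← star_star x, ← hy]
      simp [eval]
      rfl
  | add x y _ _ hx hy =>
    obtain ⟨v, rfl⟩ := hx; obtain ⟨w, rfl⟩ := hy
    exact ⟨v + w, by simp⟩
  | zero => exact ⟨0, by simp; rfl⟩
  | mul x y _ _ hx hy =>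
    obtain ⟨v, rfl⟩ := hx; obtain ⟨w, rfl⟩ := hy
    exact ⟨v * w, by simp⟩
  | smul r x _ hx =>
    obtain ⟨v, rfl⟩ := hx
    exact ⟨r • v, by simp⟩

lemma graph_unique (hf : R.holds D f) {a : lp R.Alg ∞} {d d' : D} (h : (a, d) ∈ R.graph f)
    (h' : (a, d') ∈ R.graph f) : d = d' := by
  have := R.graph_norm f hf (sub_mem h h')
  simpa [sub_eq_zero] using this

lemma graph_exists (hf : R.holds D f) (a : R.Univ) : ∃ d, (a.1, d) ∈ R.graph f := by
  let p : R.graph f →⋆ₙₐ[ℂ] lp R.Alg ∞ :=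
    (NonUnitalStarAlgHom.fst ℂ _ _).comp (NonUnitalStarSubalgebraClass.subtype (R.graph f))
  have : IsClosed (R.graph f : Set (lp R.Alg ∞ × D)) := genC_isClosed _
  have hinj : Function.Injective p := by
    rintro ⟨⟨a, d⟩, h⟩ ⟨⟨a', d'⟩, h'⟩ haa
    obtain rfl : a = a' := haa
    obtain rfl := R.graph_unique f hf h h'
    rfl
  have hiso : Isometry p := NonUnitalStarAlgHom.isometry p hinj
  have hcl : IsClosed (NonUnitalStarAlgHom.range p : Set (lp R.Alg ∞)) :=
    hiso.isClosedEmbedding.isClosed_range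
  have hle : genC (Set.range R.gen') ≤ NonUnitalStarAlgHom.range p := by
    refine genC_le ?_ hcl
    rintro _ ⟨x, rfl⟩
    exact ⟨⟨(R.gen' x, f x), subset_genC _ ⟨x, rfl⟩⟩, rfl⟩
  obtain ⟨⟨⟨b, d⟩, h⟩, hb⟩ := hle a.2
  obtain rfl : b = a.1 := hb
  exact ⟨d, h⟩

/-- The universal property: a family satisfying the relations induces a homomorphism. -/
def lift (hf : R.holds D f) : R.Univ →⋆ₙₐ[ℂ] D where
  toFun a := (R.graph_exists f hf a).choose
  map_smul' c a := R.graph_unique f hf (R.graph_exists f hf (c • a)).choose_spec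
    ((R.graph f).smul_mem c (R.graph_exists f hf a).choose_spec)
  map_zero' := R.graph_unique f hf (R.graph_exists f hf 0).choose_spec (R.graph f).zero_mem
  map_add' a b := R.graph_unique f hf (R.graph_exists f hf (a + b)).choose_spec
    ((R.graph f).add_mem (R.graph_exists f hf a).choose_spec (R.graph_exists f hf b).choose_spec)
  map_mul' a b := R.graph_unique f hf (R.graph_exists f hf (a * b)).choose_spec
    ((R.graph f).mul_mem (R.graph_exists f hf a).choose_spec (R.graph_exists f hf b).choose_spec)
  map_star' a := R.graph_unique f hf (R.graph_exists f hf (star a)).choose_spec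
    (star_mem (R.graph_exists f hf a).choose_spec)

@[simp]
lemma lift_gen (hf : R.holds D f) (x : X) : R.lift f hf (R.gen x) = f x :=
  R.graph_unique f hf (R.graph_exists f hf (R.gen x)).choose_spec (subset_genC _ ⟨x, rfl⟩)

/-- Induction: a closed C*-subalgebra of the universal algebra containing the generators is
everything. -/
lemma mem_of_gen_mem (S : NonUnitalStarSubalgebra ℂ R.Univ) (hS : IsClosed (S : Set R.Univ))
    (h : ∀ x, R.gen x ∈ S) (a : R.Univ) : a ∈ S := by
  let j : R.Univ →⋆ₙₐ[ℂ] lp R.Alg ∞ :=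
    NonUnitalStarSubalgebraClass.subtype (genC (Set.range R.gen'))
  have hj : Function.Injective j := Subtype.val_injective
  have hcl : IsClosed (S.map j : Set (lp R.Alg ∞)) := by
    have := (NonUnitalStarAlgHom.isometry j hj).isClosedEmbedding.isClosedMap _ hS
    simpa using this
  have hle : genC (Set.range R.gen') ≤ S.map j := by
    refine genC_le ?_ hcl
    rintro _ ⟨x, rfl⟩
    exact ⟨R.gen x, h x, rfl⟩
  obtain ⟨b, hb, hba⟩ := hle a.2
  have : b = a := hj hba
  exact this ▸ hb

lemma hom_ext {φ ψ : R.Univ →⋆ₙₐ[ℂ] D} (h : ∀ x, φ (R.gen x) = ψ (R.gen x)) : φ = ψ := by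
  ext a
  exact R.mem_of_gen_mem (NonUnitalStarAlgHom.equalizer φ ψ)
    (isClosed_eq (continuous_hom φ) (continuous_hom ψ)) h a

end Lift

end Relations

/-! ### The free product `QA = A ⋆ A` and the ideal `qA` -/

section FreeProduct

variable (A : Type u) [NonUnitalCStarAlgebra A]

/-- The relations of the free product `A ⋆ A`: two copies of `A` embedded by `*`-homomorphisms. -/
def freeRel : Relations (A ⊕ A) where
  holds D _ f := ∃ φ ψ : A →⋆ₙₐ[ℂ] D, f = Sum.elim φ ψ
  bound := Sum.elim (fun a => ‖a‖) (fun a => ‖a‖)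
  norm_le := by
    rintro D _ _ ⟨φ, ψ, rfl⟩ (a | a)
    · exact NonUnitalStarAlgHom.norm_apply_le φ a
    · exact NonUnitalStarAlgHom.norm_apply_le ψ a

/-- The C*-algebra free product `QA = A ⋆ A`. -/
def Q : Type u := (freeRel A).Univ

instance : NonUnitalCStarAlgebra (Q A) := inferInstanceAs (NonUnitalCStarAlgebra (freeRel A).Univ)

/-- The first inclusion `ι : A → QA`. -/
def ι : A →⋆ₙₐ[ℂ] Q A where
  toFun a := (freeRel A).gen (Sum.inl a)
  map_smul' c a := (freeRel A).ext_coord fun i => by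
    obtain ⟨φ, ψ, h⟩ := (freeRel A).holds_fam i
    change (freeRel A).fam i _ = c • (freeRel A).fam i _
    simp [h]
  map_zero' := (freeRel A).ext_coord fun i => by
    obtain ⟨φ, ψ, h⟩ := (freeRel A).holds_fam i
    change (freeRel A).fam i _ = 0
    simp [h]
  map_add' a b := (freeRel A).ext_coord fun i => by
    obtain ⟨φ, ψ, h⟩ := (freeRel A).holds_fam i
    change (freeRel A).fam i _ = (freeRel A).fam i _ + (freeRel A).fam i _
    simp [h]
  map_mul' a b := (freeRel A).ext_coord fun i => by
    obtain ⟨φ, ψ, h⟩ := (freeRel A).holds_fam i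
    change (freeRel A).fam i _ = (freeRel A).fam i _ * (freeRel A).fam i _
    simp [h]
  map_star' a := (freeRel A).ext_coord fun i => by
    obtain ⟨φ, ψ, h⟩ := (freeRel A).holds_fam i
    change (freeRel A).fam i _ = star ((freeRel A).fam i _)
    simp [h, map_star]

/-- The second inclusion `ῑ : A → QA`. -/
def ι' : A →⋆ₙₐ[ℂ] Q A where
  toFun a := (freeRel A).gen (Sum.inr a)
  map_smul' c a := (freeRel A).ext_coord fun i => by
    obtain ⟨φ, ψ, h⟩ := (freeRel A).holds_fam i
    change (freeRel A).fam i _ = c • (freeRel A).fam i _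
    simp [h]
  map_zero' := (freeRel A).ext_coord fun i => by
    obtain ⟨φ, ψ, h⟩ := (freeRel A).holds_fam i
    change (freeRel A).fam i _ = 0
    simp [h]
  map_add' a b := (freeRel A).ext_coord fun i => by
    obtain ⟨φ, ψ, h⟩ := (freeRel A).holds_fam i
    change (freeRel A).fam i _ = (freeRel A).fam i _ + (freeRel A).fam i _
    simp [h]
  map_mul' a b := (freeRel A).ext_coord fun i => by
    obtain ⟨φ, ψ, h⟩ := (freeRel A).holds_fam i
    change (freeRel A).fam i _ = (freeRel A).fam i _ * (freeRel A).fam i _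
    simp [h]
  map_star' a := (freeRel A).ext_coord fun i => by
    obtain ⟨φ, ψ, h⟩ := (freeRel A).holds_fam i
    change (freeRel A).fam i _ = star ((freeRel A).fam i _)
    simp [h, map_star]

variable {A} {D : Type u} [NonUnitalCStarAlgebra D]

/-- The homomorphism `φ ⋆ ψ : QA → D` that is `φ` on the first and `ψ` on the second copy. -/
def Q.lift (φ ψ : A →⋆ₙₐ[ℂ] D) : Q A →⋆ₙₐ[ℂ] D := (freeRel A).lift (Sum.elim φ ψ) ⟨φ, ψ, rfl⟩

@[simp]
lemma Q.lift_ι (φ ψ : A →⋆ₙₐ[ℂ] D) (a : A) : Q.lift φ ψ (ι A a) = φ a :=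
  (freeRel A).lift_gen _ _ (Sum.inl a)

@[simp]
lemma Q.lift_ι' (φ ψ : A →⋆ₙₐ[ℂ] D) (a : A) : Q.lift φ ψ (ι' A a) = ψ a :=
  (freeRel A).lift_gen _ _ (Sum.inr a)

lemma Q.mem_of_mem (S : NonUnitalStarSubalgebra ℂ (Q A)) (hS : IsClosed (S : Set (Q A)))
    (h : ∀ a, ι A a ∈ S) (h' : ∀ a, ι' A a ∈ S) (w : Q A) : w ∈ S :=
  (freeRel A).mem_of_gen_mem S hS (by rintro (a | a); exacts [h a, h' a]) w

lemma Q.hom_ext {φ ψ : Q A →⋆ₙₐ[ℂ] D} (h : ∀ a, φ (ι A a) = ψ (ι A a))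
    (h' : ∀ a, φ (ι' A a) = ψ (ι' A a)) : φ = ψ :=
  (freeRel A).hom_ext (by rintro (a | a); exacts [h a, h' a])

variable (A) in
/-- The map `id ⋆ id : QA → A` that identifies the two copies of `A`. -/
def fold : Q A →⋆ₙₐ[ℂ] A := Q.lift (NonUnitalStarAlgHom.id ℂ A) (NonUnitalStarAlgHom.id ℂ A)

variable (A) in
/-- The kernel of `id ⋆ id : QA → A`. -/
def qSub : NonUnitalStarSubalgebra ℂ (Q A) := NonUnitalStarAlgHom.equalizer (fold A) 0

lemma mem_qSub {w : Q A} : w ∈ qSub A ↔ fold A w = 0 := Iff.rfl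

instance : IsClosed (qSub A : Set (Q A)) := isClosed_eq (continuous_hom _) (continuous_hom _)

variable (A) in
/-- The C*-algebra `qA`, the kernel of `id ⋆ id : QA → A`. -/
def q : Type u := ↥(qSub A)

instance : NonUnitalCStarAlgebra (q A) := inferInstanceAs (NonUnitalCStarAlgebra ↥(qSub A))

variable (A) in
/-- The inclusion `qA ⊆ QA`. -/
def q.incl : q A →⋆ₙₐ[ℂ] Q A := NonUnitalStarSubalgebraClass.subtype (qSub A)

lemma q.incl_injective : Function.Injective (q.incl A) := Subtype.val_injective

lemma q.fold_incl (z : q A) : fold A (q.incl A z) = 0 := z.2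

/-- Multiplication of an element of the ideal `qA` by an element of `QA`. -/
def q.lmul (w : Q A) (z : q A) : q A := ⟨w * q.incl A z, by
  rw [mem_qSub, map_mul, q.fold_incl, mul_zero]⟩

variable (A) in
/-- The projection `π_A : qA → A`, the restriction of `id ⋆ 0`. -/
def piq : q A →⋆ₙₐ[ℂ] A := (Q.lift (NonUnitalStarAlgHom.id ℂ A) 0).comp (q.incl A)

/-- Functoriality of `A ↦ QA`. -/
def Q.map (f : A →⋆ₙₐ[ℂ] D) : Q A →⋆ₙₐ[ℂ] Q D := Q.lift ((ι D).comp f) ((ι' D).comp f)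

lemma fold_map (f : A →⋆ₙₐ[ℂ] D) (w : Q A) : fold D (Q.map f w) = f (fold A w) := by
  have : (fold D).comp (Q.map f) = f.comp (fold A) :=
    Q.hom_ext (fun a => by simp [fold, Q.map]) (fun a => by simp [fold, Q.map])
  exact DFunLike.congr_fun this w

/-- Functoriality of `A ↦ qA`. -/
def q.map (f : A →⋆ₙₐ[ℂ] D) : q A →⋆ₙₐ[ℂ] q D :=
  NonUnitalStarAlgHom.codRestrict ((Q.map f).comp (q.incl A)) (qSub D) fun z => by
    rw [mem_qSub, NonUnitalStarAlgHom.comp_apply, fold_map, q.fold_incl, map_zero]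

end FreeProduct

/-! ### Prequasihomomorphisms -/

section Prequasi

variable {A E J : Type u} [NonUnitalCStarAlgebra A] [NonUnitalCStarAlgebra E]
  [NonUnitalCStarAlgebra J]

/-- `j` embeds `J` as a closed two-sided ideal of `E` (`J` is self-adjoint and complete, so it is
enough to consider left multiplication). -/
structure IsIdealEmbedding (j : J →⋆ₙₐ[ℂ] E) : Prop where
  injective : Function.Injective j
  mul_mem : ∀ e b, ∃ b', j b' = e * j b

lemma IsIdealEmbedding.mul_mem' {j : J →⋆ₙₐ[ℂ] E} (hj : IsIdealEmbedding j) (b : J) (e : E) :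
    ∃ b', j b' = j b * e := by
  obtain ⟨c, hc⟩ := hj.mul_mem (star e) (star b)
  exact ⟨star c, by rw [map_star, hc, star_mul, map_star, star_star, star_star]⟩

lemma IsIdealEmbedding.lift_sub_mem {j : J →⋆ₙₐ[ℂ] E} (hj : IsIdealEmbedding j)
    (φ ψ : A →⋆ₙₐ[ℂ] E) (h : ∀ x, ∃ b, j b = φ x - ψ x) (w : Q A) :
    ∃ b, j b = Q.lift φ ψ w - φ (fold A w) := by
  let S : NonUnitalStarSubalgebra ℂ (Q A) :=
    { carrier := {w | ∃ b, j b = Q.lift φ ψ w - φ (fold A w)}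
      zero_mem' := ⟨0, by simp⟩
      add_mem' := by
        rintro v w ⟨b, hb⟩ ⟨c, hc⟩
        exact ⟨b + c, by simp only [map_add, hb, hc]; abel⟩
      mul_mem' := by
        rintro v w ⟨b, hb⟩ ⟨c, hc⟩
        obtain ⟨b', hb'⟩ := hj.mul_mem' b (φ (fold A w))
        obtain ⟨c', hc'⟩ := hj.mul_mem (Q.lift φ ψ v) c
        refine ⟨c' + b', ?_⟩
        rw [map_add, hb', hc', hb, hc, map_mul, map_mul, map_mul, mul_sub, sub_mul]
        abel
      smul_mem' := by
        rintro c w ⟨b, hb⟩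
        exact ⟨c • b, by simp only [map_smul, hb, smul_sub]⟩
      star_mem' := by
        rintro w ⟨b, hb⟩
        exact ⟨star b, by simp only [map_star, hb, star_sub]⟩ }
  refine Q.mem_of_mem S ?_ (fun a => ?_) (fun a => ?_) w
  · have h1 : IsClosed (Set.range j) :=
      (NonUnitalStarAlgHom.isometry j hj.injective).isClosedEmbedding.isClosed_range
    have h2 : Continuous fun w => Q.lift φ ψ w - φ (fold A w) :=
      (continuous_hom _).sub ((continuous_hom φ).comp (continuous_hom _))
    exact h1.preimage h2
  · exact ⟨0, by simp [fold]⟩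
  · obtain ⟨b, hb⟩ := h a
    exact ⟨-b, by simp [fold, hb]⟩

lemma IsIdealEmbedding.lift_mem {j : J →⋆ₙₐ[ℂ] E} (hj : IsIdealEmbedding j)
    (φ ψ : A →⋆ₙₐ[ℂ] E) (h : ∀ x, ∃ b, j b = φ x - ψ x) (z : q A) :
    ∃ b, j b = Q.lift φ ψ (q.incl A z) := by
  obtain ⟨b, hb⟩ := hj.lift_sub_mem φ ψ h (q.incl A z)
  exact ⟨b, by rw [hb, q.fold_incl, map_zero, sub_zero]⟩

/-- The homomorphism `q(φ, ψ) : qA → J` of a prequasihomomorphism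
`φ, ψ : A ⇉ E ▷ J`, i.e. the restriction of `φ ⋆ ψ : QA → E` to `qA`. -/
def qHom (j : J →⋆ₙₐ[ℂ] E) (hj : IsIdealEmbedding j) (φ ψ : A →⋆ₙₐ[ℂ] E)
    (h : ∀ x, ∃ b, j b = φ x - ψ x) : q A →⋆ₙₐ[ℂ] J where
  toFun z := (hj.lift_mem φ ψ h z).choose
  map_smul' c z := hj.injective (by
    rw [(hj.lift_mem φ ψ h _).choose_spec]
    simp only [map_smul, (hj.lift_mem φ ψ h _).choose_spec]
    rfl)
  map_zero' := hj.injective (by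
    rw [(hj.lift_mem φ ψ h _).choose_spec]
    simp only [map_zero])
  map_add' z w := hj.injective (by
    rw [(hj.lift_mem φ ψ h _).choose_spec]
    simp only [map_add, (hj.lift_mem φ ψ h _).choose_spec])
  map_mul' z w := hj.injective (by
    rw [(hj.lift_mem φ ψ h _).choose_spec]
    simp only [map_mul, (hj.lift_mem φ ψ h _).choose_spec])
  map_star' z := hj.injective (by
    rw [(hj.lift_mem φ ψ h _).choose_spec]
    simp only [map_star, (hj.lift_mem φ ψ h _).choose_spec])

lemma qHom_spec (j : J →⋆ₙₐ[ℂ] E) (hj : IsIdealEmbedding j) (φ ψ : A →⋆ₙₐ[ℂ] E)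
    (h : ∀ x, ∃ b, j b = φ x - ψ x) (z : q A) :
    j (qHom j hj φ ψ h z) = Q.lift φ ψ (q.incl A z) :=
  (hj.lift_mem φ ψ h z).choose_spec

end Prequasi

/-! ### Matrix algebras -/

section Matrices

/-- The C*-algebra `M_n(A)`. -/
def Mat (n : ℕ) (A : Type u) [NonUnitalCStarAlgebra A] : Type u := CStarMatrix (Fin n) (Fin n) A

variable {n : ℕ} {A B : Type u} [NonUnitalCStarAlgebra A] [NonUnitalCStarAlgebra B]

instance : NonUnitalCStarAlgebra (Mat n A) :=
  letI := CStarAlgebra.spectralOrder A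
  letI := CStarAlgebra.spectralOrderedRing A
  inferInstanceAs (NonUnitalCStarAlgebra (CStarMatrix (Fin n) (Fin n) A))

/-- The matrix with the given entries. -/
def Mat.of (a : Fin n → Fin n → A) : Mat n A := CStarMatrix.ofMatrix (Matrix.of a)

/-- The entries of a matrix. -/
def Mat.entry (a : Mat n A) (i j : Fin n) : A := (show CStarMatrix (Fin n) (Fin n) A from a) i j

@[simp] lemma Mat.entry_of (a : Fin n → Fin n → A) (i j : Fin n) : (Mat.of a).entry i j = a i j :=
  rfl

lemma Mat.ext {a b : Mat n A} (h : ∀ i j, a.entry i j = b.entry i j) : a = b :=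
  CStarMatrix.ext h

@[simp] lemma Mat.entry_add (a b : Mat n A) (i j : Fin n) :
    (a + b).entry i j = a.entry i j + b.entry i j := rfl
@[simp] lemma Mat.entry_sub (a b : Mat n A) (i j : Fin n) :
    (a - b).entry i j = a.entry i j - b.entry i j := rfl
@[simp] lemma Mat.entry_zero (i j : Fin n) : (0 : Mat n A).entry i j = 0 := rfl
@[simp] lemma Mat.entry_smul (c : ℂ) (a : Mat n A) (i j : Fin n) :
    (c • a).entry i j = c • a.entry i j := rfl
@[simp] lemma Mat.entry_star (a : Mat n A) (i j : Fin n) :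
    (star a).entry i j = star (a.entry j i) := rfl
lemma Mat.entry_mul (a b : Mat n A) (i j : Fin n) :
    (a * b).entry i j = ∑ k, a.entry i k * b.entry k j := rfl

/-- Applying a homomorphism to every entry: the extension `M_n(f) : M_n(A) → M_n(B)`. -/
def Mat.map (n : ℕ) (f : A →⋆ₙₐ[ℂ] B) : Mat n A →⋆ₙₐ[ℂ] Mat n B where
  toFun a := Mat.of fun i j => f (a.entry i j)
  map_smul' c a := Mat.ext fun i j => by simp
  map_zero' := Mat.ext fun i j => by simp
  map_add' a b := Mat.ext fun i j => by simp
  map_mul' a b := Mat.ext fun i j => by simp [Mat.entry_mul, map_sum]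
  map_star' a := Mat.ext fun i j => by simp [map_star]

/-- The direct sum `φ₁ ⊕ ⋯ ⊕ φₙ : A → M_n(B)` of homomorphisms. -/
def dsum (φ : Fin n → A →⋆ₙₐ[ℂ] B) : A →⋆ₙₐ[ℂ] Mat n B where
  toFun a := Mat.of fun i j => if i = j then φ i a else 0
  map_smul' c a := Mat.ext fun i j => by simp
  map_zero' := Mat.ext fun i j => by simp
  map_add' a b := Mat.ext fun i j => by
    by_cases h : i = j <;> simp [h]
  map_mul' a b := Mat.ext fun i j => by
    by_cases h : i = j <;> simp [Mat.entry_mul, h]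
  map_star' a := Mat.ext fun i j => by
    by_cases h : i = j
    · simp [h, map_star]
    · simp [h, Ne.symm h]

/-- The matrix with a single entry. -/
def Mat.single (i j : Fin n) (a : A) : Mat n A :=
  Mat.of fun k l => if k = i ∧ l = j then a else 0

lemma IsIdealEmbedding.mat {j : A →⋆ₙₐ[ℂ] B} (hj : IsIdealEmbedding j) (n : ℕ) :
    IsIdealEmbedding (Mat.map n j) where
  injective a b h := Mat.ext fun i k => hj.injective (congrArg (fun m => Mat.entry m i k) h)
  mul_mem e b := by
    choose c hc using fun i k l => hj.mul_mem (e.entry i l) (b.entry l k)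
    refine ⟨Mat.of fun i k => ∑ l, c i k l, Mat.ext fun i k => ?_⟩
    simp [Mat.entry_mul, Mat.map, map_sum, hc]

end Matrices

/-! ### The stabilization `𝒦 ⊗ B` -/

section Stabilization

/-- The relations satisfied by the elements `e_{ij} ⊗ b`, where `e_{ij}` are matrix units. -/
structure IsMatrixUnitFamily {B D : Type u} [NonUnitalCStarAlgebra B] [NonUnitalCStarAlgebra D]
    (f : ℕ → ℕ → B → D) : Prop where
  add : ∀ i j b c, f i j (b + c) = f i j b + f i j c
  smul : ∀ i j (t : ℂ) b, f i j (t • b) = t • f i j b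
  mul : ∀ i j k b c, f i j b * f j k c = f i k (b * c)
  mul_of_ne : ∀ i j k l b c, j ≠ k → f i j b * f k l c = 0
  star_eq : ∀ i j b, star (f i j b) = f j i (star b)

namespace IsMatrixUnitFamily

variable {B D : Type u} [NonUnitalCStarAlgebra B] [NonUnitalCStarAlgebra D] {f : ℕ → ℕ → B → D}

lemma map_zero (hf : IsMatrixUnitFamily f) (i j : ℕ) : f i j 0 = 0 := by
  simpa using hf.smul i j 0 0

lemma norm_le (hf : IsMatrixUnitFamily f) (i j : ℕ) (b : B) : ‖f i j b‖ ≤ ‖b‖ := by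
  let φ : B →⋆ₙₐ[ℂ] D :=
    { toFun := f j j
      map_smul' := hf.smul j j
      map_zero' := hf.map_zero j j
      map_add' := hf.add j j
      map_mul' := fun b c => (hf.mul j j j b c).symm
      map_star' := fun b => (hf.star_eq j j b).symm }
  have h : ‖φ (star b * b)‖ ≤ ‖star b * b‖ := NonUnitalStarAlgHom.norm_apply_le φ _
  have h2 : φ (star b * b) = star (f i j b) * f i j b := by
    rw [hf.star_eq, hf.mul]; rfl
  rw [h2, CStarRing.norm_star_mul_self, CStarRing.norm_star_mul_self] at h
  nlinarith [norm_nonneg (f i j b), norm_nonneg b]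

end IsMatrixUnitFamily

variable (B : Type u) [NonUnitalCStarAlgebra B]

/-- The relations defining `𝒦 ⊗ B`. -/
def stabRel : Relations (ℕ × ℕ × B) where
  holds _ _ f := IsMatrixUnitFamily fun i j b => f (i, j, b)
  bound x := ‖x.2.2‖
  norm_le _ _ _ hf x := hf.norm_le x.1 x.2.1 x.2.2

/-- The C*-algebra `𝒦 ⊗ B`, where `𝒦` denotes the compact operators on `ℓ²(ℕ)`. It is realized as
the C*-completion of the algebraic tensor product of `B` with the finite `ℕ × ℕ`-matrices, i.e.
as the universal C*-algebra generated by the elements `e_{ij} ⊗ b`, where `(e_{ij})` are the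
standard matrix units of `𝒦`. -/
def K : Type u := (stabRel B).Univ

instance : NonUnitalCStarAlgebra (K B) := inferInstanceAs (NonUnitalCStarAlgebra (stabRel B).Univ)

variable {B}

/-- The element `e_{ij} ⊗ b` of `𝒦 ⊗ B`. -/
def K.e (i j : ℕ) (b : B) : K B := (stabRel B).gen (i, j, b)

lemma K.isMatrixUnitFamily : IsMatrixUnitFamily (K.e (B := B)) where
  add i j b c := (stabRel B).ext_coord fun s => ((stabRel B).holds_fam s).add i j b c
  smul i j t b := (stabRel B).ext_coord fun s => ((stabRel B).holds_fam s).smul i j t b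
  mul i j k b c := (stabRel B).ext_coord fun s => ((stabRel B).holds_fam s).mul i j k b c
  mul_of_ne i j k l b c h := (stabRel B).ext_coord fun s =>
    ((stabRel B).holds_fam s).mul_of_ne i j k l b c h
  star_eq i j b := (stabRel B).ext_coord fun s => ((stabRel B).holds_fam s).star_eq i j b

variable {C D : Type u} [NonUnitalCStarAlgebra C] [NonUnitalCStarAlgebra D]

/-- The homomorphism `𝒦 ⊗ B → D` with `e_{ij} ⊗ b ↦ f i j b`. -/
def K.lift (f : ℕ → ℕ → B → D) (hf : IsMatrixUnitFamily f) : K B →⋆ₙₐ[ℂ] D :=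
  (stabRel B).lift (fun x => f x.1 x.2.1 x.2.2) hf

@[simp]
lemma K.lift_e (f : ℕ → ℕ → B → D) (hf : IsMatrixUnitFamily f) (i j : ℕ) (b : B) :
    K.lift f hf (K.e i j b) = f i j b :=
  (stabRel B).lift_gen (fun x : ℕ × ℕ × B => f x.1 x.2.1 x.2.2) hf (i, j, b)

/-- The homomorphism `id ⊗ φ : 𝒦 ⊗ B → 𝒦 ⊗ C`. -/
def K.map (φ : B →⋆ₙₐ[ℂ] C) : K B →⋆ₙₐ[ℂ] K C :=
  K.lift (fun i j b => K.e i j (φ b))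
    { add := fun i j b c => by rw [map_add, K.isMatrixUnitFamily.add]
      smul := fun i j t b => by rw [map_smul, K.isMatrixUnitFamily.smul]
      mul := fun i j k b c => by rw [map_mul, K.isMatrixUnitFamily.mul]
      mul_of_ne := fun i j k l b c h => K.isMatrixUnitFamily.mul_of_ne i j k l _ _ h
      star_eq := fun i j b => by rw [map_star, K.isMatrixUnitFamily.star_eq] }

variable (B) in
/-- The isomorphism `𝒦 ⊗ B ≅ 𝒦 ⊗ (𝒦 ⊗ B)` coming from the isomorphism `𝒦 ≅ 𝒦 ⊗ 𝒦` induced by a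
bijection `ℕ ≅ ℕ × ℕ`. -/
def K.double : K B →⋆ₙₐ[ℂ] K (K B) :=
  K.lift (fun m n b => K.e m.unpair.1 n.unpair.1 (K.e m.unpair.2 n.unpair.2 b))
    { add := fun i j b c => by rw [K.isMatrixUnitFamily.add, K.isMatrixUnitFamily.add]
      smul := fun i j t b => by rw [K.isMatrixUnitFamily.smul, K.isMatrixUnitFamily.smul]
      mul := fun i j k b c => by rw [K.isMatrixUnitFamily.mul, K.isMatrixUnitFamily.mul]
      mul_of_ne := fun i j k l b c h => by
        by_cases h1 : j.unpair.1 = k.unpair.1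
        · have h2 : j.unpair.2 ≠ k.unpair.2 := fun h2 => h (by
            rw [← Nat.pair_unpair j, ← Nat.pair_unpair k, h1, h2])
          rw [h1, K.isMatrixUnitFamily.mul, K.isMatrixUnitFamily.mul_of_ne _ _ _ _ _ _ h2,
            K.isMatrixUnitFamily.map_zero]
        · exact K.isMatrixUnitFamily.mul_of_ne _ _ _ _ _ _ h1
      star_eq := fun i j b => by rw [K.isMatrixUnitFamily.star_eq, K.isMatrixUnitFamily.star_eq] }

variable (B) in
/-- The isomorphism `𝒦 ⊗ B ≅ M_n(𝒦 ⊗ B)` coming from the isomorphism `𝒦 ≅ M_n(𝒦)` induced by a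
bijection `ℕ ≅ ℕ × {0, …, n-1}`. -/
def K.toMat (n : ℕ) [NeZero n] : K B →⋆ₙₐ[ℂ] Mat n (K B) :=
  K.lift (fun r s b => Mat.single (Nat.divModEquiv n r).2 (Nat.divModEquiv n s).2
      (K.e (Nat.divModEquiv n r).1 (Nat.divModEquiv n s).1 b))
    { add := fun i j b c => Mat.ext fun k l => by
        rw [K.isMatrixUnitFamily.add]
        simp only [Mat.single, Mat.entry_of, Mat.entry_add]
        split_ifs <;> simp
      smul := fun i j t b => Mat.ext fun k l => by
        rw [K.isMatrixUnitFamily.smul]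
        simp only [Mat.single, Mat.entry_of, Mat.entry_smul]
        split_ifs <;> simp
      mul := fun i j k b c => Mat.ext fun r s => by
        rw [← K.isMatrixUnitFamily.mul _ (Nat.divModEquiv n j).1]
        simp only [Mat.single, Mat.entry_of, Mat.entry_mul]
        rw [Finset.sum_eq_single (Nat.divModEquiv n j).2]
        · split_ifs <;> simp_all
        · intro t _ ht
          rw [if_neg fun h => ht h.2, zero_mul]
        · simp
      mul_of_ne := fun i j k l b c h => Mat.ext fun r s => by
        simp only [Mat.single, Mat.entry_of, Mat.entry_mul, Mat.entry_zero]
        refine Finset.sum_eq_zero fun t _ => ?_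
        split_ifs with h1 h2 <;> try simp
        refine K.isMatrixUnitFamily.mul_of_ne _ _ _ _ _ _ fun h3 => h ?_
        exact (Nat.divModEquiv n).injective (Prod.ext h3 (h1.2.symm.trans h2.1))
      star_eq := fun i j b => Mat.ext fun r s => by
        rw [← K.isMatrixUnitFamily.star_eq]
        simp only [Mat.single, Mat.entry_of, Mat.entry_star]
        split_ifs <;> simp_all }

end Stabilization

/-! ### Hereditary subalgebras and extension to multipliers -/

section Hereditary

open Filter Topology

variable {A Y : Type u} [NonUnitalCStarAlgebra A] [NonUnitalCStarAlgebra Y]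

/-- An approximate unit of a C*-algebra. -/
def apx (X : Type u) [NonUnitalCStarAlgebra X] : Filter X :=
  letI := CStarAlgebra.spectralOrder X
  letI := CStarAlgebra.spectralOrderedRing X
  CStarAlgebra.approximateUnit X

instance (X : Type u) [NonUnitalCStarAlgebra X] : (apx X).NeBot := by
  let _ := CStarAlgebra.spectralOrder X
  let _ := CStarAlgebra.spectralOrderedRing X
  exact inferInstanceAs (CStarAlgebra.approximateUnit X).NeBot

lemma apx_norm (X : Type u) [NonUnitalCStarAlgebra X] : ∀ᶠ x in apx X, ‖x‖ ≤ 1 := by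
  let _ := CStarAlgebra.spectralOrder X
  let _ := CStarAlgebra.spectralOrderedRing X
  exact (CStarAlgebra.increasingApproximateUnit X).eventually_norm

lemma apx_left {X : Type u} [NonUnitalCStarAlgebra X] (x : X) :
    Tendsto (fun u => u * x) (apx X) (𝓝 x) := by
  let _ := CStarAlgebra.spectralOrder X
  let _ := CStarAlgebra.spectralOrderedRing X
  exact (CStarAlgebra.increasingApproximateUnit X).tendsto_mul_right x

lemma apx_right {X : Type u} [NonUnitalCStarAlgebra X] (x : X) :
    Tendsto (fun u => x * u) (apx X) (𝓝 x) := by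
  let _ := CStarAlgebra.spectralOrder X
  let _ := CStarAlgebra.spectralOrderedRing X
  exact (CStarAlgebra.increasingApproximateUnit X).tendsto_mul_left x

/-- The hereditary C*-subalgebra of `Y` generated by the image of `α : qA → Y`, that is, the
C*-subalgebra generated by `α(qA) Y α(qA)`. -/
def herSub (α : q A →⋆ₙₐ[ℂ] Y) : NonUnitalStarSubalgebra ℂ Y :=
  genC {x | ∃ z y z', x = α z * y * α z'}

instance (α : q A →⋆ₙₐ[ℂ] Y) : IsClosed (herSub α : Set Y) := genC_isClosed _

lemma mem_herSub (α : q A →⋆ₙₐ[ℂ] Y) (z : q A) : α z ∈ herSub α := by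
  have h : Tendsto (fun u => α (z * u)) (apx (q A)) (𝓝 (α z)) :=
    ((continuous_hom α).tendsto z).comp (apx_right z)
  have h' : ∀ v, v ∈ (Set.univ : Set (q A)) → α (z * v) ∈ herSub α := by
    intro v _
    have hv : Tendsto (fun u => α (z * (u * v))) (apx (q A)) (𝓝 (α (z * v))) :=
      ((continuous_hom α).tendsto _).comp
        (((continuous_const.mul continuous_id).tendsto v).comp (apx_left v))
    refine (genC_isClosed _).mem_of_tendsto hv (Eventually.of_forall fun u => ?_)
    exact subset_genC _ ⟨z, α u, v, by simp [mul_assoc]⟩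
  exact (genC_isClosed _).mem_of_tendsto h (Eventually.of_forall fun u => h' u trivial)

/-- The hereditary subalgebra generated by the image of `α`, as a C*-algebra. -/
def Her (α : q A →⋆ₙₐ[ℂ] Y) : Type u := ↥(herSub α)

instance (α : q A →⋆ₙₐ[ℂ] Y) : NonUnitalCStarAlgebra (Her α) :=
  inferInstanceAs (NonUnitalCStarAlgebra ↥(herSub α))

/-- The inclusion of the hereditary subalgebra. -/
def Her.incl (α : q A →⋆ₙₐ[ℂ] Y) : Her α →⋆ₙₐ[ℂ] Y :=
  NonUnitalStarSubalgebraClass.subtype (herSub α)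

/-- The corestriction `qA → B₀` of `α` to the hereditary subalgebra. -/
def Her.corestrict (α : q A →⋆ₙₐ[ℂ] Y) : q A →⋆ₙₐ[ℂ] Her α :=
  NonUnitalStarAlgHom.codRestrict α (herSub α) (mem_herSub α)

variable (α : q A →⋆ₙₐ[ℂ] Y)

lemma norm_cor_le (z : q A) : ‖Her.corestrict α z‖ ≤ ‖z‖ := NonUnitalStarAlgHom.norm_apply_le _ z

lemma cor_apx (b : Her α) : Tendsto (fun u => Her.corestrict α u * b) (apx (q A)) (𝓝 b) := by
  suffices H : ∀ y ∈ herSub α, Tendsto (fun u => α u * y) (apx (q A)) (𝓝 y) by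
    exact tendsto_subtype_rng.2 (H b.1 b.2)
  intro y hy
  rw [Metric.tendsto_nhds]
  intro ε hε
  obtain ⟨y', hy', hd⟩ := Metric.mem_closure_iff.1 hy (ε / 3) (by positivity)
  have key : Tendsto (fun u => α u * y') (apx (q A)) (𝓝 y') := by
    change y' ∈ NonUnitalStarAlgebra.adjoin ℂ _ at hy'
    have hgen : ∀ x ∈ {x | ∃ z y z', x = α z * y * α z'},
        Tendsto (fun u => α u * x) (apx (q A)) (𝓝 x) := by
      rintro x ⟨z, y, z', rfl⟩
      have h1 : Tendsto (fun u => α (u * z) * y * α z') (apx (q A)) (𝓝 (α z * y * α z')) :=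
        ((((continuous_hom α).tendsto z).comp (apx_left z)).mul_const y).mul_const (α z')
      simpa [mul_assoc] using h1
    change y' ∈ NonUnitalAlgebra.adjoin ℂ _ at hy'
    clear hd
    induction hy' using NonUnitalAlgebra.adjoin_induction with
    | mem x hx =>
      rcases hx with hx | hx
      · exact hgen x hx
      · obtain ⟨z, y, z', h⟩ := hx
        refine hgen x ⟨star z', star y, star z, ?_⟩
        rw [← star_star x, h, star_mul, star_mul, map_star, map_star, mul_assoc]
    | add x y _ _ hx hy => simpa [mul_add] using hx.add hy
    | zero => simp
    | mul x y _ _ hx _ => simpa [mul_assoc] using hx.mul_const y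
    | smul r x _ hx => simpa [mul_smul_comm] using hx.const_smul r
  filter_upwards [(Metric.tendsto_nhds.1 key) (ε / 3) (by positivity), apx_norm (q A)] with u hu hu1
  have h1 : dist (α u * y) (α u * y') ≤ dist y y' := by
    rw [dist_eq_norm, dist_eq_norm, ← mul_sub]
    calc ‖α u * (y - y')‖ ≤ ‖α u‖ * ‖y - y'‖ := norm_mul_le _ _
      _ ≤ 1 * ‖y - y'‖ := by
        gcongr
        exact (NonUnitalStarAlgHom.norm_apply_le α u).trans hu1
      _ = _ := one_mul _
  calc dist (α u * y) y ≤ dist (α u * y) (α u * y') + dist (α u * y') y' + dist y' y :=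
        dist_triangle4 _ _ _ _
    _ < ε := by rw [dist_comm y' y]; linarith

lemma lmul_apx_exists (w : Q A) (b : Her α) :
    ∃ c, Tendsto (fun u => Her.corestrict α (q.lmul w u) * b) (apx (q A)) (𝓝 c) := by
  have hb : ∀ u : q A, ‖u‖ ≤ 1 → ∀ b : Her α, ‖Her.corestrict α (q.lmul w u) * b‖ ≤ ‖w‖ * ‖b‖ := by
    intro u hu b
    refine (norm_mul_le _ _).trans ?_
    gcongr
    refine (norm_cor_le α _).trans ?_
    change ‖w * q.incl A u‖ ≤ _
    refine (norm_mul_le _ _).trans ?_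
    have : ‖q.incl A u‖ ≤ 1 := hu
    nlinarith [norm_nonneg w]
  have hmul : ∀ v u : q A, Her.corestrict α (q.lmul w u) * Her.corestrict α v = Her.corestrict α (q.lmul w (u * v)) := by
    intro v u
    rw [← map_mul]
    congr 1
    exact Subtype.ext (mul_assoc _ _ _)
  apply cauchy_map_iff_exists_tendsto.1
  rw [Metric.cauchy_iff]
  refine ⟨inferInstance, fun ε hε => ?_⟩
  have hδ : 0 < ε / (4 * (‖w‖ + 1)) := by positivity
  obtain ⟨v, hv⟩ := ((Metric.tendsto_nhds.1 (cor_apx α b)) _ hδ).exists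
  have hlim : Tendsto (fun u => Her.corestrict α (q.lmul w (u * v)) * b) (apx (q A))
      (𝓝 (Her.corestrict α (q.lmul w v) * b)) := by
    refine Tendsto.mul_const b (((continuous_hom _).tendsto _).comp ?_)
    refine tendsto_subtype_rng.2 ?_
    exact ((continuous_const.mul (continuous_hom (q.incl A))).tendsto v).comp (apx_left v)
  have hev := (Metric.tendsto_nhds.1 hlim) (ε / 4) (by positivity)
  refine ⟨_, image_mem_map (hev.and (apx_norm (q A))), ?_⟩
  have hone : ∀ u : q A, dist (Her.corestrict α (q.lmul w (u * v)) * b) (Her.corestrict α (q.lmul w v) * b) < ε / 4 ∧ ‖u‖ ≤ 1 →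
      dist (Her.corestrict α (q.lmul w u) * b) (Her.corestrict α (q.lmul w v) * b) < ε / 2 := by
    rintro u ⟨hu, hu1⟩
    have h1 : dist (Her.corestrict α (q.lmul w u) * b) (Her.corestrict α (q.lmul w (u * v)) * b) ≤ ε / 4 := by
      rw [← hmul, mul_assoc, dist_eq_norm, ← mul_sub]
      refine (hb u hu1 _).trans ?_
      rw [dist_comm, dist_eq_norm] at hv
      calc ‖w‖ * ‖b - Her.corestrict α v * b‖ ≤ (‖w‖ + 1) * (ε / (4 * (‖w‖ + 1))) := by
            gcongr
            linarith
        _ = ε / 4 := by field_simp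
    have := dist_triangle (Her.corestrict α (q.lmul w u) * b) (Her.corestrict α (q.lmul w (u * v)) * b) (Her.corestrict α (q.lmul w v) * b)
    linarith
  rintro _ ⟨u, hu, rfl⟩ _ ⟨u', hu', rfl⟩
  have := dist_triangle_right (Her.corestrict α (q.lmul w u) * b) (Her.corestrict α (q.lmul w u') * b) (Her.corestrict α (q.lmul w v) * b)
  have h1 := hone u hu
  have h2 := hone u' hu'
  exact this.trans_lt (by linarith)

/-- The left action of `w ∈ QA` on `B₀`: the limit of `α(w u) b` along an approximate unit `u` of
`qA`. -/
def leftFun (w : Q A) (b : Her α) : Her α := (lmul_apx_exists α w b).choose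

lemma leftFun_tendsto (w : Q A) (b : Her α) :
    Tendsto (fun u => Her.corestrict α (q.lmul w u) * b) (apx (q A)) (𝓝 (leftFun α w b)) :=
  (lmul_apx_exists α w b).choose_spec

lemma norm_leftFun_le (w : Q A) (b : Her α) : ‖leftFun α w b‖ ≤ ‖w‖ * ‖b‖ := by
  refine le_of_tendsto (leftFun_tendsto α w b).norm ?_
  filter_upwards [apx_norm (q A)] with u hu
  refine (norm_mul_le _ _).trans ?_
  gcongr
  refine (norm_cor_le α _).trans ?_
  change ‖w * q.incl A u‖ ≤ _
  refine (norm_mul_le _ _).trans ?_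
  have : ‖q.incl A u‖ ≤ 1 := hu
  nlinarith [norm_nonneg w]

/-- `leftFun` as a bounded operator. -/
def leftOp (w : Q A) : Her α →L[ℂ] Her α :=
  LinearMap.mkContinuous
    { toFun := leftFun α w
      map_add' := fun b c => tendsto_nhds_unique (leftFun_tendsto α w (b + c)) (by
        simpa only [mul_add] using (leftFun_tendsto α w b).add (leftFun_tendsto α w c))
      map_smul' := fun t b => tendsto_nhds_unique (leftFun_tendsto α w (t • b)) (by
        simpa only [mul_smul_comm, RingHom.id_apply] using
          (leftFun_tendsto α w b).const_smul t) }
    ‖w‖ (norm_leftFun_le α w)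

lemma leftOp_tendsto (w : Q A) (b : Her α) :
    Tendsto (fun u => Her.corestrict α (q.lmul w u) * b) (apx (q A)) (𝓝 (leftOp α w b)) :=
  leftFun_tendsto α w b

lemma leftOp_cor (w : Q A) (z : q A) (b : Her α) :
    leftOp α w (Her.corestrict α z * b) = Her.corestrict α (q.lmul w z) * b := by
  refine tendsto_nhds_unique (leftOp_tendsto α w _) ?_
  have h : Tendsto (fun u => Her.corestrict α (q.lmul w (u * z)) * b) (apx (q A)) (𝓝 (Her.corestrict α (q.lmul w z) * b)) := by
    refine Tendsto.mul_const b (((continuous_hom _).tendsto _).comp ?_)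
    refine tendsto_subtype_rng.2 ?_
    exact ((continuous_const.mul (continuous_hom (q.incl A))).tendsto z).comp (apx_left z)
  refine h.congr fun u => ?_
  rw [← mul_assoc, ← map_mul]
  congr 2
  exact Subtype.ext (mul_assoc _ _ _).symm

lemma her_ext {T T' : Her α → Her α} (hT : Continuous T) (hT' : Continuous T')
    (h : ∀ z b, T (Her.corestrict α z * b) = T' (Her.corestrict α z * b)) (b : Her α) : T b = T' b :=
  tendsto_nhds_unique ((hT.tendsto b).comp (cor_apx α b))
    (((hT'.tendsto b).comp (cor_apx α b)).congr fun u => (h u b).symm)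

/-- The right action of `w ∈ QA` on `B₀`. -/
def rightOp (w : Q A) : Her α →L[ℂ] Her α :=
  LinearMap.mkContinuous
    { toFun := fun b => star (leftOp α (star w) (star b))
      map_add' := fun b c => by simp only [star_add, map_add]
      map_smul' := fun t b => by simp [star_smul] }
    ‖w‖ (fun b => by
      have := norm_leftFun_le α (star w) (star b)
      simp only [norm_star] at this
      change ‖star (leftFun α (star w) (star b))‖ ≤ _
      rwa [norm_star])

lemma rightOp_apply (w : Q A) (b : Her α) :
    rightOp α w b = star (leftOp α (star w) (star b)) := rfl

lemma central (w : Q A) (a b : Her α) : rightOp α w a * b = a * leftOp α w b := by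
  refine her_ext α (T := fun b => rightOp α w a * b) (T' := fun b => a * leftOp α w b)
    (by fun_prop) (by fun_prop) (fun z b => ?_) b
  rw [leftOp_cor]
  have h1 : Tendsto (fun u => star (Her.corestrict α (q.lmul (star w) u) * star a) * (Her.corestrict α z * b)) (apx (q A))
      (𝓝 (rightOp α w a * (Her.corestrict α z * b))) :=
    (((continuous_star.tendsto _).comp (leftOp_tendsto α (star w) (star a)))).mul_const _
  have h2 : Tendsto (fun u => star (Her.corestrict α u * star a) * (Her.corestrict α (q.lmul w z) * b)) (apx (q A))
      (𝓝 (star (star a) * (Her.corestrict α (q.lmul w z) * b))) :=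
    (((continuous_star.tendsto _).comp (cor_apx α (star a)))).mul_const _
  rw [star_star] at h2
  refine tendsto_nhds_unique h1 (h2.congr fun u => ?_)
  simp only [star_mul, star_star, mul_assoc, ← map_star]
  congr 1
  rw [← mul_assoc, ← mul_assoc, ← map_mul, ← map_mul]
  congr 2
  refine Subtype.ext ?_
  change star (u.1) * (w * z.1) = star (star w * u.1) * z.1
  rw [star_mul, star_star, mul_assoc]

lemma multiplier_ext {X : Type u} [NonUnitalCStarAlgebra X] {m m' : 𝓜(ℂ, X)}
    (h : ∀ x, m.fst x = m'.fst x) : m = m' := by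
  refine DoubleCentralizer.ext _ _ _ _ (Prod.ext (ContinuousLinearMap.ext h) ?_)
  refine ContinuousLinearMap.ext fun x => ?_
  rw [← sub_eq_zero, ← CStarRing.mul_star_self_eq_zero_iff, sub_mul, m.central, m'.central, h,
    sub_self]

/-- The canonical extension `QA → ℳ(B₀)` of `α : qA → B₀`, i.e. the composition of the canonical
map `QA → ℳ(qA)` with `α° : ℳ(qA) → ℳ(B₀)`. -/
def extM : Q A →⋆ₙₐ[ℂ] 𝓜(ℂ, Her α) where
  toFun w := { fst := leftOp α w, snd := rightOp α w, central := central α w }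
  map_smul' t w := multiplier_ext fun b => by
    refine her_ext α (T' := fun b => (t • leftOp α w) b)
      (leftOp α (t • w)).continuous (by fun_prop) (fun z b => ?_) b
    simp only [leftOp_cor, smul_apply]
    rw [← smul_mul_assoc, ← map_smul]
    congr 2
    exact Subtype.ext (smul_mul_assoc _ _ _)
  map_zero' := multiplier_ext fun b => by
    refine her_ext α (T' := fun _ => 0)
      (leftOp α 0).continuous (by fun_prop) (fun z b => ?_) b
    rw [leftOp_cor, show q.lmul (0 : Q A) z = 0 from Subtype.ext (zero_mul _), map_zero, zero_mul]
  map_add' v w := multiplier_ext fun b => by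
    refine her_ext α (T' := fun b => leftOp α v b + leftOp α w b)
      (leftOp α (v + w)).continuous (by fun_prop) (fun z b => ?_) b
    simp only [leftOp_cor]
    rw [← add_mul, ← map_add]
    congr 2
    exact Subtype.ext (add_mul _ _ _)
  map_mul' v w := multiplier_ext fun b => by
    refine her_ext α (T' := fun b => leftOp α v (leftOp α w b))
      (leftOp α (v * w)).continuous (by fun_prop) (fun z b => ?_) b
    simp only [leftOp_cor]
    congr 2
    exact Subtype.ext (mul_assoc _ _ _)
  map_star' w := multiplier_ext fun b => by
    rw [DoubleCentralizer.star_fst]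
    change _ = star (star (leftOp α (star w) (star (star b))))
    rw [star_star, star_star]

lemma extM_fst_cor (w : Q A) (z : q A) (b : Her α) :
    (extM α w).fst (Her.corestrict α z * b) = Her.corestrict α (q.lmul w z) * b := leftOp_cor α w z b

lemma extM_incl (z : q A) : extM α (q.incl A z) = DoubleCentralizer.coeHom (𝕜 := ℂ) (Her.corestrict α z) := by
  refine multiplier_ext fun b => ?_
  refine her_ext α (T' := fun b => Her.corestrict α z * b)
      (leftOp α (q.incl A z)).continuous (by fun_prop) (fun z' b => ?_) b
  rw [leftOp_cor, ← mul_assoc, ← map_mul]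
  rfl

end Hereditary

/-! ### The extension `E_α` -/

section Extension

variable {A Y : Type u} [NonUnitalCStarAlgebra A] [NonUnitalCStarAlgebra Y]
  (α : q A →⋆ₙₐ[ℂ] Y)

/-- `E_α = C*(B₀, α_E(A), ᾱ_E(A)) ⊆ ℳ(B₀) ⊕ A`, where `α_E(x) = (α°(ι x), x)` and
`ᾱ_E(x) = (α°(ῑ x), x)`. -/
def eSub : NonUnitalStarSubalgebra ℂ (𝓜(ℂ, Her α) × A) :=
  genC (Set.range (fun b : Her α => ((DoubleCentralizer.coeHom (𝕜 := ℂ) b, 0) : 𝓜(ℂ, Her α) × A)) ∪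
    Set.range (fun x : A => (extM α (ι A x), x)) ∪
    Set.range (fun x : A => (extM α (ι' A x), x)))

instance : IsClosed (eSub α : Set (𝓜(ℂ, Her α) × A)) := genC_isClosed _

/-- The C*-algebra `E_α`. -/
def Ext : Type u := ↥(eSub α)

instance : NonUnitalCStarAlgebra (Ext α) := inferInstanceAs (NonUnitalCStarAlgebra ↥(eSub α))

/-- The inclusion `j_E : B₀ → E_α`. -/
def Ext.j : Her α →⋆ₙₐ[ℂ] Ext α where
  toFun b := ⟨(DoubleCentralizer.coeHom (𝕜 := ℂ) b, 0), subset_genC _ (Or.inl (Or.inl ⟨b, rfl⟩))⟩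
  map_smul' c b := Subtype.ext (Prod.ext (map_smul _ c b) (smul_zero c).symm)
  map_zero' := Subtype.ext (Prod.ext (map_zero _) rfl)
  map_add' b c := Subtype.ext (Prod.ext (map_add _ b c) (add_zero (0 : A)).symm)
  map_mul' b c := Subtype.ext (Prod.ext (map_mul _ b c) (mul_zero (0 : A)).symm)
  map_star' b := Subtype.ext (Prod.ext (map_star _ b) (star_zero A).symm)

/-- The homomorphism `α_E : A → E_α`. -/
def Ext.hom : A →⋆ₙₐ[ℂ] Ext α where
  toFun x := ⟨(extM α (ι A x), x), subset_genC _ (Or.inl (Or.inr ⟨x, rfl⟩))⟩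
  map_smul' c b := Subtype.ext (Prod.ext (map_smul ((extM α).comp (ι A)) c b) rfl)
  map_zero' := Subtype.ext (Prod.ext (map_zero ((extM α).comp (ι A))) rfl)
  map_add' b c := Subtype.ext (Prod.ext (map_add ((extM α).comp (ι A)) b c) rfl)
  map_mul' b c := Subtype.ext (Prod.ext (map_mul ((extM α).comp (ι A)) b c) rfl)
  map_star' b := Subtype.ext (Prod.ext (map_star ((extM α).comp (ι A)) b) rfl)

/-- The homomorphism `ᾱ_E : A → E_α`. -/
def Ext.hom' : A →⋆ₙₐ[ℂ] Ext α where
  toFun x := ⟨(extM α (ι' A x), x), subset_genC _ (Or.inr ⟨x, rfl⟩)⟩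
  map_smul' c b := Subtype.ext (Prod.ext (map_smul ((extM α).comp (ι' A)) c b) rfl)
  map_zero' := Subtype.ext (Prod.ext (map_zero ((extM α).comp (ι' A))) rfl)
  map_add' b c := Subtype.ext (Prod.ext (map_add ((extM α).comp (ι' A)) b c) rfl)
  map_mul' b c := Subtype.ext (Prod.ext (map_mul ((extM α).comp (ι' A)) b c) rfl)
  map_star' b := Subtype.ext (Prod.ext (map_star ((extM α).comp (ι' A)) b) rfl)

lemma Ext.j_isIdealEmbedding : IsIdealEmbedding (Ext.j α) where
  injective b c h := by
    have h1 : (DoubleCentralizer.coeHom (𝕜 := ℂ) b : 𝓜(ℂ, Her α)) =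
        DoubleCentralizer.coeHom (𝕜 := ℂ) c := congrArg (fun e : Ext α => e.1.1) h
    have h2 : ∀ x, b * x = c * x := fun x =>
      DFunLike.congr_fun (congrArg (fun m : 𝓜(ℂ, Her α) => m.fst) h1) x
    rw [← sub_eq_zero, ← CStarRing.mul_star_self_eq_zero_iff, sub_mul, h2, sub_self]
  mul_mem e b := by
    refine ⟨e.1.1.fst b, Subtype.ext (Prod.ext (multiplier_ext fun x => ?_) ?_)⟩
    · change e.1.1.fst b * x = e.1.1.fst (b * x)
      rw [← sub_eq_zero, ← CStarRing.star_mul_self_eq_zero_iff]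
      have : ∀ y, y * (e.1.1.fst b * x - e.1.1.fst (b * x)) = 0 := fun y => by
        rw [mul_sub, ← mul_assoc, ← DoubleCentralizer.central, ← DoubleCentralizer.central,
          mul_assoc, sub_self]
      exact this _
    · exact (mul_zero e.1.2).symm

lemma Ext.hom_sub_hom' (x : A) : ∃ b, Ext.j α b = Ext.hom α x - Ext.hom' α x := by
  let z : q A := ⟨ι A x - ι' A x, by simp [mem_qSub, fold]⟩
  refine ⟨Her.corestrict α z, Subtype.ext (Prod.ext ?_ (sub_self x).symm)⟩
  change DoubleCentralizer.coeHom (𝕜 := ℂ) (Her.corestrict α z) = extM α (ι A x) - extM α (ι' A x)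
  rw [← extM_incl, ← map_sub]
  rfl

lemma Ext.hom'_sub_hom (x : A) : ∃ b, Ext.j α b = Ext.hom' α x - Ext.hom α x := by
  obtain ⟨b, hb⟩ := Ext.hom_sub_hom' α x
  exact ⟨-b, by rw [map_neg, hb, neg_sub]⟩

variable {X : Type u} [NonUnitalCStarAlgebra X]

/-- Given homomorphisms `φᵢ, ψᵢ : X → E_α` (`i = 1, …, n`) that agree modulo `B₀`, the homomorphism
`q(φ₁ ⊕ ⋯ ⊕ φₙ, ψ₁ ⊕ ⋯ ⊕ ψₙ) : qX → M_n(B₀) ⊆ M_n(Y)`, where `B₀ ⊆ Y` is the hereditary subalgebra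
generated by the image of `α`. -/
def qSum {n : ℕ} (φ ψ : Fin n → X →⋆ₙₐ[ℂ] Ext α)
    (h : ∀ i x, ∃ b, Ext.j α b = φ i x - ψ i x) : q X →⋆ₙₐ[ℂ] Mat n Y :=
  (Mat.map n (Her.incl α)).comp
    (qHom (Mat.map n (Ext.j α)) ((Ext.j_isIdealEmbedding α).mat n) (dsum φ) (dsum ψ) (by
      intro x
      choose b hb using fun i => h i x
      refine ⟨Mat.of fun i k => if i = k then b i else 0, Mat.ext fun i k => ?_⟩
      by_cases hik : i = k <;> simp [Mat.map, dsum, hik, hb]))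

end Extension

/-! ### The universal map `φ_A : qA → M₂(q²A)` -/

section UniversalMap

variable (A : Type u) [NonUnitalCStarAlgebra A]

/-- The C*-algebra `R ⊆ M₂(Q²A)` generated by the matrices with entries in
`(R₁, R₁R₂; R₂R₁, R₂)`, where `R₁ = η(qA)`, `R₂ = η̄(qA)` and `η, η̄ : QA → Q²A` are the two
inclusions. -/
def rSub : NonUnitalStarSubalgebra ℂ (Mat 2 (Q (Q A))) :=
  genC {m | (∃ z, m.entry 0 0 = ι (Q A) (q.incl A z)) ∧
    (∃ z z', m.entry 0 1 = ι (Q A) (q.incl A z) * ι' (Q A) (q.incl A z')) ∧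
    (∃ z z', m.entry 1 0 = ι' (Q A) (q.incl A z) * ι (Q A) (q.incl A z')) ∧
    ∃ z, m.entry 1 1 = ι' (Q A) (q.incl A z)}

instance : IsClosed (rSub A : Set (Mat 2 (Q (Q A)))) := genC_isClosed _

/-- The C*-algebra `R`. -/
def RAlg : Type u := ↥(rSub A)

instance : NonUnitalCStarAlgebra (RAlg A) := inferInstanceAs (NonUnitalCStarAlgebra ↥(rSub A))

/-- The inclusion `R ⊆ M₂(Q²A)`. -/
def RAlg.incl : RAlg A →⋆ₙₐ[ℂ] Mat 2 (Q (Q A)) := NonUnitalStarSubalgebraClass.subtype (rSub A)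

/-- The natural map `q²A = q(qA) → Q²A`. -/
def q2incl : q (q A) →⋆ₙₐ[ℂ] Q (Q A) := (Q.map (q.incl A)).comp (q.incl (q A))

/-- The ideal `J = R ∩ M₂(q²A)` of `R`. -/
def InJ (r : RAlg A) : Prop := ∀ i j, ∃ z, (RAlg.incl A r).entry i j = q2incl A z

variable {A}

/-- The homomorphism `η e ⊕ η̄ e' : A → M₂(Q²A)`, for `e, e' : A → QA`. -/
def diagHom (e e' : A →⋆ₙₐ[ℂ] Q A) : A →⋆ₙₐ[ℂ] Mat 2 (Q (Q A)) :=
  dsum ![(ι (Q A)).comp e, (ι' (Q A)).comp e']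

lemma diagHom_mul_mem (e e' : A →⋆ₙₐ[ℂ] Q A) (a : A) {r : Mat 2 (Q (Q A))} (hr : r ∈ rSub A) :
    diagHom e e' a * r ∈ rSub A := by
  have hcl : IsClosed {r | diagHom e e' a * r ∈ rSub A} :=
    (genC_isClosed _).preimage (continuous_const.mul continuous_id)
  refine closure_minimal ?_ hcl hr
  intro r hr
  change r ∈ NonUnitalAlgebra.adjoin ℂ _ at hr
  have hgen : ∀ (r : Mat 2 (Q (Q A))), (∃ z, r.entry 0 0 = ι (Q A) (q.incl A z)) ∧
      (∃ z z', r.entry 0 1 = ι (Q A) (q.incl A z) * ι' (Q A) (q.incl A z')) ∧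
      (∃ z z', r.entry 1 0 = ι' (Q A) (q.incl A z) * ι (Q A) (q.incl A z')) ∧
      (∃ z, r.entry 1 1 = ι' (Q A) (q.incl A z)) → diagHom e e' a * r ∈ rSub A := by
    rintro r ⟨⟨z₁, h₁⟩, ⟨z₂, z₃, h₂⟩, ⟨z₄, z₅, h₄⟩, ⟨z₆, h₆⟩⟩
    refine subset_genC _ ⟨⟨q.lmul (e a) z₁, ?_⟩, ⟨q.lmul (e a) z₂, z₃, ?_⟩,
      ⟨q.lmul (e' a) z₄, z₅, ?_⟩, ⟨q.lmul (e' a) z₆, ?_⟩⟩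
    · change _ = ι (Q A) (e a * q.incl A z₁)
      simp [Mat.entry_mul, diagHom, dsum, h₁]
    · change _ = ι (Q A) (e a * q.incl A z₂) * _
      simp [Mat.entry_mul, diagHom, dsum, h₂, mul_assoc]
    · change _ = ι' (Q A) (e' a * q.incl A z₄) * _
      simp [Mat.entry_mul, diagHom, dsum, h₄, mul_assoc]
    · change _ = ι' (Q A) (e' a * q.incl A z₆)
      simp [Mat.entry_mul, diagHom, dsum, h₆]
  have hle : ∀ x ∈ NonUnitalAlgebra.adjoin ℂ _, x ∈ rSub A := fun x hx =>
    NonUnitalStarSubalgebra.le_topologicalClosure _ hx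
  change diagHom e e' a * r ∈ rSub A
  induction hr using NonUnitalAlgebra.adjoin_induction with
  | mem x hx =>
    rcases hx with hx | hx
    · exact hgen x hx
    · obtain ⟨⟨z₁, h₁⟩, ⟨z₂, z₃, h₂⟩, ⟨z₄, z₅, h₄⟩, ⟨z₆, h₆⟩⟩ := hx
      refine hgen x ⟨⟨star z₁, ?_⟩, ⟨star z₅, star z₄, ?_⟩, ⟨star z₃, star z₂, ?_⟩,
        ⟨star z₆, ?_⟩⟩
      · simp only [map_star, ← h₁, Mat.entry_star, star_star]
      · simp only [map_star, ← star_mul, ← h₄, Mat.entry_star, star_star]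
      · simp only [map_star, ← star_mul, ← h₂, Mat.entry_star, star_star]
      · simp only [map_star, ← h₆, Mat.entry_star, star_star]
  | add x y _ _ hx hy => rw [mul_add]; exact add_mem hx hy
  | zero => rw [mul_zero]; exact zero_mem _
  | mul x y _ hy hx _ => rw [← mul_assoc]; exact mul_mem hx (hle y hy)
  | smul t x _ hx => rw [mul_smul_comm]; exact (rSub A).smul_mem t hx

lemma mul_diagHom_mem (e e' : A →⋆ₙₐ[ℂ] Q A) (a : A) {r : Mat 2 (Q (Q A))} (hr : r ∈ rSub A) :
    r * diagHom e e' a ∈ rSub A := by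
  have := star_mem (diagHom_mul_mem e e' (star a) (star_mem hr))
  rwa [star_mul, star_star, map_star, star_star] at this

/-- The homomorphism `A → ℳ(R)` given by multiplication with `η e(x) ⊕ η̄ e'(x)`. -/
def diagM (e e' : A →⋆ₙₐ[ℂ] Q A) : A →⋆ₙₐ[ℂ] 𝓜(ℂ, RAlg A) where
  toFun a :=
    { fst := LinearMap.mkContinuous
        { toFun := fun r => ⟨diagHom e e' a * r.1, diagHom_mul_mem e e' a r.2⟩
          map_add' := fun r s => Subtype.ext (mul_add _ _ _)
          map_smul' := fun t r => Subtype.ext (mul_smul_comm _ _ _) }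
        ‖diagHom e e' a‖ (fun r => norm_mul_le _ r.1)
      snd := LinearMap.mkContinuous
        { toFun := fun r => ⟨r.1 * diagHom e e' a, mul_diagHom_mem e e' a r.2⟩
          map_add' := fun r s => Subtype.ext (add_mul _ _ _)
          map_smul' := fun t r => Subtype.ext (smul_mul_assoc _ _ _) }
        ‖diagHom e e' a‖ (fun r => (norm_mul_le r.1 _).trans (mul_comm _ _).le)
      central := fun r s => Subtype.ext (mul_assoc _ _ _) }
  map_smul' t a := multiplier_ext fun r => Subtype.ext (by
    change diagHom e e' (t • a) * r.1 = t • (diagHom e e' a * r.1)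
    rw [map_smul, smul_mul_assoc])
  map_zero' := multiplier_ext fun r => Subtype.ext (by
    change diagHom e e' 0 * r.1 = 0
    rw [map_zero, zero_mul])
  map_add' a b := multiplier_ext fun r => Subtype.ext (by
    change diagHom e e' (a + b) * r.1 = diagHom e e' a * r.1 + diagHom e e' b * r.1
    rw [map_add, add_mul])
  map_mul' a b := multiplier_ext fun r => Subtype.ext (by
    change diagHom e e' (a * b) * r.1 = diagHom e e' a * (diagHom e e' b * r.1)
    rw [map_mul, mul_assoc])
  map_star' a := multiplier_ext fun r => Subtype.ext (by
    rw [DoubleCentralizer.star_fst]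
    change diagHom e e' (star a) * r.1 = star (star r.1 * diagHom e e' a)
    rw [star_mul, star_star, map_star])

/-- `S` is a self-adjoint multiplier of `R` that lifts the multiplier `(0, 1; 1, 0)` of
`R / J ≅ M₂(qA)` and that commutes modulo `J` with the elements `d(x) = η ε(x) ⊕ η̄ ε(x)`. -/
structure IsSwapLift (S : 𝓜(ℂ, RAlg A)) : Prop where
  isSelfAdjoint : IsSelfAdjoint S
  lifts : ∀ (r : RAlg A) (i j : Fin 2),
    ∃ z, (RAlg.incl A (S.fst r)).entry i j - (RAlg.incl A r).entry i.rev j = q2incl A z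
  commutes : ∀ x : A, ∃ r : RAlg A, InJ A r ∧
    S * diagM (ι A) (ι A) x - diagM (ι A) (ι A) x * S = DoubleCentralizer.coeHom (𝕜 := ℂ) r

/-- The unitary `F = exp(πi/2 · S)`. -/
def expF {S : 𝓜(ℂ, RAlg A)} (hS : IsSelfAdjoint S) : unitary 𝓜(ℂ, RAlg A) :=
  selfAdjoint.expUnitary ((Real.pi / 2 : ℝ) • (⟨S, hS⟩ : selfAdjoint 𝓜(ℂ, RAlg A)))

/-- The automorphism `σ = Ad F`. -/
def sigma {S : 𝓜(ℂ, RAlg A)} (hS : IsSelfAdjoint S) : 𝓜(ℂ, RAlg A) →⋆ₙₐ[ℂ] 𝓜(ℂ, RAlg A) where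
  toFun m := (expF hS : 𝓜(ℂ, RAlg A)) * m * star (expF hS : 𝓜(ℂ, RAlg A))
  map_smul' t m := by simp
  map_zero' := by simp
  map_add' m n := by rw [mul_add, add_mul]
  map_mul' m n := by
    have h : star (expF hS : 𝓜(ℂ, RAlg A)) * (expF hS : 𝓜(ℂ, RAlg A)) = 1 :=
      Unitary.coe_star_mul_self _
    calc _ = (expF hS : 𝓜(ℂ, RAlg A)) * m * 1 * n * star (expF hS : 𝓜(ℂ, RAlg A)) := by
          rw [mul_one, mul_assoc (expF hS : 𝓜(ℂ, RAlg A)) m n]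
      _ = _ := by rw [← h]; simp only [mul_assoc]
  map_star' m := by simp [mul_assoc]

/-- `φ : qA → M₂(q²A)` is a version of the universal map `φ_A = q(h₁, σ h₂)`, for some choice of the
multiplier `S`, where `h₁ = ηε ⊕ η̄ε̄`, `h₂ = ηε̄ ⊕ η̄ε` and `σ = Ad exp(πi/2 · S)`. -/
def IsUniversalMap (φ : q A →⋆ₙₐ[ℂ] Mat 2 (q (q A))) : Prop :=
  ∃ (S : 𝓜(ℂ, RAlg A)) (hS : IsSwapLift S), ∀ z : q A, ∃ r : RAlg A,
    Q.lift (diagM (ι A) (ι' A)) ((sigma hS.isSelfAdjoint).comp (diagM (ι' A) (ι A)))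
      (q.incl A z) = DoubleCentralizer.coeHom (𝕜 := ℂ) r ∧
    RAlg.incl A r = Mat.map 2 (q2incl A) (φ z)

end UniversalMap

/-! ### The product -/

section Product

variable {A B C : Type u} [NonUnitalCStarAlgebra A] [NonUnitalCStarAlgebra B]
  [NonUnitalCStarAlgebra C]

/-- `μ` is the natural map `q(𝒦 ⊗ B) → 𝒦 ⊗ qB`, i.e. the restriction of
`(id ⊗ ι) ⋆ (id ⊗ ῑ) : Q(𝒦 ⊗ B) → 𝒦 ⊗ QB`. -/
def IsMu (μ : q (K B) →⋆ₙₐ[ℂ] K (q B)) : Prop :=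
  ∀ z, K.map (q.incl B) (μ z) = Q.lift (K.map (ι B)) (K.map (ι' B)) (q.incl (K B) z)

/-- `δ : qA → 𝒦 ⊗ C` is a representative `β ♯ α` of the `KK`-product of `α : qA → 𝒦 ⊗ B` and
`β : qB → 𝒦 ⊗ C`. That is, `δ` is the composition
`qA → M₂(q²A) → M₂(q(𝒦 ⊗ B)) → M₂(𝒦 ⊗ qB) → M₂(𝒦 ⊗ 𝒦 ⊗ C) ≅ 𝒦 ⊗ C`
of a version of `φ_A` with `q(α)`, `μ` and `id ⊗ β` (all extended to matrices). -/
def IsProduct (α : q A →⋆ₙₐ[ℂ] K B) (β : q B →⋆ₙₐ[ℂ] K C) (δ : q A →⋆ₙₐ[ℂ] K C) : Prop :=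
  ∃ (φ : q A →⋆ₙₐ[ℂ] Mat 2 (q (q A))) (μ : q (K B) →⋆ₙₐ[ℂ] K (q B)),
    IsUniversalMap φ ∧ IsMu μ ∧
    ((K.toMat (K C) 2).comp (K.double C)).comp δ =
      (Mat.map 2 ((K.map β).comp (μ.comp (q.map α)))).comp φ

/-- `β' : qE_α → 𝒦 ⊗ C` extends `β : qB → 𝒦 ⊗ C` up to homotopy: the restriction of `β'` to `qB₀` is
homotopic to the restriction `qB₀ → q(𝒦 ⊗ B) → 𝒦 ⊗ qB → 𝒦 ⊗ 𝒦 ⊗ C` of (the stabilization of)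
`β`, up to the identification `𝒦 ⊗ C ≅ 𝒦 ⊗ 𝒦 ⊗ C`. -/
def ExtendsUpToHomotopy (α : q A →⋆ₙₐ[ℂ] K B) (β : q B →⋆ₙₐ[ℂ] K C)
    (β' : q (Ext α) →⋆ₙₐ[ℂ] K C) : Prop :=
  ∃ μ : q (K B) →⋆ₙₐ[ℂ] K (q B), IsMu μ ∧
    Homotopic ((K.double C).comp (β'.comp (q.map (Ext.j α))))
      ((K.map β).comp (μ.comp (q.map (Her.incl α))))

/-- The homomorphism
`ω = q(β'_E α_E ⊕ β̄'_E ᾱ_E, β̄'_E α_E ⊕ β'_E ᾱ_E) : qA → M₂(C₀) ⊆ M₂(Z)`,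
where `C₀ ⊆ Z` is the hereditary subalgebra generated by the image of `β'`. -/
def omega {Y Z : Type u} [NonUnitalCStarAlgebra Y] [NonUnitalCStarAlgebra Z]
    (α : q A →⋆ₙₐ[ℂ] Y) (β' : q (Ext α) →⋆ₙₐ[ℂ] Z) : q A →⋆ₙₐ[ℂ] Mat 2 Z :=
  qSum β' ![(Ext.hom β').comp (Ext.hom α), (Ext.hom' β').comp (Ext.hom' α)]
    ![(Ext.hom' β').comp (Ext.hom α), (Ext.hom β').comp (Ext.hom' α)] (by
      intro i x
      fin_cases i
      · exact Ext.hom_sub_hom' β' _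
      · exact Ext.hom'_sub_hom β' _)

/-- The triple product
`q(γ'β'α ⊕ γ̄'β̄'α ⊕ γ'β̄'ᾱ ⊕ γ̄'β'ᾱ, γ̄'β'α ⊕ γ'β̄'α ⊕ γ̄'β̄'ᾱ ⊕ γ'β'ᾱ)`, where the subscripts `E` have
been omitted. -/
def tripleProduct {Y Z W : Type u} [NonUnitalCStarAlgebra Y] [NonUnitalCStarAlgebra Z]
    [NonUnitalCStarAlgebra W] (α : q A →⋆ₙₐ[ℂ] Y) (β' : q (Ext α) →⋆ₙₐ[ℂ] Z)
    (γ' : q (Ext β') →⋆ₙₐ[ℂ] W) : q A →⋆ₙₐ[ℂ] Mat 4 W :=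
  qSum γ'
    ![(Ext.hom γ').comp ((Ext.hom β').comp (Ext.hom α)),
      (Ext.hom' γ').comp ((Ext.hom' β').comp (Ext.hom α)),
      (Ext.hom γ').comp ((Ext.hom' β').comp (Ext.hom' α)),
      (Ext.hom' γ').comp ((Ext.hom β').comp (Ext.hom' α))]
    ![(Ext.hom' γ').comp ((Ext.hom β').comp (Ext.hom α)),
      (Ext.hom γ').comp ((Ext.hom' β').comp (Ext.hom α)),
      (Ext.hom' γ').comp ((Ext.hom' β').comp (Ext.hom' α)),
      (Ext.hom γ').comp ((Ext.hom β').comp (Ext.hom' α))] (by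
      intro i x
      fin_cases i
      · exact Ext.hom_sub_hom' γ' _
      · exact Ext.hom'_sub_hom γ' _
      · exact Ext.hom_sub_hom' γ' _
      · exact Ext.hom'_sub_hom γ' _)

end Product

end CuntzKK

end

noncomputable section

namespace CuntzKK

/-! ### Homotopies of homomorphisms -/

section HomotopyBasics

variable {X Y Z : Type u} [NonUnitalCStarAlgebra X] [NonUnitalCStarAlgebra Y]
  [NonUnitalCStarAlgebra Z]

/-! The proof is formal computation in a category, supported by a few rotations and one analytic
construction.

The category. Homotopy classes of homomorphisms `X → 𝒦 ⊗ Y` are the morphisms of a category `SH`,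
with composition through `𝒦 ⊗ 𝒦 ≅ 𝒦`. It works because every injection of index sets acts on `𝒦 ⊗ Y`
by an endomorphism homotopic to the identity (`K.reindex_homotopic_id`), so the choices in `𝒦 ≅ 𝒦 ⊗
𝒦` and `𝒦 ≅ M_n(𝒦)` disappear. By means of `μ`, `q` is a functor on `SH` (`SH.qhat`), and `π` is a
natural transformation from it to the identity (`SH.comp_of_piq`).

Three identities in `SH` carry the theorem. (a) `q(π_A) φ_A = id` (`of_qmap_piq_comp_universal`).
Under `id ⋆ 0` the pair defining `φ_A` becomes `(ε ⊕ 0, σ(0 ⊕ ε̄))`. Running `Ad exp(πi/2 · tS)` on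
`0 ⊕ ε̄` and a scalar rotation on `0 ⊕ ε` connects it with `(0 ⊕ ε, 0 ⊕ ε̄)`, which is the identity
of `qA`. The two legs agree modulo `qA` all the way, since there `S` is the flip. (b) `π_{qA} =
q(π_A)` on `q²A` (`of_piq_q`). With naturality of `π` this makes (a) two-sided: `φ_A q(π_A) = φ_A
π_{qA} = π_{q²A} q(φ_A) = q(q(π_A) φ_A) = id`. (c) The map `q²A → q(QA)` induced by `qA ⊆ QA` equals
`c q(π_A)`, where `c = q(ηε ⊕ η̄ε̄, η̄ε ⊕ ηε̄)` is `crossPair` (`of_qmap_incl`).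

Consequences. By (a) and (b) a product `δ` of `α` and `β` is determined by `δ q(π_A) = β q(α)`.
Associativity follows by cancelling `q(π_A)` and `q(q(π_A))`. Since `j_E α₀` is the restriction of
`α_E ⋆ ᾱ_E` to `qA`, (c) gives `β' q(j_E) q(α₀) = β' q(α_E ⋆ ᾱ_E) c q(π_A)`, and `β' q(α_E ⋆ ᾱ_E) c`
is `ω`. The triple product results from applying (c) once more, to `γ'` and `ω`.

Existence of `φ_A`. Let `b_n` be an increasing approximate unit of `qA` that is quasicentral in
`QA`, and `b_{n+1} - b_n = e_n* e_n`. The multiplier `S` is the strict limit of the matrices `(0, s;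
s*, 0)` for the partial sums `s` of `∑ η(e_n)* (1 - v_n) η̄(e_n)`. Modulo `J` these sums telescope
to `b_N`, so the limit is the flip. The factors `1 - v_n`, with `v_n ∈ q²A` quasicentral, make the
commutators with `ηε(x) ⊕ η̄ε(x)` norm-summable. Strict convergence is the Cauchy-Schwarz
inequality. -/

lemma Homotopic.refl (φ : X →⋆ₙₐ[ℂ] Y) : Homotopic φ φ :=
  ⟨fun _ => φ, rfl, rfl, fun _ => continuous_const⟩

lemma Homotopic.symm {φ ψ : X →⋆ₙₐ[ℂ] Y} (h : Homotopic φ ψ) : Homotopic ψ φ := by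
  obtain ⟨Φ, h0, h1, hc⟩ := h
  exact ⟨fun t => Φ (unitInterval.symm t), by simpa using h1, by simpa using h0,
    fun x => (hc x).comp unitInterval.continuous_symm⟩

lemma Homotopic.trans {φ ψ χ : X →⋆ₙₐ[ℂ] Y} (h : Homotopic φ ψ) (h' : Homotopic ψ χ) :
    Homotopic φ χ := by
  obtain ⟨Φ, h0, h1, hc⟩ := h
  obtain ⟨Ψ, k0, k1, kc⟩ := h'
  let p : ∀ x, Path (φ x) (ψ x) := fun x => ⟨⟨fun t => Φ t x, hc x⟩, by simp [h0], by simp [h1]⟩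
  let q : ∀ x, Path (ψ x) (χ x) := fun x => ⟨⟨fun t => Ψ t x, kc x⟩, by simp [k0], by simp [k1]⟩
  -- The concatenation is written out so that its values are homomorphisms; concatenation of the
  -- pointwise paths then supplies the continuity.
  let Θ : unitInterval → (X →⋆ₙₐ[ℂ] Y) := fun t =>
    if h : (t : ℝ) ≤ 1 / 2 then Φ ⟨2 * t, (unitInterval.mul_pos_mem_iff zero_lt_two).2 ⟨t.2.1, h⟩⟩
    else Ψ ⟨2 * t - 1, unitInterval.two_mul_sub_one_mem_iff.2 ⟨(not_le.1 h).le, t.2.2⟩⟩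
  have hΘ : ∀ t x, Θ t x = (p x).trans (q x) t := by
    intro t x
    rw [Path.trans_apply]
    by_cases h : (t : ℝ) ≤ 1 / 2
    · simp only [Θ, h, dite_true]; rfl
    · simp only [Θ, h, dite_false]; rfl
  refine ⟨Θ, ?_, ?_, fun x => ?_⟩
  · ext x; rw [hΘ, Path.source]
  · ext x; rw [hΘ, Path.target]
  · simp only [hΘ]; exact ((p x).trans (q x)).continuous

lemma Homotopic.postcomp {φ ψ : X →⋆ₙₐ[ℂ] Y} (h : Homotopic φ ψ) (f : Y →⋆ₙₐ[ℂ] Z) :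
    Homotopic (f.comp φ) (f.comp ψ) := by
  obtain ⟨Φ, h0, h1, hc⟩ := h
  exact ⟨fun t => f.comp (Φ t), by simp only [h0], by simp only [h1],
    fun x => (continuous_hom f).comp (hc x)⟩

lemma Homotopic.precomp {φ ψ : Y →⋆ₙₐ[ℂ] Z} (h : Homotopic φ ψ) (f : X →⋆ₙₐ[ℂ] Y) :
    Homotopic (φ.comp f) (ψ.comp f) := by
  obtain ⟨Φ, h0, h1, hc⟩ := h
  exact ⟨fun t => (Φ t).comp f, by simp only [h0], by simp only [h1], fun x => hc (f x)⟩

/-- The elements at which a family of homomorphisms is continuous form a closed subalgebra. -/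
def continuitySubalgebra {T : Type*} [TopologicalSpace T] (Φ : T → (X →⋆ₙₐ[ℂ] Y)) :
    NonUnitalStarSubalgebra ℂ X where
  carrier := {x | Continuous fun t => Φ t x}
  zero_mem' := by simp [continuous_const]
  add_mem' hx hy := by simp only [Set.mem_ofPred_eq, map_add]; exact Continuous.add hx hy
  mul_mem' hx hy := by simp only [Set.mem_ofPred_eq, map_mul]; exact Continuous.mul hx hy
  smul_mem' c x hx := by simp only [Set.mem_ofPred_eq, map_smul]; exact Continuous.const_smul hx c
  star_mem' hx := by simp only [Set.mem_ofPred_eq, map_star]; exact Continuous.star hx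

/-- Homomorphisms are contractive, so approximating `x` approximates `t ↦ Φ t x` uniformly in `t`.
This is why continuity of a path need only be tested on generators. -/
lemma isClosed_continuitySubalgebra {T : Type*} [TopologicalSpace T] (Φ : T → (X →⋆ₙₐ[ℂ] Y)) :
    IsClosed (continuitySubalgebra Φ : Set X) := by
  refine isClosed_of_closure_subset fun x hx => ?_
  change Continuous fun t => Φ t x
  refine continuous_of_uniform_approx_of_continuous fun v hv => ?_
  obtain ⟨ε, hε, hv⟩ := Metric.mem_uniformity_dist.1 hv
  obtain ⟨y, hy, hd⟩ := Metric.mem_closure_iff.1 hx ε hε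
  refine ⟨fun t => Φ t y, hy, fun t => hv ?_⟩
  rw [dist_eq_norm, ← map_sub]
  exact (NonUnitalStarAlgHom.norm_apply_le _ _).trans_lt (by rwa [← dist_eq_norm])

lemma Relations.continuous_family {T : Type*} [TopologicalSpace T] {G : Type u} (R : Relations G)
    (Φ : T → (R.Univ →⋆ₙₐ[ℂ] Y)) (h : ∀ g, Continuous fun t => Φ t (R.gen g)) (a : R.Univ) :
    Continuous fun t => Φ t a :=
  R.mem_of_gen_mem (continuitySubalgebra Φ) (isClosed_continuitySubalgebra Φ) h a

lemma Q.continuous_family {T : Type*} [TopologicalSpace T] (φ ψ : T → (X →⋆ₙₐ[ℂ] Y))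
    (h : ∀ x, Continuous fun t => φ t x) (h' : ∀ x, Continuous fun t => ψ t x) (w : Q X) :
    Continuous fun t => Q.lift (φ t) (ψ t) w :=
  (freeRel X).continuous_family (fun t => Q.lift (φ t) (ψ t)) (by
    rintro (x | x)
    · exact (h x).congr fun t => (Q.lift_ι (φ t) (ψ t) x).symm
    · exact (h' x).congr fun t => (Q.lift_ι' (φ t) (ψ t) x).symm) w

/-- The factorization of a homomorphism through an injective homomorphism. -/
def factor (j : Y →⋆ₙₐ[ℂ] Z) (hj : Function.Injective j) (f : X →⋆ₙₐ[ℂ] Z)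
    (h : ∀ x, ∃ y, j y = f x) : X →⋆ₙₐ[ℂ] Y where
  toFun x := (h x).choose
  map_smul' c x := hj (by
    rw [(h _).choose_spec, MonoidHom.id_apply, map_smul, map_smul, (h _).choose_spec])
  map_zero' := hj (by rw [(h _).choose_spec, map_zero, map_zero])
  map_add' x y := hj (by rw [(h _).choose_spec, map_add, map_add, (h _).choose_spec,
    (h _).choose_spec])
  map_mul' x y := hj (by rw [(h _).choose_spec, map_mul, map_mul, (h _).choose_spec,
    (h _).choose_spec])
  map_star' x := hj (by rw [(h _).choose_spec, map_star, map_star, (h _).choose_spec])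

@[simp]
lemma factor_spec (j : Y →⋆ₙₐ[ℂ] Z) (hj : Function.Injective j) (f : X →⋆ₙₐ[ℂ] Z)
    (h : ∀ x, ∃ y, j y = f x) (x : X) : j (factor j hj f h x) = f x := (h x).choose_spec

lemma hom_cancel (j : Y →⋆ₙₐ[ℂ] Z) (hj : Function.Injective j) {f g : X →⋆ₙₐ[ℂ] Y}
    (h : j.comp f = j.comp g) : f = g := by
  ext x
  exact hj (DFunLike.congr_fun h x)

lemma norm_hom_of_injective (j : Y →⋆ₙₐ[ℂ] Z) (hj : Function.Injective j) (y : Y) :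
    ‖j y‖ = ‖y‖ :=
  (AddMonoidHomClass.isometry_iff_norm j).1 (NonUnitalStarAlgHom.isometry j hj) y

lemma isClosed_range_of_injective (j : Y →⋆ₙₐ[ℂ] Z) (hj : Function.Injective j) :
    IsClosed (Set.range j) :=
  (NonUnitalStarAlgHom.isometry j hj).isClosedEmbedding.isClosed_range

lemma continuous_of_injective_comp {T : Type*} [TopologicalSpace T] (j : Y →⋆ₙₐ[ℂ] Z)
    (hj : Function.Injective j) (f : T → Y) (h : Continuous fun t => j (f t)) : Continuous f :=
  (NonUnitalStarAlgHom.isometry j hj).isEmbedding.continuous_iff.2 h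

end HomotopyBasics

/-! ### Calculus of the homomorphisms `q(φ, ψ)` -/

section IdealHoms

variable {A D E J : Type u} [NonUnitalCStarAlgebra A] [NonUnitalCStarAlgebra D]
  [NonUnitalCStarAlgebra E] [NonUnitalCStarAlgebra J]

lemma q.incl_isIdealEmbedding : IsIdealEmbedding (q.incl A) where
  injective := q.incl_injective
  mul_mem e b := ⟨q.lmul e b, rfl⟩

lemma q.exists_of_fold {w : Q A} (h : fold A w = 0) : ∃ z, q.incl A z = w := ⟨⟨w, h⟩, rfl⟩

lemma q.incl_map (f : A →⋆ₙₐ[ℂ] D) (z : q A) :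
    q.incl D (q.map f z) = Q.map f (q.incl A z) := rfl

@[simp] lemma Q.map_ι (f : A →⋆ₙₐ[ℂ] D) (a : A) : Q.map f (ι A a) = ι D (f a) :=
  Q.lift_ι _ _ a
@[simp] lemma Q.map_ι' (f : A →⋆ₙₐ[ℂ] D) (a : A) : Q.map f (ι' A a) = ι' D (f a) :=
  Q.lift_ι' _ _ a

lemma Q.lift_map (f : A →⋆ₙₐ[ℂ] D) (φ ψ : D →⋆ₙₐ[ℂ] E) (w : Q A) :
    Q.lift φ ψ (Q.map f w) = Q.lift (φ.comp f) (ψ.comp f) w :=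
  DFunLike.congr_fun (Q.hom_ext (φ := (Q.lift φ ψ).comp (Q.map f))
    (by simp) (by simp)) w

lemma Q.comp_lift (f : D →⋆ₙₐ[ℂ] E) (φ ψ : A →⋆ₙₐ[ℂ] D) (w : Q A) :
    f (Q.lift φ ψ w) = Q.lift (f.comp φ) (f.comp ψ) w :=
  DFunLike.congr_fun (Q.hom_ext (φ := f.comp (Q.lift φ ψ)) (by simp) (by simp)) w

lemma Q.map_comp (f : A →⋆ₙₐ[ℂ] D) (g : D →⋆ₙₐ[ℂ] E) : Q.map (g.comp f) = (Q.map g).comp (Q.map f) :=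
  Q.hom_ext (by simp) (by simp)

lemma q.map_comp (f : A →⋆ₙₐ[ℂ] D) (g : D →⋆ₙₐ[ℂ] E) : q.map (g.comp f) = (q.map g).comp (q.map f) := by
  refine hom_cancel _ q.incl_injective ?_
  ext z
  simp [q.incl_map, Q.map_comp]

lemma q.map_id : q.map (NonUnitalStarAlgHom.id ℂ A) = NonUnitalStarAlgHom.id ℂ (q A) := by
  refine hom_cancel _ q.incl_injective ?_
  ext z
  have : Q.map (NonUnitalStarAlgHom.id ℂ A) = NonUnitalStarAlgHom.id ℂ (Q A) :=
    Q.hom_ext (by simp) (by simp)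
  simp [q.incl_map, this]

lemma Q.lift_self (φ : A →⋆ₙₐ[ℂ] D) (w : Q A) : Q.lift φ φ w = φ (fold A w) :=
  DFunLike.congr_fun (Q.hom_ext (φ := Q.lift φ φ) (ψ := φ.comp (fold A))
    (by simp [fold]) (by simp [fold])) w

lemma Q.lift_self_incl (φ : A →⋆ₙₐ[ℂ] D) (z : q A) : Q.lift φ φ (q.incl A z) = 0 := by
  rw [Q.lift_self, q.fold_incl, map_zero]

lemma Q.lift_ι_ι' (w : Q A) : Q.lift (ι A) (ι' A) w = w :=
  DFunLike.congr_fun (Q.hom_ext (φ := Q.lift (ι A) (ι' A)) (ψ := NonUnitalStarAlgHom.id ℂ _)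
    (by simp) (by simp)) w

lemma piq_apply (z : q A) : piq A z = Q.lift (NonUnitalStarAlgHom.id ℂ A) 0 (q.incl A z) := rfl

lemma comp_piq (φ : A →⋆ₙₐ[ℂ] D) (z : q A) : φ (piq A z) = Q.lift φ 0 (q.incl A z) := by
  rw [piq_apply, Q.comp_lift, NonUnitalStarAlgHom.comp_id]
  congr 2
  ext x
  simp

variable (j : J →⋆ₙₐ[ℂ] E) (hj : IsIdealEmbedding j)

/-- The standard way to identify a homomorphism with some `q(φ, ψ)`: as `j` is injective, only `φ ⋆
ψ` on `qA` has to be computed. -/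
lemma eq_qHom {φ ψ : A →⋆ₙₐ[ℂ] E} (h : ∀ x, ∃ b, j b = φ x - ψ x) {f : q A →⋆ₙₐ[ℂ] J}
    (hf : ∀ z, j (f z) = Q.lift φ ψ (q.incl A z)) : f = qHom j hj φ ψ h := by
  ext z
  exact hj.injective (by rw [hf, qHom_spec])

/-- The source of all homotopies between pairs: both legs may move, provided that they agree modulo
`J` at every time. Continuity can be tested in `E`, because `j` is isometric. -/
lemma qHom_homotopic (φ ψ : unitInterval → (A →⋆ₙₐ[ℂ] E)) (h : ∀ t x, ∃ b, j b = φ t x - ψ t x)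
    (hφ : ∀ x, Continuous fun t => φ t x) (hψ : ∀ x, Continuous fun t => ψ t x) :
    Homotopic (qHom j hj (φ 0) (ψ 0) (h 0)) (qHom j hj (φ 1) (ψ 1) (h 1)) := by
  refine ⟨fun t => qHom j hj (φ t) (ψ t) (h t), rfl, rfl, fun z => ?_⟩
  refine continuous_of_injective_comp j hj.injective _ ?_
  simp only [qHom_spec]
  exact Q.continuous_family φ ψ hφ hψ _

lemma Homotopic.qmap {f g : A →⋆ₙₐ[ℂ] D} (h : Homotopic f g) :
    Homotopic (q.map f) (q.map g) := by
  obtain ⟨Φ, h0, h1, hc⟩ := h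
  refine ⟨fun t => q.map (Φ t), by simp only [h0], by simp only [h1], fun z => ?_⟩
  refine continuous_of_injective_comp _ q.incl_injective _ ?_
  change Continuous fun t => Q.lift ((ι D).comp (Φ t)) ((ι' D).comp (Φ t)) (q.incl A z)
  exact Q.continuous_family (fun t => (ι D).comp (Φ t)) (fun t => (ι' D).comp (Φ t))
    (fun x => (continuous_hom (ι D)).comp (hc x)) (fun x => (continuous_hom (ι' D)).comp (hc x)) _

/-- Two pairs that agree modulo an ideal induce maps on the free product that agree modulo the
ideal. -/
lemma IsIdealEmbedding.lift_sub_lift {j : J →⋆ₙₐ[ℂ] E} (hj : IsIdealEmbedding j)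
    {φ ψ φ' ψ' : A →⋆ₙₐ[ℂ] E}
    (h : ∀ x, ∃ b, j b = φ x - φ' x) (h' : ∀ x, ∃ b, j b = ψ x - ψ' x) (w : Q A) :
    ∃ b, j b = Q.lift φ ψ w - Q.lift φ' ψ' w := by
  let S : NonUnitalStarSubalgebra ℂ (Q A) :=
    { carrier := {w | ∃ b, j b = Q.lift φ ψ w - Q.lift φ' ψ' w}
      zero_mem' := ⟨0, by simp⟩
      add_mem' := by
        rintro v w ⟨b, hb⟩ ⟨c, hc⟩
        exact ⟨b + c, by simp only [map_add, hb, hc]; abel⟩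
      mul_mem' := by
        rintro v w ⟨b, hb⟩ ⟨c, hc⟩
        -- Writing `L`, `L'` for the two maps: `L(vw) - L'(vw) = L(v)(L(w) - L'(w)) + (L(v) -
        -- L'(v))L'(w)`.
        obtain ⟨b', hb'⟩ := hj.mul_mem' b (Q.lift φ' ψ' w)
        obtain ⟨c', hc'⟩ := hj.mul_mem (Q.lift φ ψ v) c
        refine ⟨c' + b', ?_⟩
        rw [map_add, hb', hc', hb, hc, map_mul, map_mul, mul_sub, sub_mul]
        abel
      smul_mem' := by
        rintro c w ⟨b, hb⟩
        exact ⟨c • b, by simp only [map_smul, hb, smul_sub]⟩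
      star_mem' := by
        rintro w ⟨b, hb⟩
        exact ⟨star b, by simp only [map_star, hb, star_sub]⟩ }
  refine Q.mem_of_mem S ?_ (fun a => ?_) (fun a => ?_) w
  · exact (isClosed_range_of_injective j hj.injective).preimage
      (f := fun w => Q.lift φ ψ w - Q.lift φ' ψ' w) ((continuous_hom _).sub (continuous_hom _))
  · change ∃ b, j b = _
    simpa using h a
  · change ∃ b, j b = _
    simpa using h' a

end IdealHoms

/-! ### Hilbert space representations -/

section Representations

open Filter Topology ContinuousLinearMap
open scoped InnerProductSpace ComplexOrder

/-- A functional on a unital C*-algebra with `‖f‖ ≤ 1` and `f 1 = 1` is positive. -/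
lemma nonneg_of_norm_le_one {U : Type u} [CStarAlgebra U] [PartialOrder U] [StarOrderedRing U]
    (f : U →L[ℂ] ℂ) (hf : ‖f‖ ≤ 1) (h1 : f 1 = 1) {x : U} (hx : 0 ≤ x) : 0 ≤ f x := by
  rcases subsingleton_or_nontrivial U with hU | hU
  · simp [Subsingleton.elim x 0]
  have hb : ∀ y, ‖f y‖ ≤ ‖y‖ := fun y => (f.le_opNorm y).trans
    (mul_le_of_le_one_left (norm_nonneg y) hf)
  have hsa : IsSelfAdjoint x := IsSelfAdjoint.of_nonneg hx
  have him : (f x).im = 0 := by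
    by_contra him
    -- From `|f(x) + it|² ≤ ‖x + it‖² ≤ ‖x‖² + t²` the squares of `t` cancel. What remains is linear
    -- in `t` and bounded above, which forces its slope `2 Im f(x)` to vanish.
    have key : ∀ t : ℝ, (f x).im ^ 2 + 2 * (f x).im * t ≤ ‖x‖ ^ 2 := by
      intro t
      have e1 : f (x + (t * Complex.I) • (1 : U)) = f x + t * Complex.I := by
        rw [map_add, map_smul, h1, smul_eq_mul, mul_one]
      have h2 := hb (x + (t * Complex.I) • (1 : U))
      rw [e1] at h2
      have h3 : ‖x + (t * Complex.I) • (1 : U)‖ ^ 2 ≤ ‖x‖ ^ 2 + t ^ 2 := by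
        rw [sq, ← CStarRing.norm_star_mul_self]
        have : star (x + (t * Complex.I) • (1 : U)) * (x + (t * Complex.I) • (1 : U)) =
            x * x + ((t ^ 2 : ℝ) : ℂ) • (1 : U) := by
          simp only [star_add, star_smul, hsa.star_eq, star_one, add_mul, mul_add,
            smul_mul_assoc, mul_smul_comm, one_mul, mul_one]
          have : star ((t : ℂ) * Complex.I) = -(t * Complex.I) := by simp
          rw [this]
          have h4 : (t : ℂ) * Complex.I * -(t * Complex.I) = ((t ^ 2 : ℝ) : ℂ) := by
            push_cast
            linear_combination (-(t:ℂ)^2) * Complex.I_mul_I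
          rw [smul_add, smul_smul, h4, neg_smul]
          abel
        rw [this]
        refine (norm_add_le _ _).trans (add_le_add ?_ ?_)
        · exact (norm_mul_le _ _).trans (sq _).ge
        · rw [norm_smul, CStarRing.norm_one, mul_one, Complex.norm_real]
          exact (abs_of_nonneg (sq_nonneg t)).le
      have h4 : ((f x).im + t) ^ 2 ≤ ‖f x + t * Complex.I‖ ^ 2 := by
        rw [← Complex.normSq_eq_norm_sq, Complex.normSq_apply]
        simp
        nlinarith [sq_nonneg (f x).re]
      have h5 : ‖f x + t * Complex.I‖ ^ 2 ≤ ‖x‖ ^ 2 + t ^ 2 :=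
        le_trans (by gcongr) h3
      nlinarith
    have := key ((‖x‖ ^ 2 + 1) / (2 * (f x).im))
    have h6 : 2 * (f x).im * ((‖x‖ ^ 2 + 1) / (2 * (f x).im)) = ‖x‖ ^ 2 + 1 := by
      field_simp
    nlinarith [sq_nonneg (f x).im]
  have hre : 0 ≤ (f x).re := by
    -- Since `0 ≤ x ≤ ‖x‖ · 1`. Applying `f` gives `|‖x‖ - f(x)| ≤ ‖x‖`, hence `Re f(x) ≥ 0`.
    have h2 : ‖‖x‖ • (1 : U) - x‖ ≤ ‖x‖ := by
      refine (CStarAlgebra.norm_le_norm_of_nonneg_of_le (b := ‖x‖ • (1 : U)) ?_ ?_).trans ?_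
      · rw [sub_nonneg, ← Algebra.algebraMap_eq_smul_one]
        exact IsSelfAdjoint.le_algebraMap_norm_self hsa
      · exact sub_le_self _ hx
      · rw [norm_smul, CStarRing.norm_one, mul_one, norm_norm]
    have h3 := (hb _).trans h2
    have e1 : f (‖x‖ • (1 : U) - x) = ‖x‖ - f x := by
      rw [map_sub, ← Complex.coe_smul, map_smul, h1, smul_eq_mul, mul_one]
    rw [e1] at h3
    have h4 := (Complex.abs_re_le_norm _).trans h3
    simp at h4
    have := (abs_le.1 h4).2
    linarith
  exact Complex.nonneg_iff.2 ⟨hre, him.symm⟩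

/-- Every nonzero element of a C*-algebra is nonzero in some Hilbert space representation. -/
lemma exists_representation {D : Type u} [NonUnitalCStarAlgebra D] {d : D} (hd : d ≠ 0) :
    ∃ (H : Type u) (_ : NormedAddCommGroup H) (_ : InnerProductSpace ℂ H) (_ : CompleteSpace H)
      (π : D →⋆ₙₐ[ℂ] (H →L[ℂ] H)), π d ≠ 0 := by
  let U := Unitization ℂ D
  let _ := CStarAlgebra.spectralOrder U
  let _ := CStarAlgebra.spectralOrderedRing U
  let a : U := star (d : U) * (d : U)
  have ha : 0 ≤ a := star_mul_self_nonneg _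
  have hn : ‖a‖ = ‖d‖ * ‖d‖ := by
    rw [CStarRing.norm_star_mul_self, Unitization.norm_inr]
  have hpos : 0 < ‖a‖ := by rw [hn]; positivity
  -- A norming functional `f` of `‖a‖ · 1 + a` must attain the maximum on both summands, because
  -- `‖c‖ ≥ 2‖a‖`. Thus `f(1) = 1` and `Re f(a) = ‖a‖`, so `f` is a state that does not vanish on
  -- `d* d`.
  let c : U := ‖a‖ • (1 : U) + a
  have hc : 2 * ‖a‖ ≤ ‖c‖ := by
    have h1 := CStarAlgebra.norm_mem_spectrum_of_nonneg ha
    have h2 : ‖a‖ + ‖a‖ ∈ spectrum ℝ c := by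
      have := spectrum.add_mem_add_iff (a := a) (s := ‖a‖) (r := ‖a‖) |>.2 h1
      rwa [Algebra.algebraMap_eq_smul_one] at this
    have := spectrum.norm_le_norm_of_mem h2
    rw [Real.norm_of_nonneg (by positivity)] at this
    linarith
  have hc0 : ‖c‖ ≠ 0 := by intro h; linarith
  obtain ⟨f, hf, hfc⟩ := exists_dual_vector ℂ c hc0
  have hb : ∀ y, ‖f y‖ ≤ ‖y‖ := fun y => by
    simpa [hf] using f.le_opNorm y
  have e1 : f c = ‖a‖ * f 1 + f a := by
    rw [map_add, ← Complex.coe_smul, map_smul, smul_eq_mul]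
  have h1n : ‖f 1‖ ≤ 1 := by simpa using hb 1
  have h1a := hb a
  have hre : ‖c‖ = ‖a‖ * (f 1).re + (f a).re := by
    have := congrArg Complex.re (hfc.symm.trans e1)
    simpa using this
  have h1re : (f 1).re ≤ 1 := (Complex.re_le_norm _).trans h1n
  have hare : (f a).re ≤ ‖a‖ := (Complex.re_le_norm _).trans h1a
  have h1re' : (f 1).re = 1 := by nlinarith
  have hare' : (f a).re = ‖a‖ := by nlinarith
  have hf1 : f 1 = 1 := by
    apply Complex.ext
    · simpa using h1re'
    · have h7 := h1n
      have h8 : Complex.normSq (f 1) ≤ 1 := by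
        rw [Complex.normSq_eq_norm_sq]; nlinarith [norm_nonneg (f 1)]
      rw [Complex.normSq_apply, h1re'] at h8
      simp only [Complex.one_im]
      nlinarith
  let F : U →ₚ[ℂ] ℂ := PositiveLinearMap.mk₀ f.toLinearMap
    (fun x hx => nonneg_of_norm_le_one f hf.le hf1 hx)
  refine ⟨F.GNS, inferInstance, inferInstance, inferInstance,
    F.gnsNonUnitalStarAlgHom.comp (Unitization.inrNonUnitalStarAlgHom ℂ D), fun h => ?_⟩
  -- If the representation killed `d`, then the class of `1` would give `0 = ‖d · 1‖² = F(d* d) =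
  -- F(a)`.
  have h2 : F.gnsNonUnitalStarAlgHom (d : U) (F.toPreGNS 1 : F.PreGNS) = 0 := by
    have := DFunLike.congr_fun h ((F.toPreGNS 1 : F.PreGNS) : F.GNS)
    exact this
  rw [PositiveLinearMap.gnsNonUnitalStarAlgHom_apply_coe] at h2
  have h3 : ‖F.leftMulMapPreGNS (d : U) (F.toPreGNS 1)‖ = 0 := by
    rw [← UniformSpace.Completion.norm_coe, h2, norm_zero]
  have h4 := F.preGNS_norm_sq (F.leftMulMapPreGNS (d : U) (F.toPreGNS 1))
  rw [h3] at h4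
  simp only [PositiveLinearMap.leftMulMapPreGNS_apply, PositiveLinearMap.ofPreGNS_toPreGNS] at h4
  have h5 : F a = 0 := by
    simpa [a] using h4.symm
  have h6 : (F a).re = ‖a‖ := hare'
  rw [h5] at h6
  simp at h6
  exact hpos.ne' (by simpa using h6.symm)

variable {J E : Type u} [NonUnitalCStarAlgebra J] [NonUnitalCStarAlgebra E] {j : J →⋆ₙₐ[ℂ] E}
  {H : Type u} [NormedAddCommGroup H] [InnerProductSpace ℂ H] [CompleteSpace H]

/-- A representation of an ideal extends to the algebra. -/
lemma IsIdealEmbedding.exists_extension (hj : IsIdealEmbedding j) (π : J →⋆ₙₐ[ℂ] (H →L[ℂ] H)) :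
    ∃ ρ : E →⋆ₙₐ[ℂ] (H →L[ℂ] H), ρ.comp j = π := by
  choose m hm using hj.mul_mem
  have hmm : ∀ e b c, m e b * c = m e (b * c) := fun e b c => hj.injective (by
    rw [map_mul, hm, hm, map_mul, mul_assoc])
  have hmn : ∀ e b, ‖m e b‖ ≤ ‖e‖ * ‖b‖ := fun e b => by
    rw [← norm_hom_of_injective j hj.injective, hm, ← norm_hom_of_injective j hj.injective b]
    exact norm_mul_le _ _
  have hmc : ∀ e, Continuous (m e) := fun e => continuous_of_injective_comp j hj.injective _ (by
    simp only [hm]; exact continuous_const.mul (continuous_hom j))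
  have hπn : ∀ b, ‖π b‖ ≤ ‖b‖ := fun b => NonUnitalStarAlgHom.norm_apply_le π b
  have hev : ∀ (x : H), Continuous fun b => π b x := fun x =>
    (ContinuousLinearMap.apply ℂ H x).continuous.comp (continuous_hom π)
  -- The essential subspace of `π`. The extension acts by `e · π(b)y = π(eb)y` on it and by zero on
  -- its complement; both are captured by the limit of `π(eu)x` along an approximate unit `u` of
  -- `J`.
  let H₁ : Submodule ℂ H := (Submodule.span ℂ {x | ∃ b y, x = π b y}).topologicalClosure
  have hmem : ∀ b y, π b y ∈ H₁ := fun b y =>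
    Submodule.le_topologicalClosure _ (Submodule.subset_span ⟨b, y, rfl⟩)
  have hperp : ∀ x ∈ H₁ᗮ, ∀ b, π b x = 0 := by
    intro x hx b
    have h1 : ⟪π (star b) (π b x), x⟫_ℂ = 0 := hx _ (hmem _ _)
    rw [map_star, star_eq_adjoint, adjoint_inner_left] at h1
    exact inner_self_eq_zero.1 h1
  have hconv : ∀ e x, ∃ y, Tendsto (fun u => π (m e u) x) (apx J) (𝓝 y) := by
    intro e x
    have : CompleteSpace H₁ := Submodule.isClosed_topologicalClosure _ |>.completeSpace_coe
    obtain ⟨y, hy, z, hz, rfl⟩ := H₁.exists_add_mem_mem_orthogonal x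
    suffices h : ∃ w, Tendsto (fun u => π (m e u) y) (apx J) (𝓝 w) by
      obtain ⟨w, hw⟩ := h
      exact ⟨w, by simpa [map_add, hperp z hz] using hw⟩
    apply cauchy_map_iff_exists_tendsto.1
    rw [Metric.cauchy_iff]
    refine ⟨inferInstance, fun ε hε => ?_⟩
    have hδ : 0 < ε / (8 * (‖e‖ + 1)) := by positivity
    obtain ⟨y', hy', hd⟩ := Metric.mem_closure_iff.1 hy _ hδ
    have hlim : ∃ w, Tendsto (fun u => π (m e u) y') (apx J) (𝓝 w) := by
      clear hd
      induction hy' using Submodule.span_induction with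
      | mem x hx =>
        obtain ⟨b, x', rfl⟩ := hx
        refine ⟨π (m e b) x', ?_⟩
        have h1 : Tendsto (fun u => π (m e (u * b)) x') (apx J) (𝓝 (π (m e b) x')) :=
          ((hev x').tendsto _).comp (((hmc e).tendsto _).comp (apx_left b))
        refine h1.congr fun u => ?_
        rw [← hmm, map_mul]; rfl
      | zero => exact ⟨0, by simp⟩
      | add x y _ _ hx hy =>
        obtain ⟨v, hv⟩ := hx
        obtain ⟨w, hw⟩ := hy
        exact ⟨v + w, by simpa [map_add] using hv.add hw⟩
      | smul c x _ hx =>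
        obtain ⟨v, hv⟩ := hx
        exact ⟨c • v, by simpa using hv.const_smul c⟩
    obtain ⟨w, hw⟩ := hlim
    have hev := (Metric.tendsto_nhds.1 hw) (ε / 4) (by positivity)
    refine ⟨_, image_mem_map (hev.and (apx_norm J)), ?_⟩
    have hone : ∀ u : J, dist (π (m e u) y') w < ε / 4 ∧ ‖u‖ ≤ 1 →
        dist (π (m e u) y) w < ε / 2 := by
      rintro u ⟨hu, hu1⟩
      have h1 : dist (π (m e u) y) (π (m e u) y') ≤ ε / 8 := by
        rw [dist_eq_norm, ← map_sub]
        rw [dist_eq_norm] at hd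
        calc _ ≤ ‖π (m e u)‖ * ‖y - y'‖ := le_opNorm _ _
          _ ≤ (‖e‖ * 1) * (ε / (8 * (‖e‖ + 1))) := by
            gcongr
            exact (hπn _).trans ((hmn _ _).trans (by gcongr))
          _ ≤ (‖e‖ + 1) * (ε / (8 * (‖e‖ + 1))) := by gcongr; linarith
          _ = ε / 8 := by field_simp
      have := dist_triangle (π (m e u) y) (π (m e u) y') w
      linarith
    rintro _ ⟨u, hu, rfl⟩ _ ⟨u', hu', rfl⟩
    have := dist_triangle_right (π (m e u) y) (π (m e u') y) w
    linarith [hone u hu, hone u' hu']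
  choose T hT using hconv
  have hTb : ∀ e b x, T e (π b x) = π (m e b) x := by
    intro e b x
    refine tendsto_nhds_unique (hT e _) ?_
    have h1 : Tendsto (fun u => π (m e (u * b)) x) (apx J) (𝓝 (π (m e b) x)) :=
      ((hev x).tendsto _).comp (((hmc e).tendsto _).comp (apx_left b))
    refine h1.congr fun u => ?_
    rw [← hmm, map_mul]; rfl
  have hTn : ∀ e x, ‖T e x‖ ≤ ‖e‖ * ‖x‖ := by
    intro e x
    refine le_of_tendsto (hT e x).norm ?_
    filter_upwards [apx_norm J] with u hu
    refine (le_opNorm _ _).trans ?_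
    gcongr
    exact (hπn _).trans ((hmn _ _).trans (mul_le_of_le_one_right (norm_nonneg e) hu))
  let L : E → (H →L[ℂ] H) := fun e => LinearMap.mkContinuous
    { toFun := T e
      map_add' := fun x y => tendsto_nhds_unique (hT e _)
        (by simpa [map_add] using (hT e x).add (hT e y))
      map_smul' := fun c x => tendsto_nhds_unique (hT e _)
        (by simpa using (hT e x).const_smul c) } ‖e‖ (hTn e)
  have hL : ∀ e x, L e x = T e x := fun _ _ => rfl
  refine ⟨{ toFun := L
            map_smul' := fun c e => ?_
            map_zero' := ?_
            map_add' := fun e e' => ?_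
            map_mul' := fun e e' => ?_
            map_star' := fun e => ?_ }, ?_⟩
  · ext x
    refine tendsto_nhds_unique (hT _ x) ?_
    have h1 := (hT e x).const_smul c
    refine h1.congr fun u => ?_
    rw [← smul_apply, ← map_smul]
    congr 2
    exact hj.injective (by rw [map_smul, hm, hm, smul_mul_assoc])
  · ext x
    refine tendsto_nhds_unique (hT _ x) ?_
    have : ∀ u, m 0 u = 0 := fun u => hj.injective (by rw [hm, zero_mul, map_zero])
    simp [this]
  · ext x
    refine tendsto_nhds_unique (hT _ x) ?_
    have h1 := (hT e x).add (hT e' x)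
    refine h1.congr fun u => ?_
    rw [← add_apply, ← map_add]
    congr 2
    exact hj.injective (by rw [map_add, hm, hm, hm, add_mul])
  · ext x
    change T (e * e') x = L e (T e' x)
    refine tendsto_nhds_unique (hT _ x) ?_
    have h1 := ((L e).continuous.tendsto _).comp (hT e' x)
    refine h1.congr fun u => ?_
    rw [Function.comp_apply, hL, hTb]
    congr 2
    exact hj.injective (by rw [hm, hm, hm, mul_assoc])
  · rw [star_eq_adjoint, eq_adjoint_iff]
    intro x y
    -- This is the adjoint relation `⟪e* π(b)x, π(b')y⟫ = ⟪π(b)x, e π(b')y⟫` on generating vectors.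
    -- The complement of `H₁` contributes nothing to either side, and density does the rest.
    have key : ∀ b b' : J, star (m (star e) b) * b' = star b * m e b' := fun b b' =>
      hj.injective (by rw [map_mul, map_star, hm, star_mul, star_star, map_mul, hm, map_star,
        mul_assoc])
    have h0 : ∀ e x, ∀ z ∈ H₁ᗮ, ⟪T e x, z⟫_ℂ = 0 := fun e x z hz => by
      refine hz _ ?_
      exact (Submodule.isClosed_topologicalClosure _).mem_of_tendsto (hT e x)
        (Eventually.of_forall fun u => hmem _ _)
    have h0' : ∀ e, ∀ z ∈ H₁ᗮ, T e z = 0 := fun e z hz =>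
      tendsto_nhds_unique (hT e z) (by simp [hperp z hz])
    have hcl : CompleteSpace H₁ := Submodule.isClosed_topologicalClosure _ |>.completeSpace_coe
    obtain ⟨x₁, hx₁, x₂, hx₂, rfl⟩ := H₁.exists_add_mem_mem_orthogonal x
    obtain ⟨y₁, hy₁, y₂, hy₂, rfl⟩ := H₁.exists_add_mem_mem_orthogonal y
    change ⟪L (star e) (x₁ + x₂), y₁ + y₂⟫_ℂ = ⟪x₁ + x₂, L e (y₁ + y₂)⟫_ℂ
    have h0L : ∀ e, ∀ z ∈ H₁ᗮ, L e z = 0 := h0'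
    have h0R : ∀ e x, ∀ z ∈ H₁ᗮ, ⟪L e x, z⟫_ℂ = 0 := h0
    rw [map_add, map_add, h0L _ _ hx₂, h0L _ _ hy₂, add_zero, add_zero, inner_add_left,
      inner_add_right, h0R _ _ _ hy₂, ← inner_conj_symm x₂, h0R _ _ _ hx₂, map_zero, add_zero,
      add_zero]
    have hcl1 : IsClosed {x | ⟪L (star e) x, y₁⟫_ℂ = ⟪x, L e y₁⟫_ℂ} :=
      isClosed_eq (by fun_prop) (by fun_prop)
    refine closure_minimal ?_ hcl1 hx₁
    intro x hx
    change ⟪L (star e) x, y₁⟫_ℂ = ⟪x, L e y₁⟫_ℂ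
    induction hx using Submodule.span_induction with
    | mem x hx =>
      obtain ⟨b, x', rfl⟩ := hx
      have hcl2 : IsClosed {y | ⟪L (star e) (π b x'), y⟫_ℂ = ⟪π b x', L e y⟫_ℂ} :=
        isClosed_eq (by fun_prop) (by fun_prop)
      refine closure_minimal ?_ hcl2 hy₁
      intro y hy
      change ⟪L (star e) (π b x'), y⟫_ℂ = ⟪π b x', L e y⟫_ℂ
      induction hy using Submodule.span_induction with
      | mem y hy =>
        obtain ⟨b', y', rfl⟩ := hy
        rw [hL, hL, hTb, hTb]
        have h1 : ⟪x', π (star (m (star e) b) * b') y'⟫_ℂ = ⟪x', π (star b * m e b') y'⟫_ℂ := by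
          rw [key]
        rw [map_mul, map_mul, map_star, map_star, star_eq_adjoint, star_eq_adjoint] at h1
        simpa [adjoint_inner_right] using h1
      | zero => simp
      | add x y _ _ hx hy => simp only [map_add, inner_add_right, hx, hy]
      | smul c x _ hx => simp only [map_smul, inner_smul_right, hx]
    | zero => simp
    | add x y _ _ hx hy => simp only [map_add, inner_add_left, hx, hy]
    | smul c x _ hx => simp only [map_smul, inner_smul_left, hx]
  · ext b x
    change T (j b) x = π b x
    refine tendsto_nhds_unique (hT _ x) ?_
    have h1 : Tendsto (fun u => π (b * u) x) (apx J) (𝓝 (π b x)) :=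
      ((hev x).tendsto _).comp (apx_right b)
    refine h1.congr fun u => ?_
    congr 2
    exact hj.injective (by rw [hm, map_mul])

/-- The free product of two copies of an ideal embeds into the free product of two copies of the
algebra. -/
lemma IsIdealEmbedding.Q_map_injective (hj : IsIdealEmbedding j) :
    Function.Injective (Q.map j) := by
  refine (injective_iff_map_eq_zero _).2 fun w hw => ?_
  by_contra hne
  obtain ⟨H, _, _, _, π, hπ⟩ := exists_representation hne
  -- A representation of `QJ` is a pair of representations of `J`. Extending each of them to `E`
  -- factors `π` through `Q.map j`, so `π w = 0`.
  obtain ⟨ρ, hρ⟩ := hj.exists_extension (π.comp (ι J))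
  obtain ⟨ρ', hρ'⟩ := hj.exists_extension (π.comp (ι' J))
  have h1 := Q.lift_map j ρ ρ' w
  rw [hw, map_zero, hρ, hρ', ← Q.comp_lift, Q.lift_ι_ι'] at h1
  exact hπ h1.symm

end Representations

/-! ### Matrices in the stabilization -/

section MatrixBasics

variable {n : ℕ} {A B : Type u} [NonUnitalCStarAlgebra A] [NonUnitalCStarAlgebra B]

lemma Mat.continuous_of_entry {T : Type*} [TopologicalSpace T] {f : T → Mat n A}
    (h : ∀ i j, Continuous fun t => (f t).entry i j) : Continuous f :=
  continuous_pi fun i => continuous_pi fun j => h i j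

lemma Mat.continuous_entry (i j : Fin n) : Continuous fun a : Mat n A => a.entry i j :=
  (continuous_apply j).comp (continuous_apply i)

@[simp] lemma Mat.entry_map (f : A →⋆ₙₐ[ℂ] B) (a : Mat n A) (i j : Fin n) :
    (Mat.map n f a).entry i j = f (a.entry i j) := rfl

lemma Mat.entry_sum {s : Type*} (t : Finset s) (f : s → Mat n A) (i j : Fin n) :
    (∑ x ∈ t, f x).entry i j = ∑ x ∈ t, (f x).entry i j :=
  map_sum (AddMonoidHom.mk' (fun m : Mat n A => m.entry i j) fun _ _ => rfl) f t

lemma Mat.norm_entry_le (a : Mat n A) (i j : Fin n) : ‖a.entry i j‖ ≤ ‖a‖ := by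
  let _ := CStarAlgebra.spectralOrder A
  let _ := CStarAlgebra.spectralOrderedRing A
  exact CStarMatrix.norm_entry_le_norm (M := a)

lemma Mat.map_injective {f : A →⋆ₙₐ[ℂ] B} (hf : Function.Injective f) :
    Function.Injective (Mat.map n f) := fun _ _ h =>
  Mat.ext fun i j => hf (congrArg (fun m => Mat.entry m i j) h)

@[simp] lemma Mat.entry_single (i j : Fin n) (a : A) (k l : Fin n) :
    (Mat.single i j a).entry k l = if k = i ∧ l = j then a else 0 := rfl

lemma entry_dsum (φ : Fin n → A →⋆ₙₐ[ℂ] B) (a : A) (i j : Fin n) :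
    (dsum φ a).entry i j = if i = j then φ i a else 0 := rfl

/-- The embedding of `A` into `M_n(A)` at the diagonal position `i`. -/
def Mat.corner (i : Fin n) : A →⋆ₙₐ[ℂ] Mat n A where
  toFun := Mat.single i i
  map_smul' c a := Mat.ext fun k l => by simp
  map_zero' := Mat.ext fun k l => by simp
  map_add' a b := Mat.ext fun k l => by by_cases h : k = i ∧ l = i <;> simp [h]
  map_mul' a b := Mat.ext fun k l => by
    by_cases hk : k = i <;> by_cases hl : l = i <;> simp [Mat.entry_mul, hk, hl]
  map_star' a := Mat.ext fun k l => by
    by_cases hk : k = i <;> by_cases hl : l = i <;> simp [hk, hl]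

@[simp] lemma Mat.entry_corner (i : Fin n) (a : A) (k l : Fin n) :
    (Mat.corner i a).entry k l = if k = i ∧ l = i then a else 0 := rfl

end MatrixBasics

/-! ### The stabilization as a limit of matrix algebras -/

section StabilizationBasics

open Filter

variable {B C D : Type u} [NonUnitalCStarAlgebra B] [NonUnitalCStarAlgebra C]
  [NonUnitalCStarAlgebra D]

lemma K.e_add (i j : ℕ) (b c : B) : K.e i j (b + c) = K.e i j b + K.e i j c :=
  K.isMatrixUnitFamily.add i j b c
lemma K.e_smul (i j : ℕ) (t : ℂ) (b : B) : K.e i j (t • b) = t • K.e i j b :=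
  K.isMatrixUnitFamily.smul i j t b
lemma K.e_zero (i j : ℕ) : K.e i j (0 : B) = 0 := K.isMatrixUnitFamily.map_zero i j
lemma K.e_mul (i j k : ℕ) (b c : B) : K.e i j b * K.e j k c = K.e i k (b * c) :=
  K.isMatrixUnitFamily.mul i j k b c
lemma K.e_mul_of_ne {j k : ℕ} (h : j ≠ k) (i l : ℕ) (b c : B) : K.e i j b * K.e k l c = 0 :=
  K.isMatrixUnitFamily.mul_of_ne i j k l b c h
lemma K.star_e (i j : ℕ) (b : B) : star (K.e i j b) = K.e j i (star b) :=
  K.isMatrixUnitFamily.star_eq i j b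
lemma K.norm_e_le (i j : ℕ) (b : B) : ‖K.e i j b‖ ≤ ‖b‖ := K.isMatrixUnitFamily.norm_le i j b

/-- `b ↦ e_{ij} ⊗ b` as a linear map. -/
def K.eL (i j : ℕ) : B →L[ℂ] K B :=
  LinearMap.mkContinuous ⟨⟨K.e i j, K.e_add i j⟩, K.e_smul i j⟩ 1
    (fun b => by simpa using K.norm_e_le i j b)

@[simp] lemma K.eL_apply (i j : ℕ) (b : B) : K.eL i j b = K.e i j b := rfl

lemma K.e_sum {s : Type*} (t : Finset s) (f : s → B) (i j : ℕ) :
    K.e i j (∑ x ∈ t, f x) = ∑ x ∈ t, K.e i j (f x) := map_sum (K.eL i j) f t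

lemma K.e_sub (i j : ℕ) (b c : B) : K.e i j (b - c) = K.e i j b - K.e i j c :=
  map_sub (K.eL i j) b c

/-- The inclusion `M_n(B) ⊆ 𝒦 ⊗ B`. -/
def K.ofMat (n : ℕ) : Mat n B →⋆ₙₐ[ℂ] K B where
  toFun a := ∑ i : Fin n, ∑ j : Fin n, K.e i j (a.entry i j)
  map_smul' c a := by simp [K.e_smul, Finset.smul_sum]
  map_zero' := by simp [K.e_zero]
  map_add' a b := by simp [K.e_add, Finset.sum_add_distrib]
  map_mul' a b := by
    simp only [Mat.entry_mul, K.e_sum, Finset.sum_mul]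
    refine Finset.sum_congr rfl fun i _ => ?_
    rw [Finset.sum_comm]
    refine Finset.sum_congr rfl fun k _ => ?_
    symm
    rw [Finset.mul_sum, Finset.sum_eq_single k]
    · simp only [Finset.mul_sum, K.e_mul]
    · intro l _ hl
      rw [Finset.mul_sum]
      exact Finset.sum_eq_zero fun j _ =>
        K.e_mul_of_ne (fun h => hl (Fin.ext h.symm)) _ _ _ _
    · simp
  map_star' a := by
    simp only [star_sum, K.star_e, Mat.entry_star]
    rw [Finset.sum_comm]

lemma K.ofMat_apply (n : ℕ) (a : Mat n B) : K.ofMat n a = ∑ i : Fin n, ∑ j : Fin n, K.e i j (a.entry i j) := rfl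

lemma K.ofMat_single (n : ℕ) (i j : Fin n) (b : B) : K.ofMat n (Mat.single i j b) = K.e i j b := by
  rw [K.ofMat_apply, Finset.sum_eq_single i, Finset.sum_eq_single j]
  · simp
  · intro k _ hk; simp [hk, K.e_zero]
  · simp
  · intro k _ hk; simp [hk, K.e_zero]
  · simp

/-- A closed subalgebra of `𝒦 ⊗ B` that contains the elements `e_{ij} ⊗ b` is everything. -/
lemma K.mem_of_e_mem (S : NonUnitalStarSubalgebra ℂ (K B)) (hS : IsClosed (S : Set (K B)))
    (h : ∀ i j b, K.e i j b ∈ S) (x : K B) : x ∈ S :=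
  (stabRel B).mem_of_gen_mem S hS (fun g => h g.1 g.2.1 g.2.2) x

lemma K.hom_ext {φ ψ : K B →⋆ₙₐ[ℂ] D} (h : ∀ i j b, φ (K.e i j b) = ψ (K.e i j b)) : φ = ψ :=
  (stabRel B).hom_ext fun g => h g.1 g.2.1 g.2.2

lemma K.continuous_family {T : Type*} [TopologicalSpace T] (Φ : T → (K B →⋆ₙₐ[ℂ] D))
    (h : ∀ i j b, Continuous fun t => Φ t (K.e i j b)) (x : K B) : Continuous fun t => Φ t x :=
  (stabRel B).continuous_family Φ (fun g => h g.1 g.2.1 g.2.2) x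

/-- A closed property that holds on all finite matrices holds on `𝒦 ⊗ B`. -/
lemma K.induction_ofMat {P : K B → Prop} (hP : IsClosed {x | P x})
    (h : ∀ n (a : Mat n B), P (K.ofMat n a)) (x : K B) : P x := by
  -- Requiring `x ∈ M_m(B)` for all large `m`, and not for some `m`, places two elements in a common
  -- matrix algebra.
  let S : NonUnitalStarSubalgebra ℂ (K B) :=
    { carrier := {x | ∀ᶠ m in atTop, ∃ a : Mat m B, K.ofMat m a = x}
      zero_mem' := Eventually.of_forall fun m => ⟨0, map_zero _⟩
      add_mem' := fun hx hy => by
        filter_upwards [hx, hy] with m ⟨a, ha⟩ ⟨b, hb⟩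
        exact ⟨a + b, by rw [map_add, ha, hb]⟩
      mul_mem' := fun hx hy => by
        filter_upwards [hx, hy] with m ⟨a, ha⟩ ⟨b, hb⟩
        exact ⟨a * b, by rw [map_mul, ha, hb]⟩
      smul_mem' := fun c x hx => by
        filter_upwards [hx] with m ⟨a, ha⟩
        exact ⟨c • a, by rw [map_smul, ha]⟩
      star_mem' := fun hx => by
        filter_upwards [hx] with m ⟨a, ha⟩
        exact ⟨star a, by rw [map_star, ha]⟩ }
  have hx : x ∈ S.topologicalClosure := by
    refine K.mem_of_e_mem _ (NonUnitalStarSubalgebra.isClosed_topologicalClosure _)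
      (fun i j b => NonUnitalStarSubalgebra.le_topologicalClosure _ ?_) x
    filter_upwards [eventually_gt_atTop i, eventually_gt_atTop j] with m hi hj
    exact ⟨Mat.single ⟨i, hi⟩ ⟨j, hj⟩ b, K.ofMat_single m ⟨i, hi⟩ ⟨j, hj⟩ b⟩
  refine closure_minimal ?_ hP hx
  intro y hy
  obtain ⟨m, a, rfl⟩ := hy.exists
  exact h m a

lemma eq_zero_of_mul_mul {a : B} (h : ∀ c d, c * a * d = 0) : a = 0 := by
  have h1 : ∀ d, a * d = 0 := fun d => by
    rw [← CStarRing.star_mul_self_eq_zero_iff, ← mul_assoc]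
    exact h _ _
  rw [← CStarRing.mul_star_self_eq_zero_iff]
  exact h1 _

/-- On `M_n(B)` the elements `f 0 p c` and `f r 0 d` cut out the entry `(p, r)`, so the map is
injective and therefore isometric there. Isometry, unlike injectivity, passes to the closure. -/
lemma K.lift_injective {f : ℕ → ℕ → B → D} (hf : IsMatrixUnitFamily f)
    (h0 : ∀ b, f 0 0 b = 0 → b = 0) : Function.Injective (K.lift f hf) := by
  refine (injective_iff_map_eq_zero _).2 fun x hx => ?_
  suffices h : ‖K.lift f hf x‖ = ‖x‖ by
    rw [hx, norm_zero] at h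
    exact norm_eq_zero.1 h.symm
  refine K.induction_ofMat (P := fun x => ‖K.lift f hf x‖ = ‖x‖)
    (isClosed_eq (continuous_hom _).norm continuous_norm) (fun n a => ?_) x
  have hinj : Function.Injective ((K.lift f hf).comp (K.ofMat n)) := by
    refine (injective_iff_map_eq_zero _).2 fun a ha => Mat.ext fun p r => ?_
    refine eq_zero_of_mul_mul fun c d => h0 _ ?_
    have h1 : f 0 p c * (K.lift f hf).comp (K.ofMat n) a * f r 0 d = 0 := by
      rw [ha, mul_zero, zero_mul]
    rw [NonUnitalStarAlgHom.comp_apply, K.ofMat_apply, map_sum, Finset.mul_sum, Finset.sum_mul,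
      Finset.sum_eq_single p] at h1
    · rw [map_sum, Finset.mul_sum, Finset.sum_mul, Finset.sum_eq_single r] at h1
      · rwa [K.lift_e, hf.mul, hf.mul] at h1
      · intro k _ hk
        rw [K.lift_e, hf.mul, hf.mul_of_ne _ _ _ _ _ _ (fun h => hk (Fin.ext h))]
      · simp
    · intro k _ hk
      rw [map_sum, Finset.mul_sum, Finset.sum_mul]
      refine Finset.sum_eq_zero fun l _ => ?_
      rw [K.lift_e, hf.mul_of_ne _ _ _ _ _ _ (fun h => hk (Fin.ext h.symm)), zero_mul]
    · simp
  have h1 : ‖K.lift f hf (K.ofMat n a)‖ = ‖a‖ := norm_hom_of_injective _ hinj a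
  refine le_antisymm (NonUnitalStarAlgHom.norm_apply_le _ _) ?_
  rw [h1]
  exact NonUnitalStarAlgHom.norm_apply_le _ _

-- The relations alone do not exclude that the universal algebra collapses; a model is needed. If
-- `B` acts on `H` by `π`, then `e_{ij} ⊗ b` can act on `ℓ²(ℕ, H)` as `V_i π(b) V_j*`, where `V_i`
-- is the inclusion of the `i`-th summand.
open ContinuousLinearMap in
lemma K.e_injective (i j : ℕ) {b : B} (hb : K.e i j b = 0) : b = 0 := by
  by_contra hne
  obtain ⟨H, _, _, _, π, hπ⟩ := exists_representation hne
  let V : ℕ → H →L[ℂ] lp (fun _ : ℕ => H) 2 := fun i =>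
    lp.singleContinuousLinearMap ℂ (fun _ : ℕ => H) 2 i
  have hV : ∀ i j, adjoint (V i) ∘L V j = if i = j then ContinuousLinearMap.id ℂ H else 0 := by
    intro i j
    ext x
    refine ext_inner_left ℂ fun y => ?_
    rw [comp_apply, adjoint_inner_right]
    change inner ℂ (lp.single (E := fun _ : ℕ => H) 2 i y) (lp.single (E := fun _ : ℕ => H) 2 j x) = _
    rw [lp.inner_single_left, lp.single_apply]
    by_cases h : i = j
    · subst h; simp
    · simp [h]
  have hVi : ∀ i x, adjoint (V i) (V i x) = x := fun i x => by
    have := DFunLike.congr_fun (hV i i) x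
    simpa using this
  have hVj : ∀ i j x, i ≠ j → adjoint (V i) (V j x) = 0 := fun i j x h => by
    have := DFunLike.congr_fun (hV i j) x
    simpa [h] using this
  have hfam : IsMatrixUnitFamily fun i j (b : B) => V i ∘L π b ∘L adjoint (V j) :=
    { add := fun i j b c => by simp [map_add, add_comp, comp_add]
      smul := fun i j t b => by simp [map_smul]
      mul := fun i j k b c => by
        ext x : 1
        simp [hVi, map_mul]
      mul_of_ne := fun i j k l b c h => by
        ext x : 1
        simp [hVj _ _ _ h]
      star_eq := fun i j b => by
        simp [star_eq_adjoint, adjoint_comp, map_star, comp_assoc] }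
  have h1 := K.lift_e _ hfam i j b
  rw [hb, map_zero] at h1
  apply hπ
  ext x
  have h2 := congrArg (adjoint (V i)) (DFunLike.congr_fun h1 (V j x))
  simpa [hVi] using h2.symm

lemma K.map_e (φ : B →⋆ₙₐ[ℂ] C) (i j : ℕ) (b : B) : K.map φ (K.e i j b) = K.e i j (φ b) :=
  K.lift_e _ _ i j b

lemma K.map_comp (φ : B →⋆ₙₐ[ℂ] C) (ψ : C →⋆ₙₐ[ℂ] D) : K.map (ψ.comp φ) = (K.map ψ).comp (K.map φ) :=
  K.hom_ext fun i j b => by simp [K.map_e]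

lemma K.map_injective {φ : B →⋆ₙₐ[ℂ] C} (hφ : Function.Injective φ) :
    Function.Injective (K.map φ) :=
  K.lift_injective _ fun b hb => hφ (by rw [K.e_injective 0 0 hb, map_zero])

lemma K.map_ofMat (φ : B →⋆ₙₐ[ℂ] C) (n : ℕ) (a : Mat n B) :
    K.map φ (K.ofMat n a) = K.ofMat n (Mat.map n φ a) := by
  simp [K.ofMat_apply, map_sum, K.map_e]

lemma K.double_e (m n : ℕ) (b : B) :
    K.double B (K.e m n b) = K.e m.unpair.1 n.unpair.1 (K.e m.unpair.2 n.unpair.2 b) :=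
  K.lift_e _ _ m n b

lemma K.double_injective : Function.Injective (K.double B) :=
  K.lift_injective _ fun _ hb => K.e_injective _ _ (K.e_injective _ _ hb)

lemma K.toMat_e (n : ℕ) [NeZero n] (r s : ℕ) (b : B) :
    K.toMat B n (K.e r s b) = Mat.single (Nat.divModEquiv n r).2 (Nat.divModEquiv n s).2
      (K.e (Nat.divModEquiv n r).1 (Nat.divModEquiv n s).1 b) :=
  K.lift_e _ _ r s b

lemma K.toMat_injective (n : ℕ) [NeZero n] : Function.Injective (K.toMat B n) :=
  K.lift_injective _ fun b hb => by
    have := congrArg (fun m => Mat.entry m (Nat.divModEquiv n 0).2 (Nat.divModEquiv n 0).2) hb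
    exact K.e_injective _ _ (by simpa using this)

/-- Surjectivity onto `𝒦 ⊗ B` may be tested on the elements `e_{ij} ⊗ b`. -/
lemma K.surjective_of_e {X : Type u} [NonUnitalCStarAlgebra X] (φ : X →⋆ₙₐ[ℂ] K B)
    (hφ : Function.Injective φ) (h : ∀ i j b, ∃ x, φ x = K.e i j b) : Function.Surjective φ := by
  intro y
  exact K.mem_of_e_mem (NonUnitalStarAlgHom.range φ) (by
    simpa using isClosed_range_of_injective φ hφ) h y

/-- The range is closed, and the `y` for which every `e_{ij} ⊗ y` lies in it form a closed
subalgebra: a product is split as `e_{ij} ⊗ ab = (e_{ij} ⊗ a)(e_{jj} ⊗ b)`. It contains the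
generators. -/
lemma K.double_surjective : Function.Surjective (K.double B) := by
  refine K.surjective_of_e _ K.double_injective fun i j y => ?_
  let S : NonUnitalStarSubalgebra ℂ (K B) :=
    { carrier := {y | ∀ i j, ∃ x, K.double B x = K.e i j y}
      zero_mem' := fun i j => ⟨0, by rw [map_zero, K.e_zero]⟩
      add_mem' := fun hx hy i j => by
        obtain ⟨a, ha⟩ := hx i j
        obtain ⟨b, hb⟩ := hy i j
        exact ⟨a + b, by rw [map_add, ha, hb, K.e_add]⟩
      mul_mem' := fun hx hy i j => by
        obtain ⟨a, ha⟩ := hx i j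
        obtain ⟨b, hb⟩ := hy j j
        exact ⟨a * b, by rw [map_mul, ha, hb, K.e_mul]⟩
      smul_mem' := fun c x hx i j => by
        obtain ⟨a, ha⟩ := hx i j
        exact ⟨c • a, by rw [map_smul, ha, K.e_smul]⟩
      star_mem' := fun hx i j => by
        obtain ⟨a, ha⟩ := hx j i
        exact ⟨star a, by rw [map_star, ha, K.star_e]⟩ }
  have hS : IsClosed (S : Set (K B)) := by
    have : (S : Set (K B)) = ⋂ i, ⋂ j, (K.eL i j) ⁻¹' (Set.range (K.double B)) := by
      ext y
      change (∀ i j, ∃ x, K.double B x = K.e i j y) ↔ _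
      simp
    rw [this]
    exact isClosed_iInter fun i => isClosed_iInter fun j =>
      (isClosed_range_of_injective _ K.double_injective).preimage (K.eL i j).continuous
  exact K.mem_of_e_mem S hS (fun k l b i j =>
    ⟨K.e (Nat.pair i k) (Nat.pair j l) b, by simp [K.double_e]⟩) y i j

/-- The inverse of the isomorphism `𝒦 ⊗ B ≅ 𝒦 ⊗ 𝒦 ⊗ B`. -/
def K.undouble (B : Type u) [NonUnitalCStarAlgebra B] : K (K B) →⋆ₙₐ[ℂ] K B :=
  factor (K.double B) K.double_injective (NonUnitalStarAlgHom.id ℂ _) K.double_surjective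

@[simp] lemma K.double_undouble (x : K (K B)) : K.double B (K.undouble B x) = x :=
  factor_spec _ _ _ _ x

@[simp] lemma K.undouble_double (x : K B) : K.undouble B (K.double B x) = x :=
  K.double_injective (K.double_undouble _)

lemma K.undouble_e (i j k l : ℕ) (b : B) :
    K.undouble B (K.e i j (K.e k l b)) = K.e (Nat.pair i k) (Nat.pair j l) b :=
  K.double_injective (by simp [K.double_e])

lemma K.toMat_surjective (n : ℕ) [NeZero n] : Function.Surjective (K.toMat B n) := by
  have h1 : ∀ (y : K B) (p r : Fin n), ∃ x, K.toMat B n x = Mat.single p r y := by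
    intro y
    have hs0 : ∀ p r : Fin n, Mat.single p r (0 : K B) = 0 := fun p r => Mat.ext (by simp)
    have hsa : ∀ (p r : Fin n) (y z : K B),
        Mat.single p r (y + z) = Mat.single p r y + Mat.single p r z := fun p r y z =>
      Mat.ext fun k l => by by_cases h : k = p ∧ l = r <;> simp [h]
    have hss : ∀ (p r : Fin n) (c : ℂ) (y : K B),
        Mat.single p r (c • y) = c • Mat.single p r y := fun p r c y =>
      Mat.ext fun k l => by by_cases h : k = p ∧ l = r <;> simp [h]
    have hsm : ∀ (p r t : Fin n) (y z : K B),
        Mat.single p r y * Mat.single r t z = Mat.single p t (y * z) := fun p r t y z =>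
      Mat.ext fun k l => by
        by_cases h : k = p <;> by_cases h' : l = t <;> simp [h, h', Mat.entry_mul]
    have hst : ∀ (p r : Fin n) (y : K B), star (Mat.single p r y) = Mat.single r p (star y) :=
      fun p r y => Mat.ext fun k l => by
        by_cases h : k = r <;> by_cases h' : l = p <;> simp [h, h']
    let S : NonUnitalStarSubalgebra ℂ (K B) :=
      { carrier := {y | ∀ p r : Fin n, ∃ x, K.toMat B n x = Mat.single p r y}
        zero_mem' := fun i j => ⟨0, by rw [map_zero, hs0]⟩
        add_mem' := fun hx hy i j => by
          obtain ⟨a, ha⟩ := hx i j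
          obtain ⟨b, hb⟩ := hy i j
          exact ⟨a + b, by rw [map_add, ha, hb, hsa]⟩
        mul_mem' := fun hx hy i j => by
          obtain ⟨a, ha⟩ := hx i j
          obtain ⟨b, hb⟩ := hy j j
          exact ⟨a * b, by rw [map_mul, ha, hb, hsm]⟩
        smul_mem' := fun c x hx i j => by
          obtain ⟨a, ha⟩ := hx i j
          exact ⟨c • a, by rw [map_smul, ha, hss]⟩
        star_mem' := fun hx i j => by
          obtain ⟨a, ha⟩ := hx j i
          exact ⟨star a, by rw [map_star, ha, hst]⟩ }
    have hcs : ∀ p r : Fin n, Continuous (Mat.single p r : K B → Mat n (K B)) := fun p r =>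
      Mat.continuous_of_entry fun k l => by
        by_cases h : k = p ∧ l = r
        · simpa [h] using continuous_id'
        · simpa [h] using continuous_const
    have hS : IsClosed (S : Set (K B)) := by
      have : (S : Set (K B)) =
          ⋂ p : Fin n, ⋂ r : Fin n, (Mat.single p r) ⁻¹' (Set.range (K.toMat B n)) := by
        ext y
        change (∀ p r : Fin n, ∃ x, K.toMat B n x = Mat.single p r y) ↔ _
        simp
      rw [this]
      exact isClosed_iInter fun i => isClosed_iInter fun j =>
        (isClosed_range_of_injective _ (K.toMat_injective n)).preimage (hcs i j)
    exact K.mem_of_e_mem S hS (fun k l b i j =>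
      ⟨K.e ((Nat.divModEquiv n).symm (k, i)) ((Nat.divModEquiv n).symm (l, j)) b, by
        rw [K.toMat_e, Equiv.apply_symm_apply, Equiv.apply_symm_apply]⟩) y
  intro a
  choose x hx using fun p r => h1 (a.entry p r) p r
  refine ⟨∑ p, ∑ r, x p r, Mat.ext fun k l => ?_⟩
  simp only [map_sum, hx, Mat.entry_sum, Mat.entry_single]
  rw [Finset.sum_eq_single k, Finset.sum_eq_single l]
  · simp
  · intro r _ hr; simp [Ne.symm hr]
  · simp
  · intro p _ hp; exact Finset.sum_eq_zero fun r _ => by simp [Ne.symm hp]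
  · simp

end StabilizationBasics

/-! ### Reindexing the compact operators -/

section Reindex

variable {B C D Y : Type u} [NonUnitalCStarAlgebra B] [NonUnitalCStarAlgebra C]
  [NonUnitalCStarAlgebra D] [NonUnitalCStarAlgebra Y]

/-- The endomorphism of `𝒦 ⊗ B` induced by an injection of index sets. -/
def K.reindex (σ : ℕ → ℕ) (hσ : Function.Injective σ) : K B →⋆ₙₐ[ℂ] K B :=
  K.lift (fun i j b => K.e (σ i) (σ j) b)
    { add := fun _ _ b c => K.e_add _ _ b c
      smul := fun _ _ t b => K.e_smul _ _ t b
      mul := fun _ _ _ b c => K.e_mul _ _ _ b c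
      mul_of_ne := fun _ _ _ _ b c h => K.e_mul_of_ne (hσ.ne h) _ _ b c
      star_eq := fun _ _ b => K.star_e _ _ b }

lemma K.reindex_e (σ : ℕ → ℕ) (hσ : Function.Injective σ) (i j : ℕ) (b : B) :
    K.reindex σ hσ (K.e i j b) = K.e (σ i) (σ j) b := K.lift_e _ _ i j b

/-- `𝒦`-conjugation by the isometry that maps the `i`-th basis vector to
`p • e (σ i) + r • e (τ i)`. -/
lemma isMatrixUnitFamily_mix {σ τ : ℕ → ℕ} (hσ : Function.Injective σ) (hτ : Function.Injective τ)
    (hστ : ∀ i j, σ i = τ j ↔ τ i = σ j) {p r : ℂ} (h1 : p * star p + r * star r = 1)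
    (h2 : p * star r + r * star p = 0) :
    IsMatrixUnitFamily fun i j (b : B) => (p * star p) • K.e (σ i) (σ j) b +
      (p * star r) • K.e (σ i) (τ j) b + (r * star p) • K.e (τ i) (σ j) b +
      (r * star r) • K.e (τ i) (τ j) b := by
  have hmul : ∀ (i j k l : ℕ) (b c : B), K.e i j b * K.e k l c =
      (if j = k then (1 : ℂ) else 0) • K.e i l (b * c) := fun i j k l b c => by
    split_ifs with h
    · rw [h, K.e_mul, one_smul]
    · rw [K.e_mul_of_ne h, zero_smul]
  refine ⟨fun i j b c => ?_, fun i j t b => ?_, fun i j k b c => ?_, fun i j k l b c h => ?_,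
    fun i j b => ?_⟩
  · simp only [K.e_add, smul_add]; abel
  · simp only [K.e_smul, smul_add, smul_comm t]
  · simp only [add_mul, mul_add, smul_mul_assoc, mul_smul_comm, hmul, smul_smul, if_true]
    -- The middle factor is the squared norm of `p • e (σ j) + r • e (τ j)`: it is the left-hand
    -- side of `h1` if the two vectors are distinct, and that of `h1` plus that of `h2` if they
    -- coincide. Vectors with different indices can only overlap crosswise, and `h2` makes them
    -- orthogonal.
    by_cases h : σ j = τ j
    · simp only [h, if_true]
      match_scalars
      · linear_combination (p * star p) * (h1 + h2)
      · linear_combination (r * star p) * (h1 + h2)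
      · linear_combination (p * star r) * (h1 + h2)
      · linear_combination (r * star r) * (h1 + h2)
    · have h' : ¬ τ j = σ j := fun h' => h h'.symm
      simp only [h, h', if_false]
      match_scalars
      · linear_combination (p * star p) * h1
      · linear_combination (r * star p) * h1
      · linear_combination (p * star r) * h1
      · linear_combination (r * star r) * h1
  · simp only [add_mul, mul_add, smul_mul_assoc, mul_smul_comm, hmul, smul_smul, hσ.ne h, hτ.ne h,
      if_false]
    by_cases h' : σ j = τ k
    · simp only [h', (hστ j k).1 h', if_true]
      match_scalars
      · linear_combination (p * star p) * h2
      · linear_combination (r * star p) * h2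
      · linear_combination (p * star r) * h2
      · linear_combination (r * star r) * h2
    · have h'' : ¬ τ j = σ k := mt (hστ j k).2 h'
      simp [h', h'']
  · simp only [star_add, star_smul, K.star_e, star_mul, star_star]
    abel

/-- The unit circle, parametrized by the interval from `1` to `-1`. -/
def circ (t : unitInterval) : ℂ := Complex.exp (t * Real.pi * Complex.I)

lemma circ_mul_star (t : unitInterval) : circ t * star (circ t) = 1 := by
  rw [circ, Complex.star_def, ← Complex.exp_conj, ← Complex.exp_add]
  simp

lemma circ_zero : circ 0 = 1 := by simp [circ]

lemma circ_one : circ 1 = -1 := by simp [circ]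

lemma continuous_circ : Continuous circ := by
  unfold circ
  fun_prop

/-- Two injections of which the difference is an involution induce homotopic endomorphisms. -/
lemma K.exists_path {σ τ : ℕ → ℕ} (hσ : Function.Injective σ) (hτ : Function.Injective τ)
    (hστ : ∀ i j, σ i = τ j ↔ τ i = σ j) :
    ∃ Φ : unitInterval → (K B →⋆ₙₐ[ℂ] K B), Φ 0 = K.reindex σ hσ ∧ Φ 1 = K.reindex τ hτ ∧
      (∀ x, Continuous fun t => Φ t x) ∧
      ∀ i j b, σ i = τ i → σ j = τ j → ∀ t, Φ t (K.e i j b) = K.e (σ i) (σ j) b := by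
  -- With `p = (1 + z)/2` and `r = (1 - z)/2` both conditions hold if `|z| = 1`. As `z` runs from
  -- `1` to `-1`, the isometry moves from `σ` to `τ`.
  have h1 : ∀ t, (1 + circ t) / 2 * star ((1 + circ t) / 2) +
      (1 - circ t) / 2 * star ((1 - circ t) / 2) = 1 := fun t => by
    have := circ_mul_star t
    simp only [star_div₀, star_add, star_sub, star_one, star_ofNat]
    linear_combination (1 / 2) * this
  have h2 : ∀ t, (1 + circ t) / 2 * star ((1 - circ t) / 2) +
      (1 - circ t) / 2 * star ((1 + circ t) / 2) = 0 := fun t => by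
    have := circ_mul_star t
    simp only [star_div₀, star_add, star_sub, star_one, star_ofNat]
    linear_combination (-1 / 2) * this
  refine ⟨fun t => K.lift _ (isMatrixUnitFamily_mix hσ hτ hστ (h1 t) (h2 t)), ?_, ?_, ?_, ?_⟩
  · refine K.hom_ext fun i j b => ?_
    rw [K.lift_e, K.reindex_e, circ_zero]
    simp
  · refine K.hom_ext fun i j b => ?_
    rw [K.lift_e, K.reindex_e, circ_one]
    simp
  · refine fun x => K.continuous_family _ (fun i j b => ?_) x
    simp only [K.lift_e]
    have := continuous_circ
    fun_prop
  · intro i j b hi hj t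
    rw [K.lift_e, ← hi, ← hj, ← add_smul, ← add_smul, ← add_smul]
    have : (1 + circ t) / 2 * star ((1 + circ t) / 2) + (1 + circ t) / 2 * star ((1 - circ t) / 2) +
      (1 - circ t) / 2 * star ((1 + circ t) / 2) + (1 - circ t) / 2 * star ((1 - circ t) / 2) = 1 := by
      linear_combination h1 t + h2 t
    rw [this, one_smul]

/-- Concatenation of infinitely many homotopies which are eventually constant on the generators. -/
lemma K.homotopic_of_seq (φ : ℕ → (K B →⋆ₙₐ[ℂ] Y)) (Φ : ℕ → unitInterval → (K B →⋆ₙₐ[ℂ] Y))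
    (h0 : ∀ k, Φ k 0 = φ k) (h1 : ∀ k, Φ k 1 = φ (k + 1)) (hc : ∀ k x, Continuous fun t => Φ k t x)
    (ψ : K B →⋆ₙₐ[ℂ] Y)
    (hev : ∀ i j b, ∃ N, ∀ k ≥ N, ∀ t, Φ k t (K.e i j b) = ψ (K.e i j b)) :
    Homotopic (φ 0) ψ := by
  classical
  -- The `k`-th homotopy is run for `t` between `1 - 2^{-k}` and `1 - 2^{-k-1}`.
  let c : ℕ → unitInterval → unitInterval := fun k t =>
    Set.projIcc (0 : ℝ) 1 zero_le_one (2 - 2 ^ (k + 1) * (1 - (t : ℝ)))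
  have hcc : ∀ k, Continuous (c k) := fun k => continuous_projIcc.comp (by fun_prop)
  have hc1 : ∀ k t, c k t ≠ 1 → ∀ m > k, c m t = 0 := by
    intro k t hk m hm
    refine Set.projIcc_of_le_left _ ?_
    have h2 : 1 < 2 ^ (k + 1) * (1 - (t : ℝ)) := by
      by_contra hle
      exact hk (Set.projIcc_of_right_le _ (by linarith))
    have h3 : (2 : ℝ) ^ (m + 1) = 2 ^ (k + 1) * 2 ^ (m - k) := by
      rw [← pow_add]; congr 1; omega
    have h4 : (2 : ℝ) ≤ 2 ^ (m - k) := by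
      calc (2 : ℝ) = 2 ^ 1 := by norm_num
        _ ≤ _ := pow_le_pow_right₀ (by norm_num) (by omega)
    rw [h3]
    nlinarith
  let Γ : unitInterval → (K B →⋆ₙₐ[ℂ] Y) := fun t =>
    if h : ∃ k, c k t ≠ 1 then Φ (Nat.find h) (c (Nat.find h) t) else ψ
  refine ⟨Γ, ?_, ?_, K.continuous_family Γ fun i j b => ?_⟩
  · have h : c 0 0 = 0 := Set.projIcc_of_le_left _ (by norm_num)
    have hex : ∃ k, c k 0 ≠ 1 := ⟨0, by rw [h]; exact zero_ne_one⟩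
    have hf : Nat.find hex = 0 := (Nat.find_eq_zero hex).2 (by rw [h]; exact zero_ne_one)
    simp only [Γ, hex, dite_true, hf, h, h0]
  · have h : ∀ k, c k 1 = 1 := fun k => Set.projIcc_of_right_le _ (by norm_num)
    simp [Γ, h]
  · obtain ⟨N, hN⟩ := hev i j b
    generalize K.e i j b = x at hN
    have hφ : ∀ k ≥ N, φ k x = ψ x := fun k hk => by rw [← h0]; exact hN k hk 0
    -- On a fixed generator only the first `N` homotopies are visible. The path is then a finite sum
    -- of continuous increments, which gives continuity also at `t = 1`.
    have key : ∀ t, Γ t x = φ 0 x + ∑ k ∈ Finset.range N, (Φ k (c k t) x - φ k x) := by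
      intro t
      have htel : ∀ M, (∀ k < M, c k t = 1) →
          φ 0 x + ∑ k ∈ Finset.range M, (Φ k (c k t) x - φ k x) = φ M x := by
        intro M
        induction M with
        | zero => simp
        | succ M ih =>
          intro hM
          rw [Finset.sum_range_succ, ← add_assoc, ih fun k hk => hM k (by omega), hM M (by omega),
            h1]
          abel
      by_cases h : ∃ k, c k t ≠ 1
      · simp only [Γ, h, dite_true]
        have hlt : ∀ k < Nat.find h, c k t = 1 := fun k hk => not_not.1 (Nat.find_min h hk)
        have hne := Nat.find_spec h
        generalize Nat.find h = k₀ at hlt hne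
        rcases lt_or_ge k₀ N with hk | hk
        · have : ∀ d, φ 0 x + ∑ k ∈ Finset.range (k₀ + 1 + d), (Φ k (c k t) x - φ k x) =
              Φ k₀ (c k₀ t) x := by
            intro d
            induction d with
            | zero =>
              rw [add_zero, Finset.sum_range_succ, ← add_assoc, htel k₀ hlt]
              abel
            | succ d ih =>
              rw [← add_assoc, Finset.sum_range_succ, ← add_assoc, ih,
                hc1 k₀ t hne (k₀ + 1 + d) (by omega), h0]
              abel
          rw [← this (N - (k₀ + 1))]
          congr 3
          omega
        · rw [htel N fun k hk' => hlt k (by omega), hN k₀ hk, hφ N le_rfl]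
      · simp only [Γ, h, dite_false]
        push Not at h
        rw [htel N fun k _ => h k, hφ N le_rfl]
    simp only [key]
    exact continuous_const.add (continuous_finsetSum _ fun k _ =>
      ((hc k x).comp (hcc k)).sub continuous_const)

/-- The sequence of injections that deforms `σ` into the identity. -/
def swapSeq (σ : ℕ → ℕ) : ℕ → ℕ → ℕ
  | 0 => σ
  | k + 1 => fun i => Equiv.swap k (swapSeq σ k k) (swapSeq σ k i)

lemma swapSeq_injective {σ : ℕ → ℕ} (hσ : Function.Injective σ) (k : ℕ) :
    Function.Injective (swapSeq σ k) := by
  induction k with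
  | zero => exact hσ
  | succ k ih => exact (Equiv.injective _).comp ih

/-- The `k`-th transposition moves the value at `k` to `k`. The values at smaller indices have
already been corrected, and by injectivity the transposition does not touch them. -/
lemma swapSeq_of_lt {σ : ℕ → ℕ} (hσ : Function.Injective σ) {k i : ℕ} (h : i < k) :
    swapSeq σ k i = i := by
  induction k with
  | zero => omega
  | succ k ih =>
    rcases Nat.lt_succ_iff_lt_or_eq.1 h with h' | rfl
    · have h1 := ih h'
      change Equiv.swap k (swapSeq σ k k) (swapSeq σ k i) = i
      rw [h1, Equiv.swap_apply_of_ne_of_ne (by omega)]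
      intro h2
      exact absurd (swapSeq_injective hσ k (h1.trans h2)) (by omega)
    · exact Equiv.swap_apply_right _ _

/-- Consecutive members of `swapSeq σ` differ by a transposition, an involution, so `K.exists_path`
connects them. On `e_{ij} ⊗ b` these paths are constant as soon as `k > i + j`, hence infinitely
many of them can be concatenated. A non-surjective `σ` is allowed, which is what makes `x ↦ e₀₀ ⊗ x`
a unit for the stable composition. -/
lemma K.reindex_homotopic_id (σ : ℕ → ℕ) (hσ : Function.Injective σ) :
    Homotopic (K.reindex σ hσ) (NonUnitalStarAlgHom.id ℂ (K B)) := by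
  have hp := fun k => K.exists_path (B := B) (swapSeq_injective hσ k) (swapSeq_injective hσ (k + 1))
    (fun i j => by
      change swapSeq σ k i = Equiv.swap k (swapSeq σ k k) (swapSeq σ k j) ↔
        Equiv.swap k (swapSeq σ k k) (swapSeq σ k i) = swapSeq σ k j
      exact (Equiv.swap_apply_eq_iff).symm)
  choose Φ h0 h1 hc he using hp
  refine K.homotopic_of_seq (fun k => K.reindex (swapSeq σ k) (swapSeq_injective hσ k)) Φ h0 h1 hc _
    fun i j b => ⟨i + j + 1, fun k hk t => ?_⟩
  rw [he k i j b, swapSeq_of_lt hσ (by omega), swapSeq_of_lt hσ (by omega)]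
  · rfl
  · rw [swapSeq_of_lt hσ (by omega), swapSeq_of_lt hσ (by omega)]
  · rw [swapSeq_of_lt hσ (by omega), swapSeq_of_lt hσ (by omega)]

end Reindex

/-! ### Stable homotopy classes -/

section StableClasses

variable {W X Y Z : Type u} [NonUnitalCStarAlgebra W] [NonUnitalCStarAlgebra X]
  [NonUnitalCStarAlgebra Y] [NonUnitalCStarAlgebra Z]

variable (X Y) in
/-- Homotopy as an equivalence relation. -/
def homotopySetoid : Setoid (X →⋆ₙₐ[ℂ] Y) where
  r := Homotopic
  iseqv := ⟨Homotopic.refl, Homotopic.symm, Homotopic.trans⟩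

variable (X Y) in
/-- Homotopy classes of homomorphisms `X → 𝒦 ⊗ Y`. -/
def SH : Type u := Quotient (homotopySetoid X (K Y))

/-- The class of a homomorphism `X → 𝒦 ⊗ Y`. -/
def SH.mk (f : X →⋆ₙₐ[ℂ] K Y) : SH X Y := Quotient.mk (homotopySetoid X (K Y)) f

lemma SH.mk_eq {f g : X →⋆ₙₐ[ℂ] K Y} : SH.mk f = SH.mk g ↔ Homotopic f g :=
  Quotient.eq (r := homotopySetoid X (K Y))

lemma SH.mk_eq_of_reindex {f g : X →⋆ₙₐ[ℂ] K Y} (σ : ℕ → ℕ) (hσ : Function.Injective σ)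
    (h : f = (K.reindex σ hσ).comp g) : SH.mk f = SH.mk g :=
  SH.mk_eq.2 (h ▸ (K.reindex_homotopic_id σ hσ).precomp g)

lemma SH.ind {P : SH X Y → Prop} (h : ∀ f, P (SH.mk f)) (a : SH X Y) : P a :=
  Quotient.ind h a

lemma Homotopic.kmap {f g : X →⋆ₙₐ[ℂ] Y} (h : Homotopic f g) : Homotopic (K.map f) (K.map g) := by
  obtain ⟨Φ, h0, h1, hc⟩ := h
  refine ⟨fun t => K.map (Φ t), by simp only [h0], by simp only [h1],
    K.continuous_family _ fun i j b => ?_⟩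
  simp only [K.map_e]
  exact (K.eL i j).continuous.comp (hc b)

/-- The composition of stable homotopy classes. -/
def SH.comp (g : SH Y Z) (f : SH X Y) : SH X Z :=
  Quotient.map₂ (sa := homotopySetoid Y (K Z)) (sb := homotopySetoid X (K Y))
    (sc := homotopySetoid X (K Z))
    (fun g f => (K.undouble Z).comp ((K.map g).comp f))
    (fun _ _ hg f _ hf => Homotopic.postcomp
      (((Homotopic.kmap hg).precomp f).trans (Homotopic.postcomp hf _)) _) g f

lemma SH.mk_comp_mk (g : Y →⋆ₙₐ[ℂ] K Z) (f : X →⋆ₙₐ[ℂ] K Y) :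
    (SH.mk g).comp (SH.mk f) = SH.mk ((K.undouble Z).comp ((K.map g).comp f)) := rfl

variable (X) in
/-- The inclusion `x ↦ e₀₀ ⊗ x`. -/
def K.inc : X →⋆ₙₐ[ℂ] K X := (K.ofMat 1).comp (Mat.corner 0)

lemma K.inc_apply (x : X) : K.inc X x = K.e 0 0 x := K.ofMat_single 1 0 0 x

/-- The stable class of a homomorphism. -/
def SH.of (h : X →⋆ₙₐ[ℂ] Y) : SH X Y := SH.mk ((K.inc Y).comp h)

lemma SH.of_eq {f g : X →⋆ₙₐ[ℂ] Y} (h : Homotopic f g) : SH.of f = SH.of g :=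
  SH.mk_eq.2 (h.postcomp _)

lemma K.undouble_map_inc : (K.undouble Y).comp (K.map (K.inc Y)) =
    K.reindex (fun i => Nat.pair i 0) (fun _ _ h => (Nat.pair_eq_pair.1 h).1) :=
  K.hom_ext fun i j b => by
    simp only [NonUnitalStarAlgHom.comp_apply, K.map_e, K.inc_apply, K.undouble_e]
    exact (K.reindex_e (fun i => Nat.pair i 0) _ i j b).symm

lemma K.undouble_inc : (K.undouble Y).comp (K.inc (K Y)) =
    K.reindex (fun i => Nat.pair 0 i) (fun _ _ h => (Nat.pair_eq_pair.1 h).2) :=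
  K.hom_ext fun i j b => by
    simp only [NonUnitalStarAlgHom.comp_apply, K.inc_apply, K.undouble_e]
    exact (K.reindex_e (fun i => Nat.pair 0 i) _ i j b).symm

lemma K.hom_ext₂ {φ ψ : K (K Y) →⋆ₙₐ[ℂ] Z}
    (h : ∀ i j k l b, φ (K.e i j (K.e k l b)) = ψ (K.e i j (K.e k l b))) : φ = ψ := by
  have : φ.comp (K.double Y) = ψ.comp (K.double Y) := K.hom_ext fun m n b => by
    simp [K.double_e, h]
  ext x
  obtain ⟨y, rfl⟩ := K.double_surjective x
  exact DFunLike.congr_fun this y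

lemma K.map_undouble (h : Y →⋆ₙₐ[ℂ] Z) :
    (K.map h).comp (K.undouble Y) = (K.undouble Z).comp (K.map (K.map h)) :=
  K.hom_ext₂ fun i j k l b => by simp [K.map_e, K.undouble_e]

/-- The stable composite is `g ∘ h` placed in the corner `e₀₀`, that is, reindexed along `i ↦ (0,
i)`. -/
lemma SH.mk_comp_of (g : Y →⋆ₙₐ[ℂ] K Z) (h : X →⋆ₙₐ[ℂ] Y) :
    (SH.mk g).comp (SH.of h) = SH.mk (g.comp h) := by
  refine SH.mk_eq_of_reindex (fun i => Nat.pair 0 i) (fun i j h => (Nat.pair_eq_pair.1 h).2) ?_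
  rw [← K.undouble_inc]
  ext x
  simp [K.inc_apply, K.map_e]

lemma SH.of_comp_mk (h : Y →⋆ₙₐ[ℂ] Z) (f : X →⋆ₙₐ[ℂ] K Y) :
    (SH.of h).comp (SH.mk f) = SH.mk ((K.map h).comp f) := by
  refine SH.mk_eq_of_reindex (fun i => Nat.pair i 0) (fun i j h => (Nat.pair_eq_pair.1 h).1) ?_
  rw [← K.undouble_map_inc]
  ext x
  simp only [NonUnitalStarAlgHom.comp_apply]
  rw [K.map_comp]
  rfl

lemma SH.of_comp (g : Y →⋆ₙₐ[ℂ] Z) (h : X →⋆ₙₐ[ℂ] Y) :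
    SH.of (g.comp h) = (SH.of g).comp (SH.of h) := by
  rw [SH.of, SH.of, SH.mk_comp_of]
  rfl

variable (X) in
/-- The identity class. -/
def SH.id : SH X X := SH.of (NonUnitalStarAlgHom.id ℂ X)

@[simp] lemma SH.comp_id (f : SH X Y) : f.comp (SH.id X) = f := by
  induction f using SH.ind with | h f => ?_
  rw [SH.id, SH.mk_comp_of]
  rfl

/-- The permutation of indices that compares the two identifications `𝒦 ⊗ 𝒦 ⊗ 𝒦 ≅ 𝒦`. -/
def pairAssoc (n : ℕ) : ℕ :=
  Nat.pair n.unpair.1.unpair.1 (Nat.pair n.unpair.1.unpair.2 n.unpair.2)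

lemma pairAssoc_pair (i j k : ℕ) :
    pairAssoc (Nat.pair (Nat.pair i j) k) = Nat.pair i (Nat.pair j k) := by
  simp [pairAssoc]

lemma pairAssoc_injective : Function.Injective pairAssoc := by
  intro m n h
  obtain ⟨h1, h2⟩ := Nat.pair_eq_pair.1 h
  obtain ⟨h3, h4⟩ := Nat.pair_eq_pair.1 h2
  have h5 : m.unpair.1 = n.unpair.1 := by
    rw [← Nat.pair_unpair m.unpair.1, ← Nat.pair_unpair n.unpair.1, h1, h3]
  rw [← Nat.pair_unpair m, ← Nat.pair_unpair n, h5, h4]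

lemma K.undouble_map_undouble : (K.undouble Z).comp (K.map (K.undouble Z)) =
    (K.reindex pairAssoc pairAssoc_injective).comp
      ((K.undouble Z).comp (K.undouble (K Z))) := by
  have h : ((K.undouble Z).comp (K.map (K.undouble Z))).comp (K.map (K.double Z)) =
      ((K.reindex pairAssoc pairAssoc_injective).comp
      ((K.undouble Z).comp (K.undouble (K Z)))).comp (K.map (K.double Z)) :=
    K.hom_ext₂ fun i j k l b => by
      obtain ⟨k, k', rfl⟩ : ∃ a b, k = Nat.pair a b := ⟨_, _, (Nat.pair_unpair k).symm⟩
      obtain ⟨l, l', rfl⟩ : ∃ a b, l = Nat.pair a b := ⟨_, _, (Nat.pair_unpair l).symm⟩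
      simp [K.map_e, K.double_e, K.undouble_e, K.reindex_e, pairAssoc_pair]
  have hs : (K.map (K.double Z)).comp (K.map (K.undouble Z)) = NonUnitalStarAlgHom.id ℂ _ :=
    K.hom_ext fun i j b => by simp [K.map_e]
  have := congrArg (fun f => f.comp (K.map (K.undouble Z))) h
  simpa only [NonUnitalStarAlgHom.comp_assoc, hs, NonUnitalStarAlgHom.comp_id] using this

/-- The two sides use the two bracketings of `𝒦 ⊗ 𝒦 ⊗ 𝒦 ≅ 𝒦`, which differ by the reindexing
`pairAssoc`. -/
lemma SH.assoc (h : SH Y Z) (g : SH X Y) (f : SH W X) : (h.comp g).comp f = h.comp (g.comp f) := by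
  induction f using SH.ind with | h f => ?_
  induction g using SH.ind with | h g => ?_
  induction h using SH.ind with | h h => ?_
  simp only [SH.mk_comp_mk]
  refine SH.mk_eq_of_reindex pairAssoc pairAssoc_injective ?_
  have h1 := K.map_undouble h
  have h2 := K.undouble_map_undouble (Z := Z)
  ext x
  have h3 := DFunLike.congr_fun h1 (K.map g (f x))
  have h4 := DFunLike.congr_fun h2 (K.map (K.map h) (K.map g (f x)))
  simp only [NonUnitalStarAlgHom.comp_apply] at h3 h4 ⊢
  rw [h3, ← h4, K.map_comp, K.map_comp]
  rfl

end StableClasses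

/-! ### Matrix-valued homomorphisms as stable classes -/

section MatrixClasses

variable {W X Y Z C : Type u} [NonUnitalCStarAlgebra W] [NonUnitalCStarAlgebra X]
  [NonUnitalCStarAlgebra Y] [NonUnitalCStarAlgebra Z] [NonUnitalCStarAlgebra C] {n : ℕ}

/-- The stable class of a homomorphism `X → M_n(Y)`. -/
def SH.ofMat (f : X →⋆ₙₐ[ℂ] Mat n Y) : SH X Y := SH.mk ((K.ofMat n).comp f)

lemma SH.ofMat_eq {f g : X →⋆ₙₐ[ℂ] Mat n Y} (h : Homotopic f g) : SH.ofMat f = SH.ofMat g :=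
  SH.mk_eq.2 (h.postcomp _)

lemma SH.ofMat_comp (f : X →⋆ₙₐ[ℂ] Mat n Y) (h : W →⋆ₙₐ[ℂ] X) :
    SH.ofMat (f.comp h) = (SH.ofMat f).comp (SH.of h) := by
  rw [SH.ofMat, SH.ofMat, SH.mk_comp_of]
  rfl

lemma SH.of_comp_ofMat (g : Y →⋆ₙₐ[ℂ] Z) (f : X →⋆ₙₐ[ℂ] Mat n Y) :
    (SH.of g).comp (SH.ofMat f) = SH.ofMat ((Mat.map n g).comp f) := by
  rw [SH.ofMat, SH.ofMat, SH.of_comp_mk]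
  congr 1
  ext x
  simp [K.map_ofMat]

/-- The position on the diagonal is irrelevant, because a transposition of indices acts trivially up
to homotopy. -/
lemma SH.ofMat_corner (i : Fin n) (f : X →⋆ₙₐ[ℂ] Y) :
    SH.ofMat ((Mat.corner i).comp f) = SH.of f := by
  refine SH.mk_eq_of_reindex (Equiv.swap 0 (i : ℕ)) (Equiv.injective _) ?_
  ext x
  simp only [NonUnitalStarAlgHom.comp_apply, K.inc_apply, K.reindex_e, Equiv.swap_apply_left]
  exact K.ofMat_single n i i (f x)

variable (C) in
/-- The class of the identity map of `𝒦 ⊗ C`, as a stable class from `𝒦 ⊗ C` to `C`. -/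
def SH.ev : SH (K C) C := SH.mk (NonUnitalStarAlgHom.id ℂ (K C))

lemma SH.ev_comp_of (f : X →⋆ₙₐ[ℂ] K C) : (SH.ev C).comp (SH.of f) = SH.mk f :=
  SH.mk_comp_of _ _

lemma K.map_id : K.map (NonUnitalStarAlgHom.id ℂ Y) = NonUnitalStarAlgHom.id ℂ (K Y) :=
  K.hom_ext fun i j b => by simp [K.map_e]

lemma SH.ev_comp_mk (f : X →⋆ₙₐ[ℂ] K (K C)) :
    (SH.ev C).comp (SH.mk f) = SH.mk ((K.undouble C).comp f) := by
  rw [SH.ev, SH.mk_comp_mk, K.map_id]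
  rfl

lemma divModEquiv_pair_injective (n : ℕ) [NeZero n] : Function.Injective fun r =>
    Nat.pair (Nat.divModEquiv n r).2 (Nat.divModEquiv n r).1 := fun r s h => by
  obtain ⟨h1, h2⟩ := Nat.pair_eq_pair.1 h
  exact (Nat.divModEquiv n).injective (Prod.ext h2 (Fin.ext h1))

/-- Splitting an index into quotient and remainder and recombining the two by the pairing function
is an injection of `ℕ`. Thus the identification `𝒦 ⊗ C ≅ M_n(𝒦 ⊗ C)` is invisible on stable classes.
-/
lemma SH.ev_ofMat_toMat [NeZero n] (f : X →⋆ₙₐ[ℂ] K C) :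
    (SH.ev C).comp (SH.ofMat ((K.toMat C n).comp f)) = SH.mk f := by
  rw [SH.ofMat, SH.ev_comp_mk]
  refine SH.mk_eq_of_reindex _ (divModEquiv_pair_injective n) ?_
  have : (K.undouble C).comp ((K.ofMat n).comp (K.toMat C n)) =
      K.reindex _ (divModEquiv_pair_injective n) := K.hom_ext fun i j b => by
    simp only [NonUnitalStarAlgHom.comp_apply, K.toMat_e, K.ofMat_single, K.undouble_e]
    rw [K.reindex_e]
  rw [← this]
  rfl

/-- Homotopy of matrix-valued homomorphisms can be checked on stable classes. -/
lemma homotopic_of_ev_ofMat_eq [NeZero n] {f g : X →⋆ₙₐ[ℂ] Mat n (K C)}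
    (h : (SH.ev C).comp (SH.ofMat f) = (SH.ev C).comp (SH.ofMat g)) : Homotopic f g := by
  have key : ∀ f : X →⋆ₙₐ[ℂ] Mat n (K C), ∃ f', (K.toMat C n).comp f' = f := fun f =>
    ⟨factor (K.toMat C n) (K.toMat_injective n) f fun x => K.toMat_surjective n (f x), by ext; simp⟩
  obtain ⟨f, rfl⟩ := key f
  obtain ⟨g, rfl⟩ := key g
  rw [SH.ev_ofMat_toMat, SH.ev_ofMat_toMat] at h
  exact (SH.mk_eq.1 h).postcomp _

variable (n Y) in
/-- The class of the inclusion `M_n(Y) ⊆ 𝒦 ⊗ Y`. -/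
def SH.unmat : SH (Mat n Y) Y := SH.mk (K.ofMat n)

lemma SH.unmat_comp_of (f : X →⋆ₙₐ[ℂ] Mat n Y) : (SH.unmat Y n).comp (SH.of f) = SH.ofMat f :=
  SH.mk_comp_of _ _

end MatrixClasses

/-! ### Rotations -/

section Rotation

variable {A E D J : Type u} [NonUnitalCStarAlgebra A] [NonUnitalCStarAlgebra E]
  [NonUnitalCStarAlgebra D] [NonUnitalCStarAlgebra J]

/-- The coefficients of the unitary `((1 + z) / 2, (1 - z) / 2; (1 - z) / 2, (1 + z) / 2)`. -/
def rotCoeff (z : ℂ) (i j : Fin 2) : ℂ := if i = j then (1 + z) / 2 else (1 - z) / 2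

lemma sum_rotCoeff {z : ℂ} (hz : z * star z = 1) (k l : Fin 2) :
    ∑ m, star (rotCoeff z m k) * rotCoeff z m l = if k = l then 1 else 0 := by
  fin_cases k <;> fin_cases l <;>
    simp only [rotCoeff, Fin.sum_univ_two, star_div₀, star_add, star_sub, star_one, star_ofNat,
      Fin.isValue, Fin.zero_eta, Fin.mk_one, if_true, one_ne_zero, zero_ne_one, if_false] <;>
    first | linear_combination (1 / 2) * hz | linear_combination (-1 / 2) * hz

/-- Conjugation of `M₂(E)` by the unitary
`((1 + z) / 2, (1 - z) / 2; (1 - z) / 2, (1 + z) / 2)`, where `|z| = 1`. -/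
def Mat.rot (z : ℂ) (hz : z * star z = 1) : Mat 2 E →⋆ₙₐ[ℂ] Mat 2 E where
  toFun a := Mat.of fun i j =>
    ∑ k, ∑ l, (rotCoeff z i k * star (rotCoeff z j l)) • a.entry k l
  map_smul' c a := Mat.ext fun i j => by
    simp only [Mat.entry_of, Mat.entry_smul, Finset.smul_sum, MonoidHom.id_apply, smul_comm c]
  map_zero' := Mat.ext fun i j => by simp
  map_add' a b := Mat.ext fun i j => by
    simp only [Mat.entry_of, Mat.entry_add, smul_add, Finset.sum_add_distrib]
  map_mul' a b := Mat.ext fun i j => by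
    -- Multiplicativity only needs that the columns of the coefficient matrix are orthonormal.
    have h00 := sum_rotCoeff hz 0 0
    have h01 := sum_rotCoeff hz 0 1
    have h10 := sum_rotCoeff hz 1 0
    have h11 := sum_rotCoeff hz 1 1
    simp only [Fin.sum_univ_two, if_true, Fin.isValue, zero_ne_one, one_ne_zero, if_false]
      at h00 h01 h10 h11
    simp only [Mat.entry_mul, Mat.entry_of, Fin.sum_univ_two, add_mul, mul_add, smul_mul_assoc,
      mul_smul_comm, smul_smul, smul_add]
    generalize rotCoeff z i 0 = x₀
    generalize rotCoeff z i 1 = x₁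
    generalize star (rotCoeff z j 0) = y₀
    generalize star (rotCoeff z j 1) = y₁
    match_scalars
    all_goals first
      | linear_combination (-(x₀ * y₀)) * h00
      | linear_combination (-(x₀ * y₁)) * h00
      | linear_combination (-(x₁ * y₀)) * h00
      | linear_combination (-(x₁ * y₁)) * h00
      | linear_combination (-(x₀ * y₀)) * h11
      | linear_combination (-(x₀ * y₁)) * h11
      | linear_combination (-(x₁ * y₀)) * h11
      | linear_combination (-(x₁ * y₁)) * h11
      | linear_combination (-(x₀ * y₀)) * h01
      | linear_combination (-(x₀ * y₁)) * h01
      | linear_combination (-(x₁ * y₀)) * h01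
      | linear_combination (-(x₁ * y₁)) * h01
      | linear_combination (-(x₀ * y₀)) * h10
      | linear_combination (-(x₀ * y₁)) * h10
      | linear_combination (-(x₁ * y₀)) * h10
      | linear_combination (-(x₁ * y₁)) * h10
  map_star' a := Mat.ext fun i j => by
    simp only [Mat.entry_of, Mat.entry_star, star_sum, star_smul, star_mul, star_star]
    rw [Finset.sum_comm]

lemma Mat.entry_rot (z : ℂ) (hz : z * star z = 1) (a : Mat 2 E) (i j : Fin 2) :
    (Mat.rot z hz a).entry i j = ∑ k, ∑ l, (rotCoeff z i k * star (rotCoeff z j l)) • a.entry k l :=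
  rfl

lemma Mat.rot_one (h : (1 : ℂ) * star (1 : ℂ) = 1) (a : Mat 2 E) : Mat.rot 1 h a = a :=
  Mat.ext fun i j => by
    rw [Mat.entry_rot]
    fin_cases i <;> fin_cases j <;> simp [rotCoeff]

lemma Mat.entry_rot_neg_one (h : (-1 : ℂ) * star (-1 : ℂ) = 1) (a : Mat 2 E) (i j : Fin 2) :
    (Mat.rot (-1) h a).entry i j = a.entry i.rev j.rev := by
  rw [Mat.entry_rot]
  fin_cases i <;> fin_cases j <;> simp [rotCoeff, Fin.sum_univ_two, Fin.rev]

lemma Mat.map_rot (z : ℂ) (hz : z * star z = 1) (f : E →⋆ₙₐ[ℂ] D) (a : Mat 2 E) :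
    Mat.map 2 f (Mat.rot z hz a) = Mat.rot z hz (Mat.map 2 f a) :=
  Mat.ext fun i j => by simp [Mat.entry_rot]

/-- Scalar matrices are fixed by rotations. -/
lemma Mat.rot_scalar (z : ℂ) (hz : z * star z = 1) (x : E) :
    Mat.rot z hz (Mat.of fun i j => if i = j then x else 0) =
      Mat.of fun i j => if i = j then x else 0 :=
  Mat.ext fun i j => by
    have h00 := sum_rotCoeff (z := star z) (by rw [star_star, mul_comm, hz]) i j
    rw [Mat.entry_rot]
    simp only [Mat.entry_of, smul_ite, smul_zero, Finset.sum_ite_eq, Finset.mem_univ, if_true,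
      ← Finset.sum_smul]
    have hs : ∀ i k, rotCoeff z i k = rotCoeff z k i := fun i k => by simp only [rotCoeff, eq_comm]
    have h : ∑ k, rotCoeff z i k * star (rotCoeff z j k) = if i = j then 1 else 0 := by
      simp only [eq_comm (a := i), ← sum_rotCoeff hz j i]
      exact Finset.sum_congr rfl fun k _ => by rw [mul_comm, hs i, hs j]
    rw [h]
    split_ifs <;> simp

lemma Mat.continuous_rot (a : Mat 2 E) :
    Continuous fun t => Mat.rot (circ t) (circ_mul_star t) a :=
  Mat.continuous_of_entry fun i j => by
    simp only [Mat.entry_rot]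
    have hc := continuous_circ
    have : ∀ i k, Continuous fun t => rotCoeff (circ t) i k := fun i k => by
      unfold rotCoeff
      split_ifs <;> fun_prop
    fun_prop

end Rotation

/-! ### Pairs of homomorphisms into matrix algebras -/

section MatrixPairs

variable {A E D J : Type u} [NonUnitalCStarAlgebra A] [NonUnitalCStarAlgebra E]
  [NonUnitalCStarAlgebra D] [NonUnitalCStarAlgebra J] {n : ℕ}

lemma Q.lift_dsum (φ ψ : Fin n → A →⋆ₙₐ[ℂ] D) (w : Q A) :
    Q.lift (dsum φ) (dsum ψ) w = dsum (fun i => Q.lift (φ i) (ψ i)) w :=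
  DFunLike.congr_fun (Q.hom_ext (φ := Q.lift (dsum φ) (dsum ψ))
    (fun a => Mat.ext fun i j => by simp [entry_dsum])
    (fun a => Mat.ext fun i j => by simp [entry_dsum])) w

lemma map_dsum (φ : Fin n → A →⋆ₙₐ[ℂ] D) (f : D →⋆ₙₐ[ℂ] E) (x : A) :
    Mat.map n f (dsum φ x) = dsum (fun i => f.comp (φ i)) x :=
  Mat.ext fun i j => by
    simp only [Mat.entry_map, entry_dsum]
    split_ifs <;> simp

/-- Membership in `M_n(J)` may be tested on the entries. -/
lemma Mat.exists_map {j : J →⋆ₙₐ[ℂ] E} {a : Mat n E} (h : ∀ i k, ∃ b, j b = a.entry i k) :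
    ∃ b, Mat.map n j b = a := by
  choose b hb using h
  exact ⟨Mat.of b, Mat.ext fun i k => hb i k⟩

lemma dsum_sub_mem {j : J →⋆ₙₐ[ℂ] E} {φ ψ : Fin n → A →⋆ₙₐ[ℂ] E}
    (h : ∀ i x, ∃ b, j b = φ i x - ψ i x) (x : A) :
    ∃ b, Mat.map n j b = dsum φ x - dsum ψ x :=
  Mat.exists_map fun i k => by
    rw [Mat.entry_sub, entry_dsum, entry_dsum]
    by_cases hik : i = k
    · simpa [hik] using h k x
    · exact ⟨0, by simp [hik]⟩

lemma Mat.rot_circ_zero (a : Mat 2 E) : Mat.rot (circ 0) (circ_mul_star 0) a = a := by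
  have : ∀ (z : ℂ) (hz : z * star z = 1), z = 1 → Mat.rot z hz a = a := by
    rintro z hz rfl
    exact Mat.rot_one _ _
  exact this _ (circ_mul_star 0) circ_zero

lemma Mat.entry_rot_circ_one (a : Mat 2 E) (i k : Fin 2) :
    (Mat.rot (circ 1) (circ_mul_star 1) a).entry i k = a.entry i.rev k.rev := by
  have : ∀ (z : ℂ) (hz : z * star z = 1), z = -1 →
      (Mat.rot z hz a).entry i k = a.entry i.rev k.rev := by
    rintro z hz rfl
    exact Mat.entry_rot_neg_one _ _ _ _
  exact this _ (circ_mul_star 1) circ_one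

lemma Mat.rot_circ_one_dsum (f g : A →⋆ₙₐ[ℂ] E) (x : A) :
    Mat.rot (circ 1) (circ_mul_star 1) (dsum ![f, g] x) = dsum ![g, f] x :=
  Mat.ext fun i k => by
    rw [Mat.entry_rot_circ_one]
    fin_cases i <;> fin_cases k <;> simp [entry_dsum, Fin.rev]

/-- A pair of direct sums whose summands coincide except at one position. -/
lemma ofMat_qHom_dsum (j : J →⋆ₙₐ[ℂ] E) (hj : IsIdealEmbedding j) (φ ψ : Fin n → A →⋆ₙₐ[ℂ] E)
    (h : ∀ x, ∃ b, Mat.map n j b = dsum φ x - dsum ψ x) (i : Fin n)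
    {f g : A →⋆ₙₐ[ℂ] E} (hf : φ i = f) (hg : ψ i = g)
    (h' : ∀ x, ∃ b, j b = f x - g x) (hne : ∀ k ≠ i, φ k = ψ k) :
    SH.ofMat (qHom (Mat.map n j) (hj.mat n) (dsum φ) (dsum ψ) h) =
      SH.of (qHom j hj f g h') := by
  subst hf hg
  -- A pair `(X, X)` vanishes on `qA`, so the homomorphism is concentrated in the corner `i`.
  rw [← SH.ofMat_corner i]
  congr 1
  refine (eq_qHom _ _ _ fun z => Mat.ext fun k l => ?_).symm
  rw [Q.lift_dsum, entry_dsum, Mat.entry_map, NonUnitalStarAlgHom.comp_apply, Mat.entry_corner]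
  by_cases hk : k = i
  · subst hk
    by_cases hl : l = k
    · subst hl
      simp [qHom_spec]
    · simp [hl, Ne.symm hl]
  · simp only [hk, false_and, if_false, map_zero, hne k hk, Q.lift_self_incl, ite_self]

lemma Q.lift_comp_incl_sub {j : J →⋆ₙₐ[ℂ] E} (hj : IsIdealEmbedding j) {h₁ h₂ X X' : A →⋆ₙₐ[ℂ] E}
    (h : ∀ x, ∃ b, j b = h₁ x - h₂ x) (h' : ∀ x, ∃ b, j b = X x - X' x) (z : q A) :
    ∃ b, j b = ((Q.lift h₁ X).comp (q.incl A)) z - ((Q.lift h₂ X').comp (q.incl A)) z :=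
  hj.lift_sub_lift h h' _

lemma sub_self_mem (j : J →⋆ₙₐ[ℂ] E) (X : A →⋆ₙₐ[ℂ] E) (x : A) : ∃ b, j b = X x - X x :=
  ⟨0, by rw [map_zero, sub_self]⟩

lemma comp_piq_sub {j : J →⋆ₙₐ[ℂ] E} {h₁ h₂ : A →⋆ₙₐ[ℂ] E}
    (h : ∀ x, ∃ b, j b = h₁ x - h₂ x) (z : q A) :
    ∃ b, j b = (h₁.comp (piq A)) z - (h₂.comp (piq A)) z := h _

/-- Modulo stable homotopy the pair `(h₁ ∘ π, h₂ ∘ π)` on `qA` may be replaced by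
`(h₁ ⋆ X, h₂ ⋆ X)` for an arbitrary `X`. -/
lemma of_qHom_comp_piq (j : J →⋆ₙₐ[ℂ] E) (hj : IsIdealEmbedding j) (h₁ h₂ X : A →⋆ₙₐ[ℂ] E)
    (h : ∀ x, ∃ b, j b = h₁ x - h₂ x) :
    SH.of (qHom j hj (h₁.comp (piq A)) (h₂.comp (piq A)) (comp_piq_sub h)) =
      SH.of (qHom j hj ((Q.lift h₁ X).comp (q.incl A)) ((Q.lift h₂ X).comp (q.incl A))
        (Q.lift_comp_incl_sub hj h (sub_self_mem j X))) := by
  -- The second copy of `A` is sent to a rotation `R_t` of `0 ⊕ X`, the first to `h₁ ⊕ 0` or `h₂ ⊕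
  -- 0`. The same `R_t` is used in both legs, so they always agree modulo `M₂(J)`. On `qA` the leg
  -- of `h` is `hπ ⊕ (0 ⋆ X)` at time `0` and `(h ⋆ X) ⊕ 0` at time `1`; the second summands
  -- coincide and may be dropped.
  let R : unitInterval → (A →⋆ₙₐ[ℂ] Mat 2 E) := fun t =>
    (Mat.rot (circ t) (circ_mul_star t)).comp (dsum ![0, X])
  have hR0 : R 0 = dsum ![0, X] := NonUnitalStarAlgHom.ext fun _ => Mat.rot_circ_zero _
  have hR1 : R 1 = dsum ![X, 0] := NonUnitalStarAlgHom.ext fun x => Mat.rot_circ_one_dsum 0 X x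
  have hRc : ∀ x, Continuous fun t => R t x := fun x => Mat.continuous_rot _
  have hd : ∀ x, ∃ b, Mat.map 2 j b = dsum ![h₁, 0] x - dsum ![h₂, 0] x := dsum_sub_mem (by
    intro i
    fin_cases i
    · exact h
    · exact sub_self_mem j _)
  have hhom := SH.ofMat_eq (qHom_homotopic (Mat.map 2 j) (hj.mat 2)
    (fun t => (Q.lift (dsum ![h₁, 0]) (R t)).comp (q.incl A))
    (fun t => (Q.lift (dsum ![h₂, 0]) (R t)).comp (q.incl A))
    (fun t => Q.lift_comp_incl_sub (hj.mat 2) hd (sub_self_mem _ _))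
    (fun z => Q.continuous_family _ _ (fun _ => continuous_const) hRc _)
    (fun z => Q.continuous_family _ _ (fun _ => continuous_const) hRc _))
  have e0 : ∀ g : A →⋆ₙₐ[ℂ] E, (Q.lift (dsum ![g, 0]) (R 0)).comp (q.incl A) =
      dsum ![g.comp (piq A), (Q.lift 0 X).comp (q.incl A)] := fun g => by
    rw [hR0]
    ext z
    refine Mat.ext fun i k => ?_
    rw [NonUnitalStarAlgHom.comp_apply, Q.lift_dsum]
    fin_cases i <;> fin_cases k <;> simp [entry_dsum, comp_piq]
  have e1 : ∀ g : A →⋆ₙₐ[ℂ] E, (Q.lift (dsum ![g, 0]) (R 1)).comp (q.incl A) =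
      dsum ![(Q.lift g X).comp (q.incl A), 0] := fun g => by
    rw [hR1]
    ext z
    refine Mat.ext fun i k => ?_
    rw [NonUnitalStarAlgHom.comp_apply, Q.lift_dsum]
    fin_cases i <;> fin_cases k <;> simp [entry_dsum, Q.lift_self_incl]
  simp only [e0, e1] at hhom
  have hne : ∀ f g Z : q A →⋆ₙₐ[ℂ] E, ∀ k ≠ (0 : Fin 2), ![f, Z] k = ![g, Z] k := by
    intro f g Z k hk
    obtain rfl : k = 1 := by omega
    rw [Matrix.cons_val_one, Matrix.cons_val_one]
  rw [ofMat_qHom_dsum j hj _ _ _ 0 (Matrix.cons_val_zero _ _) (Matrix.cons_val_zero _ _)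
      (comp_piq_sub h) (hne _ _ _),
    ofMat_qHom_dsum j hj _ _ _ 0 (Matrix.cons_val_zero _ _) (Matrix.cons_val_zero _ _)
      (Q.lift_comp_incl_sub hj h (sub_self_mem j X)) (hne _ _ _)] at hhom
  exact hhom

variable (A) in
/-- The two projections `q²A → qA` coincide as stable classes. -/
lemma of_piq_q : SH.of (piq (q A)) = SH.of (q.map (piq A)) := by
  have h : ∀ x, ∃ b, q.incl A b = ι A x - ι' A x := fun x =>
    q.exists_of_fold (by simp [fold])
  -- For `(ε, ε̄)` and `X = ε̄`: the pair `(επ, ε̄π)` gives `q(π_A)`, while `ε ⋆ ε̄` is the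
  -- inclusion and `ε̄ ⋆ ε̄` vanishes on `qA`, so the other pair gives `π_{qA}`.
  have key := of_qHom_comp_piq (q.incl A) q.incl_isIdealEmbedding (ι A) (ι' A) (ι' A) h
  have h1 : (Q.lift (ι A) (ι' A)).comp (q.incl A) = q.incl A :=
    NonUnitalStarAlgHom.ext fun _ => Q.lift_ι_ι' _
  have h2 : (Q.lift (ι' A) (ι' A)).comp (q.incl A) = 0 :=
    NonUnitalStarAlgHom.ext fun _ => Q.lift_self_incl _ _
  have e1 : piq (q A) = qHom (q.incl A) q.incl_isIdealEmbedding
      ((Q.lift (ι A) (ι' A)).comp (q.incl A)) ((Q.lift (ι' A) (ι' A)).comp (q.incl A))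
      (Q.lift_comp_incl_sub q.incl_isIdealEmbedding h (sub_self_mem _ (ι' A))) :=
    eq_qHom _ _ _ fun z => by rw [comp_piq, h1, h2]
  have e2 : q.map (piq A) = qHom (q.incl A) q.incl_isIdealEmbedding ((ι A).comp (piq A))
      ((ι' A).comp (piq A)) (comp_piq_sub h) := eq_qHom _ _ _ fun z => q.incl_map _ _
  rw [e1, e2]
  exact key.symm

variable (A) in
lemma crossPair_sub_mem (x : A) : ∃ b, Mat.map 2 (q.incl (Q A)) b =
    dsum ![(ι (Q A)).comp (ι A), (ι' (Q A)).comp (ι' A)] x -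
      dsum ![(ι' (Q A)).comp (ι A), (ι (Q A)).comp (ι' A)] x :=
  dsum_sub_mem (fun i x => q.exists_of_fold (by fin_cases i <;> simp [fold])) x

variable (A) in
/-- The homomorphism `q(ηε ⊕ η̄ε̄, η̄ε ⊕ ηε̄) : qA → M₂(q(QA))`. -/
def crossPair : q A →⋆ₙₐ[ℂ] Mat 2 (q (Q A)) :=
  qHom (Mat.map 2 (q.incl (Q A))) (q.incl_isIdealEmbedding.mat 2)
    (dsum ![(ι (Q A)).comp (ι A), (ι' (Q A)).comp (ι' A)])
    (dsum ![(ι' (Q A)).comp (ι A), (ι (Q A)).comp (ι' A)]) (crossPair_sub_mem A)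

lemma lift_dsum_comp_incl (f g k : A →⋆ₙₐ[ℂ] D) :
    (Q.lift (dsum ![f, k]) (dsum ![g, k])).comp (q.incl A) =
      dsum ![(Q.lift f g).comp (q.incl A), 0] := by
  ext z
  refine Mat.ext fun i j => ?_
  rw [NonUnitalStarAlgHom.comp_apply, Q.lift_dsum]
  fin_cases i <;> fin_cases j <;> simp [entry_dsum, Q.lift_self_incl]

lemma lift_comp_ι (f : Q A →⋆ₙₐ[ℂ] D) : Q.lift (f.comp (ι A)) (f.comp (ι' A)) = f :=
  NonUnitalStarAlgHom.ext fun w => by rw [← Q.comp_lift, Q.lift_ι_ι']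

variable (A) in
/-- The diagonal homomorphism `ηε̄ ⊕ η̄ε̄`. -/
def auxDiag : A →⋆ₙₐ[ℂ] Mat 2 (Q (Q A)) :=
  dsum ![(ι (Q A)).comp (ι' A), (ι' (Q A)).comp (ι' A)]

/-- Modulo `q(QA)` the maps `η` and `η̄` coincide, so `auxDiag` becomes the scalar diagonal matrix
of `ε̄(x)`, which rotations fix. -/
lemma auxDiag_sub_rot (t : unitInterval) (x : A) : ∃ b, Mat.map 2 (q.incl (Q A)) b =
    auxDiag A x - Mat.rot (circ t) (circ_mul_star t) (auxDiag A x) := by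
  refine Mat.exists_map fun i k => q.exists_of_fold ?_
  have e1 : Mat.map 2 (fold (Q A)) (auxDiag A x) = Mat.of fun i j => if i = j then ι' A x else 0 :=
    Mat.ext fun i k => by
      fin_cases i <;> fin_cases k <;> simp [auxDiag, entry_dsum, fold]
  have e2 := Mat.map_rot (circ t) (circ_mul_star t) (fold (Q A)) (auxDiag A x)
  rw [e1, Mat.rot_scalar, ← e1] at e2
  have e3 := congrArg (fun m => Mat.entry m i k) e2
  simp only [Mat.entry_map] at e3
  rw [Mat.entry_sub, map_sub, e3, sub_self]

variable (A) in
/-- The map `q²A → q(QA)` induced by the inclusion factors stably through `q(π_A)`. -/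
lemma of_qmap_incl : SH.of (q.map (q.incl A)) =
    (SH.ofMat (crossPair A)).comp (SH.of (q.map (piq A))) := by
  have hj := (q.incl_isIdealEmbedding (A := Q A)).mat 2
  -- Here `X = ηε̄ ⊕ η̄ε̄` is chosen so that the first leg becomes `(ηε ⋆ ηε̄) ⊕ (η̄ε̄ ⋆ η̄ε̄)`,
  -- which on `qA` is `η ⊕ 0`.
  have s1 := of_qHom_comp_piq (Mat.map 2 (q.incl (Q A))) hj _ _ (auxDiag A) (crossPair_sub_mem A)
  -- Now `X` is rotated in the second leg only, until it is `η̄ε̄ ⊕ ηε̄`. Then that leg is `(η̄ε ⋆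
  -- η̄ε̄) ⊕ (ηε̄ ⋆ ηε̄)`, which on `qA` is `η̄ ⊕ 0`. The resulting pair `(η, η̄)` on `qA` defines
  -- `q` of the inclusion.
  have s2 := SH.of_eq (qHom_homotopic (Mat.map 2 (q.incl (Q A))) hj
    (fun _ => (Q.lift (dsum ![(ι (Q A)).comp (ι A), (ι' (Q A)).comp (ι' A)])
      (auxDiag A)).comp (q.incl A))
    (fun t => (Q.lift (dsum ![(ι' (Q A)).comp (ι A), (ι (Q A)).comp (ι' A)])
      ((Mat.rot (circ t) (circ_mul_star t)).comp (auxDiag A))).comp (q.incl A))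
    (fun t => Q.lift_comp_incl_sub hj (crossPair_sub_mem A) (auxDiag_sub_rot t))
    (fun z => continuous_const)
    (fun z => Q.continuous_family _ _ (fun _ => continuous_const)
      (fun x => Mat.continuous_rot (auxDiag A x)) _))
  have eR0 : (Mat.rot (circ 0) (circ_mul_star 0)).comp (auxDiag A) = auxDiag A :=
    NonUnitalStarAlgHom.ext fun _ => Mat.rot_circ_zero _
  have eR1 : (Mat.rot (circ 1) (circ_mul_star 1)).comp (auxDiag A) =
      dsum ![(ι' (Q A)).comp (ι' A), (ι (Q A)).comp (ι' A)] :=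
    NonUnitalStarAlgHom.ext fun _ => Mat.rot_circ_one_dsum _ _ _
  have f1 : (Q.lift (dsum ![(ι (Q A)).comp (ι A), (ι' (Q A)).comp (ι' A)])
      (auxDiag A)).comp (q.incl A) = dsum ![(ι (Q A)).comp (q.incl A), 0] := by
    rw [auxDiag, lift_dsum_comp_incl, lift_comp_ι]
  have f2 : (Q.lift (dsum ![(ι' (Q A)).comp (ι A), (ι (Q A)).comp (ι' A)])
      (dsum ![(ι' (Q A)).comp (ι' A), (ι (Q A)).comp (ι' A)])).comp (q.incl A) =
      dsum ![(ι' (Q A)).comp (q.incl A), 0] := by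
    rw [lift_dsum_comp_incl, lift_comp_ι]
  simp only [eR0, eR1, f1, f2] at s2
  have s3 := s1.trans (by simpa only [f1] using s2)
  have e3 : (crossPair A).comp (q.map (piq A)) = qHom (Mat.map 2 (q.incl (Q A))) hj
      ((dsum ![(ι (Q A)).comp (ι A), (ι' (Q A)).comp (ι' A)]).comp (piq A))
      ((dsum ![(ι' (Q A)).comp (ι A), (ι (Q A)).comp (ι' A)]).comp (piq A))
      (comp_piq_sub (crossPair_sub_mem A)) :=
    eq_qHom _ hj (comp_piq_sub (crossPair_sub_mem A)) fun z => by
      rw [NonUnitalStarAlgHom.comp_apply, crossPair, qHom_spec, q.incl_map, Q.lift_map]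
  have hne : ∀ f g Z : q A →⋆ₙₐ[ℂ] Q (Q A), ∀ k ≠ (0 : Fin 2), ![f, Z] k = ![g, Z] k := by
    intro f g Z k hk
    obtain rfl : k = 1 := by omega
    rw [Matrix.cons_val_one, Matrix.cons_val_one]
  have hd : ∀ z, ∃ b, q.incl (Q A) b =
      (ι (Q A)).comp (q.incl A) z - (ι' (Q A)).comp (q.incl A) z := fun z =>
    q.exists_of_fold (by simp [fold])
  have e : q.map (q.incl A) = qHom (q.incl (Q A)) q.incl_isIdealEmbedding
      ((ι (Q A)).comp (q.incl A)) ((ι' (Q A)).comp (q.incl A)) hd :=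
    eq_qHom _ _ _ fun z => q.incl_map _ _
  rw [← SH.ofMat_comp, ← SH.unmat_comp_of, e3, s3, SH.unmat_comp_of, e]
  exact (ofMat_qHom_dsum (q.incl (Q A)) q.incl_isIdealEmbedding _ _ _ 0
    (Matrix.cons_val_zero _ _) (Matrix.cons_val_zero _ _) hd (hne _ _ _)).symm

end MatrixPairs

/-! ### The natural map `q(𝒦 ⊗ B) → 𝒦 ⊗ qB` -/

section NaturalMap

variable {W X Y Z E J : Type u} [NonUnitalCStarAlgebra W] [NonUnitalCStarAlgebra X]
  [NonUnitalCStarAlgebra Y] [NonUnitalCStarAlgebra Z] [NonUnitalCStarAlgebra E]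
  [NonUnitalCStarAlgebra J]

lemma IsIdealEmbedding.kmap {j : J →⋆ₙₐ[ℂ] E} (hj : IsIdealEmbedding j) :
    IsIdealEmbedding (K.map j) where
  injective := K.map_injective hj.injective
  mul_mem := by
    have hcl := isClosed_range_of_injective _ (K.map_injective hj.injective)
    intro e b
    change e * K.map j b ∈ Set.range (K.map j)
    refine K.induction_ofMat (P := fun e => e * K.map j b ∈ Set.range (K.map j))
      (hcl.preimage (continuous_mul_const _)) (fun n a => ?_) e
    refine K.induction_ofMat (P := fun b => K.ofMat n a * K.map j b ∈ Set.range (K.map j))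
      (hcl.preimage (continuous_const.mul (continuous_hom _))) (fun m c => ?_) b
    change _ ∈ NonUnitalStarAlgHom.range (K.map j)
    simp only [K.ofMat_apply, map_sum, Finset.mul_sum, Finset.sum_mul, K.map_e]
    refine sum_mem fun p _ => sum_mem fun r _ => sum_mem fun s _ => sum_mem fun t _ => ?_
    rcases eq_or_ne (t : ℕ) (p : ℕ) with h | h
    · obtain ⟨d, hd⟩ := hj.mul_mem (a.entry s t) (c.entry p r)
      exact ⟨K.e s r d, by simp only [h, K.e_mul, ← hd]; exact K.map_e _ _ _ _⟩
    · rw [K.e_mul_of_ne h]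
      exact zero_mem _

lemma K.map_sub_mem {j : J →⋆ₙₐ[ℂ] E} (hj : Function.Injective j) {φ ψ : X →⋆ₙₐ[ℂ] E}
    (h : ∀ x, ∃ b, j b = φ x - ψ x) (x : K X) : ∃ b, K.map j b = K.map φ x - K.map ψ x := by
  refine K.induction_ofMat (P := fun x => K.map φ x - K.map ψ x ∈ Set.range (K.map j))
    ((isClosed_range_of_injective _ (K.map_injective hj)).preimage
      ((continuous_hom _).sub (continuous_hom _))) (fun n a => ?_) x
  change _ ∈ NonUnitalStarAlgHom.range (K.map j)
  simp only [K.ofMat_apply, map_sum, ← Finset.sum_sub_distrib, K.map_e, ← K.e_sub]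
  refine sum_mem fun p _ => sum_mem fun r _ => ?_
  obtain ⟨b, hb⟩ := h (a.entry p r)
  exact ⟨K.e p r b, by rw [← hb]; exact K.map_e _ _ _ _⟩

variable (Y) in
/-- The natural map `μ : q(𝒦 ⊗ Y) → 𝒦 ⊗ qY`. -/
def K.mu : q (K Y) →⋆ₙₐ[ℂ] K (q Y) :=
  qHom (K.map (q.incl Y)) q.incl_isIdealEmbedding.kmap (K.map (ι Y)) (K.map (ι' Y))
    (K.map_sub_mem q.incl_injective fun _ => q.exists_of_fold (by simp [fold]))

lemma K.map_incl_mu (z : q (K Y)) :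
    K.map (q.incl Y) (K.mu Y z) = Q.lift (K.map (ι Y)) (K.map (ι' Y)) (q.incl (K Y) z) :=
  qHom_spec _ _ _ _ _ z

lemma isMu_iff {μ : q (K Y) →⋆ₙₐ[ℂ] K (q Y)} : IsMu μ ↔ μ = K.mu Y := by
  refine ⟨fun h => hom_cancel _ (K.map_injective q.incl_injective) ?_, fun h => h ▸ K.map_incl_mu⟩
  ext z
  exact (h z).trans (K.map_incl_mu z).symm

lemma K.mu_inc (z : q Y) : K.mu Y (q.map (K.inc Y) z) = K.inc (q Y) z := by
  refine K.map_injective q.incl_injective ?_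
  rw [K.map_incl_mu, q.incl_map, Q.lift_map]
  have h : ∀ f : Y →⋆ₙₐ[ℂ] Q Y, (K.map f).comp (K.inc Y) = (K.inc (Q Y)).comp f := fun f => by
    ext y
    simp [K.inc_apply, K.map_e]
  rw [h, h, ← Q.comp_lift, Q.lift_ι_ι', K.inc_apply, K.inc_apply, K.map_e]

lemma K.mu_map (g : X →⋆ₙₐ[ℂ] Y) (z : q (K X)) :
    K.mu Y (q.map (K.map g) z) = K.map (q.map g) (K.mu X z) := by
  refine K.map_injective q.incl_injective ?_
  have h1 : (K.map (q.incl Y)).comp (K.map (q.map g)) =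
      (K.map (Q.map g)).comp (K.map (q.incl X)) := by
    rw [← K.map_comp, ← K.map_comp]
    rfl
  have h1' := DFunLike.congr_fun h1 (K.mu X z)
  simp only [NonUnitalStarAlgHom.comp_apply] at h1'
  have h2 : (Q.map g).comp (ι X) = (ι Y).comp g := by ext; simp
  have h3 : (Q.map g).comp (ι' X) = (ι' Y).comp g := by ext; simp
  rw [K.map_incl_mu, q.incl_map, Q.lift_map, h1', K.map_incl_mu, Q.comp_lift]
  simp only [← K.map_comp, h2, h3]

/-- Compatibility of `μ` with `𝒦 ⊗ 𝒦 ≅ 𝒦`; this is what makes `SH.qhat` respect composition. -/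
lemma K.mu_undouble (z : q (K (K Y))) :
    K.mu Y (q.map (K.undouble Y) z) = K.undouble (q Y) (K.map (K.mu Y) (K.mu (K Y) z)) := by
  refine K.map_injective q.incl_injective ?_
  have h0 : (K.map (K.map (q.incl Y))).comp (K.map (K.mu Y)) =
      (K.map (Q.lift (K.map (ι Y)) (K.map (ι' Y)))).comp (K.map (q.incl (K Y))) := by
    rw [← K.map_comp, ← K.map_comp]
    exact congrArg K.map (NonUnitalStarAlgHom.ext K.map_incl_mu)
  have h0' := DFunLike.congr_fun h0 (K.mu (K Y) z)
  have h1 : (Q.lift (K.map (ι Y)) (K.map (ι' Y))).comp (ι (K Y)) = K.map (ι Y) := by ext; simp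
  have h2 : (Q.lift (K.map (ι Y)) (K.map (ι' Y))).comp (ι' (K Y)) = K.map (ι' Y) := by ext; simp
  have hu := DFunLike.congr_fun (K.map_undouble (q.incl Y)) (K.map (K.mu Y) (K.mu (K Y) z))
  simp only [NonUnitalStarAlgHom.comp_apply] at hu h0'
  rw [K.map_incl_mu, q.incl_map, Q.lift_map, hu, h0', K.map_incl_mu, Q.comp_lift, Q.comp_lift]
  simp only [← K.map_comp, h1, h2, K.map_undouble]

lemma K.map_piq_mu (z : q (K Y)) : K.map (piq Y) (K.mu Y z) = piq (K Y) z := by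
  have h1 : (Q.lift (NonUnitalStarAlgHom.id ℂ Y) 0).comp (ι Y) = NonUnitalStarAlgHom.id ℂ Y := by
    ext; simp
  have h2 : (Q.lift (NonUnitalStarAlgHom.id ℂ Y) 0).comp (ι' Y) = 0 := by ext; simp
  have h3 : K.map (0 : Y →⋆ₙₐ[ℂ] Y) = 0 := K.hom_ext fun i j b => by simp [K.map_e, K.e_zero]
  rw [piq, K.map_comp, NonUnitalStarAlgHom.comp_apply, K.map_incl_mu, Q.comp_lift, ← K.map_comp,
    ← K.map_comp, h1, h2, K.map_id, h3]
  rfl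

lemma piq_natural (f : X →⋆ₙₐ[ℂ] Y) (z : q X) : piq Y (q.map f z) = f (piq X z) := by
  rw [comp_piq, piq_apply, q.incl_map, Q.lift_map]
  rfl

/-- The functor `q` on stable classes. -/
def SH.qhat (a : SH X Y) : SH (q X) (q Y) :=
  Quotient.map (sa := homotopySetoid X (K Y)) (sb := homotopySetoid (q X) (K (q Y)))
    (fun f => (K.mu Y).comp (q.map f)) (fun _ _ h => Homotopic.postcomp (Homotopic.qmap h) _) a

lemma SH.qhat_mk (f : X →⋆ₙₐ[ℂ] K Y) : (SH.mk f).qhat = SH.mk ((K.mu Y).comp (q.map f)) := rfl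

lemma SH.qhat_of (f : X →⋆ₙₐ[ℂ] Y) : (SH.of f).qhat = SH.of (q.map f) := by
  rw [SH.of, SH.qhat_mk, SH.of]
  congr 1
  ext z
  simp only [NonUnitalStarAlgHom.comp_apply, q.map_comp, K.mu_inc]

lemma SH.qhat_id : (SH.id X).qhat = SH.id (q X) := by
  rw [SH.id, SH.qhat_of, q.map_id, SH.id]

lemma SH.qhat_comp (g : SH Y Z) (f : SH X Y) : (g.comp f).qhat = g.qhat.comp f.qhat := by
  induction f using SH.ind with | h f => ?_
  induction g using SH.ind with | h g => ?_
  rw [SH.mk_comp_mk, SH.qhat_mk, SH.qhat_mk, SH.qhat_mk, SH.mk_comp_mk]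
  congr 1
  ext z
  simp only [NonUnitalStarAlgHom.comp_apply, q.map_comp, K.map_comp, K.mu_undouble, K.mu_map]

/-- Naturality of `π` for homomorphisms, combined with the fact that `id ⊗ π` applied after `μ` is
again `π`. -/
lemma SH.comp_of_piq (f : SH X Y) :
    f.comp (SH.of (piq X)) = (SH.of (piq Y)).comp f.qhat := by
  induction f using SH.ind with | h f => ?_
  rw [SH.mk_comp_of, SH.qhat_mk, SH.of_comp_mk]
  congr 1
  ext z
  simp only [NonUnitalStarAlgHom.comp_apply, K.map_piq_mu, piq_natural]

end NaturalMap

/-! ### Multipliers -/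

section Multipliers

open Filter Topology

variable {X D : Type u} [NonUnitalCStarAlgebra X] [NonUnitalCStarAlgebra D]

/-- Conjugation of multipliers by a unitary multiplier. -/
def adM (F : unitary 𝓜(ℂ, X)) : 𝓜(ℂ, X) →⋆ₙₐ[ℂ] 𝓜(ℂ, X) where
  toFun m := (F : 𝓜(ℂ, X)) * m * star (F : 𝓜(ℂ, X))
  map_smul' t m := by simp
  map_zero' := by simp
  map_add' m n := by rw [mul_add, add_mul]
  map_mul' m n := by
    have h : star (F : 𝓜(ℂ, X)) * (F : 𝓜(ℂ, X)) = 1 := Unitary.coe_star_mul_self _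
    calc _ = (F : 𝓜(ℂ, X)) * m * 1 * n * star (F : 𝓜(ℂ, X)) := by
          rw [mul_one, mul_assoc (F : 𝓜(ℂ, X)) m n]
      _ = _ := by rw [← h]; simp only [mul_assoc]
  map_star' m := by simp [mul_assoc]

variable (X) in
/-- The inclusion of a C*-algebra into its multiplier algebra. -/
def coeM : X →⋆ₙₐ[ℂ] 𝓜(ℂ, X) := DoubleCentralizer.coeHom (𝕜 := ℂ)

lemma coeM_fst (x y : X) : (coeM X x).fst y = x * y := rfl

lemma mul_coeM (m : 𝓜(ℂ, X)) (x : X) : m * coeM X x = coeM X (m.fst x) :=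
  multiplier_ext fun y => by
    change m.fst (x * y) = m.fst x * y
    rw [← sub_eq_zero, ← CStarRing.star_mul_self_eq_zero_iff]
    have : ∀ z, z * (m.fst (x * y) - m.fst x * y) = 0 := fun z => by
      rw [mul_sub, ← mul_assoc, ← m.central, ← m.central, mul_assoc, sub_self]
    exact this _

lemma coeM_isIdealEmbedding : IsIdealEmbedding (coeM X) where
  injective x y h := by
    have h2 := DFunLike.congr_fun (congrArg (fun m : 𝓜(ℂ, X) => m.fst) h) (star (x - y))
    change x * _ = y * _ at h2
    rw [← sub_eq_zero, ← CStarRing.mul_star_self_eq_zero_iff, sub_mul, h2, sub_self]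
  mul_mem m x := ⟨m.fst x, (mul_coeM m x).symm⟩

lemma DoubleCentralizer.fst_mul (m : 𝓜(ℂ, X)) (x y : X) : m.fst (x * y) = m.fst x * y := by
  have h := congrArg (fun n : 𝓜(ℂ, X) => n.fst y) (mul_coeM m x)
  exact h

/-- Kernels of homomorphisms are invariant under multipliers. -/
lemma map_fst_eq_zero (p : X →⋆ₙₐ[ℂ] D) (m : 𝓜(ℂ, X)) {x : X} (h : p x = 0) : p (m.fst x) = 0 := by
  -- Approximating `x` by `ux` works because `m(ux) = m(u)x`, which `p` kills.
  have h1 : Tendsto (fun u => p (m.fst (u * x))) (apx X) (𝓝 (p (m.fst x))) :=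
    (((continuous_hom p).comp m.fst.continuous).tendsto x).comp (apx_left x)
  refine tendsto_nhds_unique h1 (tendsto_const_nhds.congr fun u => ?_)
  rw [DoubleCentralizer.fst_mul, map_mul, h, mul_zero]

/-- Conjugation by a unitary multiplier. -/
def adX (F : unitary 𝓜(ℂ, X)) : X →⋆ₙₐ[ℂ] X :=
  factor (coeM X) coeM_isIdealEmbedding.injective ((adM F).comp (coeM X)) fun x => by
    obtain ⟨y, hy⟩ := coeM_isIdealEmbedding.mul_mem' x (star (F : 𝓜(ℂ, X)))
    exact ⟨(F : 𝓜(ℂ, X)).fst y, by rw [← mul_coeM, hy, ← mul_assoc]; rfl⟩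

lemma coeM_adX (F : unitary 𝓜(ℂ, X)) (x : X) :
    coeM X (adX F x) = (F : 𝓜(ℂ, X)) * coeM X x * star (F : 𝓜(ℂ, X)) := factor_spec _ _ _ _ x

lemma adX_apply (F : unitary 𝓜(ℂ, X)) (x : X) :
    adX F x = (F : 𝓜(ℂ, X)).fst (star ((F : 𝓜(ℂ, X)).fst (star x))) := by
  refine coeM_isIdealEmbedding.injective ?_
  rw [coeM_adX, ← mul_coeM, map_star, ← mul_coeM, star_mul, map_star, star_star, mul_assoc]

lemma map_adX_eq_zero (p : X →⋆ₙₐ[ℂ] D) (F : unitary 𝓜(ℂ, X)) {x : X} (h : p x = 0) :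
    p (adX F x) = 0 := by
  rw [adX_apply]
  refine map_fst_eq_zero p _ ?_
  rw [map_star, map_fst_eq_zero p _ (by rw [map_star, h, star_zero]), star_zero]

lemma continuous_adX {T : Type*} [TopologicalSpace T] {F : T → unitary 𝓜(ℂ, X)} (hF : Continuous F)
    (x : X) : Continuous fun t => adX (F t) x := by
  refine continuous_of_injective_comp (coeM X) coeM_isIdealEmbedding.injective _ ?_
  simp only [coeM_adX]
  fun_prop

/-- The one-parameter group generated by a self-adjoint multiplier. -/
def expPath {S : 𝓜(ℂ, X)} (hS : IsSelfAdjoint S) (t : unitInterval) : unitary 𝓜(ℂ, X) :=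
  selfAdjoint.expUnitary ((t * (Real.pi / 2) : ℝ) • (⟨S, hS⟩ : selfAdjoint 𝓜(ℂ, X)))

lemma continuous_expPath {S : 𝓜(ℂ, X)} (hS : IsSelfAdjoint S) : Continuous (expPath hS) := by
  unfold expPath
  exact selfAdjoint.continuous_expUnitary.comp (by fun_prop)

lemma expPath_zero {S : 𝓜(ℂ, X)} (hS : IsSelfAdjoint S) : expPath hS 0 = 1 := by
  have h : ((0 : unitInterval) * (Real.pi / 2) : ℝ) • (⟨S, hS⟩ : selfAdjoint 𝓜(ℂ, X)) = 0 :=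
    Subtype.ext (by
      change ((0 : unitInterval) * (Real.pi / 2) : ℝ) • S = 0
      simp)
  rw [expPath, h, selfAdjoint.expUnitary_zero]

lemma adX_one (x : X) : adX 1 x = x :=
  coeM_isIdealEmbedding.injective (by rw [coeM_adX]; simp)

/-- If a self-adjoint multiplier acts in a quotient as the flip of the rows of a `2 × 2`-matrix, then
its exponential acts as a rotation. -/
lemma entry_map_expPath {S : 𝓜(ℂ, X)} (hS : IsSelfAdjoint S) (g : X →⋆ₙₐ[ℂ] Mat 2 D)
    (hg : ∀ x i j, (g (S.fst x)).entry i j = (g x).entry i.rev j) (t : unitInterval) (x : X)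
    (i j : Fin 2) : (g ((expPath hS t : 𝓜(ℂ, X)).fst x)).entry i j =
      Complex.exp (t * (Real.pi / 2) * Complex.I) •
        ∑ k, rotCoeff (star (circ t)) i k • (g x).entry k j := by
  -- In the quotient `S` is an involution. Decomposing into its eigenspaces for `1` and `-1` turns
  -- `exp(cS)` into the scalars `exp(c)` and `exp(-c)`.
  have hpow : ∀ n : ℕ, (g ((S ^ n).fst x)).entry i j =
      (1 / 2 : ℂ) • ((g x).entry i j + (g x).entry i.rev j) +
        (-1) ^ n • (1 / 2 : ℂ) • ((g x).entry i j - (g x).entry i.rev j) := by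
    intro n
    induction n generalizing i with
    | zero =>
      simp only [pow_zero, one_smul]
      change (g x).entry i j = _
      module
    | succ n ih =>
      rw [pow_succ']
      change (g (S.fst ((S ^ n).fst x))).entry i j = _
      rw [hg, ih, Fin.rev_rev, pow_succ]
      match_scalars <;> ring
  let c : ℂ := t * (Real.pi / 2) * Complex.I
  let L : 𝓜(ℂ, X) →+ D := AddMonoidHom.mk' (fun m => (g (m.fst x)).entry i j) fun a b => by
    change (g (a.fst x + b.fst x)).entry i j = _
    rw [map_add]
    rfl
  have hLs : ∀ (c : ℂ) m, L (c • m) = c • L m := fun c m => by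
    change (g (c • m.fst x)).entry i j = _
    rw [map_smul]
    rfl
  have hLc : Continuous L := by
    refine AddMonoidHomClass.continuous_of_bound L ‖x‖ fun m => ?_
    refine (Mat.norm_entry_le _ i j).trans ((NonUnitalStarAlgHom.norm_apply_le g _).trans ?_)
    refine (m.fst.le_opNorm x).trans ?_
    rw [DoubleCentralizer.norm_fst, mul_comm]
  have hF : (expPath hS t : 𝓜(ℂ, X)) = NormedSpace.exp (c • S) := by
    rw [expPath, selfAdjoint.expUnitary_coe]
    congr 1
    change Complex.I • ((t * (Real.pi / 2) : ℝ) • S) = c • S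
    rw [← Complex.coe_smul, smul_smul]
    congr 1
    simp only [c]
    push_cast
    ring
  have h1 := (NormedSpace.exp_series_hasSum_exp' (𝕂 := ℂ) (c • S)).map L hLc
  have h2 : HasSum (fun n : ℕ => ((n.factorial : ℂ)⁻¹ * c ^ n)) (Complex.exp c) := by
    have := NormedSpace.exp_series_hasSum_exp' (𝕂 := ℂ) c
    rw [← Complex.exp_eq_exp_ℂ] at this
    simpa using this
  have h3 : HasSum (fun n : ℕ => ((n.factorial : ℂ)⁻¹ * (-c) ^ n)) (Complex.exp (-c)) := by
    have := NormedSpace.exp_series_hasSum_exp' (𝕂 := ℂ) (-c)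
    rw [← Complex.exp_eq_exp_ℂ] at this
    simpa using this
  have h4 := (h2.smul_const ((1 / 2 : ℂ) • ((g x).entry i j + (g x).entry i.rev j))).add
    (h3.smul_const ((1 / 2 : ℂ) • ((g x).entry i j - (g x).entry i.rev j)))
  have h5 : (fun n : ℕ => ((n.factorial : ℂ)⁻¹ * c ^ n) •
        ((1 / 2 : ℂ) • ((g x).entry i j + (g x).entry i.rev j)) +
      ((n.factorial : ℂ)⁻¹ * (-c) ^ n) •
        ((1 / 2 : ℂ) • ((g x).entry i j - (g x).entry i.rev j))) =
      L ∘ fun n : ℕ => ((n.factorial : ℂ)⁻¹) • (c • S) ^ n := by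
    funext n
    rw [Function.comp_apply, hLs, smul_pow, hLs]
    change _ = _ • _ • (g ((S ^ n).fst x)).entry i j
    rw [hpow, neg_pow c]
    match_scalars <;> ring
  rw [h5] at h4
  have h6 := h1.unique h4
  rw [hF]
  change L (NormedSpace.exp (c • S)) = _
  rw [h6]
  -- Since `c = πit/2`, the two eigenvalues are `exp(c)` times `1` and times the conjugate of `circ
  -- t`. So `exp(cS)` is a phase times a rotation, and the phase cancels under conjugation.
  have h7 : Complex.exp (-c) = Complex.exp c * star (circ t) := by
    rw [circ, Complex.star_def, ← Complex.exp_conj, ← Complex.exp_add]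
    congr 1
    simp [c]
    ring
  rw [h7]
  change _ = Complex.exp c • _
  generalize Complex.exp c = w
  generalize star (circ t) = z
  generalize g x = y
  fin_cases i <;> simp [rotCoeff, Fin.rev] <;> match_scalars <;> ring

lemma map_adX_expPath {S : 𝓜(ℂ, X)} (hS : IsSelfAdjoint S) (g : X →⋆ₙₐ[ℂ] Mat 2 D)
    (hg : ∀ x i j, (g (S.fst x)).entry i j = (g x).entry i.rev j) (t : unitInterval)
    (hz : star (circ t) * star (star (circ t)) = 1) (x : X) :
    g (adX (expPath hS t) x) = Mat.rot (star (circ t)) hz (g x) := by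
  refine Mat.ext fun i j => ?_
  have he : Complex.exp (t * (Real.pi / 2) * Complex.I) *
      star (Complex.exp (t * (Real.pi / 2) * Complex.I)) = 1 := by
    have hr : (t * (Real.pi / 2) * Complex.I : ℂ) = ((t * (Real.pi / 2) : ℝ) : ℂ) * Complex.I := by
      push_cast
      ring
    rw [hr, Complex.star_def, ← Complex.exp_conj, ← Complex.exp_add, map_mul, Complex.conj_ofReal,
      Complex.conj_I, mul_neg, add_neg_cancel, Complex.exp_zero]
  rw [adX_apply, entry_map_expPath hS g hg, Mat.entry_rot, Finset.smul_sum]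
  refine Finset.sum_congr rfl fun k _ => ?_
  rw [map_star, Mat.entry_star, entry_map_expPath hS g hg, star_smul, star_sum, Finset.smul_sum,
    Finset.smul_sum, Finset.smul_sum]
  refine Finset.sum_congr rfl fun l _ => ?_
  rw [star_smul, map_star, Mat.entry_star, star_star, smul_smul, smul_smul, smul_smul]
  congr 1
  linear_combination (rotCoeff (star (circ t)) i k * star (rotCoeff (star (circ t)) j l)) * he

end Multipliers

/-! ### The universal map is a right inverse of `q(π_A)` -/

section RightInverse

variable {A D : Type u} [NonUnitalCStarAlgebra A] [NonUnitalCStarAlgebra D]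

/-- The element `ε(x) - ε̄(x)` of `qA`. -/
def dq (x : A) : q A := ⟨ι A x - ι' A x, by simp [mem_qSub, fold]⟩

@[simp] lemma incl_dq (x : A) : q.incl A (dq x) = ι A x - ι' A x := rfl

@[simp] lemma piq_dq (x : A) : piq A (dq x) = x := by simp [piq_apply]

/-- A homomorphism that vanishes on the kernel of `π : qA → A` descends to `A`. -/
def descend (H : q A →⋆ₙₐ[ℂ] D) (hH : ∀ z, piq A z = 0 → H z = 0) : A →⋆ₙₐ[ℂ] D :=
  -- The section `dq` of `π` is not multiplicative; it is so modulo the kernel of `π`, which `H`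
  -- annihilates.
  have key : ∀ z w, piq A z = piq A w → H z = H w := fun z w h => by
    rw [← sub_eq_zero, ← map_sub]
    exact hH _ (by rw [map_sub, h, sub_self])
  { toFun := fun x => H (dq x)
    map_smul' := fun c x => by rw [MonoidHom.id_apply, ← map_smul]; exact key _ _ (by simp)
    map_zero' := by rw [← map_zero H]; exact key _ _ (by simp)
    map_add' := fun x y => by rw [← map_add]; exact key _ _ (by simp)
    map_mul' := fun x y => by rw [← map_mul]; exact key _ _ (by simp)
    map_star' := fun x => by rw [← map_star]; exact key _ _ (by simp [map_star]) }

variable (A) in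
/-- The homomorphism `0 ⊕ η̄ : qA → R`. -/
def RAlg.corner₁ : q A →⋆ₙₐ[ℂ] RAlg A :=
  NonUnitalStarAlgHom.codRestrict ((Mat.corner 1).comp ((ι' (Q A)).comp (q.incl A))) (rSub A)
    fun z => subset_genC _ ⟨⟨0, by simp⟩, ⟨0, 0, by simp⟩, ⟨0, 0, by simp⟩, ⟨z, by simp⟩⟩

variable (A) in
/-- The homomorphism `η ⊕ 0 : qA → R`. -/
def RAlg.corner₀ : q A →⋆ₙₐ[ℂ] RAlg A :=
  NonUnitalStarAlgHom.codRestrict ((Mat.corner 0).comp ((ι (Q A)).comp (q.incl A))) (rSub A)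
    fun z => subset_genC _ ⟨⟨z, by simp⟩, ⟨0, 0, by simp⟩, ⟨0, 0, by simp⟩, ⟨0, by simp⟩⟩

lemma RAlg.incl_corner₁ (z : q A) :
    RAlg.incl A (RAlg.corner₁ A z) = Mat.corner 1 (ι' (Q A) (q.incl A z)) := rfl

lemma RAlg.incl_corner₀ (z : q A) :
    RAlg.incl A (RAlg.corner₀ A z) = Mat.corner 0 (ι (Q A) (q.incl A z)) := rfl

lemma RAlg.incl_injective : Function.Injective (RAlg.incl A) := Subtype.val_injective

variable (A) in
/-- The homomorphism `R → M₂(QA)` induced by `id ⋆ 0 : QA → A`. -/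
def RAlg.proj : RAlg A →⋆ₙₐ[ℂ] Mat 2 (Q A) :=
  (Mat.map 2 (Q.map (Q.lift (NonUnitalStarAlgHom.id ℂ A) 0))).comp (RAlg.incl A)

lemma RAlg.proj_apply (r : RAlg A) : RAlg.proj A r =
    Mat.map 2 (Q.map (Q.lift (NonUnitalStarAlgHom.id ℂ A) 0)) (RAlg.incl A r) := rfl

lemma RAlg.proj_corner₁ (z : q A) :
    RAlg.proj A (RAlg.corner₁ A z) = Mat.corner 1 (ι' A (piq A z)) :=
  Mat.ext fun i j => by
    rw [RAlg.proj_apply, RAlg.incl_corner₁, Mat.entry_map, Mat.entry_corner, Mat.entry_corner]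
    split_ifs
    · rw [Q.map_ι']
      rfl
    · rw [map_zero]

lemma RAlg.proj_corner₀ (z : q A) :
    RAlg.proj A (RAlg.corner₀ A z) = Mat.corner 0 (ι A (piq A z)) :=
  Mat.ext fun i j => by
    rw [RAlg.proj_apply, RAlg.incl_corner₀, Mat.entry_map, Mat.entry_corner, Mat.entry_corner]
    split_ifs
    · rw [Q.map_ι]
      rfl
    · rw [map_zero]

lemma incl_diagM_fst (e e' : A →⋆ₙₐ[ℂ] Q A) (x : A) (r : RAlg A) :
    RAlg.incl A ((diagM e e' x).fst r) = diagHom e e' x * RAlg.incl A r := rfl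

lemma Q_map_proj_q2incl (z : q (q A)) :
    Q.map (Q.lift (NonUnitalStarAlgHom.id ℂ A) 0) (q2incl A z) = q.incl A (q.map (piq A) z) := by
  have : (Q.map (Q.lift (NonUnitalStarAlgHom.id ℂ A) 0)).comp (Q.map (q.incl A)) =
      Q.map (piq A) := (Q.map_comp _ _).symm
  rw [q2incl, NonUnitalStarAlgHom.comp_apply, q.incl_map]
  exact DFunLike.congr_fun this _

/-- Modulo `qA` the multiplier `S` acts as the flip of the rows. -/
lemma IsSwapLift.fold_proj {S : 𝓜(ℂ, RAlg A)} (hS : IsSwapLift S) (r : RAlg A) (i j : Fin 2) :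
    (((Mat.map 2 (fold A)).comp (RAlg.proj A)) (S.fst r)).entry i j =
      (((Mat.map 2 (fold A)).comp (RAlg.proj A)) r).entry i.rev j := by
  obtain ⟨z, hz⟩ := hS.lifts r i j
  rw [← sub_eq_zero]
  change fold A (Q.map _ ((RAlg.incl A (S.fst r)).entry i j)) -
    fold A (Q.map _ ((RAlg.incl A r).entry i.rev j)) = 0
  rw [← map_sub, ← map_sub, hz, Q_map_proj_q2incl, q.fold_incl]

/-- The rotated copy of `0 ⊕ ε̄`. -/
def rotated (F : unitary 𝓜(ℂ, RAlg A)) : A →⋆ₙₐ[ℂ] Mat 2 (Q A) :=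
  descend ((RAlg.proj A).comp ((adX F).comp (RAlg.corner₁ A))) fun z hz =>
    -- `F` is a multiplier of `R` and need not act on `M₂(QA)`. Conjugation by it still preserves
    -- the kernel of `RAlg.proj`, which is enough.
    map_adX_eq_zero _ F (by
      rw [RAlg.proj_corner₁, hz, map_zero, map_zero])

lemma rotated_apply (F : unitary 𝓜(ℂ, RAlg A)) (x : A) :
    rotated F x = RAlg.proj A (adX F (RAlg.corner₁ A (dq x))) := rfl

lemma star_circ_mul_star (t : unitInterval) : star (circ t) * star (star (circ t)) = 1 := by
  rw [star_star, mul_comm, circ_mul_star]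

/-- Modulo `qA` both `0 ⊕ ε` and `0 ⊕ ε̄` become `0 ⊕ id`, and conjugation by the exponential of the
flip becomes exactly this scalar rotation. -/
lemma rot_sub_rotated_mem {S : 𝓜(ℂ, RAlg A)} (hS : IsSwapLift S) (t : unitInterval) (x : A) :
    ∃ b, Mat.map 2 (q.incl A) b =
      (Mat.rot (star (circ t)) (star_circ_mul_star t)).comp (dsum ![0, ι A]) x -
        rotated (expPath hS.isSelfAdjoint t) x := by
  refine Mat.exists_map fun i k => q.exists_of_fold ?_
  have h1 := map_adX_expPath hS.isSelfAdjoint ((Mat.map 2 (fold A)).comp (RAlg.proj A))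
    hS.fold_proj t (star_circ_mul_star t) (RAlg.corner₁ A (dq x))
  have h2 := Mat.map_rot (star (circ t)) (star_circ_mul_star t) (fold A) (dsum ![0, ι A] x)
  have h3 : Mat.map 2 (fold A) (dsum ![0, ι A] x) =
      ((Mat.map 2 (fold A)).comp (RAlg.proj A)) (RAlg.corner₁ A (dq x)) := by
    rw [NonUnitalStarAlgHom.comp_apply, RAlg.proj_corner₁, piq_dq]
    refine Mat.ext fun i j => ?_
    fin_cases i <;> fin_cases j <;> simp [entry_dsum, fold]
  rw [h3, ← h1] at h2
  have h4 := congrArg (fun m => Mat.entry m i k) h2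
  rw [Mat.entry_sub, map_sub, sub_eq_zero]
  exact h4

/-- Universal maps are defined by multipliers of `R`, whereas the homotopy of pairs takes place in
`M₂(QA)`. This translates the action of the former into left multiplication by the latter. It
suffices to check the two copies of `A`, as both sides are multiplicative in `w`. -/
lemma proj_diagM (F : unitary 𝓜(ℂ, RAlg A)) (w : Q A) (r : RAlg A) :
    RAlg.proj A ((Q.lift (diagM (ι A) (ι' A)) ((adM F).comp (diagM (ι' A) (ι A))) w).fst r) =
      Q.lift (dsum ![ι A, 0]) (rotated F) w * RAlg.proj A r := by
  have hd : ∀ (e e' : A →⋆ₙₐ[ℂ] Q A) x (r : RAlg A), RAlg.proj A ((diagM e e' x).fst r) =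
      Mat.map 2 (Q.map (Q.lift (NonUnitalStarAlgHom.id ℂ A) 0)) (diagHom e e' x) *
        RAlg.proj A r := fun e e' x r => by
    rw [RAlg.proj_apply, incl_diagM_fst, map_mul]
    rfl
  have g1 : ∀ x (r : RAlg A), RAlg.proj A ((diagM (ι A) (ι' A) x).fst r) =
      dsum ![ι A, 0] x * RAlg.proj A r := fun x r => by
    rw [hd]
    congr 1
    refine Mat.ext fun i j => ?_
    fin_cases i <;> fin_cases j <;> simp [diagHom, entry_dsum]
  -- The map `id ⋆ 0` kills `ε̄` and sends `ε(x)` and `ε(x) - ε̄(x)` to the same element, so the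
  -- multiplier `ηε̄(x) ⊕ η̄ε(x)` may be replaced by an element of `R`.
  have g2 : ∀ x (r : RAlg A), RAlg.proj A ((diagM (ι' A) (ι A) x).fst r) =
      RAlg.proj A (RAlg.corner₁ A (dq x) * r) := fun x r => by
    rw [hd, map_mul, RAlg.proj_corner₁, piq_dq]
    congr 1
    refine Mat.ext fun i j => ?_
    fin_cases i <;> fin_cases j <;> simp [diagHom, entry_dsum]
  have g3 : ∀ x (r : RAlg A), RAlg.proj A (((adM F).comp (diagM (ι' A) (ι A)) x).fst r) =
      rotated F x * RAlg.proj A r := fun x r => by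
    rw [rotated_apply, ← map_mul]
    have h : adX F (RAlg.corner₁ A (dq x)) * r = (F : 𝓜(ℂ, RAlg A)).fst
        (RAlg.corner₁ A (dq x) * (star (F : 𝓜(ℂ, RAlg A))).fst r) := by
      rw [← coeM_fst, coeM_adX]
      rfl
    rw [h, ← sub_eq_zero, ← map_sub]
    change RAlg.proj A ((F : 𝓜(ℂ, RAlg A)).fst ((diagM (ι' A) (ι A) x).fst
      ((star (F : 𝓜(ℂ, RAlg A))).fst r)) - _) = 0
    rw [← map_sub]
    refine map_fst_eq_zero _ _ ?_
    rw [map_sub, g2, sub_self]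
  let P : Q A → Prop := fun w => ∀ r : RAlg A,
    RAlg.proj A ((Q.lift (diagM (ι A) (ι' A)) ((adM F).comp (diagM (ι' A) (ι A))) w).fst r) =
      Q.lift (dsum ![ι A, 0]) (rotated F) w * RAlg.proj A r
  have hPs : ∀ x (r : RAlg A), P (ι A x) := fun x _ r => by rw [Q.lift_ι, Q.lift_ι, g1]
  have hPs' : ∀ x (r : RAlg A), P (ι' A x) := fun x _ r => by rw [Q.lift_ι', Q.lift_ι', g3]
  let T : NonUnitalStarSubalgebra ℂ (Q A) :=
    { carrier := {w | P w ∧ P (star w)}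
      zero_mem' := by
        constructor <;> intro r
        · rw [map_zero, map_zero, zero_mul]; exact map_zero (RAlg.proj A)
        · rw [star_zero, map_zero, map_zero, zero_mul]; exact map_zero (RAlg.proj A)
      add_mem' := by
        have : ∀ {v w}, P v → P w → P (v + w) := fun {v w} hv hw r => by
          rw [map_add, map_add, add_mul, ← hv, ← hw, ← map_add (RAlg.proj A)]; rfl
        rintro v w ⟨hv, hv'⟩ ⟨hw, hw'⟩
        exact ⟨this hv hw, by rw [star_add]; exact this hv' hw'⟩
      mul_mem' := by
        have : ∀ {v w}, P v → P w → P (v * w) := fun {v w} hv hw r => by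
          rw [map_mul, map_mul, mul_assoc, ← hw, ← hv]; rfl
        rintro v w ⟨hv, hv'⟩ ⟨hw, hw'⟩
        exact ⟨this hv hw, by rw [star_mul]; exact this hw' hv'⟩
      smul_mem' := by
        have : ∀ (c : ℂ) {v}, P v → P (c • v) := fun c {v} hv r => by
          rw [map_smul, map_smul, smul_mul_assoc, ← hv, ← map_smul (RAlg.proj A)]; rfl
        rintro c v ⟨hv, hv'⟩
        exact ⟨this c hv, by rw [star_smul]; exact this _ hv'⟩
      star_mem' := by
        rintro w ⟨hw, hw'⟩
        exact ⟨hw', by rwa [star_star]⟩ }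
  have hcl : IsClosed {w | P w} := by
    have : {w | P w} = ⋂ r : RAlg A, {w | RAlg.proj A ((Q.lift (diagM (ι A) (ι' A))
        ((adM F).comp (diagM (ι' A) (ι A))) w).fst r) =
          Q.lift (dsum ![ι A, 0]) (rotated F) w * RAlg.proj A r} := by
      ext w; simp [P]
    rw [this]
    refine isClosed_iInter fun r => isClosed_eq ?_ ((continuous_hom _).mul continuous_const)
    refine (continuous_hom _).comp ?_
    have hc : Continuous fun m : 𝓜(ℂ, RAlg A) => m.fst r :=
      AddMonoidHomClass.continuous_of_bound
        (AddMonoidHom.mk' (fun m : 𝓜(ℂ, RAlg A) => m.fst r) fun _ _ => rfl) ‖r‖ fun m => by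
          rw [mul_comm, ← DoubleCentralizer.norm_fst]
          exact m.fst.le_opNorm r
    exact hc.comp (continuous_hom _)
  have hT : IsClosed (T : Set (Q A)) := hcl.inter (hcl.preimage continuous_star)
  exact (Q.mem_of_mem T hT (fun x => ⟨hPs x r, by rw [← map_star]; exact hPs _ r⟩)
    (fun x => ⟨hPs' x r, by rw [← map_star]; exact hPs' _ r⟩) w).1 r

/-- The class of a universal map is a right inverse of the class of `q(π_A)`. -/
lemma of_qmap_piq_comp_universal {φ : q A →⋆ₙₐ[ℂ] Mat 2 (q (q A))} (hφ : IsUniversalMap φ) :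
    (SH.of (q.map (piq A))).comp (SH.ofMat φ) = SH.id (q A) := by
  obtain ⟨S, hS, hφ⟩ := hφ
  have hj := q.incl_isIdealEmbedding.mat (A := q A) (B := Q A) (j := q.incl A) 2
  -- The path of pairs from `(0 ⊕ ε, 0 ⊕ ε̄)`, which represents the identity, to `(ε ⊕ 0, σ(0 ⊕
  -- ε̄))`, which represents the composite of `φ` with `q(π_A)`.
  have hhom := SH.ofMat_eq (qHom_homotopic (Mat.map 2 (q.incl A)) hj
    (fun t => (Mat.rot (star (circ t)) (star_circ_mul_star t)).comp (dsum ![0, ι A]))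
    (fun t => rotated (expPath hS.isSelfAdjoint t)) (rot_sub_rotated_mem hS)
    (fun x => Mat.continuous_of_entry fun i j => by
      simp only [NonUnitalStarAlgHom.comp_apply, Mat.entry_rot]
      have hc := continuous_circ
      have : ∀ i k, Continuous fun t => rotCoeff (star (circ t)) i k := fun i k => by
        unfold rotCoeff
        split_ifs <;> fun_prop
      fun_prop)
    (fun x => by
      simp only [rotated_apply]
      exact (continuous_hom (RAlg.proj A)).comp
        (continuous_adX (continuous_expPath hS.isSelfAdjoint) _)))
  have e0 : (Mat.rot (star (circ 0)) (star_circ_mul_star 0)).comp (dsum ![0, ι A]) =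
      dsum ![0, ι A] := by
    have : ∀ (z : ℂ) (hz : z * star z = 1), z = 1 → ∀ a : Mat 2 (Q A), Mat.rot z hz a = a := by
      rintro z hz rfl a
      exact Mat.rot_one _ _
    exact NonUnitalStarAlgHom.ext fun x =>
      this _ (star_circ_mul_star 0) (by rw [circ_zero, star_one]) _
  have e1 : (Mat.rot (star (circ 1)) (star_circ_mul_star 1)).comp (dsum ![0, ι A]) =
      dsum ![ι A, 0] := by
    have : ∀ (z : ℂ) (hz : z * star z = 1), z = -1 → ∀ (a : Mat 2 (Q A)) i k,
        (Mat.rot z hz a).entry i k = a.entry i.rev k.rev := by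
      rintro z hz rfl a i k
      exact Mat.entry_rot_neg_one _ _ _ _
    refine NonUnitalStarAlgHom.ext fun x => Mat.ext fun i k => ?_
    rw [NonUnitalStarAlgHom.comp_apply, this _ _ (by rw [circ_one, star_neg, star_one])]
    fin_cases i <;> fin_cases k <;> simp [entry_dsum, Fin.rev]
  have e2 : rotated (expPath hS.isSelfAdjoint 0) = dsum ![0, ι' A] := by
    refine NonUnitalStarAlgHom.ext fun x => Mat.ext fun i k => ?_
    rw [rotated_apply, expPath_zero, adX_one, RAlg.proj_corner₁, piq_dq]
    fin_cases i <;> fin_cases k <;> simp [entry_dsum]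
  simp only [e0, e1, e2] at hhom
  have hd : ∀ x, ∃ b, q.incl A b = ι A x - ι' A x := fun x => ⟨dq x, rfl⟩
  have hne : ∀ k ≠ (1 : Fin 2), ![0, ι A] k = ![0, ι' A] k := by
    intro k hk
    obtain rfl : k = 0 := by omega
    rw [Matrix.cons_val_zero, Matrix.cons_val_zero]
  have hid : qHom (q.incl A) q.incl_isIdealEmbedding (ι A) (ι' A) hd =
      NonUnitalStarAlgHom.id ℂ (q A) := (eq_qHom _ _ _ fun z => (Q.lift_ι_ι' _).symm).symm
  rw [ofMat_qHom_dsum (q.incl A) q.incl_isIdealEmbedding _ _ _ 1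
    (f := ι A) (g := ι' A) (Matrix.cons_val_one _ _) (Matrix.cons_val_one _ _) hd hne, hid] at hhom
  rw [SH.of_comp_ofMat, SH.id, hhom]
  congr 1
  refine eq_qHom _ _ _ fun z => ?_
  obtain ⟨r, hr1, hr2⟩ := hφ z
  have hpath : expPath hS.isSelfAdjoint 1 = expF hS.isSelfAdjoint := by
    rw [expPath, expF]
    congr 2
    simp
  -- The required identity is known only after multiplication by elements of the image of `R`. Both
  -- sides lie in the C*-algebra generated by this image, so the difference times its own adjoint is
  -- zero.
  have hL : ∀ w : Q A, Q.lift (dsum ![ι A, 0]) (rotated (expPath hS.isSelfAdjoint 1)) w ∈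
      genC (Set.range (RAlg.proj A)) := by
    refine Q.mem_of_mem ((genC (Set.range (RAlg.proj A))).comap
      (Q.lift (dsum ![ι A, 0]) (rotated (expPath hS.isSelfAdjoint 1)))) ?_ (fun x => ?_)
      (fun x => ?_)
    · rw [NonUnitalStarSubalgebra.coe_comap]
      exact (genC_isClosed _).preimage (continuous_hom _)
    · rw [NonUnitalStarSubalgebra.mem_comap, Q.lift_ι]
      refine subset_genC _ ⟨RAlg.corner₀ A (dq x), Mat.ext fun i j => ?_⟩
      rw [RAlg.proj_corner₀, piq_dq]
      fin_cases i <;> fin_cases j <;> simp [entry_dsum]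
    · rw [NonUnitalStarSubalgebra.mem_comap, Q.lift_ι']
      exact subset_genC _ ⟨_, rfl⟩
  have h1 : Mat.map 2 (q.incl A) (((Mat.map 2 (q.map (piq A))).comp φ) z) = RAlg.proj A r := by
    rw [RAlg.proj_apply, hr2]
    exact Mat.ext fun i j => (Q_map_proj_q2incl _).symm
  rw [h1]
  have h2 : ∀ s, (Q.lift (dsum ![ι A, 0]) (rotated (expPath hS.isSelfAdjoint 1)) (q.incl A z) -
      RAlg.proj A r) * RAlg.proj A s = 0 := fun s => by
    have h3 := proj_diagM (expPath hS.isSelfAdjoint 1) (q.incl A z) s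
    rw [sub_mul, ← h3, hpath]
    have h4 : Q.lift (diagM (ι A) (ι' A)) ((adM (expF hS.isSelfAdjoint)).comp
      (diagM (ι' A) (ι A))) (q.incl A z) = coeM (RAlg A) r := hr1
    rw [h4, coeM_fst, map_mul, sub_self]
  have hmem := sub_mem (hL (q.incl A z))
    (subset_genC (Set.range (RAlg.proj A)) (Set.mem_range_self r))
  generalize Q.lift (dsum ![ι A, 0]) (rotated (expPath hS.isSelfAdjoint 1)) (q.incl A z) = v
    at h2 hmem
  refine (sub_eq_zero.1 ((CStarRing.mul_star_self_eq_zero_iff _).1 ?_)).symm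
  have hle : closure (NonUnitalStarAlgHom.range (RAlg.proj A) : Set (Mat 2 (Q A))) ⊆
      {b | (v - RAlg.proj A r) * b = 0} := by
    refine closure_minimal ?_ (isClosed_eq (continuous_const.mul continuous_id) continuous_const)
    rintro _ ⟨s, rfl⟩
    exact h2 s
  have hg : genC (Set.range (RAlg.proj A)) ≤
      (NonUnitalStarAlgHom.range (RAlg.proj A)).topologicalClosure :=
    genC_le (fun _ hx => NonUnitalStarSubalgebra.le_topologicalClosure _ hx)
      (NonUnitalStarSubalgebra.isClosed_topologicalClosure _)
  exact hle (hg (star_mem hmem))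

end RightInverse

/-! ### The product in terms of stable classes -/

section ProductClasses

variable {A B C D E X Y : Type u} [NonUnitalCStarAlgebra A] [NonUnitalCStarAlgebra B]
  [NonUnitalCStarAlgebra C] [NonUnitalCStarAlgebra D] [NonUnitalCStarAlgebra E]
  [NonUnitalCStarAlgebra X] [NonUnitalCStarAlgebra Y]

lemma of_piq_q_q : SH.of (piq (q (q A))) = (SH.of (q.map (piq A))).qhat := by
  rw [of_piq_q, ← SH.qhat_of, of_piq_q]

/-- The class of a universal map is a left inverse of the class of `q(π_A)`. -/
lemma universal_comp_of_qmap_piq {φ : q A →⋆ₙₐ[ℂ] Mat 2 (q (q A))} (hφ : IsUniversalMap φ) :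
    (SH.ofMat φ).comp (SH.of (q.map (piq A))) = SH.id (q (q A)) := by
  -- In formulas: `φ q(π) = φ π_{qA} = π_{q²A} q(φ) = q(q(π)) q(φ) = q(q(π) φ) = id`.
  rw [← of_piq_q, SH.comp_of_piq, of_piq_q_q, ← SH.qhat_comp,
    of_qmap_piq_comp_universal hφ, SH.qhat_id]

lemma cancel_of_qmap_piq {φ : q A →⋆ₙₐ[ℂ] Mat 2 (q (q A))} (hφ : IsUniversalMap φ)
    {f g : SH (q A) X} (h : f.comp (SH.of (q.map (piq A))) = g.comp (SH.of (q.map (piq A)))) :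
    f = g := by
  have := congrArg (fun k => SH.comp k (SH.ofMat φ)) h
  simpa only [SH.assoc, of_qmap_piq_comp_universal hφ, SH.comp_id] using this

lemma cancel_qhat_of_qmap_piq {φ : q A →⋆ₙₐ[ℂ] Mat 2 (q (q A))} (hφ : IsUniversalMap φ)
    {f g : SH (q (q A)) X}
    (h : f.comp (SH.of (q.map (piq A))).qhat = g.comp (SH.of (q.map (piq A))).qhat) : f = g := by
  have := congrArg (fun k => SH.comp k (SH.ofMat φ).qhat) h
  simpa only [SH.assoc, ← SH.qhat_comp, of_qmap_piq_comp_universal hφ, SH.qhat_id,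
    SH.comp_id] using this

/-- The identifications in the definition of the product are reindexings, which `SH.ev` removes. -/
lemma isProduct_iff_aux {δ : q A →⋆ₙₐ[ℂ] K C} {g : q (q A) →⋆ₙₐ[ℂ] K (K C)}
    {φ : q A →⋆ₙₐ[ℂ] Mat 2 (q (q A))}
    (h : ((K.toMat (K C) 2).comp (K.double C)).comp δ = (Mat.map 2 g).comp φ) :
    SH.mk δ = (SH.mk ((K.undouble C).comp g)).comp (SH.ofMat φ) := by
  have h1 : (SH.ev (K C)).comp (SH.ofMat ((K.toMat (K C) 2).comp ((K.double C).comp δ))) =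
      (SH.ev (K C)).comp (SH.ofMat ((Mat.map 2 g).comp φ)) :=
    congrArg (fun f => (SH.ev (K C)).comp (SH.ofMat f)) h
  rw [SH.ev_ofMat_toMat, ← SH.of_comp_ofMat, ← SH.assoc, SH.ev_comp_of] at h1
  have h2 := congrArg (SH.ev C).comp h1
  rw [← SH.assoc, SH.ev_comp_mk, SH.ev_comp_mk] at h2
  rw [← h2]
  congr 1
  ext z
  simp

/-- The class of a product. -/
lemma IsProduct.mk_eq {α : q A →⋆ₙₐ[ℂ] K B} {β : q B →⋆ₙₐ[ℂ] K C} {δ : q A →⋆ₙₐ[ℂ] K C}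
    (h : IsProduct α β δ) : ∃ φ : q A →⋆ₙₐ[ℂ] Mat 2 (q (q A)), IsUniversalMap φ ∧
      SH.mk δ = ((SH.mk β).comp (SH.mk α).qhat).comp (SH.ofMat φ) := by
  obtain ⟨φ, μ, hφ, hμ, h⟩ := h
  rw [isMu_iff] at hμ
  subst hμ
  exact ⟨φ, hφ, isProduct_iff_aux h⟩

/-- A characterization of the product from which the universal map has disappeared: `q(π_A)` is
invertible on stable classes, so at most one class satisfies it. In particular the product does not
depend on the choice of `S`. -/
lemma IsProduct.mk_comp {α : q A →⋆ₙₐ[ℂ] K B} {β : q B →⋆ₙₐ[ℂ] K C} {δ : q A →⋆ₙₐ[ℂ] K C}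
    (h : IsProduct α β δ) :
    (SH.mk δ).comp (SH.of (q.map (piq A))) = (SH.mk β).comp (SH.mk α).qhat := by
  obtain ⟨φ, hφ, h⟩ := h.mk_eq
  rw [h, SH.assoc, universal_comp_of_qmap_piq hφ, SH.comp_id]

lemma exists_isProduct {φ : q A →⋆ₙₐ[ℂ] Mat 2 (q (q A))} (hφ : IsUniversalMap φ)
    (α : q A →⋆ₙₐ[ℂ] K B) (β : q B →⋆ₙₐ[ℂ] K C) : ∃ δ, IsProduct α β δ := by
  have hinj : Function.Injective ((K.toMat (K C) 2).comp (K.double C)) :=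
    (K.toMat_injective 2).comp K.double_injective
  have hsurj : Function.Surjective ((K.toMat (K C) 2).comp (K.double C)) :=
    (K.toMat_surjective 2).comp K.double_surjective
  refine ⟨factor _ hinj ((Mat.map 2 ((K.map β).comp ((K.mu B).comp (q.map α)))).comp φ)
    (fun x => hsurj _), φ, K.mu B, hφ, isMu_iff.2 rfl, ?_⟩
  ext x
  exact factor_spec ((K.toMat (K C) 2).comp (K.double C)) hinj _ (fun x => hsurj _) x

/-- Associativity of the product. -/
lemma IsProduct.assoc {φ : q A →⋆ₙₐ[ℂ] Mat 2 (q (q A))} (hφ : IsUniversalMap φ)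
    {α : q A →⋆ₙₐ[ℂ] K B} {β : q B →⋆ₙₐ[ℂ] K C} {γ : q C →⋆ₙₐ[ℂ] K D}
    {δ₁ : q A →⋆ₙₐ[ℂ] K C} {ε₁ : q A →⋆ₙₐ[ℂ] K D} {δ₂ : q B →⋆ₙₐ[ℂ] K D} {ε₂ : q A →⋆ₙₐ[ℂ] K D}
    (h₁ : IsProduct α β δ₁) (h₁' : IsProduct δ₁ γ ε₁) (h₂ : IsProduct β γ δ₂)
    (h₂' : IsProduct α δ₂ ε₂) : SH.mk ε₁ = SH.mk ε₂ := by
  refine cancel_of_qmap_piq hφ (cancel_qhat_of_qmap_piq hφ ?_)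
  -- Both bracketings become `γ q(β) q(q(α))` after composition with `q(π_A)` and `q(q(π_A))`. For
  -- the left one the defining identity is used for `ε₁` and then, under the functor `q`, for `δ₁`.
  have e1 : ((SH.mk ε₁).comp (SH.of (q.map (piq A)))).comp (SH.of (q.map (piq A))).qhat =
      ((SH.mk γ).comp (SH.mk β).qhat).comp (SH.mk α).qhat.qhat := by
    rw [h₁'.mk_comp, SH.assoc, ← SH.qhat_comp, h₁.mk_comp, SH.qhat_comp, SH.assoc]
  -- Here `q(q(π_A))` is first replaced by `π_{q²A}`, which naturality moves past `q(α)`; it becomes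
  -- `π_{qB} = q(π_B)`, ready to be absorbed by `δ₂`.
  have e2 : ((SH.mk ε₂).comp (SH.of (q.map (piq A)))).comp (SH.of (q.map (piq A))).qhat =
      ((SH.mk γ).comp (SH.mk β).qhat).comp (SH.mk α).qhat.qhat := by
    rw [h₂'.mk_comp, ← of_piq_q_q, SH.assoc, SH.comp_of_piq, of_piq_q, ← SH.assoc, h₂.mk_comp]
  rw [e1, e2]

/-! ### The homomorphisms attached to the extension `E_α` -/

lemma Ext.lift_hom (α : q A →⋆ₙₐ[ℂ] Y) (w : Q A) :
    (Q.lift (Ext.hom α) (Ext.hom' α) w).1 = (extM α w, fold A w) := by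
  let f : Q A →⋆ₙₐ[ℂ] 𝓜(ℂ, Her α) × A :=
    (NonUnitalStarSubalgebraClass.subtype (eSub α)).comp (Q.lift (Ext.hom α) (Ext.hom' α))
  have h : f = (extM α).prod (fold A) := Q.hom_ext
    (fun x => by
      change (Q.lift (Ext.hom α) (Ext.hom' α) (ι A x)).1 = (extM α (ι A x), fold A (ι A x))
      rw [Q.lift_ι, fold, Q.lift_ι]
      rfl)
    (fun x => by
      change (Q.lift (Ext.hom α) (Ext.hom' α) (ι' A x)).1 = (extM α (ι' A x), fold A (ι' A x))
      rw [Q.lift_ι', fold, Q.lift_ι']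
      rfl)
  exact DFunLike.congr_fun h w

lemma Ext.lift_hom_incl (α : q A →⋆ₙₐ[ℂ] Y) (z : q A) :
    Q.lift (Ext.hom α) (Ext.hom' α) (q.incl A z) = Ext.j α (Her.corestrict α z) :=
  Subtype.ext (by rw [Ext.lift_hom, extM_incl, q.fold_incl]; rfl)

/-- The direct sums `qSum` are the images of the corresponding universal pairs. -/
lemma qSum_eq {n : ℕ} (γ : q E →⋆ₙₐ[ℂ] Y) (φ ψ : Fin n → X →⋆ₙₐ[ℂ] Ext γ)
    (φ' ψ' : Fin n → X →⋆ₙₐ[ℂ] Q E) (h : ∀ i x, ∃ b, Ext.j γ b = φ i x - ψ i x)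
    (h' : ∀ x, ∃ b, Mat.map n (q.incl E) b = dsum φ' x - dsum ψ' x)
    (hφ : ∀ i, φ i = (Q.lift (Ext.hom γ) (Ext.hom' γ)).comp (φ' i))
    (hψ : ∀ i, ψ i = (Q.lift (Ext.hom γ) (Ext.hom' γ)).comp (ψ' i)) :
    qSum γ φ ψ h = (Mat.map n γ).comp
      (qHom (Mat.map n (q.incl E)) (q.incl_isIdealEmbedding.mat n) (dsum φ') (dsum ψ') h') := by
  -- On `qE` the corestriction of `γ`, followed by the inclusion into `Ext γ`, is the restriction of
  -- `γ_E ⋆ γ̄_E`. Hence it carries the universal pair `(φ', ψ')` to `(φ, ψ)`.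
  have key : (Mat.map n (Her.corestrict γ)).comp
      (qHom (Mat.map n (q.incl E)) (q.incl_isIdealEmbedding.mat n) (dsum φ') (dsum ψ') h') =
      qHom (Mat.map n (Ext.j γ)) ((Ext.j_isIdealEmbedding γ).mat n) (dsum φ) (dsum ψ)
        (dsum_sub_mem h) := eq_qHom _ _ _ fun z => by
    have h1 : dsum φ = (Mat.map n (Q.lift (Ext.hom γ) (Ext.hom' γ))).comp (dsum φ') := by
      ext x
      rw [NonUnitalStarAlgHom.comp_apply, map_dsum, funext hφ]
    have h2 : dsum ψ = (Mat.map n (Q.lift (Ext.hom γ) (Ext.hom' γ))).comp (dsum ψ') := by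
      ext x
      rw [NonUnitalStarAlgHom.comp_apply, map_dsum, funext hψ]
    rw [h1, h2, ← Q.comp_lift, ← qHom_spec (Mat.map n (q.incl E))
      (q.incl_isIdealEmbedding.mat n) (dsum φ') (dsum ψ') h' z]
    exact Mat.ext fun i j => (Ext.lift_hom_incl γ _).symm
  rw [qSum, ← key]
  rfl

/-- The class of `ω`. -/
lemma ofMat_omega (α : q A →⋆ₙₐ[ℂ] Y) (β' : q (Ext α) →⋆ₙₐ[ℂ] X) :
    SH.ofMat (omega α β') = ((SH.of β').comp
      (SH.of (q.map (Q.lift (Ext.hom α) (Ext.hom' α))))).comp (SH.ofMat (crossPair A)) := by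
  have h' : ∀ x, ∃ b, Mat.map 2 (q.incl (Ext α)) b =
      dsum ![(ι _).comp (Ext.hom α), (ι' _).comp (Ext.hom' α)] x -
        dsum ![(ι' _).comp (Ext.hom α), (ι _).comp (Ext.hom' α)] x :=
    dsum_sub_mem fun i x => q.exists_of_fold (by fin_cases i <;> simp [fold])
  have h1 : (Mat.map 2 (q.map (Q.lift (Ext.hom α) (Ext.hom' α)))).comp (crossPair A) =
      qHom _ (q.incl_isIdealEmbedding.mat 2) _ _ h' := eq_qHom _ _ _ fun z => by
    have h2 : ∀ f g : A →⋆ₙₐ[ℂ] Q (Q A),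
        (Mat.map 2 (Q.map (Q.lift (Ext.hom α) (Ext.hom' α)))).comp (dsum ![f, g]) =
        dsum ![(Q.map (Q.lift (Ext.hom α) (Ext.hom' α))).comp f,
          (Q.map (Q.lift (Ext.hom α) (Ext.hom' α))).comp g] := fun f g => by
      ext x
      rw [NonUnitalStarAlgHom.comp_apply, map_dsum]
      congr 2
      funext i
      fin_cases i <;> rfl
    have h3 : ∀ w, Mat.map 2 (q.incl (Ext α)) (Mat.map 2 (q.map (Q.lift (Ext.hom α) (Ext.hom' α))) w) =
      Mat.map 2 (Q.map (Q.lift (Ext.hom α) (Ext.hom' α))) (Mat.map 2 (q.incl (Q A)) w) :=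
      fun w => rfl
    rw [NonUnitalStarAlgHom.comp_apply, h3, crossPair, qHom_spec, Q.comp_lift, h2, h2]
    congr 4 <;> ext <;> simp
  rw [SH.assoc, SH.of_comp_ofMat, h1, SH.of_comp_ofMat, omega, qSum_eq β' _ _ _ _ _ h']
  · intro i
    fin_cases i <;> ext <;> simp
  · intro i
    fin_cases i <;> ext <;> simp

/-- The inclusion of `B₀` composed with `α₀` is `α_E ⋆ ᾱ_E` restricted to `qA`. Thus `q(j_E) q(α₀)`
contains `q` of the inclusion `qA ⊆ QA`, which `of_qmap_incl` factors through `q(π_A)`; the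
remaining factor is `ω`. -/
lemma of_comp_corestrict (α : q A →⋆ₙₐ[ℂ] Y) (β' : q (Ext α) →⋆ₙₐ[ℂ] X) :
    SH.of ((β'.comp (q.map (Ext.j α))).comp (q.map (Her.corestrict α))) =
      (SH.ofMat (omega α β')).comp (SH.of (q.map (piq A))) := by
  have h : (Ext.j α).comp (Her.corestrict α) =
      (Q.lift (Ext.hom α) (Ext.hom' α)).comp (q.incl A) :=
    NonUnitalStarAlgHom.ext fun z => (Ext.lift_hom_incl α z).symm
  rw [ofMat_omega, SH.assoc, ← of_qmap_incl, SH.assoc, ← SH.of_comp, ← SH.of_comp, ← q.map_comp,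
    ← h, q.map_comp]
  rfl

lemma ExtendsUpToHomotopy.mk_eq {α : q A →⋆ₙₐ[ℂ] K B} {β : q B →⋆ₙₐ[ℂ] K C}
    {β' : q (Ext α) →⋆ₙₐ[ℂ] K C} (h : ExtendsUpToHomotopy α β β') :
    (SH.mk β).comp (SH.mk (Her.incl α)).qhat = SH.mk (β'.comp (q.map (Ext.j α))) := by
  obtain ⟨μ, hμ, h⟩ := h
  rw [isMu_iff] at hμ
  subst hμ
  have h1 := SH.mk_eq.2 (h.postcomp (K.undouble C))
  refine Eq.trans ?_ (h1.symm.trans ?_)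
  · rfl
  · congr 1
    ext z
    simp

/-- The class of a product in terms of an extension of the second factor. -/
lemma IsProduct.mk_eq_omega {α : q A →⋆ₙₐ[ℂ] K B} {β : q B →⋆ₙₐ[ℂ] K C} {δ : q A →⋆ₙₐ[ℂ] K C}
    {β' : q (Ext α) →⋆ₙₐ[ℂ] K C} (h : IsProduct α β δ) (h' : ExtendsUpToHomotopy α β β') :
    SH.mk δ = (SH.ev C).comp (SH.ofMat (omega α β')) := by
  obtain ⟨φ, hφ, -⟩ := h.mk_eq
  -- After composition with `q(π_A)` both sides are the restriction of `β` to `qB₀`, composed with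
  -- `q(α₀)`.
  refine cancel_of_qmap_piq hφ ?_
  have h1 : SH.mk α = (SH.mk (Her.incl α)).comp (SH.of (Her.corestrict α)) := by
    rw [SH.mk_comp_of]
    rfl
  rw [h.mk_comp, SH.assoc, ← of_comp_corestrict, h1, SH.qhat_comp, ← SH.assoc, h'.mk_eq,
    SH.of_comp, ← SH.assoc, SH.ev_comp_of, SH.qhat_of]

end ProductClasses

/-! ### Triple products -/

section TripleProducts

variable {A B C D E X Y Z W : Type u} [NonUnitalCStarAlgebra A] [NonUnitalCStarAlgebra B]
  [NonUnitalCStarAlgebra C] [NonUnitalCStarAlgebra D] [NonUnitalCStarAlgebra E]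
  [NonUnitalCStarAlgebra X] [NonUnitalCStarAlgebra Y] [NonUnitalCStarAlgebra Z]
  [NonUnitalCStarAlgebra W]

lemma K.ofMat_dsum {n : ℕ} (φ : Fin n → A →⋆ₙₐ[ℂ] E) (x : A) :
    K.ofMat n (dsum φ x) = ∑ i : Fin n, K.e i i (φ i x) := by
  rw [K.ofMat_apply]
  refine Finset.sum_congr rfl fun i _ => ?_
  rw [Finset.sum_eq_single i]
  · rw [entry_dsum, if_pos rfl]
  · intro k _ hk
    rw [entry_dsum, if_neg hk.symm, K.e_zero]
  · simp

/-- The universal form of the formula for triple products. -/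
lemma qhat_ofMat_comp_crossPair (a b c d : A →⋆ₙₐ[ℂ] E) (h : ∀ x, ∃ z, Mat.map 4 (q.incl E) z =
      dsum ![(ι E).comp a, (ι' E).comp c, (ι E).comp b, (ι' E).comp d] x -
        dsum ![(ι' E).comp a, (ι E).comp c, (ι' E).comp b, (ι E).comp d] x) :
    (SH.ofMat (Q.lift (dsum ![a, b]) (dsum ![c, d]))).qhat.comp (SH.ofMat (crossPair A)) =
      SH.ofMat (qHom (Mat.map 4 (q.incl E)) (q.incl_isIdealEmbedding.mat 4) _ _ h) := by
  rw [SH.ofMat, SH.qhat_mk, SH.ofMat, SH.mk_comp_mk]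
  -- The pairing function orders the four diagonal places with the outer index first, as `a, b, c,
  -- d`. The sums in the statement are ordered `a, c, b, d`, whence the transposition.
  refine SH.mk_eq_of_reindex (Equiv.swap 1 2) (Equiv.injective _) ?_
  refine hom_cancel _ (K.map_injective q.incl_injective) ?_
  let f := (K.ofMat 2).comp (Q.lift (dsum ![a, b]) (dsum ![c, d]))
  let L : Q (Q A) →⋆ₙₐ[ℂ] K (Q E) := Q.lift ((K.map (ι E)).comp f) ((K.map (ι' E)).comp f)
  let U : Mat 2 (Q (Q A)) →⋆ₙₐ[ℂ] K (Q E) := (K.undouble (Q E)).comp ((K.map L).comp (K.ofMat 2))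
  let V : Mat 4 (Q E) →⋆ₙₐ[ℂ] K (Q E) :=
    (K.reindex (Equiv.swap 1 2) (Equiv.injective _)).comp (K.ofMat 4)
  have hL : (K.map (q.incl E)).comp ((K.mu E).comp (q.map f)) = L.comp (q.incl (Q A)) := by
    ext z
    simp only [NonUnitalStarAlgHom.comp_apply, L]
    rw [K.map_incl_mu, q.incl_map, Q.lift_map]
  have hLs : ∀ y : K (q (Q A)), K.map (K.map (q.incl E)) (K.map ((K.mu E).comp (q.map f)) y) =
      K.map L (K.map (q.incl (Q A)) y) := fun y => by
    have := (K.map_comp ((K.mu E).comp (q.map f)) (K.map (q.incl E))).symm.trans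
      ((congrArg K.map hL).trans (K.map_comp _ _))
    exact DFunLike.congr_fun this y
  have hl : ∀ z, K.map (q.incl E) (K.undouble (q E) (K.map ((K.mu E).comp (q.map f))
      (K.ofMat 2 (crossPair A z)))) = U (Mat.map 2 (q.incl (Q A)) (crossPair A z)) := fun z => by
    have h1 := DFunLike.congr_fun (K.map_undouble (q.incl E))
      (K.map ((K.mu E).comp (q.map f)) (K.ofMat 2 (crossPair A z)))
    refine h1.trans ?_
    rw [NonUnitalStarAlgHom.comp_apply, hLs, K.map_ofMat]
    rfl
  have hr : ∀ y, K.map (q.incl E) (K.reindex (Equiv.swap 1 2) (Equiv.injective _) y) =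
      K.reindex (Equiv.swap 1 2) (Equiv.injective _) (K.map (q.incl E) y) :=
    fun y => DFunLike.congr_fun (K.hom_ext (φ := (K.map (q.incl E)).comp
      (K.reindex (Equiv.swap 1 2) (Equiv.injective _)))
      (ψ := (K.reindex (Equiv.swap 1 2) (Equiv.injective _)).comp (K.map (q.incl E)))
      fun i j b => by simp only [NonUnitalStarAlgHom.comp_apply, K.reindex_e, K.map_e]) y
  have hLi : ∀ w, L (ι (Q A) w) = K.map (ι E) (f w) := fun w => Q.lift_ι _ _ _
  have hLi' : ∀ w, L (ι' (Q A) w) = K.map (ι' E) (f w) := fun w => Q.lift_ι' _ _ _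
  have hf : ∀ x, f (ι A x) = K.e 0 0 (a x) + K.e 1 1 (b x) := fun x => by
    simp only [f, NonUnitalStarAlgHom.comp_apply, Q.lift_ι, K.ofMat_dsum, Fin.sum_univ_two]
    rfl
  have hf' : ∀ x, f (ι' A x) = K.e 0 0 (c x) + K.e 1 1 (d x) := fun x => by
    simp only [f, NonUnitalStarAlgHom.comp_apply, Q.lift_ι', K.ofMat_dsum, Fin.sum_univ_two]
    rfl
  have hU : ∀ (g₀ g₁ : A →⋆ₙₐ[ℂ] Q (Q A)) x, U (dsum ![g₀, g₁] x) =
      K.undouble (Q E) (K.e 0 0 (L (g₀ x))) + K.undouble (Q E) (K.e 1 1 (L (g₁ x))) := by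
    intro g₀ g₁ x
    simp only [U, NonUnitalStarAlgHom.comp_apply, K.ofMat_dsum, Fin.sum_univ_two, map_add, K.map_e]
    rfl
  have hV : ∀ (g₀ g₁ g₂ g₃ : A →⋆ₙₐ[ℂ] Q E) x, V (dsum ![g₀, g₁, g₂, g₃] x) =
      K.e 0 0 (g₀ x) + K.e 2 2 (g₁ x) + K.e 1 1 (g₂ x) + K.e 3 3 (g₃ x) := by
    intro g₀ g₁ g₂ g₃ x
    simp only [V, NonUnitalStarAlgHom.comp_apply, K.ofMat_dsum, Fin.sum_univ_four, map_add,
      K.reindex_e]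
    rfl
  have p00 : Nat.pair 0 0 = 0 := rfl
  have p01 : Nat.pair 0 1 = 1 := rfl
  have p10 : Nat.pair 1 0 = 2 := rfl
  have p11 : Nat.pair 1 1 = 3 := rfl
  ext z
  have e1 := hl z
  simp only [NonUnitalStarAlgHom.comp_apply]
  refine e1.trans ?_
  rw [hr, K.map_ofMat, qHom_spec, crossPair, qHom_spec, Q.comp_lift]
  change _ = V _
  rw [Q.comp_lift]
  have q1 : U.comp (dsum ![(ι (Q A)).comp (ι A), (ι' (Q A)).comp (ι' A)]) =
      V.comp (dsum ![(ι E).comp a, (ι' E).comp c, (ι E).comp b, (ι' E).comp d]) := by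
    ext x
    change U (dsum ![_, _] x) = V (dsum ![_, _, _, _] x)
    rw [hU, hV]
    simp only [NonUnitalStarAlgHom.comp_apply, hLi, hLi', hf, hf', map_add, K.map_e, K.e_add,
      K.undouble_e, p00, p01, p10, p11]
    abel
  have q2 : U.comp (dsum ![(ι' (Q A)).comp (ι A), (ι (Q A)).comp (ι' A)]) =
      V.comp (dsum ![(ι' E).comp a, (ι E).comp c, (ι' E).comp b, (ι E).comp d]) := by
    ext x
    change U (dsum ![_, _] x) = V (dsum ![_, _, _, _] x)
    rw [hU, hV]
    simp only [NonUnitalStarAlgHom.comp_apply, hLi, hLi', hf, hf', map_add, K.map_e, K.e_add,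
      K.undouble_e, p00, p01, p10, p11]
    abel
  rw [q1, q2]

/-- The class of a triple product. -/
lemma IsProduct.mk_eq_tripleProduct {α : q A →⋆ₙₐ[ℂ] K B} {β : q B →⋆ₙₐ[ℂ] K C}
    {γ : q C →⋆ₙₐ[ℂ] K D} {δ : q A →⋆ₙₐ[ℂ] K C} {ε : q A →⋆ₙₐ[ℂ] K D}
    {β' : q (Ext α) →⋆ₙₐ[ℂ] K C} {γ' : q (Ext β') →⋆ₙₐ[ℂ] K D}
    (h : IsProduct α β δ) (h' : IsProduct δ γ ε) (hβ : ExtendsUpToHomotopy α β β')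
    (hγ : ExtendsUpToHomotopy β' γ γ') :
    SH.mk ε = (SH.ev D).comp (SH.ofMat (tripleProduct α β' γ')) := by
  obtain ⟨φ, hφ, hε⟩ := h'.mk_eq
  let a := (Ext.hom β').comp (Ext.hom α)
  let b := (Ext.hom' β').comp (Ext.hom' α)
  let c := (Ext.hom' β').comp (Ext.hom α)
  let d := (Ext.hom β').comp (Ext.hom' α)
  have hq : ∀ x, ∃ z, Mat.map 4 (q.incl (Ext β')) z =
      dsum ![(ι _).comp a, (ι' _).comp c, (ι _).comp b, (ι' _).comp d] x -
        dsum ![(ι' _).comp a, (ι _).comp c, (ι' _).comp b, (ι _).comp d] x :=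
    dsum_sub_mem fun i x => q.exists_of_fold (by fin_cases i <;> simp [fold])
  have ht : tripleProduct α β' γ' = (Mat.map 4 γ').comp
      (qHom (Mat.map 4 (q.incl (Ext β'))) (q.incl_isIdealEmbedding.mat 4) _ _ hq) := by
    rw [tripleProduct, qSum_eq γ' _ _ _ _ _ hq]
    · intro i
      fin_cases i <;> ext <;> simp [a, b, c, d]
    · intro i
      fin_cases i <;> ext <;> simp [a, b, c, d]
  have hd : ∀ x, ∃ y, Mat.map 2 (Ext.j β') y = dsum ![a, b] x - dsum ![c, d] x :=
    dsum_sub_mem fun i x => by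
      fin_cases i
      · exact Ext.hom_sub_hom' β' _
      · exact Ext.hom'_sub_hom β' _
  let ω₀ := qHom (Mat.map 2 (Ext.j β')) ((Ext.j_isIdealEmbedding β').mat 2) _ _ hd
  have hω : SH.mk δ = (SH.mk (Her.incl β')).comp (SH.ofMat ω₀) := by
    rw [h.mk_eq_omega hβ, ← SH.ev_comp_of, SH.assoc, SH.of_comp_ofMat]
    rfl
  have hω₀ : (Mat.map 2 (Ext.j β')).comp ω₀ =
      (Q.lift (dsum ![a, b]) (dsum ![c, d])).comp (q.incl A) :=
    NonUnitalStarAlgHom.ext fun z =>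
      qHom_spec (Mat.map 2 (Ext.j β')) ((Ext.j_isIdealEmbedding β').mat 2) _ _ hd z
  -- Inside `M₂(E_{β'})` the map `ω₀` is the restriction of `(a ⊕ b) ⋆ (c ⊕ d)` to `qA`. Hence
  -- `q(ω₀)` contains `q` of the inclusion `qA ⊆ QA`, and the resulting factor `q(π_A)` is cancelled
  -- by the universal map below.
  have h1 : (SH.of (q.map (Ext.j β'))).comp (SH.ofMat ω₀).qhat =
      ((SH.ofMat (Q.lift (dsum ![a, b]) (dsum ![c, d]))).qhat.comp (SH.ofMat (crossPair A))).comp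
        (SH.of (q.map (piq A))) := by
    rw [SH.assoc, ← of_qmap_incl, ← SH.qhat_of, ← SH.qhat_of, ← SH.qhat_comp, ← SH.qhat_comp,
      SH.of_comp_ofMat, hω₀, SH.ofMat_comp]
  rw [hε, hω, SH.qhat_comp, ← SH.assoc, hγ.mk_eq, ← SH.ev_comp_of, SH.of_comp, SH.assoc, SH.assoc,
    SH.assoc, ← SH.assoc (SH.of (q.map (Ext.j β'))), h1, SH.assoc,
    of_qmap_piq_comp_universal hφ, SH.comp_id, qhat_ofMat_comp_crossPair a b c d hq, ht,
    SH.of_comp_ofMat]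

end TripleProducts

/-! ### Quasicentral approximate units -/

section Quasicentral

open Filter Topology

variable {X E : Type u} [NonUnitalCStarAlgebra X] [NonUnitalCStarAlgebra E]

/-- Every eventual property of the approximate unit holds for an element of norm `< 1` that
dominates a given one. -/
lemma exists_of_eventually_approximateUnit [PartialOrder X] [StarOrderedRing X] {a : X} (ha : 0 ≤ a)
    (ha' : ‖a‖ < 1) {P : X → Prop} (hP : ∀ᶠ u in CStarAlgebra.approximateUnit X, P u) :
    ∃ u, a ≤ u ∧ ‖u‖ < 1 ∧ P u := by
  have hb := CStarAlgebra.hasBasis_approximateUnit X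
  have h1 : ∀ᶠ u in CStarAlgebra.approximateUnit X, a ≤ u :=
    hb.eventually_iff.2 ⟨a, ⟨ha, ha'⟩, fun u hu => hu.1⟩
  obtain ⟨u, ⟨-, hu⟩, h⟩ := hb.eventually_iff.1 (h1.and hP)
  have := @h u ⟨le_refl u, by simpa using hu.le⟩
  exact ⟨u, this.1, hu, this.2⟩

/-- For almost orthogonal summands the diagonal terms of `(∑ c_i)* (∑ c_k)` contribute `N C²`, the
others at most `N² δ`. The average therefore has squared norm at most `C²/N + δ`. -/
lemma norm_sum_sq_le {N : ℕ} {c : ℕ → E} {C δ : ℝ} (hC : ∀ k, ‖c k‖ ≤ C)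
    (hδ : ∀ i k, i < k → ‖star (c i) * c k‖ ≤ δ) :
    ‖∑ k ∈ Finset.range N, c k‖ ^ 2 ≤ N * C ^ 2 + N * (N * δ) := by
  have hδ0 : 0 ≤ δ := (norm_nonneg _).trans (hδ 0 1 one_pos)
  have h1 : ∀ i k, ‖star (c i) * c k‖ ≤ (if i = k then C ^ 2 else 0) + δ := by
    intro i k
    rcases lt_trichotomy i k with h | rfl | h
    · simpa [h.ne] using hδ i k h
    · rw [if_pos rfl, CStarRing.norm_star_mul_self]
      nlinarith [hC i, norm_nonneg (c i)]
    · rw [← norm_star, star_mul, star_star]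
      simpa [h.ne'] using hδ k i h
  rw [sq, ← CStarRing.norm_star_mul_self, star_sum, Finset.sum_mul_sum]
  calc ‖∑ i ∈ Finset.range N, ∑ k ∈ Finset.range N, star (c i) * c k‖
      ≤ ∑ i ∈ Finset.range N, ∑ k ∈ Finset.range N, ((if i = k then C ^ 2 else 0) + δ) :=
        (norm_sum_le _ _).trans (Finset.sum_le_sum fun i _ =>
          (norm_sum_le _ _).trans (Finset.sum_le_sum fun k _ => h1 i k))
    _ = ∑ i ∈ Finset.range N, (C ^ 2 + N * δ) := by
        refine Finset.sum_congr rfl fun i hi => ?_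
        rw [Finset.sum_add_distrib, Finset.sum_ite_eq, if_pos hi]
        simp
    _ = _ := by simp

/-- Arveson's theorem on the existence of quasicentral approximate units. -/
lemma IsIdealEmbedding.exists_quasicentral [PartialOrder X] [StarOrderedRing X] {j : X →⋆ₙₐ[ℂ] E}
    (hj : IsIdealEmbedding j) {a : X} (ha : 0 ≤ a) (ha' : ‖a‖ < 1) (F : Finset E) (G : Finset X)
    {ε : ℝ} (hε : 0 < ε) :
    ∃ v, a ≤ v ∧ ‖v‖ < 1 ∧ (∀ x ∈ F, ‖j v * x - x * j v‖ ≤ ε) ∧ ∀ z ∈ G, ‖v * z - z‖ ≤ ε := by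
  have happ := CStarAlgebra.increasingApproximateUnit X
  obtain ⟨C, hC0, hC⟩ : ∃ C : ℝ, 0 ≤ C ∧ ∀ x ∈ F, ‖x‖ ≤ C :=
    ⟨∑ x ∈ F, ‖x‖, Finset.sum_nonneg fun _ _ => norm_nonneg _, fun x hx =>
      Finset.single_le_sum (f := fun x => ‖x‖) (fun _ _ => norm_nonneg _) hx⟩
  let c : X → E → E := fun u x => j u * x - x * j u
  have hcmem : ∀ u x, ∃ d, j d = c u x := fun u x => by
    obtain ⟨d, hd⟩ := hj.mul_mem' u x
    obtain ⟨d', hd'⟩ := hj.mul_mem x u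
    exact ⟨d - d', by rw [map_sub, hd, hd']⟩
  -- Commutators with later elements of the approximate unit are almost orthogonal to a given one:
  -- if `c u x` is the image of `d`, then `d* v x - d* x v` tends to `d* x - d* x = 0`.
  have hlim : ∀ u x, Tendsto (fun v => star (c u x) * c v x) (CStarAlgebra.approximateUnit X)
      (𝓝 0) := fun u x => by
    obtain ⟨d, hd⟩ := hcmem u x
    obtain ⟨d', hd'⟩ := hj.mul_mem' (star d) x
    have h1 : Tendsto (fun v => j (star d * v) * x - j (d' * v)) (CStarAlgebra.approximateUnit X)
        (𝓝 (j (star d) * x - j d')) :=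
      ((((continuous_hom j).tendsto _).comp (happ.tendsto_mul_left _)).mul_const x).sub
        (((continuous_hom j).tendsto _).comp (happ.tendsto_mul_left _))
    rw [hd', sub_self] at h1
    refine h1.congr fun v => ?_
    rw [map_mul, map_mul, hd', map_star, hd]
    simp only [c]
    noncomm_ring
  obtain ⟨u, hu, huc⟩ := exists_seq_of_forall_finset_exists
    (fun u : X => a ≤ u ∧ ‖u‖ < 1 ∧ ∀ z ∈ G, ‖u * z - z‖ ≤ ε)
    (fun u v => ∀ x ∈ F, ‖star (c u x) * c v x‖ ≤ ε ^ 2 / 2) fun s _ => by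
      have h1 : ∀ᶠ v in CStarAlgebra.approximateUnit X, ∀ z ∈ G, ‖v * z - z‖ ≤ ε := by
        refine (eventually_all_finset G).2 fun z _ => ?_
        filter_upwards [Metric.tendsto_nhds.1 (happ.tendsto_mul_right z) ε hε] with v hv
        rw [dist_eq_norm] at hv
        exact hv.le
      have h2 : ∀ᶠ v in CStarAlgebra.approximateUnit X, ∀ u ∈ s, ∀ x ∈ F,
          ‖star (c u x) * c v x‖ ≤ ε ^ 2 / 2 := by
        refine (eventually_all_finset s).2 fun u _ => (eventually_all_finset F).2 fun x _ => ?_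
        filter_upwards [Metric.tendsto_nhds.1 (hlim u x) (ε ^ 2 / 2) (by positivity)] with v hv
        rw [dist_zero_right] at hv
        exact hv.le
      obtain ⟨v, hv, hv', hv1, hv2⟩ := exists_of_eventually_approximateUnit ha ha' (h1.and h2)
      exact ⟨v, ⟨hv, hv', hv1⟩, hv2⟩
  -- The commutators have norm at most `2C`. For this many terms the diagonal part of the estimate
  -- is at most `ε²/2`, as is the off-diagonal part, and the average of the `u k` is quasicentral up
  -- to `ε`.
  obtain ⟨n, hn⟩ := exists_nat_ge ((2 * C) ^ 2 / (ε ^ 2 / 2))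
  let N := n + 1
  have hN : (0 : ℝ) < N := by positivity
  have hN0 : (N : ℝ) ≠ 0 := hN.ne'
  let w : X := (N : ℝ)⁻¹ • ∑ k ∈ Finset.range N, u k
  have hconst : ∀ t : X, (N : ℝ)⁻¹ • ∑ k ∈ Finset.range N, t = t := fun t => by
    rw [Finset.sum_const, Finset.card_range, ← Nat.cast_smul_eq_nsmul ℝ, smul_smul,
      inv_mul_cancel₀ hN0, one_smul]
  refine ⟨w, ?_, ?_, fun x hx => ?_, fun z hz => ?_⟩
  · rw [← hconst a]
    exact smul_le_smul_of_nonneg_left (Finset.sum_le_sum fun k _ => (hu k).1) (by positivity)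
  · rw [norm_smul, norm_inv, Real.norm_natCast, inv_mul_lt_iff₀ hN, mul_one]
    refine (norm_sum_le _ _).trans_lt ?_
    calc ∑ k ∈ Finset.range N, ‖u k‖ < ∑ k ∈ Finset.range N, (1 : ℝ) :=
          Finset.sum_lt_sum_of_nonempty (by simp [N]) fun k _ => (hu k).2.1
      _ = N := by simp
  · have h1 : j w * x - x * j w = (N : ℝ)⁻¹ • ∑ k ∈ Finset.range N, c (u k) x := by
      have : j w = (N : ℝ)⁻¹ • ∑ k ∈ Finset.range N, j (u k) := by
        simp only [w]
        rw [← Complex.coe_smul, map_smul, map_sum, Complex.coe_smul]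
      rw [this, smul_mul_assoc, mul_smul_comm, ← smul_sub, Finset.sum_mul, Finset.mul_sum,
        ← Finset.sum_sub_distrib]
    have h2 := norm_sum_sq_le (N := N) (c := fun k => c (u k) x) (C := 2 * C) (δ := ε ^ 2 / 2)
      (fun k => by
        have h3 : ‖j (u k)‖ ≤ 1 := (NonUnitalStarAlgHom.norm_apply_le j _).trans (hu k).2.1.le
        have h4 := hC x hx
        calc ‖j (u k) * x - x * j (u k)‖ ≤ ‖j (u k)‖ * ‖x‖ + ‖x‖ * ‖j (u k)‖ :=
              (norm_sub_le _ _).trans (add_le_add (norm_mul_le _ _) (norm_mul_le _ _))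
          _ ≤ 2 * C := by nlinarith [norm_nonneg x])
      (fun i k hik => huc i k hik x hx)
    rw [h1]
    refine le_of_sq_le_sq ?_ hε.le
    rw [norm_smul, mul_pow, norm_inv, Real.norm_natCast]
    have h5 : (2 * C) ^ 2 ≤ N * (ε ^ 2 / 2) := by
      rw [div_le_iff₀ (by positivity)] at hn
      refine hn.trans ?_
      gcongr
      simp [N]
    calc (N : ℝ)⁻¹ ^ 2 * ‖∑ k ∈ Finset.range N, c (u k) x‖ ^ 2
        ≤ (N : ℝ)⁻¹ ^ 2 * (N * (2 * C) ^ 2 + N * (N * (ε ^ 2 / 2))) := by gcongr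
      _ ≤ (N : ℝ)⁻¹ ^ 2 * (N * (N * (ε ^ 2 / 2)) + N * (N * (ε ^ 2 / 2))) := by gcongr
      _ = ε ^ 2 := by field_simp; ring
  · have h1 : w * z - z = (N : ℝ)⁻¹ • ∑ k ∈ Finset.range N, (u k * z - z) := by
      rw [Finset.sum_sub_distrib, smul_sub, hconst, ← Finset.sum_mul, smul_mul_assoc]
    rw [h1, norm_smul, norm_inv, Real.norm_natCast, inv_mul_le_iff₀ hN]
    refine (norm_sum_le _ _).trans ?_
    calc ∑ k ∈ Finset.range N, ‖u k * z - z‖ ≤ ∑ k ∈ Finset.range N, ε :=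
          Finset.sum_le_sum fun k _ => (hu k).2.2 z hz
      _ = N * ε := by simp

end Quasicentral

/-! ### A quasicentral approximate unit of `qA` -/

section QuasicentralSequence

open Filter Topology

/-- Equi-Lipschitz maps converge to zero on a closed set, so asymptotic relations need only be
checked on a dense set. -/
lemma isClosed_tendsto_zero {X Y : Type*} [SeminormedAddCommGroup X] [SeminormedAddCommGroup Y]
    {T : ℕ → X → Y} {C : ℝ} (hT : ∀ n x y, ‖T n x - T n y‖ ≤ C * ‖x - y‖) :
    IsClosed {x | Tendsto (fun n => T n x) atTop (𝓝 0)} := by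
  refine isClosed_of_closure_subset fun x hx => ?_
  refine Metric.tendsto_atTop.2 ?_
  intro ε hε
  have hC : 0 < |C| + 1 := by positivity
  obtain ⟨y, hy, hxy⟩ := Metric.mem_closure_iff.1 hx (ε / 2 / (|C| + 1)) (by positivity)
  obtain ⟨N, hN⟩ := Metric.tendsto_atTop.1 hy (ε / 2) (by positivity)
  refine ⟨N, fun n hn => ?_⟩
  have h1 := hN n hn
  rw [dist_zero_right] at h1 ⊢
  rw [dist_eq_norm, lt_div_iff₀ hC] at hxy
  have h2 := hT n x y
  have h3 : ‖T n x‖ ≤ ‖T n y‖ + ‖T n x - T n y‖ := by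
    simpa using norm_add_le (T n y) (T n x - T n y)
  nlinarith [le_abs_self C, norm_nonneg (x - y)]

variable {A : Type u} [NonUnitalCStarAlgebra A]

/-- Induction for elements of `QA`. -/
lemma Q.induction {P : Q A → Prop} (hc : IsClosed {w | P w}) (hι : ∀ x, P (ι A x))
    (hι' : ∀ x, P (ι' A x)) (hadd : ∀ v w, P v → P w → P (v + w))
    (hmul : ∀ v w, P v → P w → P (v * w)) (hsmul : ∀ (c : ℂ) v, P v → P (c • v)) (w : Q A) :
    P w := by
  have hzero : P 0 := by simpa using hι 0
  let T : NonUnitalStarSubalgebra ℂ (Q A) :=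
    { carrier := {w | P w ∧ P (star w)}
      zero_mem' := ⟨hzero, by rw [star_zero]; exact hzero⟩
      add_mem' := fun {v w} hv hw =>
        ⟨hadd v w hv.1 hw.1, by rw [star_add]; exact hadd _ _ hv.2 hw.2⟩
      mul_mem' := fun {v w} hv hw =>
        ⟨hmul v w hv.1 hw.1, by rw [star_mul]; exact hmul _ _ hw.2 hv.2⟩
      smul_mem' := fun c v hv => ⟨hsmul c v hv.1, by rw [star_smul]; exact hsmul _ _ hv.2⟩
      star_mem' := fun {v} hv => ⟨hv.2, by rw [star_star]; exact hv.1⟩ }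
  have hT : IsClosed (T : Set (Q A)) := hc.inter (hc.preimage continuous_star)
  exact (Q.mem_of_mem T hT (fun x => ⟨hι x, by rw [← map_star]; exact hι _⟩)
    (fun x => ⟨hι' x, by rw [← map_star]; exact hι' _⟩) w).1

lemma Q.tendsto_commutator {b : ℕ → Q A} (hb : ∀ n, ‖b n‖ ≤ 1)
    (h : ∀ x, Tendsto (fun n => b n * ι A x - ι A x * b n) atTop (𝓝 0))
    (h' : ∀ x, Tendsto (fun n => b n * ι' A x - ι' A x * b n) atTop (𝓝 0)) (w : Q A) :
    Tendsto (fun n => b n * w - w * b n) atTop (𝓝 0) := by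
  refine Q.induction (P := fun w => Tendsto (fun n => b n * w - w * b n) atTop (𝓝 0))
    (isClosed_tendsto_zero (C := 2) fun n x y => ?_) h h' (fun v w hv hw => ?_)
    (fun v w hv hw => ?_) (fun c v hv => ?_) w
  · have : b n * x - x * b n - (b n * y - y * b n) = b n * (x - y) - (x - y) * b n := by
      rw [mul_sub, sub_mul]; abel
    rw [this]
    refine (norm_sub_le _ _).trans ?_
    have h1 := norm_mul_le (b n) (x - y)
    have h2 := norm_mul_le (x - y) (b n)
    nlinarith [hb n, norm_nonneg (x - y)]
  · have := hv.add hw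
    rw [add_zero] at this
    refine this.congr fun n => ?_
    rw [mul_add, add_mul]; abel
  · have := (hv.mul_const w).add (hw.const_mul v)
    rw [zero_mul, mul_zero, add_zero] at this
    refine this.congr fun n => ?_
    simp only [mul_sub, sub_mul, mul_assoc]; abel
  · have := hv.const_smul c
    rw [smul_zero] at this
    refine this.congr fun n => ?_
    rw [smul_sub, mul_smul_comm, smul_mul_assoc]

/-- A sequence that is quasicentral in `QA`, and that is an approximate unit for the elements
`ι x - ῑ x`, is an approximate unit of `qA`. -/
lemma q.tendsto_mul_of_quasicentral {b : ℕ → q A} (hb : ∀ n, ‖b n‖ ≤ 1)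
    (h : ∀ w, Tendsto (fun n => q.incl A (b n) * w - w * q.incl A (b n)) atTop (𝓝 0))
    (hd : ∀ x, Tendsto (fun n => q.incl A (b n) * (ι A x - ι' A x) - (ι A x - ι' A x)) atTop
      (𝓝 0)) (z : q A) : Tendsto (fun n => b n * z) atTop (𝓝 z) := by
  have hb' : ∀ n, ‖q.incl A (b n)‖ ≤ 1 := fun n =>
    (NonUnitalStarAlgHom.norm_apply_le _ _).trans (hb n)
  -- A closed right ideal of `QA`, and by quasicentrality of `b` a left ideal too. It contains `ε(x)
  -- - ε̄(x)`, and these elements generate `qA` as an ideal.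
  let Kr : Set (Q A) := {w | Tendsto (fun n => q.incl A (b n) * w - w) atTop (𝓝 0)}
  have hKc : IsClosed Kr := isClosed_tendsto_zero (C := 2) fun n x y => by
    have : q.incl A (b n) * x - x - (q.incl A (b n) * y - y) =
        q.incl A (b n) * (x - y) - (x - y) := by rw [mul_sub]; abel
    rw [this]
    refine (norm_sub_le _ _).trans ?_
    have := norm_mul_le (q.incl A (b n)) (x - y)
    nlinarith [hb' n, norm_nonneg (x - y)]
  have hKadd : ∀ {v w}, v ∈ Kr → w ∈ Kr → v + w ∈ Kr := fun {v w} hv hw => by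
    have := Tendsto.add hv hw
    rw [add_zero] at this
    refine this.congr fun n => ?_
    rw [mul_add]; abel
  have hKr : ∀ {v} w, v ∈ Kr → v * w ∈ Kr := fun {v} w hv => by
    have := Tendsto.mul_const w hv
    rw [zero_mul] at this
    refine this.congr fun n => ?_
    rw [sub_mul, mul_assoc]
  have hKs : ∀ (c : ℂ) {v}, v ∈ Kr → c • v ∈ Kr := fun c {v} hv => by
    have := Tendsto.const_smul hv c
    rw [smul_zero] at this
    refine this.congr fun n => ?_
    rw [smul_sub, mul_smul_comm]
  have hKl : ∀ {v} w, v ∈ Kr → w * v ∈ Kr := fun {v} w hv => by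
    have := (Tendsto.mul_const v (h w)).add (Tendsto.const_mul w hv)
    rw [zero_mul, mul_zero, add_zero] at this
    refine this.congr fun n => ?_
    simp only [mul_sub, sub_mul, mul_assoc]; abel
  have hfι : ∀ x, fold A (ι A x) = x := fun x => by simp [fold]
  have hfι' : ∀ x, fold A (ι' A x) = x := fun x => by simp [fold]
  have key := Q.induction (P := fun w => w - ι A (fold A w) ∈ Kr)
    (hKc.preimage (continuous_id.sub ((continuous_hom _).comp (continuous_hom _))))
    (fun x => by
      rw [hfι, sub_self]
      change Tendsto _ _ _
      simp only [mul_zero, sub_zero]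
      exact tendsto_const_nhds)
    (fun x => by
      rw [hfι', ← neg_sub, ← neg_one_smul ℂ]
      exact hKs _ (hd x))
    (fun v w hv hw => by
      have := hKadd hv hw
      rwa [sub_add_sub_comm, ← map_add, ← map_add] at this)
    (fun v w hv hw => by
      have := hKadd (hKl v hw) (hKr (ι A (fold A w)) hv)
      rw [mul_sub, sub_mul, sub_add_sub_cancel, ← map_mul, ← map_mul] at this
      exact this)
    (fun c v hv => by
      have := hKs c hv
      rwa [smul_sub, ← map_smul, ← map_smul] at this) (q.incl A z)
  rw [q.fold_incl, map_zero, sub_zero] at key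
  refine tendsto_subtype_rng.2 ?_
  have := Tendsto.add_const (q.incl A z) key
  rw [zero_add] at this
  exact this.congr fun n => sub_add_cancel _ _

/-- If `A` is separable, then `qA` has an increasing sequential approximate unit that is
quasicentral in `QA`. -/
lemma q.exists_quasicentral_sequence {x : ℕ → A} (hx : DenseRange x) :
    ∃ b e : ℕ → q A, b 0 = 0 ∧ (∀ n, star (b n) = b n) ∧ (∀ n, ‖b n‖ ≤ 1) ∧
      (∀ n, star (e n) * e n = b (n + 1) - b n) ∧
      (∀ n, ∀ k < n, ‖q.incl A (b n) * ι A (x k) - ι A (x k) * q.incl A (b n)‖ ≤ (1 / 2) ^ n) ∧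
      ∀ z, Tendsto (fun n => b n * z) atTop (𝓝 z) := by
  let _ := CStarAlgebra.spectralOrder (q A)
  let _ := CStarAlgebra.spectralOrderedRing (q A)
  classical
  -- Stage `n + 1` takes care of `x 0, …, x n` up to `2^{-(n+1)}`. The new element dominates the
  -- previous one, so the difference is positive and factors as `e* e`; starting from `0`, the sums
  -- of these squares telescope to `b`.
  have step : ∀ (n : ℕ) (a : {a : q A // 0 ≤ a ∧ ‖a‖ < 1}), ∃ v : {a : q A // 0 ≤ a ∧ ‖a‖ < 1},
      a.1 ≤ v.1 ∧ ∀ k < n + 1,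
        ‖q.incl A v.1 * ι A (x k) - ι A (x k) * q.incl A v.1‖ ≤ (1 / 2) ^ (n + 1) ∧
        ‖q.incl A v.1 * ι' A (x k) - ι' A (x k) * q.incl A v.1‖ ≤ (1 / 2) ^ (n + 1) ∧
        ‖v.1 * dq (x k) - dq (x k)‖ ≤ (1 / 2) ^ (n + 1) := by
    intro n a
    obtain ⟨v, hav, hv, h1, h2⟩ := q.incl_isIdealEmbedding.exists_quasicentral a.2.1 a.2.2
      ((Finset.range (n + 1)).image (fun k => ι A (x k)) ∪
        (Finset.range (n + 1)).image (fun k => ι' A (x k)))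
      ((Finset.range (n + 1)).image (fun k => dq (x k))) (ε := (1 / 2) ^ (n + 1)) (by positivity)
    refine ⟨⟨v, a.2.1.trans hav, hv⟩, hav, fun k hk => ⟨?_, ?_, ?_⟩⟩
    · exact h1 _ (Finset.mem_union_left _ (Finset.mem_image.2 ⟨k, Finset.mem_range.2 hk, rfl⟩))
    · exact h1 _ (Finset.mem_union_right _ (Finset.mem_image.2 ⟨k, Finset.mem_range.2 hk, rfl⟩))
    · exact h2 _ (Finset.mem_image.2 ⟨k, Finset.mem_range.2 hk, rfl⟩)
  choose f hf hf' using step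
  let b : ℕ → {a : q A // 0 ≤ a ∧ ‖a‖ < 1} := fun n => Nat.rec ⟨0, le_rfl, by simp⟩ f n
  have hb' : ∀ n, ∀ k < n, ‖q.incl A (b n).1 * ι A (x k) - ι A (x k) * q.incl A (b n).1‖ ≤
        (1 / 2) ^ n ∧
      ‖q.incl A (b n).1 * ι' A (x k) - ι' A (x k) * q.incl A (b n).1‖ ≤ (1 / 2) ^ n ∧
      ‖(b n).1 * dq (x k) - dq (x k)‖ ≤ (1 / 2) ^ n := by
    intro n k hk
    cases n with
    | zero => omega
    | succ n => exact hf' n (b n) k hk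
  have hpos : ∀ n, 0 ≤ (b (n + 1)).1 - (b n).1 := fun n => sub_nonneg.2 (hf n (b n))
  choose e he using fun n => CStarAlgebra.nonneg_iff_eq_star_mul_self.1 (hpos n)
  have hnorm : ∀ n, ‖q.incl A (b n).1‖ ≤ 1 := fun n =>
    (NonUnitalStarAlgHom.norm_apply_le _ _).trans (b n).2.2.le
  have hlim : ∀ (g : ℕ → A → Q A) (_ : ∀ n y y', ‖g n y - g n y'‖ ≤ 4 * ‖y - y'‖)
      (_ : ∀ n, ∀ k < n, ‖g n (x k)‖ ≤ (1 / 2) ^ n) (y : A),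
      Tendsto (fun n => g n y) atTop (𝓝 0) := by
    intro g hg hgx y
    have hcl := isClosed_tendsto_zero hg
    refine closure_minimal ?_ hcl (hx y)
    rintro _ ⟨k, rfl⟩
    refine squeeze_zero_norm' ?_ (tendsto_pow_atTop_nhds_zero_of_lt_one (r := (1 / 2 : ℝ))
      (by norm_num) (by norm_num))
    filter_upwards [eventually_gt_atTop k] with n hn using hgx n k hn
  have hcomm : ∀ (φ : A →⋆ₙₐ[ℂ] Q A) n y y', ‖q.incl A (b n).1 * φ y - φ y * q.incl A (b n).1 -
      (q.incl A (b n).1 * φ y' - φ y' * q.incl A (b n).1)‖ ≤ 4 * ‖y - y'‖ := by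
    intro φ n y y'
    have h1 : q.incl A (b n).1 * φ y - φ y * q.incl A (b n).1 -
        (q.incl A (b n).1 * φ y' - φ y' * q.incl A (b n).1) =
        q.incl A (b n).1 * φ (y - y') - φ (y - y') * q.incl A (b n).1 := by
      rw [map_sub]; noncomm_ring
    rw [h1]
    have h2 := NonUnitalStarAlgHom.norm_apply_le φ (y - y')
    have h3 := norm_mul_le (q.incl A (b n).1) (φ (y - y'))
    have h4 := norm_mul_le (φ (y - y')) (q.incl A (b n).1)
    refine (norm_sub_le _ _).trans ?_
    nlinarith [hnorm n, norm_nonneg (y - y'), norm_nonneg (φ (y - y'))]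
  refine ⟨fun n => (b n).1, e, rfl, fun n => (b n).2.1.isSelfAdjoint.star_eq, fun n => (b n).2.2.le,
    fun n => (he n).symm, fun n k hk => (hb' n k hk).1,
    q.tendsto_mul_of_quasicentral (fun n => (b n).2.2.le) (Q.tendsto_commutator hnorm ?_ ?_) ?_⟩
  · exact hlim _ (hcomm (ι A)) fun n k hk => (hb' n k hk).1
  · exact hlim _ (hcomm (ι' A)) fun n k hk => (hb' n k hk).2.1
  · refine hlim (fun n y => q.incl A (b n).1 * (ι A y - ι' A y) - (ι A y - ι' A y)) ?_
      fun n k hk => (hb' n k hk).2.2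
    intro n y y'
    have h1 : q.incl A (b n).1 * (ι A y - ι' A y) - (ι A y - ι' A y) -
        (q.incl A (b n).1 * (ι A y' - ι' A y') - (ι A y' - ι' A y')) =
        q.incl A (b n).1 * (ι A (y - y') - ι' A (y - y')) - (ι A (y - y') - ι' A (y - y')) := by
      rw [map_sub, map_sub]; noncomm_ring
    rw [h1]
    have h2 := norm_sub_le (ι A (y - y')) (ι' A (y - y'))
    have h2' := NonUnitalStarAlgHom.norm_apply_le (ι A) (y - y')
    have h2'' := NonUnitalStarAlgHom.norm_apply_le (ι' A) (y - y')
    have h3 := norm_mul_le (q.incl A (b n).1) (ι A (y - y') - ι' A (y - y'))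
    refine (norm_sub_le _ _).trans ?_
    nlinarith [hnorm n, norm_nonneg (y - y'), norm_nonneg (ι A (y - y') - ι' A (y - y'))]

end QuasicentralSequence

/-! ### The Cauchy-Schwarz inequality and strict limits -/

section StrictLimits

open Filter Topology

variable {X : Type u} [NonUnitalCStarAlgebra X]

/-- The Cauchy-Schwarz inequality in the Hilbert module `X^s`. -/
lemma norm_sum_star_mul_le {T : Type*} (s : Finset T) (a c : T → X) :
    ‖∑ i ∈ s, star (a i) * c i‖ ≤
      √‖∑ i ∈ s, star (a i) * a i‖ * √‖∑ i ∈ s, star (c i) * c i‖ := by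
  let _ := CStarAlgebra.spectralOrder X
  let _ := CStarAlgebra.spectralOrderedRing X
  let x : WithCStarModule X (s → X) := (WithCStarModule.equiv X (s → X)).symm fun i => star (c i)
  let y : WithCStarModule X (s → X) := (WithCStarModule.equiv X (s → X)).symm fun i => star (a i)
  have h := CStarModule.norm_inner_le (A := X) (WithCStarModule X (s → X)) (x := x) (y := y)
  have h1 : ∀ a c : T → X, inner X ((WithCStarModule.equiv X (s → X)).symm fun i : s => star (c i))
      ((WithCStarModule.equiv X (s → X)).symm fun i : s => star (a i)) =
        ∑ i ∈ s, star (a i) * c i := fun a c => by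
    rw [WithCStarModule.pi_inner, ← Finset.sum_coe_sort s]
    refine Finset.sum_congr rfl fun i _ => ?_
    change star (a i) * star (star (c i)) = _
    rw [star_star]
  rw [h1, CStarModule.norm_eq_sqrt_norm_inner_self (A := X) x,
    CStarModule.norm_eq_sqrt_norm_inner_self (A := X) y, h1, h1, mul_comm] at h
  exact h

/-- Cauchy-Schwarz is applied to `c` and to `vc` separately. The latter costs nothing more, because
`(vc)* (vc) ≤ c* c`; so the cutoffs do not spoil convergence. -/
lemma norm_sum_star_mul_mul_le {T : Type*} (s : Finset T) (a c v : T → X) (hv : ∀ i, ‖v i‖ ≤ 1) :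
    ‖∑ i ∈ s, star (a i) * (c i - v i * c i)‖ ≤
      2 * (√‖∑ i ∈ s, star (a i) * a i‖ * √‖∑ i ∈ s, star (c i) * c i‖) := by
  let _ := CStarAlgebra.spectralOrder X
  let _ := CStarAlgebra.spectralOrderedRing X
  have h1 : ‖∑ i ∈ s, star (v i * c i) * (v i * c i)‖ ≤ ‖∑ i ∈ s, star (c i) * c i‖ := by
    refine CStarAlgebra.norm_le_norm_of_nonneg_of_le
      (Finset.sum_nonneg fun i _ => star_mul_self_nonneg _) (Finset.sum_le_sum fun i _ => ?_)
    have h2 := CStarAlgebra.star_left_conjugate_le_norm_smul (a := c i) (b := star (v i) * v i)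
      (hb := .star_mul_self _)
    have h3 : ‖star (v i) * v i‖ ≤ 1 := by
      rw [CStarRing.norm_star_mul_self]
      nlinarith [hv i, norm_nonneg (v i)]
    have h4 : star (v i * c i) * (v i * c i) = star (c i) * (star (v i) * v i) * c i := by
      rw [star_mul]
      simp only [mul_assoc]
    rw [h4]
    refine h2.trans ?_
    have := smul_le_smul_of_nonneg_right h3 (star_mul_self_nonneg (c i))
    rwa [one_smul] at this
  simp only [mul_sub, Finset.sum_sub_distrib]
  refine (norm_sub_le _ _).trans ?_
  rw [two_mul]
  refine add_le_add (norm_sum_star_mul_le s a c) ((norm_sum_star_mul_le s a _).trans ?_)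
  gcongr

/-- The strict limit of a bounded sequence of self-adjoint elements. -/
lemma exists_multiplier_of_cauchySeq {a : ℕ → X} (ha : ∀ n, star (a n) = a n) {C : ℝ}
    (hC : ∀ n, ‖a n‖ ≤ C) (h : ∀ x, CauchySeq fun n => a n * x) :
    ∃ S : 𝓜(ℂ, X), IsSelfAdjoint S ∧ ∀ x, Tendsto (fun n => a n * x) atTop (𝓝 (S.fst x)) := by
  choose f hf using fun x => cauchySeq_tendsto_of_complete (h x)
  let L : X →L[ℂ] X := LinearMap.mkContinuous
    { toFun := f
      map_add' := fun x y => tendsto_nhds_unique (hf (x + y)) (by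
        simpa only [mul_add] using (hf x).add (hf y))
      map_smul' := fun c x => tendsto_nhds_unique (hf (c • x)) (by
        simpa only [mul_smul_comm, RingHom.id_apply] using (hf x).const_smul c) }
    C (fun x => le_of_tendsto (hf x).norm (Eventually.of_forall fun n =>
      (norm_mul_le _ _).trans (mul_le_mul_of_nonneg_right (hC n) (norm_nonneg x))))
  -- As the `a n` are self-adjoint, strict convergence on the right follows from that on the left by
  -- taking adjoints.
  let L' : X →L[ℂ] X := LinearMap.mkContinuous
    { toFun := fun x => star (L (star x))
      map_add' := fun x y => by rw [star_add, map_add, star_add]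
      map_smul' := fun c x => by simp [star_smul] }
    ‖L‖ (fun x => by
      change ‖star (L (star x))‖ ≤ _
      rw [norm_star, ← norm_star x]
      exact L.le_opNorm _)
  have hL' : ∀ x, Tendsto (fun n => x * a n) atTop (𝓝 (L' x)) := fun x => by
    refine ((continuous_star.tendsto _).comp (hf (star x))).congr fun n => ?_
    rw [Function.comp_apply, star_mul, star_star, ha]
  refine ⟨⟨(L, L'), fun x y => tendsto_nhds_unique ((hL' x).mul_const y) ?_⟩, ?_, hf⟩
  · exact ((hf y).const_mul x).congr fun n => (mul_assoc _ _ _).symm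
  · refine multiplier_ext fun x => ?_
    rw [DoubleCentralizer.star_fst]
    change star (star (L (star (star x)))) = L x
    rw [star_star, star_star]

lemma isClosed_setOf_cauchySeq_mul {a : ℕ → X} {C : ℝ} (hC : ∀ n, ‖a n‖ ≤ C) :
    IsClosed {x | CauchySeq fun n => a n * x} := by
  refine isClosed_of_closure_subset fun x hx => ?_
  refine Metric.cauchySeq_iff.2 fun ε hε => ?_
  have hC0 : 0 ≤ C := (norm_nonneg _).trans (hC 0)
  obtain ⟨y, hy, hxy⟩ := Metric.mem_closure_iff.1 hx (ε / 3 / (C + 1)) (by positivity)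
  obtain ⟨N, hN⟩ := Metric.cauchySeq_iff.1 hy (ε / 3) (by positivity)
  refine ⟨N, fun m hm n hn => ?_⟩
  rw [dist_eq_norm, lt_div_iff₀ (by positivity)] at hxy
  have h1 : ∀ n, dist (a n * x) (a n * y) ≤ ε / 3 := fun n => by
    rw [dist_eq_norm, ← mul_sub]
    refine (norm_mul_le _ _).trans ?_
    nlinarith [hC n, norm_nonneg (x - y)]
  have h2 := dist_triangle4 (a m * x) (a m * y) (a n * y) (a n * x)
  have h3 := h1 n
  rw [dist_comm] at h3
  linarith [h1 m, hN m hm n hn]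

end StrictLimits

/-! ### The algebra `R` -/

section RAlgebra

open Filter Topology

/-! ### Matrices with one nonzero entry -/

section Single

variable {n : ℕ} {X Y : Type u} [NonUnitalCStarAlgebra X] [NonUnitalCStarAlgebra Y]

lemma Mat.single_mul_single (i j k : Fin n) (a b : X) :
    Mat.single i j a * Mat.single j k b = Mat.single i k (a * b) := Mat.ext fun r s => by
  by_cases hr : r = i <;> by_cases hs : s = k <;> simp [Mat.entry_mul, hr, hs]

lemma Mat.star_single (i j : Fin n) (a : X) : star (Mat.single i j a) = Mat.single j i (star a) :=
  Mat.ext fun r s => by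
    by_cases hr : r = j <;> by_cases hs : s = i <;> simp [hr, hs]

lemma Mat.single_add (i j : Fin n) (a b : X) :
    Mat.single i j (a + b) = Mat.single i j a + Mat.single i j b := Mat.ext fun r s => by
  by_cases h : r = i ∧ s = j <;> simp [h]

lemma Mat.single_sub (i j : Fin n) (a b : X) :
    Mat.single i j (a - b) = Mat.single i j a - Mat.single i j b := Mat.ext fun r s => by
  by_cases h : r = i ∧ s = j <;> simp [h]

lemma Mat.single_smul (i j : Fin n) (c : ℂ) (a : X) :
    Mat.single i j (c • a) = c • Mat.single i j a := Mat.ext fun r s => by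
  by_cases h : r = i ∧ s = j <;> simp [h]

lemma Mat.single_zero (i j : Fin n) : Mat.single i j (0 : X) = 0 := Mat.ext fun r s => by simp

lemma Mat.map_single (f : X →⋆ₙₐ[ℂ] Y) (i j : Fin n) (a : X) :
    Mat.map n f (Mat.single i j a) = Mat.single i j (f a) := Mat.ext fun r s => by
  by_cases h : r = i ∧ s = j <;> simp [h]

lemma Mat.continuous_single (i j : Fin n) : Continuous (Mat.single i j : X → Mat n X) :=
  Mat.continuous_of_entry fun r s => by
    simp only [Mat.entry_single]
    split_ifs
    · exact continuous_id
    · exact continuous_const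

lemma Mat.norm_single_le (i j : Fin n) (a : X) : ‖Mat.single i j a‖ ≤ ‖a‖ := by
  have h : ‖star (Mat.single i j a) * Mat.single i j a‖ ≤ ‖star a * a‖ := by
    rw [Mat.star_single, Mat.single_mul_single]
    exact NonUnitalStarAlgHom.norm_apply_le (Mat.corner j) _
  rw [CStarRing.norm_star_mul_self, CStarRing.norm_star_mul_self] at h
  exact abs_le_of_sq_le_sq' (by nlinarith) (norm_nonneg a) |>.2

lemma Mat.tendsto_of_entry {T : Type*} {l : Filter T} {f : T → Mat n X} {a : Mat n X}
    (h : ∀ i j, Tendsto (fun t => (f t).entry i j) l (𝓝 (a.entry i j))) : Tendsto f l (𝓝 a) :=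
  tendsto_pi_nhds.2 fun i => tendsto_pi_nhds.2 fun j => h i j

end Single

variable {A : Type u} [NonUnitalCStarAlgebra A]

/-- The two inclusions of `X` into `QX`. -/
def Q.inc (X : Type u) [NonUnitalCStarAlgebra X] (i : Fin 2) : X →⋆ₙₐ[ℂ] Q X := ![ι X, ι' X] i

@[simp] lemma Q.inc_zero (X : Type u) [NonUnitalCStarAlgebra X] : Q.inc X 0 = ι X := rfl

@[simp] lemma Q.inc_one (X : Type u) [NonUnitalCStarAlgebra X] : Q.inc X 1 = ι' X := rfl

lemma isClosed_rSub : IsClosed (rSub A : Set (Mat 2 (Q (Q A)))) := genC_isClosed _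

lemma single_inc_mul_inc_mem_rSub (i k : Fin 2) (e e' : q A) :
    Mat.single i k (Q.map (q.incl A) (Q.inc (q A) i e * Q.inc (q A) k e')) ∈ rSub A := by
  fin_cases i <;> fin_cases k <;> refine subset_genC _ ⟨?_, ?_, ?_, ?_⟩
  · exact ⟨e * e', by simp⟩
  · exact ⟨0, 0, by simp⟩
  · exact ⟨0, 0, by simp⟩
  · exact ⟨0, by simp⟩
  · exact ⟨0, by simp⟩
  · exact ⟨e, e', by simp⟩
  · exact ⟨0, 0, by simp⟩
  · exact ⟨0, by simp⟩
  · exact ⟨0, by simp⟩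
  · exact ⟨0, 0, by simp⟩
  · exact ⟨e, e', by simp⟩
  · exact ⟨0, by simp⟩
  · exact ⟨0, by simp⟩
  · exact ⟨0, 0, by simp⟩
  · exact ⟨0, 0, by simp⟩
  · exact ⟨e * e', by simp⟩

/-- With an approximate unit `u` inserted, `η_i(e) η_l(zu) y` is the product of the matrix with
`η_i(e) η_l(z)` at `(i, l)` and the one with `η_l(u) y` at `(l, k)`, both in `R`. Iteration allows
an arbitrary element of `Q(qA)` between the outer factors, which admits the terms with `v_n`. -/
lemma single_mem_rSub_of_inc_mul {k : Fin 2} {y : Q (q A)}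
    (hy : ∀ i e, Mat.single i k (Q.map (q.incl A) (Q.inc (q A) i e * y)) ∈ rSub A) (l : Fin 2)
    (z : q A) (i : Fin 2) (e : q A) :
    Mat.single i k (Q.map (q.incl A) (Q.inc (q A) i e * (Q.inc (q A) l z * y))) ∈ rSub A := by
  have hc : Continuous fun t : q A => Mat.single i k
      (Q.map (q.incl A) (Q.inc (q A) i e * (Q.inc (q A) l t * y))) :=
    (Mat.continuous_single i k).comp ((continuous_hom _).comp
      (continuous_const.mul ((continuous_hom _).mul continuous_const)))
  refine isClosed_rSub.mem_of_tendsto ((hc.tendsto z).comp (apx_right z))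
    (Eventually.of_forall fun u => ?_)
  have := mul_mem (single_inc_mul_inc_mem_rSub i l e z) (hy l u)
  rw [Mat.single_mul_single, ← map_mul] at this
  rw [Function.comp_apply, map_mul (Q.inc (q A) l)]
  simp only [mul_assoc] at this ⊢
  exact this

lemma single_mem_rSub_of_mul {k : Fin 2} (w : Q (q A)) : ∀ {y : Q (q A)},
    (∀ i e, Mat.single i k (Q.map (q.incl A) (Q.inc (q A) i e * y)) ∈ rSub A) → ∀ i e,
      Mat.single i k (Q.map (q.incl A) (Q.inc (q A) i e * (w * y))) ∈ rSub A := by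
  refine Q.induction (P := fun w => ∀ {y : Q (q A)},
    (∀ i e, Mat.single i k (Q.map (q.incl A) (Q.inc (q A) i e * y)) ∈ rSub A) → ∀ i e,
      Mat.single i k (Q.map (q.incl A) (Q.inc (q A) i e * (w * y))) ∈ rSub A)
    ?_ (fun z y hy => single_mem_rSub_of_inc_mul hy 0 z)
    (fun z y hy => single_mem_rSub_of_inc_mul hy 1 z) (fun v w hv hw y hy i e => ?_)
    (fun v w hv hw y hy i e => ?_) (fun c v hv y hy i e => ?_) w
  · simp only [Set.ofPred_forall]
    refine isClosed_iInter fun y => isClosed_iInter fun _ => isClosed_iInter fun i =>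
      isClosed_iInter fun e => isClosed_rSub.preimage ?_
    exact (Mat.continuous_single i k).comp ((continuous_hom _).comp
      (continuous_const.mul (continuous_id.mul continuous_const)))
  · rw [add_mul, mul_add, map_add, Mat.single_add]
    exact add_mem (hv hy i e) (hw hy i e)
  · rw [mul_assoc]
    exact hv (hw hy) i e
  · rw [smul_mul_assoc, mul_smul_comm, map_smul, Mat.single_smul]
    exact (rSub A).smul_mem c (hv hy i e)

lemma single_mem_rSub (i k : Fin 2) (e : q A) (w : Q (q A)) (e' : q A) :
    Mat.single i k (Q.map (q.incl A) (Q.inc (q A) i e * (w * Q.inc (q A) k e'))) ∈ rSub A :=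
  single_mem_rSub_of_mul w (fun i e => single_inc_mul_inc_mem_rSub i k e e') i e

lemma Q_map_incl_injective : Function.Injective (Q.map (q.incl A)) :=
  q.incl_isIdealEmbedding.Q_map_injective

/-- The generators of `R` have entries in the image of `Q(qA)`, which is closed in `Q²A` since
`Q(qA) → Q²A` is injective. Hence an entry that folds to zero comes from `q²A`. -/
lemma RAlg.exists_map (r : RAlg A) : ∃ m, Mat.map 2 (Q.map (q.incl A)) m = RAlg.incl A r := by
  have h : rSub A ≤ NonUnitalStarAlgHom.range (Mat.map 2 (Q.map (q.incl A))) := by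
    refine genC_le ?_ (isClosed_range_of_injective _ (Mat.map_injective Q_map_incl_injective))
    rintro m ⟨⟨z₁, h₁⟩, ⟨z₂, z₃, h₂⟩, ⟨z₄, z₅, h₄⟩, ⟨z₆, h₆⟩⟩
    refine ⟨Mat.of ![![ι _ z₁, ι _ z₂ * ι' _ z₃], ![ι' _ z₄ * ι _ z₅, ι' _ z₆]],
      Mat.ext fun i j => ?_⟩
    change Q.map (q.incl A) _ = _
    fin_cases i <;> fin_cases j <;> simp [h₁, h₂, h₄, h₆]
  exact h r.2

variable (A) in
/-- The map `R → M₂(qA) ⊆ M₂(QA)` with kernel `J`. -/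
def RAlg.fold : RAlg A →⋆ₙₐ[ℂ] Mat 2 (Q A) := (Mat.map 2 (CuntzKK.fold (Q A))).comp (RAlg.incl A)

lemma fold_Q_map (w : Q (q A)) :
    fold (Q A) (Q.map (q.incl A) w) = q.incl A (fold (q A) w) := fold_map (q.incl A) w

lemma RAlg.fold_mem (r : RAlg A) : ∃ m, Mat.map 2 (q.incl A) m = RAlg.fold A r := by
  obtain ⟨m, hm⟩ := RAlg.exists_map r
  refine ⟨Mat.map 2 (CuntzKK.fold (q A)) m, Mat.ext fun i j => ?_⟩
  rw [RAlg.fold, NonUnitalStarAlgHom.comp_apply, ← hm]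
  exact (fold_Q_map _).symm

lemma exists_q2incl_of_fold {w : Q (q A)} (h : fold (Q A) (Q.map (q.incl A) w) = 0) :
    ∃ z, Q.map (q.incl A) w = q2incl A z := by
  rw [fold_Q_map] at h
  obtain ⟨z, rfl⟩ := q.exists_of_fold (q.incl_injective (h.trans (map_zero _).symm))
  exact ⟨z, rfl⟩

lemma fold_q2incl (z : q (q A)) : fold (Q A) (q2incl A z) = 0 := by
  rw [q2incl, NonUnitalStarAlgHom.comp_apply, fold_Q_map, q.fold_incl, map_zero]

lemma inJ_iff {r : RAlg A} : InJ A r ↔ RAlg.fold A r = 0 := by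
  refine ⟨fun h => Mat.ext fun i j => ?_, fun h i j => ?_⟩
  · obtain ⟨z, hz⟩ := h i j
    change fold (Q A) ((RAlg.incl A r).entry i j) = 0
    rw [hz, fold_q2incl]
  · obtain ⟨m, hm⟩ := RAlg.exists_map r
    have h1 := congrArg (fun m => Mat.entry m i j) h
    change fold (Q A) ((RAlg.incl A r).entry i j) = 0 at h1
    rw [← hm] at h1 ⊢
    exact exists_q2incl_of_fold h1

lemma RAlg.norm_incl (r : RAlg A) : ‖RAlg.incl A r‖ = ‖r‖ :=
  norm_hom_of_injective _ RAlg.incl_injective r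

/-- The diagonal embeddings of an approximate unit of `qA` form an approximate unit of `R`. -/
lemma RAlg.tendsto_apx (r : RAlg A) :
    Tendsto (fun u => (RAlg.corner₀ A u + RAlg.corner₁ A u) * r) (apx (q A)) (𝓝 r) := by
  let D : q A → Mat 2 (Q (Q A)) := fun u => RAlg.incl A (RAlg.corner₀ A u + RAlg.corner₁ A u)
  suffices H : ∀ m ∈ rSub A, Tendsto (fun u => D u * m) (apx (q A)) (𝓝 m) from
    tendsto_subtype_rng.2 (H _ r.2)
  have hD : ∀ u, D u = Mat.single 0 0 (ι (Q A) (q.incl A u)) +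
      Mat.single 1 1 (ι' (Q A) (q.incl A u)) := fun u => map_add (RAlg.incl A) _ _
  have hgen : ∀ m : Mat 2 (Q (Q A)), (∃ z, m.entry 0 0 = ι (Q A) (q.incl A z)) ∧
      (∃ z z', m.entry 0 1 = ι (Q A) (q.incl A z) * ι' (Q A) (q.incl A z')) ∧
      (∃ z z', m.entry 1 0 = ι' (Q A) (q.incl A z) * ι (Q A) (q.incl A z')) ∧
      (∃ z, m.entry 1 1 = ι' (Q A) (q.incl A z)) →
      Tendsto (fun u => D u * m) (apx (q A)) (𝓝 m) := by
    rintro m ⟨⟨z₁, h₁⟩, ⟨z₂, z₃, h₂⟩, ⟨z₄, z₅, h₄⟩, ⟨z₆, h₆⟩⟩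
    have hlim : ∀ (f : Q A →⋆ₙₐ[ℂ] Q (Q A)) z, Tendsto (fun u => f (q.incl A u) * f (q.incl A z))
        (apx (q A)) (𝓝 (f (q.incl A z))) := fun f z => by
      simp only [← map_mul]
      exact ((continuous_hom (f.comp (q.incl A))).tendsto z).comp (apx_left z)
    refine Mat.tendsto_of_entry fun i j => ?_
    fin_cases i <;> fin_cases j
    · simpa [hD, Mat.entry_mul, h₁] using hlim (ι (Q A)) z₁
    · simpa [hD, Mat.entry_mul, h₂, mul_assoc] using (hlim (ι (Q A)) z₂).mul_const _
    · simpa [hD, Mat.entry_mul, h₄, mul_assoc] using (hlim (ι' (Q A)) z₄).mul_const _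
    · simpa [hD, Mat.entry_mul, h₆] using hlim (ι' (Q A)) z₆
  have hnorm : ∀ᶠ u in apx (q A), ‖D u‖ ≤ 2 := by
    filter_upwards [apx_norm (q A)] with u hu
    have h1 := Mat.norm_single_le (0 : Fin 2) 0 (ι (Q A) (q.incl A u))
    have h2 := Mat.norm_single_le (1 : Fin 2) 1 (ι' (Q A) (q.incl A u))
    have h3 := NonUnitalStarAlgHom.norm_apply_le ((ι (Q A)).comp (q.incl A)) u
    have h4 := NonUnitalStarAlgHom.norm_apply_le ((ι' (Q A)).comp (q.incl A)) u
    rw [hD]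
    refine (norm_add_le _ _).trans ?_
    change ‖ι (Q A) (q.incl A u)‖ ≤ _ at h3
    change ‖ι' (Q A) (q.incl A u)‖ ≤ _ at h4
    linarith
  intro m hm
  refine Metric.tendsto_nhds.2 fun ε hε => ?_
  obtain ⟨m', hm', hd⟩ := Metric.mem_closure_iff.1 hm (ε / 4) (by positivity)
  have key : Tendsto (fun u => D u * m') (apx (q A)) (𝓝 m') := by
    change m' ∈ NonUnitalAlgebra.adjoin ℂ _ at hm'
    clear hd
    induction hm' using NonUnitalAlgebra.adjoin_induction with
    | mem x hx =>
      rcases hx with hx | hx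
      · exact hgen x hx
      · obtain ⟨⟨z₁, h₁⟩, ⟨z₂, z₃, h₂⟩, ⟨z₄, z₅, h₄⟩, ⟨z₆, h₆⟩⟩ := hx
        refine hgen x ⟨⟨star z₁, ?_⟩, ⟨star z₅, star z₄, ?_⟩, ⟨star z₃, star z₂, ?_⟩,
          ⟨star z₆, ?_⟩⟩
        · simp only [map_star, ← h₁, Mat.entry_star, star_star]
        · simp only [map_star, ← star_mul, ← h₄, Mat.entry_star, star_star]
        · simp only [map_star, ← star_mul, ← h₂, Mat.entry_star, star_star]
        · simp only [map_star, ← h₆, Mat.entry_star, star_star]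
    | add x y _ _ hx hy => simpa only [mul_add] using hx.add hy
    | zero => simp only [mul_zero]; exact tendsto_const_nhds
    | mul x y _ _ hx _ => simpa only [mul_assoc] using hx.mul_const y
    | smul c x _ hx => simpa only [mul_smul_comm] using hx.const_smul c
  filter_upwards [Metric.tendsto_nhds.1 key (ε / 4) (by positivity), hnorm] with u hu hu2
  have h1 : dist (D u * m) (D u * m') ≤ 2 * dist m m' := by
    rw [dist_eq_norm, dist_eq_norm, ← mul_sub]
    exact (norm_mul_le _ _).trans (mul_le_mul_of_nonneg_right hu2 (norm_nonneg _))
  have h2 := dist_triangle4 (D u * m) (D u * m') m' m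
  rw [dist_comm m' m] at h2
  linarith

end RAlgebra

/-! ### Lifting the flip -/

section SwapSums

open Filter Topology

variable {A : Type u} [NonUnitalCStarAlgebra A] (b e : ℕ → q A) (v : ℕ → Q (q A))

/-- The partial sums of `∑ₙ η(eₙ*) (1 - vₙ) η̄(eₙ)`, and their adjoints. -/
def swapSum (i k : Fin 2) (N : ℕ) : Q (q A) :=
  ∑ n ∈ Finset.range N,
    star (Q.inc (q A) i (e n)) * (Q.inc (q A) k (e n) - v n * Q.inc (q A) k (e n))

/-- The matrices `(0, s; s*, 0)` for the partial sums `s`. -/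
def swapElem (N : ℕ) : RAlg A :=
  ⟨Mat.single 0 1 (Q.map (q.incl A) (swapSum e v 0 1 N)) +
    Mat.single 1 0 (Q.map (q.incl A) (swapSum e v 1 0 N)), by
    have h : ∀ i k, Mat.single i k (Q.map (q.incl A) (swapSum e v i k N)) ∈ rSub A := by
      intro i k
      induction N with
      | zero => simp [swapSum, Mat.single_zero]
      | succ N ih =>
        have h1 : swapSum e v i k (N + 1) = swapSum e v i k N +
            (Q.inc (q A) i (star (e N)) * Q.inc (q A) k (e N) -
              Q.inc (q A) i (star (e N)) * (v N * Q.inc (q A) k (e N))) := by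
          rw [swapSum, Finset.sum_range_succ, mul_sub, map_star]
          rfl
        rw [h1, map_add, Mat.single_add, map_sub, Mat.single_sub]
        exact add_mem ih (sub_mem (single_inc_mul_inc_mem_rSub i k _ _)
          (single_mem_rSub i k _ _ _))
    exact add_mem (h 0 1) (h 1 0)⟩

lemma incl_swapElem (N : ℕ) : RAlg.incl A (swapElem e v N) =
    Mat.single 0 1 (Q.map (q.incl A) (swapSum e v 0 1 N)) +
      Mat.single 1 0 (Q.map (q.incl A) (swapSum e v 1 0 N)) := rfl

variable {b e v}

lemma star_swapSum (hv : ∀ n, star (v n) = v n) (i k : Fin 2) (N : ℕ) :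
    star (swapSum e v i k N) = swapSum e v k i N := by
  rw [swapSum, swapSum, star_sum]
  refine Finset.sum_congr rfl fun n _ => ?_
  rw [star_mul, star_sub, star_mul, hv, star_star, sub_mul, mul_sub, mul_assoc]

lemma star_swapElem (hv : ∀ n, star (v n) = v n) (N : ℕ) :
    star (swapElem e v N) = swapElem e v N := by
  refine RAlg.incl_injective ?_
  rw [map_star, incl_swapElem, star_add, Mat.star_single, Mat.star_single, ← map_star, ← map_star,
    star_swapSum hv, star_swapSum hv, add_comm]

lemma sum_Ico_star_mul_self (he : ∀ n, star (e n) * e n = b (n + 1) - b n) {M N : ℕ} (h : M ≤ N) :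
    ∑ n ∈ Finset.Ico M N, star (e n) * e n = b N - b M := by
  simp only [he]
  exact Finset.sum_Ico_sub b h

/-- Both square sums in the Cauchy-Schwarz inequality telescope to the image of `b N - b M`. With `M
= 0` this bounds the partial sums. -/
lemma norm_swapSum_sub_le (he : ∀ n, star (e n) * e n = b (n + 1) - b n) (hv : ∀ n, ‖v n‖ ≤ 1)
    {M N : ℕ} (h : M ≤ N) (i k : Fin 2) : ‖swapSum e v i k N - swapSum e v i k M‖ ≤
      2 * ‖b N - b M‖ := by
  have h1 : swapSum e v i k N - swapSum e v i k M = ∑ n ∈ Finset.Ico M N,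
      star (Q.inc (q A) i (e n)) * (Q.inc (q A) k (e n) - v n * Q.inc (q A) k (e n)) := by
    rw [swapSum, swapSum, Finset.sum_Ico_eq_sub _ h]
  have h2 : ∀ i, ‖∑ n ∈ Finset.Ico M N, star (Q.inc (q A) i (e n)) * Q.inc (q A) i (e n)‖ ≤
      ‖b N - b M‖ := fun i => by
    simp only [← map_star, ← map_mul, ← map_sum]
    rw [sum_Ico_star_mul_self he h]
    exact NonUnitalStarAlgHom.norm_apply_le _ _
  rw [h1]
  refine (norm_sum_star_mul_mul_le _ _ _ v hv).trans ?_
  have h3 := Real.mul_self_sqrt (norm_nonneg (b N - b M))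
  have h4 := mul_le_mul (Real.sqrt_le_sqrt (h2 i)) (Real.sqrt_le_sqrt (h2 k)) (Real.sqrt_nonneg _)
    (Real.sqrt_nonneg _)
  linarith

/-- The factor `z` turns the second square sum into `z* (b_N - b_M) z`, which tends to zero although
`b_N - b_M` does not. This yields strict convergence. -/
lemma norm_swapSum_sub_mul_le (he : ∀ n, star (e n) * e n = b (n + 1) - b n)
    (hv : ∀ n, ‖v n‖ ≤ 1) {M N : ℕ} (h : M ≤ N) (i k : Fin 2) (z : q A) :
    ‖(swapSum e v i k N - swapSum e v i k M) * Q.inc (q A) k z‖ ≤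
      2 * (√‖b N - b M‖ * √(‖z‖ * ‖b N * z - b M * z‖)) := by
  have h1 : (swapSum e v i k N - swapSum e v i k M) * Q.inc (q A) k z = ∑ n ∈ Finset.Ico M N,
      star (Q.inc (q A) i (e n)) *
        (Q.inc (q A) k (e n * z) - v n * Q.inc (q A) k (e n * z)) := by
    rw [swapSum, swapSum, ← Finset.sum_Ico_eq_sub _ h, Finset.sum_mul]
    refine Finset.sum_congr rfl fun n _ => ?_
    simp only [map_mul, mul_sub, sub_mul, mul_assoc]
  have h2 : ‖∑ n ∈ Finset.Ico M N, star (Q.inc (q A) i (e n)) * Q.inc (q A) i (e n)‖ ≤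
      ‖b N - b M‖ := by
    simp only [← map_star, ← map_mul, ← map_sum]
    rw [sum_Ico_star_mul_self he h]
    exact NonUnitalStarAlgHom.norm_apply_le _ _
  have h3 : ‖∑ n ∈ Finset.Ico M N, star (Q.inc (q A) k (e n * z)) * Q.inc (q A) k (e n * z)‖ ≤
      ‖z‖ * ‖b N * z - b M * z‖ := by
    simp only [← map_star, ← map_mul, ← map_sum]
    refine (NonUnitalStarAlgHom.norm_apply_le _ _).trans ?_
    have : ∑ n ∈ Finset.Ico M N, star (e n * z) * (e n * z) = star z * (b N * z - b M * z) := by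
      rw [← sub_mul, ← sum_Ico_star_mul_self he h, Finset.sum_mul, Finset.mul_sum]
      refine Finset.sum_congr rfl fun n _ => ?_
      simp only [star_mul, mul_assoc]
    rw [this]
    exact (norm_mul_le _ _).trans (by rw [norm_star])
  rw [h1]
  refine (norm_sum_star_mul_mul_le _ _ _ v hv).trans ?_
  gcongr

lemma norm_swapElem_le (hb0 : b 0 = 0) (hb : ∀ n, ‖b n‖ ≤ 1)
    (he : ∀ n, star (e n) * e n = b (n + 1) - b n) (hv : ∀ n, ‖v n‖ ≤ 1) (N : ℕ) :
    ‖swapElem e v N‖ ≤ 4 := by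
  have h : ∀ i k, ‖Mat.single i k (Q.map (q.incl A) (swapSum e v i k N))‖ ≤ 2 := fun i k => by
    refine (Mat.norm_single_le _ _ _).trans ((NonUnitalStarAlgHom.norm_apply_le _ _).trans ?_)
    have := norm_swapSum_sub_le he hv (Nat.zero_le N) i k
    rw [hb0, sub_zero, swapSum, swapSum, Finset.sum_range_zero, sub_zero] at this
    rw [swapSum]
    linarith [hb N]
  rw [← RAlg.norm_incl, incl_swapElem]
  refine (norm_add_le _ _).trans ?_
  linarith [h 0 1, h 1 0]

lemma cauchySeq_swapSum_mul (hb : ∀ n, ‖b n‖ ≤ 1) (he : ∀ n, star (e n) * e n = b (n + 1) - b n)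
    (hv : ∀ n, ‖v n‖ ≤ 1) {z : q A} (hz : Tendsto (fun n => b n * z) atTop (𝓝 z)) (i k : Fin 2) :
    CauchySeq fun N => swapSum e v i k N * Q.inc (q A) k z := by
  have key : ∀ M N, M ≤ N → dist (swapSum e v i k N * Q.inc (q A) k z)
      (swapSum e v i k M * Q.inc (q A) k z) ≤ 2 * (√2 * √(‖z‖ * dist (b N * z) (b M * z))) := by
    intro M N h
    rw [dist_eq_norm, dist_eq_norm, ← sub_mul]
    refine (norm_swapSum_sub_mul_le he hv h i k z).trans ?_
    gcongr
    linarith [norm_sub_le (b N) (b M), hb N, hb M]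
  have h0 := cauchySeq_iff_tendsto_dist_atTop_0.1 hz.cauchySeq
  refine cauchySeq_iff_tendsto_dist_atTop_0.2 (squeeze_zero (fun _ => dist_nonneg) (fun p => ?_)
    (g := fun p : ℕ × ℕ => 2 * (√2 * √(‖z‖ * dist (b p.1 * z) (b p.2 * z)))) ?_)
  · rcases le_total p.1 p.2 with h | h
    · rw [dist_comm, dist_comm (b p.1 * z)]
      exact key _ _ h
    · exact key _ _ h
  · have := ((Real.continuous_sqrt.tendsto _).comp (h0.const_mul ‖z‖)).const_mul (2 * √2)
    simp only [mul_zero, Real.sqrt_zero] at this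
    refine this.congr fun p => ?_
    rw [Function.comp_apply, mul_assoc]

/-- By boundedness the good `r` form a closed set, and `r` is the limit of its products with
diagonal elements `η(u) ⊕ η̄(u)`. On these, the estimate for a single entry applies. -/
lemma cauchySeq_swapElem_mul (hb0 : b 0 = 0) (hb : ∀ n, ‖b n‖ ≤ 1)
    (he : ∀ n, star (e n) * e n = b (n + 1) - b n) (hv : ∀ n, ‖v n‖ ≤ 1)
    (hlim : ∀ z, Tendsto (fun n => b n * z) atTop (𝓝 z)) (r : RAlg A) :
    CauchySeq fun N => swapElem e v N * r := by
  have hcl := isClosed_setOf_cauchySeq_mul (norm_swapElem_le hb0 hb he hv)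
  have hsingle : ∀ (i k : Fin 2) (z : q A), CauchySeq fun N => Mat.single i k (Q.map (q.incl A)
      (swapSum e v i k N * Q.inc (q A) k z)) := fun i k z => by
    refine UniformContinuous.comp_cauchySeq
      (f := fun w => Mat.single i k (Q.map (q.incl A) w)) ?_
      (cauchySeq_swapSum_mul hb he hv (hlim z) i k)
    refine (AddMonoidHomClass.lipschitz_of_bound (AddMonoidHom.mk'
      (fun w => Mat.single i k (Q.map (q.incl A) w)) fun x y => by
        rw [map_add, Mat.single_add]) 1 fun w => ?_).uniformContinuous
    rw [one_mul]
    exact (Mat.norm_single_le _ _ _).trans (NonUnitalStarAlgHom.norm_apply_le _ _)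
  have hiso : ∀ f : ℕ → RAlg A, CauchySeq (fun N => RAlg.incl A (f N)) → CauchySeq f := fun f hf =>
    (NonUnitalStarAlgHom.isometry (RAlg.incl A)
      RAlg.incl_injective).isUniformInducing.cauchy_map_iff.1 (by rwa [Filter.map_map])
  have h₀ : ∀ z, CauchySeq fun N => swapElem e v N * RAlg.corner₀ A z := fun z => by
    refine hiso _ (Eq.mp (congrArg CauchySeq (funext fun N => ?_)) (hsingle 1 0 z))
    rw [map_mul, map_mul, incl_swapElem, RAlg.incl_corner₀]
    refine Mat.ext fun i j => ?_
    fin_cases i <;> fin_cases j <;> simp [Mat.entry_mul]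
  have h₁ : ∀ z, CauchySeq fun N => swapElem e v N * RAlg.corner₁ A z := fun z => by
    refine hiso _ (Eq.mp (congrArg CauchySeq (funext fun N => ?_)) (hsingle 0 1 z))
    rw [map_mul, map_mul, incl_swapElem, RAlg.incl_corner₁]
    refine Mat.ext fun i j => ?_
    fin_cases i <;> fin_cases j <;> simp [Mat.entry_mul]
  refine hcl.mem_of_tendsto (RAlg.tendsto_apx r) (Eventually.of_forall fun u => ?_)
  have h2 := (h₀ u).add (h₁ u)
  have hmul : UniformContinuous fun x : RAlg A => x * r :=
    (AddMonoidHomClass.lipschitz_of_bound (AddMonoidHom.mulRight r) ‖r‖ fun x => by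
      rw [mul_comm]
      exact norm_mul_le x r).uniformContinuous
  refine Eq.mp (congrArg CauchySeq (funext fun N => ?_)) (hmul.comp_cauchySeq h2)
  change (_ + _) * r = _
  rw [← mul_add, mul_assoc]

/-- Folding identifies `η` with `η̄` and kills the cutoffs, so the sum of the `e_n* e_n` telescopes
to `b N`. -/
lemma fold_swapElem (hb0 : b 0 = 0) (he : ∀ n, star (e n) * e n = b (n + 1) - b n)
    (hv : ∀ n, fold (q A) (v n) = 0) (N : ℕ) : RAlg.fold A (swapElem e v N) =
      Mat.single 0 1 (q.incl A (b N)) + Mat.single 1 0 (q.incl A (b N)) := by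
  have h : ∀ i k, fold (q A) (swapSum e v i k N) = b N := fun i k => by
    have hf : ∀ i z, fold (q A) (Q.inc (q A) i z) = z := fun i z => by
      fin_cases i <;> simp [fold]
    have h1 := sum_Ico_star_mul_self he (Nat.zero_le N)
    rw [hb0, sub_zero, Nat.Ico_zero_eq_range] at h1
    rw [swapSum, map_sum, ← h1]
    refine Finset.sum_congr rfl fun n _ => ?_
    rw [map_mul, map_sub, map_mul, map_star, hf, hf, hv, zero_mul, sub_zero]
  rw [RAlg.fold, NonUnitalStarAlgHom.comp_apply, incl_swapElem, map_add, Mat.map_single,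
    Mat.map_single, fold_Q_map, fold_Q_map, h, h]

/-- In the quotient, a strict limit of the matrices `(0, s; s*, 0)` is the flip. -/
lemma entry_fold_of_tendsto (hb0 : b 0 = 0) (he : ∀ n, star (e n) * e n = b (n + 1) - b n)
    (hv : ∀ n, fold (q A) (v n) = 0) (hlim : ∀ z, Tendsto (fun n => b n * z) atTop (𝓝 z))
    {r s : RAlg A} (h : Tendsto (fun N => swapElem e v N * r) atTop (𝓝 s)) (i j : Fin 2) :
    (RAlg.fold A s).entry i j = (RAlg.fold A r).entry i.rev j := by
  have h1 : Tendsto (fun N => (RAlg.fold A (swapElem e v N * r)).entry i j) atTop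
      (𝓝 ((RAlg.fold A s).entry i j)) :=
    (((Mat.continuous_entry i j).comp (continuous_hom (RAlg.fold A))).tendsto s).comp h
  refine tendsto_nhds_unique h1 ?_
  obtain ⟨m, hm⟩ := RAlg.fold_mem r
  have h2 : ∀ N, (RAlg.fold A (swapElem e v N * r)).entry i j =
      q.incl A (b N * m.entry i.rev j) := fun N => by
    rw [map_mul, fold_swapElem hb0 he hv, ← hm, map_mul, Mat.entry_mul]
    fin_cases i <;> simp [Fin.rev]
  simp only [h2]
  rw [← hm]
  exact ((continuous_hom (q.incl A)).tendsto _).comp (hlim _)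

end SwapSums

/-! ### Commutators with the lifted flip -/

section SwapCommutators

open Filter Topology

variable {A : Type u} [NonUnitalCStarAlgebra A] {b e : ℕ → q A} {v : ℕ → Q (q A)}

/-- Multiplication of an element of the ideal `qA` by an element of `QA` from the right. -/
def q.rmul (z : q A) (w : Q A) : q A := ⟨q.incl A z * w, by
  rw [mem_qSub, map_mul, q.fold_incl, zero_mul]⟩

@[simp] lemma q.incl_rmul (z : q A) (w : Q A) : q.incl A (q.rmul z w) = q.incl A z * w := rfl

@[simp] lemma q.incl_lmul (w : Q A) (z : q A) : q.incl A (q.lmul w z) = w * q.incl A z := rfl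

lemma q.norm_incl (z : q A) : ‖q.incl A z‖ = ‖z‖ := rfl

/-- A quasicentral choice of the elements `vₙ ∈ q(qA)`. -/
lemma exists_swap_cutoff (Y : ℕ → Finset (q A)) : ∃ v : ℕ → Q (q A),
    (∀ n, star (v n) = v n) ∧ (∀ n, ‖v n‖ ≤ 1) ∧ (∀ n, fold (q A) (v n) = 0) ∧
      ∀ n, ∀ y ∈ Y n,
        ‖ι' (q A) y - ι (q A) y - v n * (ι' (q A) y - ι (q A) y)‖ ≤ (1 / 2) ^ n ∧
        ‖v n * ι (q A) y - ι (q A) y * v n‖ ≤ (1 / 2) ^ n := by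
  let _ := CStarAlgebra.spectralOrder (q (q A))
  let _ := CStarAlgebra.spectralOrderedRing (q (q A))
  classical
  have h : ∀ n, ∃ v : Q (q A), star v = v ∧ ‖v‖ ≤ 1 ∧ fold (q A) v = 0 ∧ ∀ y ∈ Y n,
      ‖ι' (q A) y - ι (q A) y - v * (ι' (q A) y - ι (q A) y)‖ ≤ (1 / 2) ^ n ∧
      ‖v * ι (q A) y - ι (q A) y * v‖ ≤ (1 / 2) ^ n := by
    intro n
    -- An element of `q(qA)` is asked to act almost as a unit on `η̄(y) - η(y)`, up to sign an
    -- element of that ideal, and to almost commute with `η(y)`.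
    obtain ⟨v, hv0, hv1, hv2, hv3⟩ := q.incl_isIdealEmbedding.exists_quasicentral
      (le_refl (0 : q (q A))) (by simp) ((Y n).image (ι (q A))) ((Y n).image dq)
      (ε := (1 / 2) ^ n) (by positivity)
    refine ⟨q.incl (q A) v, ?_, (NonUnitalStarAlgHom.norm_apply_le _ _).trans hv1.le,
      q.fold_incl v, fun y hy => ⟨?_, hv2 _ (Finset.mem_image_of_mem _ hy)⟩⟩
    · rw [← map_star, hv0.isSelfAdjoint.star_eq]
    · have h1 : ι' (q A) y - ι (q A) y - q.incl (q A) v * (ι' (q A) y - ι (q A) y) =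
          q.incl (q A) (v * dq y - dq y) := by
        rw [map_sub, map_mul, incl_dq, mul_sub, mul_sub]
        abel
      rw [h1]
      exact (NonUnitalStarAlgHom.norm_apply_le _ _).trans
        (hv3 _ (Finset.mem_image_of_mem _ hy))
  choose v hv using h
  exact ⟨v, fun n => (hv n).1, fun n => (hv n).2.1, fun n => (hv n).2.2.1,
    fun n => (hv n).2.2.2⟩

/-- The terms of the commutator of the partial sums with `x ∈ QA`. -/
def swapComm (e : q A) (v : Q (q A)) (x : Q A) : Q (q A) :=
  ι (q A) (star e) * (ι' (q A) (q.rmul e x) - v * ι' (q A) (q.rmul e x)) -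
    ι (q A) (q.lmul x (star e)) * (ι' (q A) e - v * ι' (q A) e)

/-- The cutoff allows `η̄` to be replaced by `η`: `(1 - v) η̄(y) = η(y)(1 - v) + ρ(y)` with `‖ρ(y)‖
≤ 2δ`. The main part is then `η(e* e x - x e* e)(1 - v)`, of norm at most `2δ`; the two remainders
contribute `4δ` and `4‖x‖δ`. -/
lemma norm_swapComm_le {e : q A} {v : Q (q A)} {x : Q A} {δ : ℝ} (he : ‖e‖ ≤ 2) (hv : ‖v‖ ≤ 1)
    (h : ∀ y, y = e ∨ y = q.rmul e x →
      ‖ι' (q A) y - ι (q A) y - v * (ι' (q A) y - ι (q A) y)‖ ≤ δ ∧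
      ‖v * ι (q A) y - ι (q A) y * v‖ ≤ δ)
    (hx : ‖q.incl A (star e * e) * x - x * q.incl A (star e * e)‖ ≤ δ) :
    ‖swapComm e v x‖ ≤ (6 + 4 * ‖x‖) * δ := by
  let ρ : q A → Q (q A) := fun y => ι' (q A) y - ι (q A) y - v * (ι' (q A) y - ι (q A) y) -
    (v * ι (q A) y - ι (q A) y * v)
  have hρ : ∀ y, y = e ∨ y = q.rmul e x → ‖ρ y‖ ≤ 2 * δ := fun y hy =>
    (norm_sub_le _ _).trans (by linarith [(h y hy).1, (h y hy).2])
  have hdec : ∀ y, ι' (q A) y - v * ι' (q A) y = ι (q A) y - ι (q A) y * v + ρ y := fun y => by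
    simp only [ρ, mul_sub]
    abel
  let g : q A := star e * q.rmul e x - q.lmul x (star e) * e
  have hg : ‖g‖ ≤ δ := by
    rw [← q.norm_incl]
    have : q.incl A g = q.incl A (star e * e) * x - x * q.incl A (star e * e) := by
      simp only [g, map_sub, map_mul, q.incl_rmul, q.incl_lmul, mul_assoc]
    rw [this]
    exact hx
  have hc : swapComm e v x = ι (q A) g - ι (q A) g * v + ι (q A) (star e) * ρ (q.rmul e x) -
      ι (q A) (q.lmul x (star e)) * ρ e := by
    rw [swapComm, hdec, hdec]
    simp only [g, map_sub, map_mul, mul_add, mul_sub, sub_mul, mul_assoc]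
    abel
  have hι : ∀ y, ‖ι (q A) y‖ ≤ ‖y‖ := NonUnitalStarAlgHom.norm_apply_le _
  have hδ : 0 ≤ δ := (norm_nonneg _).trans hg
  have h1 : ‖ι (q A) g * v‖ ≤ δ := (norm_mul_le _ _).trans (by
    nlinarith [hι g, norm_nonneg (ι (q A) g), norm_nonneg v])
  have h2 : ‖ι (q A) (star e) * ρ (q.rmul e x)‖ ≤ 2 * (2 * δ) :=
    (norm_mul_le _ _).trans (mul_le_mul ((hι _).trans (by rwa [norm_star])) (hρ _ (Or.inr rfl))
      (norm_nonneg _) (by norm_num))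
  have h3 : ‖ι (q A) (q.lmul x (star e)) * ρ e‖ ≤ ‖x‖ * 2 * (2 * δ) := by
    refine (norm_mul_le _ _).trans (mul_le_mul ((hι _).trans ?_) (hρ _ (Or.inl rfl))
      (norm_nonneg _) (by positivity))
    rw [← q.norm_incl, q.incl_lmul]
    refine (norm_mul_le _ _).trans ?_
    rw [q.norm_incl, norm_star]
    gcongr
  rw [hc]
  have h4 := norm_sub_le (ι (q A) g - ι (q A) g * v + ι (q A) (star e) * ρ (q.rmul e x))
    (ι (q A) (q.lmul x (star e)) * ρ e)
  have h5 := norm_add_le (ι (q A) g - ι (q A) g * v) (ι (q A) (star e) * ρ (q.rmul e x))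
  have h6 := norm_sub_le (ι (q A) g) (ι (q A) g * v)
  linarith [hι g]

/-- The commutator of a partial sum with `η(x) ⊕ η̄(x)`. -/
lemma swapSum_comm (x : Q A) (N : ℕ) :
    Q.map (q.incl A) (swapSum e v 0 1 N) * ι' (Q A) x -
      ι (Q A) x * Q.map (q.incl A) (swapSum e v 0 1 N) =
        Q.map (q.incl A) (∑ n ∈ Finset.range N, swapComm (e n) (v n) x) := by
  rw [swapSum, map_sum, map_sum, Finset.sum_mul, Finset.mul_sum, ← Finset.sum_sub_distrib]
  refine Finset.sum_congr rfl fun n _ => ?_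
  simp only [swapComm, Q.inc_zero, Q.inc_one, map_sub, map_mul, Q.map_ι, Q.map_ι', map_star,
    q.incl_rmul, q.incl_lmul]
  simp only [mul_sub, sub_mul, mul_assoc]

/-- If the commutator terms are summable and the sequence `bₙ` is quasicentral, then the strict limit
of the partial sums commutes with `η(x) ⊕ η̄(x)` modulo `J`. -/
lemma exists_commutator_of_summable (hb0 : b 0 = 0)
    (he : ∀ n, star (e n) * e n = b (n + 1) - b n) (hvs : ∀ n, star (v n) = v n)
    (hv : ∀ n, fold (q A) (v n) = 0) {S : 𝓜(ℂ, RAlg A)}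
    (hS : ∀ r, Tendsto (fun N => swapElem e v N * r) atTop (𝓝 (S.fst r))) (x : A)
    (hx : Summable fun n => swapComm (e n) (v n) (ι A x))
    (hx' : Summable fun n => swapComm (e n) (v n) (ι A (star x)))
    (hbx : Tendsto (fun n => q.incl A (b n) * ι A x - ι A x * q.incl A (b n)) atTop (𝓝 0)) :
    ∃ r : RAlg A, InJ A r ∧ S * diagM (ι A) (ι A) x - diagM (ι A) (ι A) x * S = coeM (RAlg A) r := by
  let d := diagM (ι A) (ι A) x
  have hC : ∀ N, ∃ c : RAlg A, coeM (RAlg A) c =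
      coeM (RAlg A) (swapElem e v N) * d - d * coeM (RAlg A) (swapElem e v N) := fun N => by
    obtain ⟨c, hc⟩ := coeM_isIdealEmbedding.mul_mem' (swapElem e v N) d
    obtain ⟨c', hc'⟩ := coeM_isIdealEmbedding.mul_mem d (swapElem e v N)
    exact ⟨c - c', by rw [map_sub, hc, hc']⟩
  choose c hc using hC
  have hcr : ∀ N r, c N * r = swapElem e v N * d.fst r - d.fst (swapElem e v N * r) := fun N r =>
    DFunLike.congr_fun (congrArg (fun m : 𝓜(ℂ, RAlg A) => m.fst) (hc N)) r
  have hD : diagHom (ι A) (ι A) x =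
      Mat.single 0 0 (ι (Q A) (ι A x)) + Mat.single 1 1 (ι' (Q A) (ι A x)) :=
    Mat.ext fun i j => by fin_cases i <;> fin_cases j <;> simp [diagHom, entry_dsum]
  -- The commutator is given as a multiplier of `R`. It is identified with the commutator of
  -- matrices by multiplying the difference, which lies in `R`, with its own adjoint.
  have hincl : ∀ N, RAlg.incl A (c N) =
      RAlg.incl A (swapElem e v N) * diagHom (ι A) (ι A) x -
        diagHom (ι A) (ι A) x * RAlg.incl A (swapElem e v N) := fun N => by
    have h1 : ∀ r, (RAlg.incl A (c N) - (RAlg.incl A (swapElem e v N) * diagHom (ι A) (ι A) x -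
        diagHom (ι A) (ι A) x * RAlg.incl A (swapElem e v N))) * RAlg.incl A r = 0 := fun r => by
      have h2 := congrArg (RAlg.incl A) (hcr N r)
      rw [map_sub, map_mul, map_mul] at h2
      change _ = _ * (diagHom (ι A) (ι A) x * RAlg.incl A r) -
        diagHom (ι A) (ι A) x * RAlg.incl A (swapElem e v N * r) at h2
      rw [map_mul] at h2
      rw [sub_mul, h2, sub_mul, mul_assoc, mul_assoc, sub_self]
    let y : RAlg A := ⟨RAlg.incl A (swapElem e v N) * diagHom (ι A) (ι A) x -
      diagHom (ι A) (ι A) x * RAlg.incl A (swapElem e v N),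
      sub_mem (mul_diagHom_mem _ _ _ (swapElem e v N).2) (diagHom_mul_mem _ _ _ (swapElem e v N).2)⟩
    have h3 := h1 (star (c N - y))
    have h4 : RAlg.incl A (c N) - (RAlg.incl A (swapElem e v N) * diagHom (ι A) (ι A) x -
        diagHom (ι A) (ι A) x * RAlg.incl A (swapElem e v N)) = RAlg.incl A (c N - y) := rfl
    rw [h4, map_star, CStarRing.mul_star_self_eq_zero_iff] at h3
    rw [← sub_eq_zero, h4, h3]
  -- The lower left entry of the commutator with `x` is minus the adjoint of the upper right entry
  -- of the one with `x*`. This is why summability is needed for both.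
  obtain ⟨s, hs⟩ := hx
  obtain ⟨s', hs'⟩ := hx'
  let m : Mat 2 (Q (Q A)) := Mat.single 0 1 (Q.map (q.incl A) s) -
    Mat.single 1 0 (star (Q.map (q.incl A) s'))
  have hm : Tendsto (fun N => RAlg.incl A (c N)) atTop (𝓝 m) := by
    have h1 : ∀ N, RAlg.incl A (c N) =
        Mat.single 0 1 (Q.map (q.incl A) (∑ n ∈ Finset.range N, swapComm (e n) (v n) (ι A x))) -
        Mat.single 1 0 (star (Q.map (q.incl A)
          (∑ n ∈ Finset.range N, swapComm (e n) (v n) (ι A (star x))))) := fun N => by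
      rw [hincl, ← swapSum_comm, ← swapSum_comm, incl_swapElem, hD, star_sub, star_mul, star_mul,
        ← map_star (Q.map (q.incl A)), star_swapSum hvs, ← map_star (ι' (Q A)),
        ← map_star (ι (Q A)), ← map_star (ι A), star_star]
      refine Mat.ext fun i j => ?_
      fin_cases i <;> fin_cases j <;> simp [Mat.entry_mul]
    simp only [h1]
    refine (((Mat.continuous_single 0 1).tendsto _).comp
      (((continuous_hom _).tendsto _).comp hs.tendsto_sum_nat)).sub
      (((Mat.continuous_single 1 0).tendsto _).comp ((continuous_star.tendsto _).comp
      (((continuous_hom _).tendsto _).comp hs'.tendsto_sum_nat)))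
  have hmem : m ∈ rSub A := isClosed_rSub.mem_of_tendsto hm (Eventually.of_forall fun N => (c N).2)
  let r₀ : RAlg A := ⟨m, hmem⟩
  have hr₀ : Tendsto c atTop (𝓝 r₀) := tendsto_subtype_rng.2 hm
  refine ⟨r₀, inJ_iff.2 (tendsto_nhds_unique
    (((continuous_hom (RAlg.fold A)).tendsto _).comp hr₀) ?_), multiplier_ext fun r => ?_⟩
  -- The norm limit of the commutators lies in `J`: their images in the quotient are commutators of
  -- `b N` with `ε(x)`, which tend to zero.
  · have h1 : ∀ N, RAlg.fold A (c N) =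
        Mat.single 0 1 (q.incl A (b N) * ι A x - ι A x * q.incl A (b N)) +
          Mat.single 1 0 (q.incl A (b N) * ι A x - ι A x * q.incl A (b N)) := fun N => by
      have h2 : RAlg.fold A (c N) = RAlg.fold A (swapElem e v N) *
          Mat.map 2 (fold (Q A)) (diagHom (ι A) (ι A) x) -
            Mat.map 2 (fold (Q A)) (diagHom (ι A) (ι A) x) * RAlg.fold A (swapElem e v N) := by
        rw [RAlg.fold, NonUnitalStarAlgHom.comp_apply, hincl, map_sub, map_mul, map_mul]
        rfl
      rw [h2, fold_swapElem hb0 he hv, hD]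
      refine Mat.ext fun i j => ?_
      fin_cases i <;> fin_cases j <;> simp [Mat.entry_mul, fold]
    have h3 := (((Mat.continuous_single (n := 2) 0 1).tendsto (0 : Q A)).comp hbx).add
      (((Mat.continuous_single (n := 2) 1 0).tendsto (0 : Q A)).comp hbx)
    rw [Mat.single_zero, Mat.single_zero, add_zero] at h3
    exact h3.congr fun N => (h1 N).symm
  · refine tendsto_nhds_unique (f := fun N => c N * r) ?_ (hr₀.mul_const r)
    simp only [hcr]
    exact (hS (d.fst r)).sub ((d.fst.continuous.tendsto _).comp (hS r))

end SwapCommutators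

/-! ### Existence of the lifted flip -/

section ExistsSwapLift

open Filter Topology

variable {A : Type u} [NonUnitalCStarAlgebra A]

lemma isClosed_coeM_image_inJ : IsClosed (coeM (RAlg A) '' {r | InJ A r}) := by
  refine (NonUnitalStarAlgHom.isometry (coeM (RAlg A))
    coeM_isIdealEmbedding.injective).isClosedEmbedding.isClosedMap _ ?_
  simp only [inJ_iff]
  exact isClosed_eq (continuous_hom _) continuous_const

lemma norm_commutator_star (w x : Q A) (hw : star w = w) :
    ‖w * star x - star x * w‖ = ‖w * x - x * w‖ := by
  have h : w * star x - star x * w = -star (w * x - x * w) := by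
    rw [star_sub, star_mul, star_mul, hw, neg_sub]
  rw [h, norm_neg, norm_star]

/-- Separability of `A` lets one sequence handle a dense set of `x`: the term number `n` takes care
of the first `n` points, and the admissible `x` form a closed set. -/
theorem exists_isSwapLift (A : Type u) [NonUnitalCStarAlgebra A]
    [TopologicalSpace.SeparableSpace A] : ∃ S : 𝓜(ℂ, RAlg A), IsSwapLift S := by
  classical
  let x := TopologicalSpace.denseSeq A
  obtain ⟨b, e, hb0, hbs, hb, he, hbx, hlim⟩ :=
    q.exists_quasicentral_sequence (TopologicalSpace.denseRange_denseSeq A)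
  -- These are the elements `y` at which `norm_swapComm_le` evaluates the cutoff, for `x k` and its
  -- adjoint with `k < n`.
  obtain ⟨v, hvs, hv, hvf, hvY⟩ := exists_swap_cutoff fun n => {e n} ∪
    ((Finset.range n).image (fun k => q.rmul (e n) (ι A (x k))) ∪
      (Finset.range n).image (fun k => q.rmul (e n) (ι A (star (x k)))))
  obtain ⟨S, hSa, hS⟩ := exists_multiplier_of_cauchySeq (star_swapElem hvs)
    (norm_swapElem_le hb0 hb he hv) (cauchySeq_swapElem_mul hb0 hb he hv hlim)
  have hen : ∀ n, ‖e n‖ ≤ 2 := fun n => by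
    have h1 : ‖star (e n) * e n‖ ≤ 2 := by
      rw [he]
      linarith [norm_sub_le (b (n + 1)) (b n), hb n, hb (n + 1)]
    rw [CStarRing.norm_star_mul_self] at h1
    nlinarith [norm_nonneg (e n)]
  have hcomm : ∀ n, ∀ k < n, ‖q.incl A (star (e n) * e n) * ι A (x k) -
      ι A (x k) * q.incl A (star (e n) * e n)‖ ≤ 2 * (1 / 2) ^ n := fun n k hk => by
    have h1 : q.incl A (star (e n) * e n) * ι A (x k) - ι A (x k) * q.incl A (star (e n) * e n) =
        (q.incl A (b (n + 1)) * ι A (x k) - ι A (x k) * q.incl A (b (n + 1))) -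
          (q.incl A (b n) * ι A (x k) - ι A (x k) * q.incl A (b n)) := by
      rw [he, map_sub, sub_mul, mul_sub]
      abel
    have h2 := hbx (n + 1) k (by omega)
    rw [h1]
    refine (norm_sub_le _ _).trans ?_
    have h3 : (0 : ℝ) < (1 / 2) ^ n := by positivity
    rw [pow_succ] at h2
    linarith [hbx n k hk]
  -- For `n > k` the commutator estimate applies with `δ = 2 · 2^{-n}`, so a geometric series
  -- dominates.
  have hsum : ∀ (k : ℕ) (y : Q A), (∀ n > k, q.rmul (e n) y ∈ ({e n} ∪
      ((Finset.range n).image (fun k => q.rmul (e n) (ι A (x k))) ∪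
        (Finset.range n).image (fun k => q.rmul (e n) (ι A (star (x k))))) : Finset (q A))) →
      (∀ n > k, ‖q.incl A (star (e n) * e n) * y - y * q.incl A (star (e n) * e n)‖ ≤
        2 * (1 / 2) ^ n) → Summable fun n => swapComm (e n) (v n) y := by
    intro k y h1 h2
    refine Summable.of_norm_bounded_eventually_nat
      (g := fun n => (6 + 4 * ‖y‖) * (2 * (1 / 2) ^ n))
      ((summable_geometric_two.mul_left 2).mul_left _) ?_
    filter_upwards [eventually_gt_atTop k] with n hn
    refine norm_swapComm_le (hen n) (hv n) (fun z hz => ?_) (h2 n hn)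
    have h3 : (0 : ℝ) < (1 / 2) ^ n := by positivity
    rcases hz with rfl | rfl
    · have := hvY n (e n) (Finset.mem_union_left _ (Finset.mem_singleton_self _))
      exact ⟨by linarith [this.1], by linarith [this.2]⟩
    · have := hvY n _ (h1 n hn)
      exact ⟨by linarith [this.1], by linarith [this.2]⟩
  refine ⟨S, hSa, fun r i j => ?_, fun y => ?_⟩
  · obtain ⟨m, hm⟩ := RAlg.exists_map (S.fst r)
    obtain ⟨m', hm'⟩ := RAlg.exists_map r
    have h1 := entry_fold_of_tendsto hb0 he hvf hlim (hS r) i j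
    change fold (Q A) ((RAlg.incl A (S.fst r)).entry i j) =
      fold (Q A) ((RAlg.incl A r).entry i.rev j) at h1
    rw [← hm, ← hm', ← sub_eq_zero, ← map_sub] at h1
    rw [← hm, ← hm']
    change ∃ z, Q.map (q.incl A) (m.entry i j) - Q.map (q.incl A) (m'.entry i.rev j) = _
    rw [← map_sub]
    refine exists_q2incl_of_fold ?_
    rw [map_sub]
    exact h1
  · have hcl : IsClosed {y | S * diagM (ι A) (ι A) y - diagM (ι A) (ι A) y * S ∈
        coeM (RAlg A) '' {r | InJ A r}} := isClosed_coeM_image_inJ.preimage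
      ((continuous_const.mul (continuous_hom _)).sub ((continuous_hom _).mul continuous_const))
    have hmem : ∀ y, y ∈ {y | S * diagM (ι A) (ι A) y - diagM (ι A) (ι A) y * S ∈
        coeM (RAlg A) '' {r | InJ A r}} := fun y => by
      refine closure_minimal ?_ hcl (TopologicalSpace.denseRange_denseSeq A y)
      rintro _ ⟨k, rfl⟩
      obtain ⟨r, hr, hr'⟩ := exists_commutator_of_summable hb0 he hvs hvf hS (x k)
        (hsum k _ (fun n hn => Finset.mem_union_right _ (Finset.mem_union_left _
          (Finset.mem_image.2 ⟨k, Finset.mem_range.2 hn, rfl⟩))) fun n hn => hcomm n k hn)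
        (hsum k _ (fun n hn => Finset.mem_union_right _ (Finset.mem_union_right _
          (Finset.mem_image.2 ⟨k, Finset.mem_range.2 hn, rfl⟩))) fun n hn => by
            rw [map_star, norm_commutator_star _ _ (by rw [← map_star, star_mul, star_star])]
            exact hcomm n k hn)
        (squeeze_zero_norm' (by
          filter_upwards [eventually_gt_atTop k] with n hn using hbx n k hn)
          (tendsto_pow_atTop_nhds_zero_of_lt_one (r := (1 / 2 : ℝ)) (by norm_num) (by norm_num)))
      exact ⟨r, hr, hr'.symm⟩
    obtain ⟨r, hr, hr'⟩ := hmem y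
    exact ⟨r, hr, hr'.symm⟩

end ExistsSwapLift

/-! ### Existence of universal maps -/

section ExistsUniversalMap

open Filter Topology

variable {A : Type u} [NonUnitalCStarAlgebra A]

variable (A) in
/-- The ideal `J` as a C*-subalgebra of `R`. -/
def jSub : NonUnitalStarSubalgebra ℂ (RAlg A) := NonUnitalStarAlgHom.equalizer (RAlg.fold A) 0

instance : IsClosed (jSub A : Set (RAlg A)) := isClosed_eq (continuous_hom _) (continuous_hom _)

variable (A) in
/-- The inclusion `J ⊆ ℳ(R)`. -/
def jIncl : jSub A →⋆ₙₐ[ℂ] 𝓜(ℂ, RAlg A) :=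
  (coeM (RAlg A)).comp (NonUnitalStarSubalgebraClass.subtype (jSub A))

lemma jIncl_isIdealEmbedding : IsIdealEmbedding (jIncl A) where
  injective := coeM_isIdealEmbedding.injective.comp Subtype.val_injective
  mul_mem m r := ⟨⟨m.fst r.1, map_fst_eq_zero (RAlg.fold A) m r.2⟩, (mul_coeM m r.1).symm⟩

/-- By the Leibniz rule all powers of `s` commute with `d` modulo the ideal, and the ideal is
closed. -/
lemma IsIdealEmbedding.commutator_exp_mem {J E : Type u} [NonUnitalCStarAlgebra J] [CStarAlgebra E]
    {j : J →⋆ₙₐ[ℂ] E} (hj : IsIdealEmbedding j) {s d : E} (h : ∃ r, j r = s * d - d * s) :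
    ∃ r, j r = NormedSpace.exp s * d - d * NormedSpace.exp s := by
  have hpow : ∀ n : ℕ, ∃ r, j r = s ^ n * d - d * s ^ n := fun n => by
    induction n with
    | zero => exact ⟨0, by simp⟩
    | succ n ih =>
      obtain ⟨r, hr⟩ := ih
      obtain ⟨t, ht⟩ := h
      obtain ⟨r', hr'⟩ := hj.mul_mem s r
      obtain ⟨t', ht'⟩ := hj.mul_mem' t (s ^ n)
      refine ⟨r' + t', ?_⟩
      rw [map_add, hr', ht', hr, ht, pow_succ']
      simp only [mul_sub, sub_mul, mul_assoc]
      abel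
  have h1 := NormedSpace.exp_series_hasSum_exp' (𝕂 := ℂ) s
  have h2 := (h1.mul_right d).sub (h1.mul_left d)
  refine (isClosed_range_of_injective j hj.injective).mem_of_tendsto h2
    (Eventually.of_forall fun t => ?_)
  choose r hr using hpow
  refine ⟨∑ n ∈ t, (n.factorial : ℂ)⁻¹ • r n, ?_⟩
  rw [map_sum]
  refine Finset.sum_congr rfl fun n _ => ?_
  rw [map_smul, hr, smul_sub, ← smul_mul_assoc, ← mul_smul_comm]

lemma IsSwapLift.entry_fold {S : 𝓜(ℂ, RAlg A)} (hS : IsSwapLift S) (r : RAlg A) (i j : Fin 2) :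
    (RAlg.fold A (S.fst r)).entry i j = (RAlg.fold A r).entry i.rev j := by
  obtain ⟨z, hz⟩ := hS.lifts r i j
  rw [← sub_eq_zero]
  change fold (Q A) ((RAlg.incl A (S.fst r)).entry i j) -
    fold (Q A) ((RAlg.incl A r).entry i.rev j) = 0
  rw [← map_sub, hz, fold_q2incl]

/-- Both legs of the universal pair are compared with `ηε(x) ⊕ η̄ε(x)`, the multiplier that commutes
with `S` modulo `J`. The corrections lie in `R`, in opposite corners. -/
lemma diagM_eq_sub (x : A) : diagM (ι A) (ι' A) x =
      diagM (ι A) (ι A) x - coeM (RAlg A) (RAlg.corner₁ A (dq x)) ∧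
    diagM (ι' A) (ι A) x =
      diagM (ι A) (ι A) x - coeM (RAlg A) (RAlg.corner₀ A (dq x)) := by
  constructor <;> refine multiplier_ext fun r => RAlg.incl_injective ?_
  · change diagHom (ι A) (ι' A) x * RAlg.incl A r = diagHom (ι A) (ι A) x * RAlg.incl A r -
      Mat.corner 1 (ι' (Q A) (q.incl A (dq x))) * RAlg.incl A r
    rw [← sub_mul]
    congr 1
    refine Mat.ext fun i j => ?_
    fin_cases i <;> fin_cases j <;> simp [diagHom, entry_dsum]
  · change diagHom (ι' A) (ι A) x * RAlg.incl A r = diagHom (ι A) (ι A) x * RAlg.incl A r -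
      Mat.corner 0 (ι (Q A) (q.incl A (dq x))) * RAlg.incl A r
    rw [← sub_mul]
    congr 1
    refine Mat.ext fun i j => ?_
    fin_cases i <;> fin_cases j <;> simp [diagHom, entry_dsum]

lemma IsSwapLift.fold_adX_corner₀ {S : 𝓜(ℂ, RAlg A)} (hS : IsSwapLift S) (z : q A) :
    RAlg.fold A (adX (expF hS.isSelfAdjoint) (RAlg.corner₀ A z)) =
      RAlg.fold A (RAlg.corner₁ A z) := by
  have hpath : expPath hS.isSelfAdjoint 1 = expF hS.isSelfAdjoint := by
    rw [expPath, expF]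
    congr 2
    simp
  have hrot : ∀ (t : ℂ) (ht : t * star t = 1), t = -1 → ∀ (a : Mat 2 (Q A)) i k,
      (Mat.rot t ht a).entry i k = a.entry i.rev k.rev := by
    rintro t ht rfl a i k
    exact Mat.entry_rot_neg_one _ _ _ _
  rw [← hpath, map_adX_expPath hS.isSelfAdjoint (RAlg.fold A) hS.entry_fold 1
    (star_circ_mul_star 1)]
  refine Mat.ext fun i k => ?_
  rw [hrot _ _ (by rw [circ_one, star_neg, star_one])]
  have h₀ : ∀ i k, (RAlg.fold A (RAlg.corner₀ A z)).entry i k =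
      fold (Q A) ((Mat.corner 0 (ι (Q A) (q.incl A z))).entry i k) := fun _ _ => rfl
  have h₁ : ∀ i k, (RAlg.fold A (RAlg.corner₁ A z)).entry i k =
      fold (Q A) ((Mat.corner 1 (ι' (Q A) (q.incl A z))).entry i k) := fun _ _ => rfl
  rw [h₀, h₁]
  fin_cases i <;> fin_cases k <;> simp [fold, Fin.rev]

/-- With `d = ηε(x) ⊕ η̄ε(x)` and corner elements `c₀`, `c₁`, the difference is `(d - σ(d)) + (σ(c₀)
- c₁)`. The first term is in `J` since `exp(πi/2 · S)` commutes with `d` modulo `J`; the second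
since in the quotient `σ` exchanges the two corners. -/
lemma IsSwapLift.diagM_sub_sigma_mem {S : 𝓜(ℂ, RAlg A)} (hS : IsSwapLift S) (x : A) :
    ∃ r, jIncl A r =
      diagM (ι A) (ι' A) x - (sigma hS.isSelfAdjoint).comp (diagM (ι' A) (ι A)) x := by
  have hj := jIncl_isIdealEmbedding (A := A)
  obtain ⟨r, hr, hr'⟩ := hS.commutes x
  let d := diagM (ι A) (ι A) x
  let F : 𝓜(ℂ, RAlg A) := expF hS.isSelfAdjoint
  let c : ℂ := Real.pi / 2 * Complex.I
  have hF : F = NormedSpace.exp (c • S) := by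
    simp only [F]
    rw [expF, selfAdjoint.expUnitary_coe]
    congr 1
    change Complex.I • ((Real.pi / 2 : ℝ) • S) = c • S
    rw [← Complex.coe_smul, smul_smul]
    congr 1
    simp only [c]
    push_cast
    ring
  obtain ⟨t, ht⟩ : ∃ t, jIncl A t = F * d - d * F := by
    rw [hF]
    refine hj.commutator_exp_mem ⟨c • ⟨r, inJ_iff.1 hr⟩, ?_⟩
    rw [map_smul, smul_mul_assoc, mul_smul_comm, ← smul_sub]
    exact congrArg (c • ·) hr'.symm
  obtain ⟨t', ht'⟩ := hj.mul_mem' t (star F)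
  have hFF : F * star F = 1 := Unitary.coe_mul_star_self _
  let z : q A := dq x
  let y : RAlg A := adX (expF hS.isSelfAdjoint) (RAlg.corner₀ A z) - RAlg.corner₁ A z
  have hy : RAlg.fold A y = 0 := by rw [map_sub, hS.fold_adX_corner₀, sub_self]
  refine ⟨⟨y, hy⟩ - t', ?_⟩
  have h1 : jIncl A ⟨y, hy⟩ = F * coeM (RAlg A) (RAlg.corner₀ A z) * star F -
      coeM (RAlg A) (RAlg.corner₁ A z) := by
    rw [← coeM_adX]
    exact map_sub (coeM (RAlg A)) _ _
  have h2 : (sigma hS.isSelfAdjoint).comp (diagM (ι' A) (ι A)) x =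
      F * (d - coeM (RAlg A) (RAlg.corner₀ A z)) * star F := by
    rw [NonUnitalStarAlgHom.comp_apply, (diagM_eq_sub x).2]
    rfl
  have h3 : d * F * star F = d := by rw [mul_assoc, hFF, mul_one]
  rw [map_sub, h1, ht', ht, h2, (diagM_eq_sub x).1, sub_mul (F * d), h3, mul_sub, sub_mul]
  simp only [d, z]
  abel

lemma q2incl_injective : Function.Injective (q2incl A) :=
  Q_map_incl_injective.comp q.incl_injective

/-- Universal maps exist for separable C*-algebras. -/
theorem exists_isUniversalMap (A : Type u) [NonUnitalCStarAlgebra A]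
    [TopologicalSpace.SeparableSpace A] :
    ∃ φ : q A →⋆ₙₐ[ℂ] Mat 2 (q (q A)), IsUniversalMap φ := by
  obtain ⟨S, hS⟩ := exists_isSwapLift A
  let ψ : q A →⋆ₙₐ[ℂ] jSub A := qHom (jIncl A) jIncl_isIdealEmbedding _ _ hS.diagM_sub_sigma_mem
  let ψ' : q A →⋆ₙₐ[ℂ] Mat 2 (Q (Q A)) :=
    ((RAlg.incl A).comp (NonUnitalStarSubalgebraClass.subtype (jSub A))).comp ψ
  have hinj : Function.Injective (Mat.map 2 (q2incl A)) := Mat.map_injective q2incl_injective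
  -- Entries of elements of `J` come from `q²A`. Since `q²A → Q²A` is injective, the lifts are
  -- unique and form a homomorphism.
  have hψ : ∀ z, ∃ m, Mat.map 2 (q2incl A) m = ψ' z := fun z => by
    choose w hw using inJ_iff.2 (ψ z).2
    exact ⟨Mat.of w, Mat.ext fun i j => (hw i j).symm⟩
  refine ⟨factor _ hinj ψ' hψ, S, hS, fun z => ⟨(ψ z).1, ?_, ?_⟩⟩
  · exact (qHom_spec (jIncl A) jIncl_isIdealEmbedding _ _ hS.diagM_sub_sigma_mem z).symm
  · exact (factor_spec _ hinj ψ' hψ z).symm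

end ExistsUniversalMap

end CuntzKK

end

/-! ### The main theorem -/

theorem corollary3p10 {A B C : Type u} [NonUnitalCStarAlgebra A] [NonUnitalCStarAlgebra B]
    [NonUnitalCStarAlgebra C] [TopologicalSpace.SeparableSpace A]
    (α : CuntzKK.q A →⋆ₙₐ[ℂ] CuntzKK.K B) :
    -- the universal map exists
    (∃ φ : CuntzKK.q A →⋆ₙₐ[ℂ] CuntzKK.Mat 2 (CuntzKK.q (CuntzKK.q A)),
      CuntzKK.IsUniversalMap φ) ∧
    -- the formula for `β : qB₀ → 𝒦 ⊗ C`
    (∀ (β : CuntzKK.q (CuntzKK.Her α) →⋆ₙₐ[ℂ] CuntzKK.K C)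
        (β' : CuntzKK.q (CuntzKK.Ext α) →⋆ₙₐ[ℂ] CuntzKK.K C),
      CuntzKK.Homotopic (β'.comp (CuntzKK.q.map (CuntzKK.Ext.j α))) β →
        CuntzKK.Homotopic
          ((CuntzKK.K.toMat C 2).comp (β.comp (CuntzKK.q.map (CuntzKK.Her.corestrict α))))
          ((CuntzKK.omega α β').comp (CuntzKK.q.map (CuntzKK.piq A))) ∧
        ∀ φ : CuntzKK.q A →⋆ₙₐ[ℂ] CuntzKK.Mat 2 (CuntzKK.q (CuntzKK.q A)),
          CuntzKK.IsUniversalMap φ →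
            CuntzKK.Homotopic
              ((CuntzKK.Mat.map 2
                (β.comp (CuntzKK.q.map (CuntzKK.Her.corestrict α)))).comp φ)
              (CuntzKK.omega α β')) ∧
    -- the formula for `β : qB → 𝒦 ⊗ C`
    (∀ β : CuntzKK.q B →⋆ₙₐ[ℂ] CuntzKK.K C,
      (∃ δ, CuntzKK.IsProduct α β δ) ∧
      ∀ β' : CuntzKK.q (CuntzKK.Ext α) →⋆ₙₐ[ℂ] CuntzKK.K C,
        CuntzKK.ExtendsUpToHomotopy α β β' →
          ∀ δ, CuntzKK.IsProduct α β δ →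
            CuntzKK.Homotopic ((CuntzKK.K.toMat C 2).comp δ) (CuntzKK.omega α β')) ∧
    -- triple products
    (∀ (D : Type u) [NonUnitalCStarAlgebra D] (β : CuntzKK.q B →⋆ₙₐ[ℂ] CuntzKK.K C)
        (γ : CuntzKK.q C →⋆ₙₐ[ℂ] CuntzKK.K D) [TopologicalSpace.SeparableSpace B],
      (∀ (β' : CuntzKK.q (CuntzKK.Ext α) →⋆ₙₐ[ℂ] CuntzKK.K C)
          (γ' : CuntzKK.q (CuntzKK.Ext β') →⋆ₙₐ[ℂ] CuntzKK.K D),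
        CuntzKK.ExtendsUpToHomotopy α β β' → CuntzKK.ExtendsUpToHomotopy β' γ γ' →
          (∀ δ ε, CuntzKK.IsProduct α β δ → CuntzKK.IsProduct δ γ ε →
            CuntzKK.Homotopic ((CuntzKK.K.toMat D 4).comp ε)
              (CuntzKK.tripleProduct α β' γ')) ∧
          (∀ δ ε, CuntzKK.IsProduct β γ δ → CuntzKK.IsProduct α δ ε →
            CuntzKK.Homotopic ((CuntzKK.K.toMat D 4).comp ε)
              (CuntzKK.tripleProduct α β' γ'))) ∧
      (∀ δ₁ ε₁ δ₂ ε₂, CuntzKK.IsProduct α β δ₁ → CuntzKK.IsProduct δ₁ γ ε₁ →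
        CuntzKK.IsProduct β γ δ₂ → CuntzKK.IsProduct α δ₂ ε₂ → CuntzKK.Homotopic ε₁ ε₂)) := by
  open CuntzKK in
  refine ⟨exists_isUniversalMap A, fun β β' h => ?_, fun β => ⟨?_, fun β' hβ δ hδ => ?_⟩,
    fun D _ β γ _ => ⟨fun β' γ' hβ hγ => ?_, fun δ₁ ε₁ δ₂ ε₂ h₁ h₁' h₂ h₂' => ?_⟩⟩
  -- This is the first formula for `β` on stable classes. The second one follows by composing with
  -- `φ`, which cancels `q(π_A)`.
  · have h1 : SH.of (β.comp (q.map (Her.corestrict α))) =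
        (SH.ofMat (omega α β')).comp (SH.of (q.map (piq A))) := by
      rw [← of_comp_corestrict]
      exact (SH.of_eq (h.precomp _)).symm
    refine ⟨homotopic_of_ev_ofMat_eq ?_, fun φ hφ => homotopic_of_ev_ofMat_eq ?_⟩
    · rw [SH.ev_ofMat_toMat, ← SH.ev_comp_of, h1, SH.ofMat_comp]
    · rw [← SH.of_comp_ofMat, h1, SH.assoc, of_qmap_piq_comp_universal hφ, SH.comp_id]
  · obtain ⟨φ, hφ⟩ := exists_isUniversalMap A
    exact exists_isProduct hφ α β
  · refine homotopic_of_ev_ofMat_eq ?_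
    rw [SH.ev_ofMat_toMat, hδ.mk_eq_omega hβ]
  · refine ⟨fun δ ε hδ hε => homotopic_of_ev_ofMat_eq ?_,
      fun δ ε hδ hε => homotopic_of_ev_ofMat_eq ?_⟩
    · rw [SH.ev_ofMat_toMat, hδ.mk_eq_tripleProduct hε hβ hγ]
    -- The formula is established directly for `γ ♯ (β ♯ α)`. For the other bracketing such a
    -- product is formed first, and associativity identifies the two classes.
    · obtain ⟨φ, hφ⟩ := exists_isUniversalMap A
      obtain ⟨δ', hδ'⟩ := exists_isProduct hφ α β
      obtain ⟨ε', hε'⟩ := exists_isProduct hφ δ' γ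
      rw [SH.ev_ofMat_toMat, ← IsProduct.assoc hφ hδ' hε' hδ hε,
        hδ'.mk_eq_tripleProduct hε' hβ hγ]
  · obtain ⟨φ, hφ⟩ := exists_isUniversalMap A
    exact SH.mk_eq.1 (IsProduct.assoc hφ h₁ h₁' h₂ h₂')
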